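/- Let $\mathfrak g$ be a finite-dimensional complex reductive Lie algebra, $\mathfrak h\subseteq\mathfrak g$ a Cartan subalgebra (equivalently, a maximal torus in the sense of reductive Lie algebras), $\Phi$ the roots, $\Delta\subseteq\Phi$ a system of simple roots with positive roots $\Phi^+$, $\mathfrak n=\bigoplus_{\beta\in\Phi^+}\mathfrak g_\beta$ and $\rho=\frac12\sum_{\beta\in\Phi^+}\beta$. Let $\mathfrak g_\epsilon=\mathfrak g\otimes\mathbb C[\epsilon]/(\epsilon^2)$, write $x=x\otimes1$, $\overline x=x\otimes\epsilon$ for $x\in\mathfrak g$, and let $U=U(\mathfrak g_\epsilon)$. Let $\mathcal C$ be the full subcategory of $U$-modules on which $\mathfrak h$ acts semisimply, $\mathcal O_\epsilon\subseteq\mathcal C$ the full subcategory of those $M\in\mathcal C$ that are finitely generated and on which $\mathfrak n_\epsilon$ and $\overline{\mathfrak h}$ act locally finitely, and, for $\mu\in\mathfrak h^*$, let $\mathcal O^\mu_\epsilon\subseteq\mathcal O_\epsilon$ be the full subcategory of the modules on which $\overline h-\mu(h)$ is locally nilpotent for every $h\in\mathfrak h$. For $\lambda,\mu\in\mathfrak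 h^*$ let $M_{\lambda,\mu}$ be the Verma module, i.e. the quotient of $U$ by the left ideal generated by $\mathfrak n_\epsilon$ and all $h-\lambda(h)$, $\overline h-\mu(h)$ ($h\in\mathfrak h$), and let $L_{\lambda,\mu}$ be the quotient of $M_{\lambda,\mu}$ by its largest proper submodule. Let $\alpha\in\Delta$. There exist $e_\alpha\in\mathfrak g_\alpha$, $f_\alpha\in\mathfrak g_{-\alpha}$ with $h_\alpha:=[e_\alpha,f_\alpha]\in\mathfrak h$ and $\alpha(h_\alpha)=2$, and an automorphism $\phi_\alpha$ of $\mathfrak g$ with $\phi_\alpha(h)=h-\alpha(h)h_\alpha$ for $h\in\mathfrak h$, $\phi_\alpha(e_\alpha)=f_\alpha$ and $\phi_\alpha(f_\alpha)=e_\alpha$. Fix any such choice, and extend $\phi_\alpha$ to $\mathfrak g_\epsilon$ by $\phi_\alpha(\overline x)=\overline{\phi_\alpha(x)}$, and to $U$. Put $s_\alpha(\nu)=\nu-\nu(h_\alpha)\alpha$ and $s_\alpha\bullet_2\lambda=s_\alpha(\lambda+2\rho)-2\rho$. Let $U_\alpha$ be the Ore localisation of $U$ at $\{f_\alpha^i\overline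 f_\alpha^{\,j}:i,j\ge0\}$, let $U'\subseteq U_\alpha$ be the sub-bimodule spanned by the elements $f_\alpha^i\overline f_\alpha^{\,j}u$ with $u\in U$, $i,j\in\mathbb Z$ and $i\ge0$ or $j\ge0$, and let $S_\alpha=U_\alpha/U'$, a $U$-$U$-bimodule. For a $U$-module $M$ let $\phi_\alpha^{\pm1}(M)$ be $M$ with $u\in U$ acting as $\phi_\alpha^{\pm1}(u)$, and let $\mathcal H(M)$ be the largest $\mathfrak h$-semisimple submodule of $M$. Define $$T_\alpha M=\phi_\alpha(S_\alpha\otimes_UM),\qquad G_\alpha M=\mathcal H\bigl(\operatorname{Hom}_U(S_\alpha,\phi_\alpha^{-1}(M))\bigr),$$ where $U$ acts on $\operatorname{Hom}_U(S_\alpha,\phi_\alpha^{-1}(M))$ by $(u\cdot g)(s)=g(s\cdot u)$. Then: 1. $T_\alpha$ and $G_\alpha$ restrict to functors $\mathcal C\to\mathcal C$, and there $T_\alpha$ is left adjoint to $G_\alpha$. 2. If $\mu\in\mathfrak h^*$ satisfies $\mu(h_\alpha)\ne0$, then $T_\alpha$ restricts to a functor $\mathcal O^\mu_\epsilon\to\mathcal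 O^{s_\alpha(\mu)}_\epsilon$, $G_\alpha$ restricts to a functor $\mathcal O^{s_\alpha(\mu)}_\epsilon\to\mathcal O^\mu_\epsilon$, and these are mutually inverse equivalences of categories. 3. If $\mu(h_\alpha)\ne0$, then for all $\lambda\in\mathfrak h^*$, $T_\alpha M_{\lambda,\mu}\cong M_{s_\alpha\bullet_2\lambda,\,s_\alpha(\mu)}$ and $T_\alpha L_{\lambda,\mu}\cong L_{s_\alpha\bullet_2\lambda,\,s_\alpha(\mu)}$. -/

import Mathlib

open scoped TensorProduct
open CategoryTheory

namespace TakiffO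

universe u

/-! ### Generalities on Ore sets generated by two commuting ad-nilpotent elements -/

section Ore

variable {A : Type u} [Ring A]

/-- Every `x` can be moved past powers of `a`: `a ^ j * x ∈ A * a ^ i` for some `j`. -/
def MovesPast (a x : A) : Prop := ∀ i : ℕ, ∃ (j : ℕ) (y : A), a ^ j * x = y * a ^ i

lemma MovesPast.add {a x y : A} (hx : MovesPast a x) (hy : MovesPast a y) :
    MovesPast a (x + y) := by
  intro i
  obtain ⟨j, z, hz⟩ := hx i
  obtain ⟨k, w, hw⟩ := hy i
  refine ⟨j + k, a ^ k * z + a ^ j * w, ?_⟩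
  rw [mul_add, add_mul, mul_assoc, ← hz, mul_assoc (a ^ j) w, ← hw, ← mul_assoc, ← mul_assoc,
    ← pow_add, ← pow_add, add_comm k j]

lemma MovesPast.mul {a x y : A} (hx : MovesPast a x) (hy : MovesPast a y) :
    MovesPast a (x * y) := by
  intro i
  obtain ⟨j, z, hz⟩ := hy i
  obtain ⟨k, w, hw⟩ := hx j
  exact ⟨k, w * z, by rw [← mul_assoc, hw, mul_assoc, hz, mul_assoc]⟩

/-- `ad a` is locally nilpotent on `x`. -/
def AdNil (a x : A) : Prop := ∃ n : ℕ, (fun y => a * y - y * a)^[n] x = 0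

lemma iterate_ad_zero (a : A) (n : ℕ) : (fun y => a * y - y * a)^[n] 0 = 0 :=
  Function.iterate_fixed (by simp) n

lemma iterate_ad_add (a x y : A) (n : ℕ) : (fun y => a * y - y * a)^[n] (x + y) =
    (fun y => a * y - y * a)^[n] x + (fun y => a * y - y * a)^[n] y := by
  induction n generalizing x y with
  | zero => rfl
  | succ n ih =>
    simp only [Function.iterate_succ, Function.comp_apply]
    rw [← ih]
    congr 1
    noncomm_ring

lemma AdNil.movesPast {a x : A} (h : AdNil a x) : MovesPast a x := by
  obtain ⟨n, hn⟩ := h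
  have key : ∀ (n : ℕ) (x : A), (fun y => a * y - y * a)^[n] x = 0 → ∀ i : ℕ,
      ∃ y, a ^ (i + n) * x = y * a ^ i := by
    intro n
    induction n with
    | zero =>
      intro x hx i
      exact ⟨0, by simp only [Function.iterate_zero, id] at hx; simp [hx]⟩
    | succ n ih =>
      intro x hx i
      induction i with
      | zero => exact ⟨a ^ (0 + (n + 1)) * x, by simp⟩
      | succ i ihi =>
        obtain ⟨y, hy⟩ := ihi
        obtain ⟨z, hz⟩ := ih (a * x - x * a) (by simpa using hx) (i + 1)
        refine ⟨y + z, ?_⟩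
        have e1 : a ^ (i + 1 + (n + 1)) * x =
            (a ^ (i + (n + 1)) * x) * a + a ^ (i + 1 + n) * (a * x - x * a) := by
          have e2 : a ^ (i + 1 + (n + 1)) = a ^ (i + 1 + n) * a := by
            rw [← pow_succ]; rfl
          have e3 : i + (n + 1) = i + 1 + n := by omega
          rw [e2, e3]
          noncomm_ring
        rw [e1, hy, hz, add_mul, pow_succ, mul_assoc, ← pow_succ]
  exact fun i => ⟨i + n, key n x hn i⟩

lemma AdNil.cancel {a r : A} (h : AdNil a r) (hr : r * a = 0) : ∃ n : ℕ, a ^ n * r = 0 := by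
  obtain ⟨n, hn⟩ := h
  induction n generalizing r with
  | zero => exact ⟨0, by simpa using hn⟩
  | succ n ih =>
    obtain ⟨m, hm⟩ := ih (r := a * r - r * a)
      (by rw [hr, sub_zero, mul_assoc, hr, mul_zero]) (by simpa using hn)
    exact ⟨m + 1, by rw [pow_succ, mul_assoc]; simpa [hr] using hm⟩

lemma AdNil.cancel_pow {a r : A} (h : ∀ x : A, AdNil a x) (i : ℕ) (hr : r * a ^ i = 0) :
    ∃ n : ℕ, a ^ n * r = 0 := by
  induction i generalizing r with
  | zero => exact ⟨0, by simpa using hr⟩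
  | succ i ih =>
    rw [pow_succ, ← mul_assoc] at hr
    obtain ⟨m, hm⟩ := (h (r * a ^ i)).cancel hr
    rw [← mul_assoc] at hm
    obtain ⟨k, hk⟩ := ih hm
    exact ⟨k + m, by rw [pow_add, mul_assoc, hk]⟩

lemma AdNil.add {a x y : A} (hx : AdNil a x) (hy : AdNil a y) : AdNil a (x + y) := by
  obtain ⟨n, hn⟩ := hx
  obtain ⟨m, hm⟩ := hy
  refine ⟨m + n, ?_⟩
  rw [iterate_ad_add, Function.iterate_add_apply, hn, iterate_ad_zero, add_comm m n,
    Function.iterate_add_apply, hm, iterate_ad_zero, add_zero]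

lemma AdNil.mul {a x y : A} (hx : AdNil a x) (hy : AdNil a y) : AdNil a (x * y) := by
  obtain ⟨n, hn⟩ := hx
  obtain ⟨m, hm⟩ := hy
  have key : ∀ (k n m : ℕ) (x y : A), n + m = k → (fun y => a * y - y * a)^[n] x = 0 →
      (fun y => a * y - y * a)^[m] y = 0 → (fun y => a * y - y * a)^[k] (x * y) = 0 := by
    intro k
    induction k with
    | zero =>
      intro n m x y hk hx hy
      obtain ⟨rfl, rfl⟩ : n = 0 ∧ m = 0 := by omega
      have : x = 0 := hx
      simp [this]
    | succ k ih =>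
      intro n m x y hk hx hy
      rcases n with _ | n
      · have : x = 0 := hx
        rw [this, zero_mul, iterate_ad_zero]
      rcases m with _ | m
      · have : y = 0 := hy
        rw [this, mul_zero, iterate_ad_zero]
      rw [Function.iterate_succ_apply]
      have e : a * (x * y) - x * y * a = (a * x - x * a) * y + x * (a * y - y * a) := by
        noncomm_ring
      simp only [e]
      rw [iterate_ad_add, ih n (m + 1) _ _ (by omega) (by simpa using hx) hy,
        ih (n + 1) m _ _ (by omega) hx (by simpa using hy), add_zero]
  exact ⟨n + m, key _ n m x y rfl hn hm⟩

/-- The multiplicative set `{a ^ i * b ^ j : i, j ≥ 0}` for commuting `a`, `b`. -/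
def powSet (a b : A) (hab : Commute a b) : Submonoid A where
  carrier := {x | ∃ i j : ℕ, x = a ^ i * b ^ j}
  one_mem' := ⟨0, 0, by simp⟩
  mul_mem' := by
    rintro _ _ ⟨i, j, rfl⟩ ⟨k, l, rfl⟩
    refine ⟨i + k, j + l, ?_⟩
    rw [pow_add, pow_add, mul_assoc, ← mul_assoc (b ^ j), (hab.symm.pow_pow j k).eq]
    simp only [mul_assoc]

lemma left_mem_powSet (a b : A) (hab : Commute a b) : a ∈ powSet a b hab := ⟨1, 0, by simp⟩

lemma right_mem_powSet (a b : A) (hab : Commute a b) : b ∈ powSet a b hab := ⟨0, 1, by simp⟩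

/-- `{a ^ i * b ^ j}` is a (left) Ore set if `ad a` and `ad b` are locally nilpotent. -/
noncomputable abbrev powOreSet (a b : A) (hab : Commute a b) (ha : ∀ x : A, AdNil a x)
    (hb : ∀ x : A, AdNil b x) : OreLocalization.OreSet (powSet a b hab) := by
  refine Classical.choice (OreLocalization.nonempty_oreSet_iff.mpr ⟨?_, ?_⟩)
  · rintro r₁ r₂ ⟨_, i, j, rfl⟩ h
    have h0 : (r₁ - r₂) * a ^ i * b ^ j = 0 := by
      rw [mul_assoc, sub_mul]; exact sub_eq_zero.mpr h
    obtain ⟨k, hk⟩ := AdNil.cancel_pow hb j h0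
    rw [← mul_assoc] at hk
    obtain ⟨l, hl⟩ := AdNil.cancel_pow ha i hk
    refine ⟨⟨a ^ l * b ^ k, l, k, rfl⟩, ?_⟩
    change a ^ l * b ^ k * r₁ = a ^ l * b ^ k * r₂
    rw [← sub_eq_zero, ← mul_sub, mul_assoc, hl]
  · rintro r ⟨_, i, j, rfl⟩
    obtain ⟨k, y, hy⟩ := (hb r).movesPast j
    obtain ⟨l, z, hz⟩ := (ha y).movesPast i
    refine ⟨z, ⟨a ^ l * b ^ k, l, k, rfl⟩, ?_⟩
    change a ^ l * b ^ k * r = z * (a ^ i * b ^ j)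
    rw [mul_assoc, hy, ← mul_assoc, hz, mul_assoc]

end Ore

/-! ### The bimodule `A[(aⁱbʲ)⁻¹] / (A[(aⁱbʲ)⁻¹])'` -/

/-- Two commuting elements `a`, `b` of a ring such that `ad a`, `ad b` are locally nilpotent. -/
structure OrePair (A : Type u) [Ring A] where
  /-- The first element. -/
  a : A
  /-- The second element. -/
  b : A
  comm : Commute a b
  nil_a : ∀ x : A, AdNil a x
  nil_b : ∀ x : A, AdNil b x

namespace OrePair

variable {A : Type u} [Ring A] (P : OrePair A)

/-- The multiplicative set `{a ^ i * b ^ j : i, j ≥ 0}`. -/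
abbrev powers : Submonoid A := powSet P.a P.b P.comm

noncomputable instance : OreLocalization.OreSet P.powers :=
  powOreSet P.a P.b P.comm P.nil_a P.nil_b

/-- The Ore localisation of `A` at `{a ^ i * b ^ j : i, j ≥ 0}`. -/
abbrev Loc : Type u := OreLocalization P.powers A

/-- The canonical ring homomorphism from `A` to its localisation. -/
noncomputable def toLoc : A →+* P.Loc := OreLocalization.numeratorRingHom

/-- The image of `a`, as a unit of the localisation. -/
noncomputable def ua : P.Locˣ :=
  OreLocalization.numeratorUnit (⟨P.a, left_mem_powSet P.a P.b P.comm⟩ : P.powers)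

/-- The image of `b`, as a unit of the localisation. -/
noncomputable def ub : P.Locˣ :=
  OreLocalization.numeratorUnit (⟨P.b, right_mem_powSet P.a P.b P.comm⟩ : P.powers)

lemma coe_ua : (P.ua : P.Loc) = P.toLoc P.a := rfl

lemma coe_ub : (P.ub : P.Loc) = P.toLoc P.b := rfl

/-- The elements `a ^ i * b ^ j * u` with `i, j ∈ ℤ`, `i ≥ 0` or `j ≥ 0`, and `u ∈ A`. -/
def gens : Set P.Loc :=
  {x | ∃ (i j : ℤ) (u : A), (0 ≤ i ∨ 0 ≤ j) ∧
    x = ((P.ua ^ i : P.Locˣ) : P.Loc) * ((P.ub ^ j : P.Locˣ) : P.Loc) * P.toLoc u}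

lemma commute_units : Commute P.ua P.ub := by
  refine Units.ext ?_
  simp only [Units.val_mul, coe_ua, coe_ub, ← map_mul, P.comm.eq]

lemma toLoc_mul_pow_b (u : A) (j : ℤ) : ∃ (l : ℤ) (y : A),
    P.toLoc u * ((P.ub ^ j : P.Locˣ) : P.Loc) = ((P.ub ^ l : P.Locˣ) : P.Loc) * P.toLoc y := by
  obtain ⟨k, rfl | rfl⟩ := j.eq_nat_or_neg
  · exact ⟨0, u * P.b ^ k, by simp [coe_ub]⟩
  · obtain ⟨l, y, h⟩ := (P.nil_b u).movesPast k
    refine ⟨-l, y, ?_⟩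
    rw [zpow_neg, zpow_neg, zpow_natCast, zpow_natCast, Units.eq_inv_mul_iff_mul_eq, ← mul_assoc,
      Units.mul_inv_eq_iff_eq_mul]
    simpa [coe_ub] using congrArg P.toLoc h

lemma toLoc_mul_pow_a (u : A) (j : ℤ) : ∃ (l : ℤ) (y : A),
    P.toLoc u * ((P.ua ^ j : P.Locˣ) : P.Loc) = ((P.ua ^ l : P.Locˣ) : P.Loc) * P.toLoc y := by
  obtain ⟨k, rfl | rfl⟩ := j.eq_nat_or_neg
  · exact ⟨0, u * P.a ^ k, by simp [coe_ua]⟩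
  · obtain ⟨l, y, h⟩ := (P.nil_a u).movesPast k
    refine ⟨-l, y, ?_⟩
    rw [zpow_neg, zpow_neg, zpow_natCast, zpow_natCast, Units.eq_inv_mul_iff_mul_eq, ← mul_assoc,
      Units.mul_inv_eq_iff_eq_mul]
    simpa [coe_ua] using congrArg P.toLoc h

lemma toLoc_mul_mem_gens (v : A) {x : P.Loc} (hx : x ∈ P.gens) : P.toLoc v * x ∈ P.gens := by
  obtain ⟨i, j, u, h, rfl⟩ := hx
  rcases h with h | h
  · obtain ⟨n, rfl⟩ := Int.eq_ofNat_of_zero_le h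
    obtain ⟨l, y, hy⟩ := P.toLoc_mul_pow_b (v * P.a ^ n) j
    refine ⟨0, l, y * u, Or.inl le_rfl, ?_⟩
    rw [map_mul, map_pow, ← coe_ua] at hy
    simp only [zpow_natCast, Units.val_pow_eq_pow_val, zpow_zero, Units.val_one, one_mul, map_mul,
      ← mul_assoc, hy]
  · obtain ⟨n, rfl⟩ := Int.eq_ofNat_of_zero_le h
    obtain ⟨l, y, hy⟩ := P.toLoc_mul_pow_a (v * P.b ^ n) i
    refine ⟨l, 0, y * u, Or.inr le_rfl, ?_⟩
    rw [map_mul, map_pow, ← coe_ub] at hy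
    rw [← Units.val_mul, ((P.commute_units).zpow_zpow i n).eq, Units.val_mul]
    simp only [zpow_natCast, Units.val_pow_eq_pow_val, zpow_zero, Units.val_one, mul_one, map_mul,
      ← mul_assoc, hy]

lemma mul_toLoc_mem_gens (v : A) {x : P.Loc} (hx : x ∈ P.gens) : x * P.toLoc v ∈ P.gens := by
  obtain ⟨i, j, u, h, rfl⟩ := hx
  exact ⟨i, j, u * v, h, by rw [map_mul, ← mul_assoc]⟩

lemma smul_eq_toLoc_mul (v : A) (x : P.Loc) : v • x = P.toLoc v * x := by
  rw [← smul_eq_mul]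
  exact (OreLocalization.oreDiv_one_smul v x).symm

/-- The span of the elements `a ^ i * b ^ j * u` with `i ≥ 0` or `j ≥ 0`. -/
noncomputable def sub : Submodule A P.Loc where
  __ := (AddSubgroup.closure P.gens).toAddSubmonoid
  smul_mem' := by
    intro v x hx
    rw [smul_eq_toLoc_mul]
    change P.toLoc v * x ∈ AddSubgroup.closure P.gens
    induction hx using AddSubgroup.closure_induction with
    | mem x hx => exact AddSubgroup.subset_closure (P.toLoc_mul_mem_gens v hx)
    | zero => rw [mul_zero]; exact zero_mem _
    | add x y _ _ h1 h2 => rw [mul_add]; exact add_mem h1 h2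
    | neg x _ h => rw [mul_neg]; exact neg_mem h

/-- Right multiplication by `v ∈ A` on the localisation. -/
noncomputable def rightMul (v : A) : P.Loc →ₗ[A] P.Loc where
  toFun x := x * P.toLoc v
  map_add' x y := add_mul x y _
  map_smul' w x := by simp only [smul_eq_toLoc_mul, mul_assoc, RingHom.id_apply]

lemma sub_le_comap_rightMul (v : A) : P.sub ≤ P.sub.comap (P.rightMul v) := by
  intro x hx
  change x * P.toLoc v ∈ AddSubgroup.closure P.gens
  change x ∈ AddSubgroup.closure P.gens at hx
  induction hx using AddSubgroup.closure_induction with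
  | mem x hx => exact AddSubgroup.subset_closure (P.mul_toLoc_mem_gens v hx)
  | zero => rw [zero_mul]; exact zero_mem _
  | add x y _ _ h1 h2 => rw [add_mul]; exact add_mem h1 h2
  | neg x _ h => rw [neg_mul]; exact neg_mem h

/-- The quotient of the localisation by `P.sub`. -/
abbrev Bimod : Type u := P.Loc ⧸ P.sub

/-- The right action of `A` on `P.Bimod`. -/
noncomputable def rightAction : Aᵐᵒᵖ →+* Module.End A P.Bimod where
  toFun v := P.sub.mapQ P.sub (P.rightMul v.unop) (P.sub_le_comap_rightMul v.unop)
  map_one' := by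
    refine Submodule.linearMap_qext _ (LinearMap.ext fun x => ?_)
    simp [rightMul]
  map_mul' v w := by
    refine Submodule.linearMap_qext _ (LinearMap.ext fun x => ?_)
    simp [rightMul, mul_assoc]
  map_zero' := by
    refine Submodule.linearMap_qext _ (LinearMap.ext fun x => ?_)
    simp [rightMul]
  map_add' v w := by
    refine Submodule.linearMap_qext _ (LinearMap.ext fun x => ?_)
    simp [rightMul, mul_add]

noncomputable instance : Module Aᵐᵒᵖ P.Bimod := Module.compHom P.Bimod P.rightAction

instance : SMulCommClass A Aᵐᵒᵖ P.Bimod :=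
  ⟨fun u v s => ((P.rightAction v).map_smul u s).symm⟩

end OrePair

/-! ### Tensor product and Hom with a bimodule -/

section Bimodule

variable {A : Type u} [Ring A] (S : Type u) [AddCommGroup S] [Module A S] [Module Aᵐᵒᵖ S]
  [SMulCommClass A Aᵐᵒᵖ S]

/-- The relations `(s · u) ⊗ m = s ⊗ (u · m)` defining `S ⊗_A M` as a quotient of `S ⊗_ℤ M`. -/
def balanced (M : Type u) [AddCommGroup M] [Module A M] : Submodule A (S ⊗[ℤ] M) :=
  Submodule.span A {x | ∃ (s : S) (u : A) (m : M),
    x = (MulOpposite.op u • s) ⊗ₜ[ℤ] m - s ⊗ₜ[ℤ] (u • m)}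

/-- `S ⊗_A M`, a left `A`-module via the left action on `S`. -/
abbrev BalTensor (M : Type u) [AddCommGroup M] [Module A M] : Type u :=
  (S ⊗[ℤ] M) ⧸ balanced (A := A) S M

/-- `f ↦ (s ⊗ m ↦ s ⊗ f m)` -/
noncomputable def BalTensor.map {M N : Type u} [AddCommGroup M] [Module A M] [AddCommGroup N]
    [Module A N] (f : M →ₗ[A] N) : BalTensor (A := A) S M →ₗ[A] BalTensor (A := A) S N :=
  (balanced (A := A) S M).mapQ (balanced (A := A) S N)
    (TensorProduct.AlgebraTensorModule.map (LinearMap.id : S →ₗ[A] S)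
      (f.toAddMonoidHom.toIntLinearMap))
    (by
      rw [balanced, Submodule.span_le]
      rintro _ ⟨s, u, m, rfl⟩
      refine Submodule.subset_span ⟨s, u, f m, ?_⟩
      simp)

/-- The functor `M ↦ S ⊗_A M`. -/
noncomputable def tensorFunctor : ModuleCat.{u} A ⥤ ModuleCat.{u} A where
  obj M := ModuleCat.of A (BalTensor (A := A) S M)
  map f := ModuleCat.ofHom (BalTensor.map S f.hom)
  map_id M := by
    refine ModuleCat.hom_ext (Submodule.linearMap_qext _ (LinearMap.ext fun x => ?_))
    induction x using TensorProduct.induction_on with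
    | zero => simp
    | tmul s m => simp [BalTensor.map]
    | add x y hx hy => simp only [map_add, hx, hy]
  map_comp f g := by
    refine ModuleCat.hom_ext (Submodule.linearMap_qext _ (LinearMap.ext fun x => ?_))
    induction x using TensorProduct.induction_on with
    | zero => simp
    | tmul s m => simp [BalTensor.map]
    | add x y hx hy => simp only [map_add, hx, hy]

/-- `Hom_A(S, N)`, the left `A`-linear maps from `S` to `N`. -/
def BimodHom (N : Type u) [AddCommGroup N] [Module A N] : Type u := S →ₗ[A] N

instance (N : Type u) [AddCommGroup N] [Module A N] : AddCommGroup (BimodHom (A := A) S N) :=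
  inferInstanceAs (AddCommGroup (S →ₗ[A] N))

instance (N : Type u) [AddCommGroup N] [Module A N] : FunLike (BimodHom (A := A) S N) S N :=
  inferInstanceAs (FunLike (S →ₗ[A] N) S N)

/-- Right multiplication by `u` on `S`. -/
def rightSMul (u : A) : S →ₗ[A] S where
  toFun s := MulOpposite.op u • s
  map_add' s t := smul_add _ s t
  map_smul' v s := (smul_comm v (MulOpposite.op u) s).symm

instance (N : Type u) [AddCommGroup N] [Module A N] : SMul A (BimodHom (A := A) S N) where
  smul u g := LinearMap.comp (σ₁₂ := RingHom.id A) (show S →ₗ[A] N from g) (rightSMul S u)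

variable {S} in
lemma BimodHom.smul_apply {N : Type u} [AddCommGroup N] [Module A N] (u : A)
    (g : BimodHom (A := A) S N) (s : S) : (u • g) s = g (MulOpposite.op u • s) := rfl

set_option linter.unusedSectionVars false in
variable {S} in
lemma BimodHom.add_apply {N : Type u} [AddCommGroup N] [Module A N]
    (g h : BimodHom (A := A) S N) (s : S) : (g + h) s = g s + h s := rfl

set_option linter.unusedSectionVars false in
variable {S} in
lemma BimodHom.ext {N : Type u} [AddCommGroup N] [Module A N]
    {g h : BimodHom (A := A) S N} (H : ∀ s, g s = h s) : g = h := LinearMap.ext H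

/-- The left action `(u · g)(s) = g(s · u)` of `A` on `Hom_A(S, N)`. -/
instance (N : Type u) [AddCommGroup N] [Module A N] : Module A (BimodHom (A := A) S N) where
  one_smul g := BimodHom.ext fun s => by rw [BimodHom.smul_apply, MulOpposite.op_one, one_smul]
  mul_smul u v g := BimodHom.ext fun s => by
    simp only [BimodHom.smul_apply, MulOpposite.op_mul, mul_smul]
  smul_zero u := rfl
  smul_add u g h := rfl
  add_smul u v g := BimodHom.ext fun s => by
    simp only [BimodHom.smul_apply, BimodHom.add_apply, MulOpposite.op_add, add_smul]
    exact LinearMap.map_add (show S →ₗ[A] N from g) _ _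
  zero_smul g := BimodHom.ext fun s => by
    rw [BimodHom.smul_apply, MulOpposite.op_zero, zero_smul]
    exact LinearMap.map_zero (show S →ₗ[A] N from g)

/-- The functor `N ↦ Hom_A(S, N)`. -/
def homFunctor : ModuleCat.{u} A ⥤ ModuleCat.{u} A where
  obj N := ModuleCat.of A (BimodHom (A := A) S N)
  map {M N} f := ModuleCat.ofHom
    { toFun := fun g => show BimodHom (A := A) S N from
        LinearMap.comp (σ₁₂ := RingHom.id A) f.hom (show S →ₗ[A] M from g)
      map_add' := fun _ _ => BimodHom.ext fun _ => map_add f.hom _ _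
      map_smul' := fun _ _ => BimodHom.ext fun _ => rfl }
  map_id _ := rfl
  map_comp _ _ := rfl

end Bimodule

/-! ### Takiff Lie algebras -/

section Takiff

attribute [local instance 100] LieRing.ofAssociativeRing

variable (𝔤 : Type u) [LieRing 𝔤] [LieAlgebra ℂ 𝔤]

/-- The Takiff Lie algebra `𝔤_ε = ℂ[ε]/(ε²) ⊗ 𝔤`, as a complex Lie algebra. -/
abbrev Takiff : Type u := DualNumber ℂ ⊗[ℂ] 𝔤

/-- The universal enveloping algebra `U(𝔤_ε)`. -/
abbrev UTakiff : Type u := UniversalEnvelopingAlgebra ℂ (Takiff 𝔤)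

variable {𝔤}

/-- `x ↦ x = 1 ⊗ x ∈ 𝔤_ε` -/
noncomputable def base : 𝔤 →ₗ[ℂ] Takiff 𝔤 := TensorProduct.mk ℂ (DualNumber ℂ) 𝔤 1

/-- `x ↦ x̄ = ε ⊗ x ∈ 𝔤_ε` -/
noncomputable def bar : 𝔤 →ₗ[ℂ] Takiff 𝔤 := TensorProduct.mk ℂ (DualNumber ℂ) 𝔤 DualNumber.eps

/-- The inclusion of `𝔤_ε` in its enveloping algebra. -/
noncomputable def toU (x : Takiff 𝔤) : UTakiff 𝔤 := UniversalEnvelopingAlgebra.ι ℂ x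

/-- The subspace `𝔞_ε = 𝔞 ⊕ 𝔞̄` of `𝔤_ε` attached to a subspace `𝔞` of `𝔤`. -/
noncomputable def takiffSub (V : Submodule ℂ 𝔤) : Submodule ℂ (Takiff 𝔤) :=
  V.map base ⊔ V.map bar

/-- The endomorphism of `U(𝔤_ε)` induced by an endomorphism `φ` of `𝔤`, via `φ(x̄) = (φ x)‾`. -/
noncomputable def twist (φ : 𝔤 →ₗ⁅ℂ⁆ 𝔤) : UTakiff 𝔤 →ₐ[ℂ] UTakiff 𝔤 :=
  UniversalEnvelopingAlgebra.lift ℂ ((UniversalEnvelopingAlgebra.ι ℂ).comp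
    (LieAlgebra.ExtendScalars.map (AlgHom.id ℂ (DualNumber ℂ)) φ))

lemma toU_lie (x y : Takiff 𝔤) : toU ⁅x, y⁆ = toU x * toU y - toU y * toU x :=
  LieHom.map_lie (UniversalEnvelopingAlgebra.ι ℂ) x y

lemma adNil_toU_toU (d c : DualNumber ℂ) (f z : 𝔤) (hf : IsNilpotent (LieAlgebra.ad ℂ 𝔤 f)) :
    AdNil (toU (d ⊗ₜ[ℂ] f)) (toU (c ⊗ₜ[ℂ] z)) := by
  obtain ⟨n, hn⟩ := hf
  have key : ∀ (n : ℕ) (c : DualNumber ℂ) (z : 𝔤), (LieAlgebra.ad ℂ 𝔤 f ^ n) z = 0 →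
      (fun y => toU (d ⊗ₜ[ℂ] f) * y - y * toU (d ⊗ₜ[ℂ] f))^[n] (toU (c ⊗ₜ[ℂ] z)) = 0 := by
    intro n
    induction n with
    | zero =>
      intro c z hz
      have : z = 0 := by simpa using hz
      simp [this, toU]
    | succ n ih =>
      intro c z hz
      rw [Function.iterate_succ_apply, ← toU_lie, LieAlgebra.ExtendScalars.bracket_tmul]
      exact ih _ _ (by simpa [pow_succ] using hz)
  exact ⟨n, key n c z (by simp [hn])⟩

lemma adNil_toU (d : DualNumber ℂ) (f : 𝔤) (hf : IsNilpotent (LieAlgebra.ad ℂ 𝔤 f))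
    (u : UTakiff 𝔤) : AdNil (toU (d ⊗ₜ[ℂ] f)) u := by
  obtain ⟨t, rfl⟩ : ∃ t, UniversalEnvelopingAlgebra.mkAlgHom ℂ (Takiff 𝔤) t = u :=
    Quotient.exists_rep u
  induction t using TensorAlgebra.induction with
  | algebraMap r =>
    refine ⟨1, ?_⟩
    simp [Algebra.commutes]
  | ι x =>
    change AdNil _ (toU x)
    induction x using TensorProduct.induction_on with
    | zero => exact ⟨0, by simp [toU]⟩
    | tmul c z => exact adNil_toU_toU d c f z hf
    | add x y hx hy => rw [show toU (x + y) = toU x + toU y by simp [toU]]; exact hx.add hy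
  | mul a b ha hb => rw [map_mul]; exact ha.mul hb
  | add a b ha hb => rw [map_add]; exact ha.add hb

end Takiff

/-! ### Category `𝒪` for Takiff Lie algebras -/

section CategoryO

variable {𝔤 : Type u} [LieRing 𝔤] [LieAlgebra ℂ 𝔤] (𝔥 : LieSubalgebra ℂ 𝔤)

/-- The weight vectors of a `U(𝔤_ε)`-module `M`, for the action of `𝔥`. -/
def weightVectors (M : Type u) [AddCommGroup M] [Module (UTakiff 𝔤) M] : Set M :=
  {v | ∃ l : Module.Dual ℂ 𝔥, ∀ h : 𝔥,
    toU (base (h : 𝔤)) • v = algebraMap ℂ (UTakiff 𝔤) (l h) • v}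

/-- `𝔥` acts semisimply on `M`: every element is a sum of weight vectors. -/
def IsHSemisimple (M : Type u) [AddCommGroup M] [Module (UTakiff 𝔤) M] : Prop :=
  AddSubgroup.closure (weightVectors 𝔥 M) = ⊤

/-- The maximal `𝔥`-semisimple submodule of `M`. -/
def hPart (M : Type u) [AddCommGroup M] [Module (UTakiff 𝔤) M] : Submodule (UTakiff 𝔤) M :=
  sSup {N | IsHSemisimple 𝔥 N}

lemma IsHSemisimple.map {M N : Type u} [AddCommGroup M] [Module (UTakiff 𝔤) M] [AddCommGroup N]
    [Module (UTakiff 𝔤) N] (f : M →ₗ[UTakiff 𝔤] N) {K : Submodule (UTakiff 𝔤) M}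
    (hK : IsHSemisimple 𝔥 K) : IsHSemisimple 𝔥 (K.map f) := by
  rw [IsHSemisimple, eq_top_iff]
  rintro ⟨_, x, hx, rfl⟩ -
  have hx' : (⟨x, hx⟩ : K) ∈ AddSubgroup.closure (weightVectors 𝔥 K) := by
    rw [hK]; trivial
  have h2 := AddSubgroup.mem_map_of_mem ((f.submoduleMap K).toAddMonoidHom) hx'
  rw [AddMonoidHom.map_closure] at h2
  refine AddSubgroup.closure_mono ?_ h2
  rintro _ ⟨v, ⟨l, hl⟩, rfl⟩
  refine ⟨l, fun h => ?_⟩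
  change toU (base (h : 𝔤)) • f.submoduleMap K v = _ • f.submoduleMap K v
  rw [← map_smul, hl h, map_smul]

lemma hPart_le_comap {M N : Type u} [AddCommGroup M] [Module (UTakiff 𝔤) M] [AddCommGroup N]
    [Module (UTakiff 𝔤) N] (f : M →ₗ[UTakiff 𝔤] N) : hPart 𝔥 M ≤ (hPart 𝔥 N).comap f :=
  sSup_le fun _ hK => Submodule.map_le_iff_le_comap.mp (le_sSup (IsHSemisimple.map 𝔥 f hK))

/-- The functor sending a module to its maximal `𝔥`-semisimple submodule. -/
def hFunctor : ModuleCat.{u} (UTakiff 𝔤) ⥤ ModuleCat.{u} (UTakiff 𝔤) where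
  obj M := ModuleCat.of (UTakiff 𝔤) (hPart 𝔥 M)
  map f := ModuleCat.ofHom (f.hom.restrict (hPart_le_comap 𝔥 f.hom))
  map_id _ := rfl
  map_comp _ _ := rfl

/-- The full subcategory of `𝔥`-semisimple modules. -/
def catC : ObjectProperty (ModuleCat.{u} (UTakiff 𝔤)) := fun M => IsHSemisimple 𝔥 M

open scoped ModuleCat in
/-- A subspace `V` of `𝔤_ε` acts locally finitely on `M`: every element of `M` lies in a
finite-dimensional subspace that is stable under `V`. -/
def ActsLocallyFinitely (V : Submodule ℂ (Takiff 𝔤)) (M : ModuleCat.{u} (UTakiff 𝔤)) : Prop :=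
  ∀ m : M, ∃ W : Submodule ℂ M, FiniteDimensional ℂ W ∧ m ∈ W ∧
    ∀ x ∈ V, ∀ w ∈ W, toU x • w ∈ W

variable [LieRing.IsNilpotent 𝔥]

/-- The roots of `𝔤` with respect to `𝔥`. -/
def roots : Set (Module.Dual ℂ 𝔥) := {β | β ≠ 0 ∧ LieAlgebra.rootSpace 𝔥 β ≠ ⊥}

/-- `Δ` is a system of simple roots. -/
structure IsSimpleSystem (Δ : Set (Module.Dual ℂ 𝔥)) : Prop where
  subset_roots : Δ ⊆ roots 𝔥
  linearIndependent : LinearIndependent ℂ ((↑) : Δ → Module.Dual ℂ 𝔥)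
  pos_or_neg : ∀ β ∈ roots 𝔥, β ∈ AddSubmonoid.closure Δ ∨ -β ∈ AddSubmonoid.closure Δ

variable (Δ : Set (Module.Dual ℂ 𝔥))

/-- The positive roots. -/
def posRoots : Set (Module.Dual ℂ 𝔥) := {β | β ∈ roots 𝔥 ∧ β ∈ AddSubmonoid.closure Δ}

/-- Half the sum of the positive roots. -/
noncomputable def rho : Module.Dual ℂ 𝔥 := (1 / 2 : ℂ) • ∑ᶠ β ∈ posRoots 𝔥 Δ, β

/-- The nilradical `𝔫` of the standard Borel subalgebra: the sum of the positive root spaces. -/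
noncomputable def nPlus : Submodule ℂ 𝔤 :=
  ⨆ β ∈ posRoots 𝔥 Δ, (LieAlgebra.rootSpace 𝔥 β).toSubmodule

/-- The category `𝒪_ε`, as a full subcategory of `U(𝔤_ε)`-modules. -/
def catO : ObjectProperty (ModuleCat.{u} (UTakiff 𝔤)) := fun M =>
  Module.Finite (UTakiff 𝔤) M ∧ IsHSemisimple 𝔥 M ∧
    ActsLocallyFinitely (takiffSub (nPlus 𝔥 Δ)) M ∧
    ActsLocallyFinitely (𝔥.toSubmodule.map bar) M

/-- The full subcategory `𝒪_ε^μ` of `𝒪_ε` on which every `h̄ - μ(h)` is locally nilpotent. -/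
def catOmu (μ : Module.Dual ℂ 𝔥) : ObjectProperty (ModuleCat.{u} (UTakiff 𝔤)) := fun M =>
  catO 𝔥 Δ M ∧ ∀ (m : M) (h : 𝔥), ∃ n : ℕ,
    (toU (bar (h : 𝔤)) - algebraMap ℂ (UTakiff 𝔤) (μ h)) ^ n • m = 0

/-- The left ideal of `U(𝔤_ε)` generated by `𝔫_ε` and all `h - l(h)`, `h̄ - μ(h)`. -/
noncomputable def vermaIdeal (l μ : Module.Dual ℂ 𝔥) : Submodule (UTakiff 𝔤) (UTakiff 𝔤) :=
  Submodule.span (UTakiff 𝔤)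
    ({u | ∃ x ∈ takiffSub (nPlus 𝔥 Δ), u = toU x} ∪
      {u | ∃ h : 𝔥, u = toU (base (h : 𝔤)) - algebraMap ℂ (UTakiff 𝔤) (l h)} ∪
      {u | ∃ h : 𝔥, u = toU (bar (h : 𝔤)) - algebraMap ℂ (UTakiff 𝔤) (μ h)})

/-- The Verma module `M_{l,μ}`. -/
noncomputable def verma (l μ : Module.Dual ℂ 𝔥) : ModuleCat.{u} (UTakiff 𝔤) :=
  ModuleCat.of (UTakiff 𝔤) (UTakiff 𝔤 ⧸ vermaIdeal 𝔥 Δ l μ)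

/-- The simple module `L_{l,μ}`: the quotient of `M_{l,μ}` by its largest proper submodule. -/
noncomputable def simpleQuot (l μ : Module.Dual ℂ 𝔥) : ModuleCat.{u} (UTakiff 𝔤) :=
  ModuleCat.of (UTakiff 𝔤)
    (verma 𝔥 Δ l μ ⧸ sSup {N : Submodule (UTakiff 𝔤) (verma 𝔥 Δ l μ) | N ≠ ⊤})

/-- The shifted action `w •₂ l = w (l + 2ρ) - 2ρ`. -/
noncomputable def dotTwo (w : Module.Dual ℂ 𝔥 →ₗ[ℂ] Module.Dual ℂ 𝔥) (l : Module.Dual ℂ 𝔥) :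
    Module.Dual ℂ 𝔥 :=
  w (l + (2 : ℂ) • rho 𝔥 Δ) - (2 : ℂ) • rho 𝔥 Δ

end CategoryO

/-! ### Twisting functors -/

section Twisting

variable {𝔤 : Type u} [LieRing 𝔤] [LieAlgebra ℂ 𝔤] (𝔥 : LieSubalgebra ℂ 𝔤)
  [LieRing.IsNilpotent 𝔥]

/-- The choices entering the definition of the twisting functor at `α`: root vectors `e`, `f` for
`±α` with `[e, f] = h_α ∈ 𝔥`, `α(h_α) = 2`, and an automorphism `φ` of `𝔤` that lifts the
reflection `s_α` of `𝔥` and interchanges `e` and `f`. -/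
structure TwistingData (α : Module.Dual ℂ 𝔥) where
  /-- The root vector `e_α`. -/
  e : 𝔤
  /-- The root vector `f_α`. -/
  f : 𝔤
  /-- The coroot `h_α`. -/
  coroot : 𝔥
  e_mem : e ∈ LieAlgebra.rootSpace 𝔥 α
  f_mem : f ∈ LieAlgebra.rootSpace 𝔥 (-α)
  lie_e_f : ⁅e, f⁆ = (coroot : 𝔤)
  root_coroot : α coroot = 2
  /-- The automorphism `φ_α`. -/
  φ : 𝔤 ≃ₗ⁅ℂ⁆ 𝔤
  φ_coe : ∀ x : 𝔥, φ (x : 𝔤) = (Module.preReflection coroot α x : 𝔥)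
  φ_e : φ e = f
  φ_f : φ f = e

namespace TwistingData

variable {𝔥} {α : Module.Dual ℂ 𝔥} (D : TwistingData 𝔥 α)

/-- The reflection `s_α(l) = l - l(h_α) α` on `𝔥*`. -/
noncomputable def s : Module.Dual ℂ 𝔥 →ₗ[ℂ] Module.Dual ℂ 𝔥 :=
  Module.preReflection α (Module.Dual.eval ℂ 𝔥 D.coroot)

variable [FiniteDimensional ℂ 𝔤]

lemma isNilpotent_ad_f : IsNilpotent (LieAlgebra.ad ℂ 𝔤 D.f) := by
  refine LieAlgebra.isNilpotent_ad_of_mem_rootSpace 𝔥 (χ := -α) (fun h => ?_) D.f_mem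
  have h1 := congrFun h D.coroot
  have h2 := D.root_coroot
  simp [h2] at h1

/-- The pair `f_α`, `f̄_α` in `U(𝔤_ε)`. -/
noncomputable def pair : OrePair (UTakiff 𝔤) where
  a := toU (base D.f)
  b := toU (bar D.f)
  comm := by
    rw [commute_iff_eq, ← sub_eq_zero, ← toU_lie]
    simp [base, bar, toU]
  nil_a := adNil_toU 1 D.f D.isNilpotent_ad_f
  nil_b := adNil_toU DualNumber.eps D.f D.isNilpotent_ad_f

/-- The `U(𝔤_ε)`-bimodule `S_α = U_α / U'`. -/
abbrev S : Type u := D.pair.Bimod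

/-- The twisting functor `T_α M = φ_α(S_α ⊗_U M)`. -/
noncomputable def T : ModuleCat.{u} (UTakiff 𝔤) ⥤ ModuleCat.{u} (UTakiff 𝔤) :=
  tensorFunctor D.S ⋙ ModuleCat.restrictScalars (twist (D.φ : 𝔤 →ₗ⁅ℂ⁆ 𝔤)).toRingHom

/-- The functor `G_α M`: the maximal `𝔥`-semisimple submodule of `Hom_U(S_α, φ_α⁻¹(M))`. -/
noncomputable def G : ModuleCat.{u} (UTakiff 𝔤) ⥤ ModuleCat.{u} (UTakiff 𝔤) :=
  ModuleCat.restrictScalars (twist (D.φ.symm : 𝔤 →ₗ⁅ℂ⁆ 𝔤)).toRingHom ⋙ homFunctor D.S ⋙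
    hFunctor 𝔥

end TwistingData

/-- The functor between full subcategories obtained by restricting `F`. -/
abbrev restrictTo {C : Type*} [Category C] (F : C ⥤ C) {P Q : ObjectProperty C}
    (h : ∀ X, P X → Q (F.obj X)) : P.FullSubcategory ⥤ Q.FullSubcategory :=
  Q.lift (P.ι ⋙ F) fun X => h X.obj X.property

end Twisting

end TakiffO

/-! Write `f`, `e`, `h` for the `sl₂`-triple of `α` and add bars for the multiples by `ε`; in the
abstract part `a = f`, `b = f̄`, `e' = ē`, `h' = h̄`. The heart is the Takiff algebra of `sl₂`
acting with `h̄` of generalised eigenvalue `c = μ(h_α) ≠ 0`, so that `h̄` is invertible.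

Regularity. If `e` and `ē` are locally nilpotent on `M`, then `f̄, f` is a regular sequence on `M`
(`isRegularOn`). In identities such as `e^(k+1) f̄ w = f̄ e^(k+1) w + (k+1) h̄ e^k w`, valid when `ē
w = 0`, the invertible last term allows powers of `e` to be removed one at a time. The same formulas
read backwards show that locally nilpotent `f`, `f̄` are coregular.

Tensoring. Every element of `S ⊗ M` is a single fraction `f⁻ⁿ f̄⁻ⁿ ⊗ m`, and by regularity `f⁻ⁱ f̄⁻ʲ
⊗ m` vanishes exactly when `m ∈ fⁱ M + f̄ʲ M` (`IsRegularOn.of_br_eq_zero`), as in second local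
cohomology. Vectors of `S ⊗ M` killed by `f`, `f̄` have the form `f⁻¹ f̄⁻¹ ⊗ v` with `e v = ē v =
0`, and such a vector generates all `f⁻ⁱ f̄⁻ʲ ⊗ v` (`HighestType.br_mem`), because `ē` and `e` raise
the two exponents up to the invertible `h̄`. Hence `M` and `S ⊗ M` have isomorphic submodule
lattices (`HighestType.orderIso`), which transports finite generation and largest proper submodules.

Unit. A weight vector `g` of `Hom(S, S ⊗ M)` takes values `f⁻ᵏ f̄⁻ᵏ ⊗ m_k`, where the `m_k` have one
weight `l` and `m_(k+1) - m_k ∈ fᵏ M + f̄ᵏ M`. The correcting vectors have weight `l + kα`, and in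
`𝒪` there are none for large `k`; so `m_k` becomes constant and `g` comes from `M`.

Counit. Let `N` be the untwist of a module in `𝒪^(s μ)`, and `K` the largest submodule of `Hom(S,
N)` satisfying the conditions of `𝒪^μ` other than finite generation. Evaluation `S ⊗ K → N` is
injective since its kernel pulls back to zero in `K`. For surjectivity it suffices to reach each
weight vector `v` killed by `f`, `f̄`. Coregularity gives `n_1 = v`, `f f̄ n_(k+1) = n_k`, hence a
map `g` with `g(f⁻¹ f̄⁻¹) = v`. Choosing all `n_k` in one generalised eigenspace of the Casimir
element forces `e g = ē g = 0`, since a first nonzero value of `e g` would be killed by `f`, `f̄`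
and have the wrong weight (`CartanAction.exists_bimodHom`). So `N ≅ S ⊗ K`, and the statement on the
unit, applied to `K`, identifies `K` with the whole `𝔥`-semisimple part of `Hom(S, N)`. Unit and
counit of the tensor-hom adjunction are therefore isomorphisms.

Verma modules. If `v` generates `M_{λ,μ}`, then `f⁻¹ f̄⁻¹ ⊗ v` has weight `λ + 2α`, and the twist
turns it into a highest weight vector of weight `s(λ) - 2α = s •₂ λ`. The resulting map from a Verma
module is onto by the lattice isomorphism, and a left inverse comes from writing the untwisted
target Verma module as `S ⊗ K`. The root space facts for a reductive algebra are obtained from its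
semisimple quotient by the centre. -/

namespace TakiffO

universe u

set_option linter.unusedSectionVars false

/-! ### Elements of `S ⊗_A M` -/

section BalTensorElements

variable {A : Type u} [Ring A] (S : Type u) [AddCommGroup S] [Module A S] [Module Aᵐᵒᵖ S]
  [SMulCommClass A Aᵐᵒᵖ S] {M : Type u} [AddCommGroup M] [Module A M]

/-- The pure tensor `s ⊗ m`, as a biadditive map. -/
noncomputable def pureTensor : S →+ M →+ BalTensor (A := A) S M where
  toFun s :=
    { toFun := fun m => (balanced (A := A) S M).mkQ (s ⊗ₜ[ℤ] m)
      map_zero' := by rw [TensorProduct.tmul_zero, map_zero]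
      map_add' := fun m n => by rw [TensorProduct.tmul_add, map_add] }
  map_zero' := by
    ext m
    change (balanced (A := A) S M).mkQ ((0 : S) ⊗ₜ[ℤ] m) = 0
    rw [TensorProduct.zero_tmul, map_zero]
  map_add' s t := by
    ext m
    change (balanced (A := A) S M).mkQ ((s + t) ⊗ₜ[ℤ] m) = (balanced (A := A) S M).mkQ (s ⊗ₜ[ℤ] m)
      + (balanced (A := A) S M).mkQ (t ⊗ₜ[ℤ] m)
    rw [TensorProduct.add_tmul, map_add]

variable {S}

lemma smul_pureTensor (u : A) (s : S) (m : M) :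
    u • pureTensor (A := A) S s m = pureTensor S (u • s) m := rfl

lemma pureTensor_op_smul (u : A) (s : S) (m : M) :
    pureTensor (A := A) S (MulOpposite.op u • s) m = pureTensor S s (u • m) := by
  rw [← sub_eq_zero]
  change (balanced (A := A) S M).mkQ ((MulOpposite.op u • s) ⊗ₜ[ℤ] m) -
    (balanced (A := A) S M).mkQ (s ⊗ₜ[ℤ] (u • m)) = 0
  rw [← map_sub, Submodule.mkQ_apply, Submodule.Quotient.mk_eq_zero]
  exact Submodule.subset_span ⟨s, u, m, rfl⟩

lemma balTensor_induction {p : BalTensor (A := A) S M → Prop} (t : BalTensor (A := A) S M)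
    (h1 : ∀ s m, p (pureTensor (A := A) S s m)) (h2 : ∀ x y, p x → p y → p (x + y)) : p t := by
  obtain ⟨t, rfl⟩ := Submodule.Quotient.mk_surjective _ t
  induction t using TensorProduct.induction_on with
  | zero => simpa using h1 0 0
  | tmul s m => exact h1 s m
  | add x y hx hy => exact h2 _ _ hx hy

lemma BalTensor.map_pureTensor {N : Type u} [AddCommGroup N] [Module A N] (f : M →ₗ[A] N) (s : S)
    (m : M) : BalTensor.map S f (pureTensor (A := A) S s m) = pureTensor S s (f m) := rfl

/-- An element of `Hom_A(S, N)` as a linear map. -/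
def BimodHom.toLin {N : Type u} [AddCommGroup N] [Module A N] (g : BimodHom (A := A) S N) :
    S →ₗ[A] N := g

/-- A linear map as an element of `Hom_A(S, N)`. -/
def BimodHom.ofLin {N : Type u} [AddCommGroup N] [Module A N] (g : S →ₗ[A] N) :
    BimodHom (A := A) S N := g

lemma BimodHom.map_smul' {N : Type u} [AddCommGroup N] [Module A N] (g : BimodHom (A := A) S N)
    (u : A) (s : S) : g (u • s) = u • g s := LinearMap.map_smul g.toLin u s

lemma BimodHom.map_add' {N : Type u} [AddCommGroup N] [Module A N] (g : BimodHom (A := A) S N)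
    (s t : S) : g (s + t) = g s + g t := LinearMap.map_add g.toLin s t

lemma BimodHom.map_zsmul' {N : Type u} [AddCommGroup N] [Module A N] (g : BimodHom (A := A) S N)
    (r : ℤ) (s : S) : g (r • s) = r • g s := map_zsmul g.toLin r s

lemma BimodHom.map_zero' {N : Type u} [AddCommGroup N] [Module A N] (g : BimodHom (A := A) S N) :
    g 0 = 0 := LinearMap.map_zero g.toLin

lemma BimodHom.zsmul_apply {N : Type u} [AddCommGroup N] [Module A N] (g : BimodHom (A := A) S N)
    (r : ℤ) (s : S) : (r • g) s = r • g s := rfl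

/-- The linear map out of `S ⊗_A M` attached to a balanced map. -/
noncomputable def balLift {N : Type u} [AddCommGroup N] [Module A N]
    (f : M →ₗ[A] BimodHom (A := A) S N) : BalTensor (A := A) S M →ₗ[A] N :=
  (balanced (A := A) S M).liftQ
    { toFun := TensorProduct.liftAddHom
        { toFun := fun s => { toFun := fun m => f m s
                              map_zero' := by rw [map_zero]; rfl
                              map_add' := fun m n => by rw [map_add]; rfl }
          map_zero' := by ext m; exact (f m).map_zero'
          map_add' := fun s t => by ext m; exact (f m).map_add' s t }
        (fun r s m => by
          change f m (r • s) = f (r • m) s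
          rw [BimodHom.map_zsmul', map_zsmul f, BimodHom.zsmul_apply])
      map_add' := fun x y => map_add _ x y
      map_smul' := fun u x => by
        induction x using TensorProduct.induction_on with
        | zero => simp
        | tmul s m =>
          rw [TensorProduct.smul_tmul']
          exact (f m).map_smul' u s
        | add x y hx hy => rw [smul_add, map_add, hx, hy, map_add, smul_add] }
    (by
      rw [balanced, Submodule.span_le]
      rintro _ ⟨s, u, m, rfl⟩
      rw [SetLike.mem_coe, LinearMap.mem_ker, map_sub, sub_eq_zero]
      change f m (MulOpposite.op u • s) = f (u • m) s
      rw [LinearMap.map_smul, BimodHom.smul_apply])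

variable (S M) in
/-- The unit `m ↦ (s ↦ s ⊗ m)` of the tensor-hom adjunction. -/
noncomputable def balUnit : M →ₗ[A] BimodHom (A := A) S (BalTensor (A := A) S M) where
  toFun m := show S →ₗ[A] BalTensor (A := A) S M from
    { toFun := fun s => pureTensor (A := A) S s m
      map_add' := fun s t => by rw [map_add]; rfl
      map_smul' := fun u s => rfl }
  map_add' m n := BimodHom.ext fun s => map_add (pureTensor (A := A) S s) m n
  map_smul' u m := BimodHom.ext fun s => (pureTensor_op_smul u s m).symm

lemma balUnit_apply (m : M) (s : S) : balUnit (A := A) S M m s = pureTensor (A := A) S s m := rfl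

end BalTensorElements

/-! ### Fractions `a⁻ⁱ b⁻ʲ` in the localisation -/

namespace OrePair

variable {A : Type u} [Ring A] (P : OrePair A)

/-- The fraction `a⁻ⁱ b⁻ʲ`. -/
noncomputable def frac (i j : ℤ) : P.Loc := ((P.ua ^ (-i) * P.ub ^ (-j) : P.Locˣ) : P.Loc)

/-- The projection of the localisation onto the bimodule. -/
noncomputable def proj : P.Loc →ₗ[A] P.Bimod := P.sub.mkQ

lemma proj_surjective : Function.Surjective P.proj := Submodule.mkQ_surjective _

lemma smul_proj (u : A) (x : P.Loc) : u • P.proj x = P.proj (P.toLoc u * x) := by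
  rw [← map_smul, smul_eq_toLoc_mul]

lemma op_smul_proj (u : A) (x : P.Loc) :
    MulOpposite.op u • P.proj x = P.proj (x * P.toLoc u) := rfl

lemma proj_eq_zero {x : P.Loc} (hx : x ∈ P.gens) : P.proj x = 0 :=
  (Submodule.Quotient.mk_eq_zero _).mpr (AddSubgroup.subset_closure hx)

lemma proj_frac_mul (i j : ℤ) (h : i ≤ 0 ∨ j ≤ 0) (u : A) :
    P.proj (P.frac i j * P.toLoc u) = 0 := by
  refine P.proj_eq_zero ⟨-i, -j, u, by omega, ?_⟩
  rw [frac, Units.val_mul]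

lemma proj_frac (i j : ℤ) (h : i ≤ 0 ∨ j ≤ 0) : P.proj (P.frac i j) = 0 := by
  simpa using P.proj_frac_mul i j h 1

lemma frac_zero : P.frac 0 0 = 1 := by simp [frac]

lemma a_mul_frac (i j : ℤ) : P.toLoc P.a * P.frac i j = P.frac (i - 1) j := by
  rw [← coe_ua, frac, frac, ← Units.val_mul, ← mul_assoc, ← zpow_one_add]
  congr 3; ring

lemma b_mul_frac (i j : ℤ) : P.toLoc P.b * P.frac i j = P.frac i (j - 1) := by
  rw [← coe_ub, frac, frac, ← Units.val_mul, ((P.commute_units).zpow_zpow _ _).eq, ← mul_assoc,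
    ← zpow_one_add, ((P.commute_units).zpow_zpow _ _).eq]
  congr 3; ring

lemma frac_mul_a (i j : ℤ) : P.frac i j * P.toLoc P.a = P.frac (i - 1) j := by
  rw [← a_mul_frac, ← coe_ua, frac, ← Units.val_mul, ← Units.val_mul]
  congr 1
  exact ((Commute.refl P.ua).zpow_right _).mul_right (P.commute_units.zpow_right _) |>.symm.eq

lemma frac_mul_b (i j : ℤ) : P.frac i j * P.toLoc P.b = P.frac i (j - 1) := by
  rw [← b_mul_frac, ← coe_ub, frac, ← Units.val_mul, ← Units.val_mul]
  congr 1
  exact (P.commute_units.symm.zpow_right _).mul_right ((Commute.refl P.ub).zpow_right _) |>.symm.eq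

lemma a_pow_mul_frac (n : ℕ) (i j : ℤ) : P.toLoc P.a ^ n * P.frac i j = P.frac (i - n) j := by
  induction n generalizing i with
  | zero => simp
  | succ n ih => rw [pow_succ, mul_assoc, a_mul_frac, ih]; push_cast; congr 1; ring

lemma b_pow_mul_frac (n : ℕ) (i j : ℤ) : P.toLoc P.b ^ n * P.frac i j = P.frac i (j - n) := by
  induction n generalizing j with
  | zero => simp
  | succ n ih => rw [pow_succ, mul_assoc, b_mul_frac, ih]; push_cast; congr 1; ring

lemma frac_mul_a_pow (n : ℕ) (i j : ℤ) : P.frac i j * P.toLoc P.a ^ n = P.frac (i - n) j := by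
  induction n generalizing i with
  | zero => simp
  | succ n ih => rw [pow_succ', ← mul_assoc, frac_mul_a, ih]; push_cast; congr 1; ring

lemma frac_mul_b_pow (n : ℕ) (i j : ℤ) : P.frac i j * P.toLoc P.b ^ n = P.frac i (j - n) := by
  induction n generalizing j with
  | zero => simp
  | succ n ih => rw [pow_succ', ← mul_assoc, frac_mul_b, ih]; push_cast; congr 1; ring

lemma frac_mul_frac (i j k l : ℤ) : P.frac i j * P.frac k l = P.frac (i + k) (j + l) := by
  rw [frac, frac, frac, ← Units.val_mul]
  congr 1
  rw [mul_assoc, ← mul_assoc (P.ub ^ _), ((P.commute_units).zpow_zpow _ _).symm.eq, mul_assoc,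
    ← zpow_add, ← mul_assoc, ← zpow_add]
  congr 2 <;> ring

lemma frac_mul_neg (i j : ℤ) : P.frac i j * P.frac (-i) (-j) = 1 := by
  rw [frac_mul_frac, add_neg_cancel, add_neg_cancel, frac_zero]

lemma frac_neg_nat (i j : ℕ) : P.frac (-i) (-j) = P.toLoc (P.a ^ i * P.b ^ j) := by
  simp [frac, coe_ua, coe_ub]

/-- Every element of the localisation is a left fraction with denominator `aⁿ bⁿ`. -/
lemma exists_left_frac (x : P.Loc) : ∃ (n : ℕ) (u : A), x = P.frac n n * P.toLoc u := by
  induction x using OreLocalization.ind with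
  | _ r s =>
    obtain ⟨_, i, j, rfl⟩ := s
    -- The denominator `aⁱ bʲ` is multiplied by `aʲ bⁱ` so that both exponents become `i + j`.
    refine ⟨i + j, P.a ^ j * P.b ^ i * r, ?_⟩
    have h1 : P.toLoc (P.a ^ i * P.b ^ j) *
        (r /ₒ (⟨P.a ^ i * P.b ^ j, i, j, rfl⟩ : P.powers) : P.Loc) = P.toLoc r := by
      exact OreLocalization.mul_cancel (s := (⟨P.a ^ i * P.b ^ j, i, j, rfl⟩ : P.powers)) (t := 1)
    rw [← frac_neg_nat] at h1
    rw [map_mul, ← frac_neg_nat, ← h1, ← mul_assoc, ← mul_assoc, frac_mul_frac, frac_mul_frac]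
    have e1 : ((i + j : ℕ) : ℤ) + -j + -i = 0 := by push_cast; ring
    have e2 : ((i + j : ℕ) : ℤ) + -i + -j = 0 := by push_cast; ring
    rw [e1, e2, frac_zero, one_mul]

end OrePair

/-! ### Moving elements past fractions; linear maps out of the bimodule -/

namespace OrePair

variable {A : Type u} [Ring A] (P : OrePair A)

/-- `a⁻¹ x - x a⁻¹` in terms of the commutator. -/
lemma toLoc_mul_frac_one_zero (x : A) : P.toLoc x * P.frac 1 0 =
    P.frac 1 0 * P.toLoc x + P.frac 1 0 * P.toLoc (P.a * x - x * P.a) * P.frac 1 0 := by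
  have h1 : P.frac 1 0 * P.toLoc P.a = 1 := by rw [frac_mul_a, sub_self, frac_zero]
  have h2 : P.toLoc P.a * P.frac 1 0 = 1 := by rw [a_mul_frac, sub_self, frac_zero]
  rw [map_sub, map_mul, map_mul, mul_sub, sub_mul, ← mul_assoc, h1, one_mul, mul_assoc,
    mul_assoc (P.toLoc x), h2, mul_one]
  abel

lemma toLoc_mul_frac_zero_one (x : A) : P.toLoc x * P.frac 0 1 =
    P.frac 0 1 * P.toLoc x + P.frac 0 1 * P.toLoc (P.b * x - x * P.b) * P.frac 0 1 := by
  have h1 : P.frac 0 1 * P.toLoc P.b = 1 := by rw [frac_mul_b, sub_self, frac_zero]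
  have h2 : P.toLoc P.b * P.frac 0 1 = 1 := by rw [b_mul_frac, sub_self, frac_zero]
  rw [map_sub, map_mul, map_mul, mul_sub, sub_mul, ← mul_assoc, h1, one_mul, mul_assoc,
    mul_assoc (P.toLoc x), h2, mul_one]
  abel

section Span

variable (V : AddSubgroup A)

/-- The additive span of the products `a⁻ⁱ b⁻ʲ y` with `y ∈ V`. -/
noncomputable def leftSpan : AddSubgroup P.Loc :=
  AddSubgroup.closure {x | ∃ (i j : ℤ) (y : A), y ∈ V ∧ x = P.frac i j * P.toLoc y}

/-- The additive span of the products `y a⁻ⁱ b⁻ʲ` with `y ∈ V`. -/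
noncomputable def rightSpan : AddSubgroup P.Loc :=
  AddSubgroup.closure {x | ∃ (i j : ℤ) (y : A), y ∈ V ∧ x = P.toLoc y * P.frac i j}

variable {V}

lemma frac_mul_mem_leftSpan (i j : ℤ) {x : P.Loc} (hx : x ∈ P.leftSpan V) :
    P.frac i j * x ∈ P.leftSpan V := by
  induction hx using AddSubgroup.closure_induction with
  | mem x hx =>
    obtain ⟨k, l, y, hy, rfl⟩ := hx
    exact AddSubgroup.subset_closure ⟨i + k, j + l, y, hy, by rw [← mul_assoc, frac_mul_frac]⟩
  | zero => rw [mul_zero]; exact zero_mem _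
  | add x y _ _ h1 h2 => rw [mul_add]; exact add_mem h1 h2
  | neg x _ h => rw [mul_neg]; exact neg_mem h

lemma mul_frac_mem_rightSpan (i j : ℤ) {x : P.Loc} (hx : x ∈ P.rightSpan V) :
    x * P.frac i j ∈ P.rightSpan V := by
  induction hx using AddSubgroup.closure_induction with
  | mem x hx =>
    obtain ⟨k, l, y, hy, rfl⟩ := hx
    exact AddSubgroup.subset_closure ⟨k + i, l + j, y, hy, by rw [mul_assoc, frac_mul_frac]⟩
  | zero => rw [zero_mul]; exact zero_mem _
  | add x y _ _ h1 h2 => rw [add_mul]; exact add_mem h1 h2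
  | neg x _ h => rw [neg_mul]; exact neg_mem h

lemma toLoc_mem_leftSpan {x : A} (hx : x ∈ V) : P.toLoc x ∈ P.leftSpan V :=
  AddSubgroup.subset_closure ⟨0, 0, x, hx, by rw [frac_zero, one_mul]⟩

lemma toLoc_mem_rightSpan {x : A} (hx : x ∈ V) : P.toLoc x ∈ P.rightSpan V :=
  AddSubgroup.subset_closure ⟨0, 0, x, hx, by rw [frac_zero, mul_one]⟩

lemma leftSpan_mul_of_forall (z : P.Loc) (h : ∀ x ∈ V, P.toLoc x * z ∈ P.leftSpan V) {x : P.Loc}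
    (hx : x ∈ P.leftSpan V) : x * z ∈ P.leftSpan V := by
  induction hx using AddSubgroup.closure_induction with
  | mem x hx =>
    obtain ⟨k, l, y, hy, rfl⟩ := hx
    rw [mul_assoc]
    exact P.frac_mul_mem_leftSpan _ _ (h y hy)
  | zero => rw [zero_mul]; exact zero_mem _
  | add x y _ _ h1 h2 => rw [add_mul]; exact add_mem h1 h2
  | neg x _ h => rw [neg_mul]; exact neg_mem h

lemma mul_rightSpan_of_forall (z : P.Loc) (h : ∀ x ∈ V, z * P.toLoc x ∈ P.rightSpan V) {x : P.Loc}
    (hx : x ∈ P.rightSpan V) : z * x ∈ P.rightSpan V := by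
  induction hx using AddSubgroup.closure_induction with
  | mem x hx =>
    obtain ⟨k, l, y, hy, rfl⟩ := hx
    rw [← mul_assoc]
    exact P.mul_frac_mem_rightSpan _ _ (h y hy)
  | zero => rw [mul_zero]; exact zero_mem _
  | add x y _ _ h1 h2 => rw [mul_add]; exact add_mem h1 h2
  | neg x _ h => rw [mul_neg]; exact neg_mem h

variable (ha : ∀ x ∈ V, P.a * x - x * P.a ∈ V) (hb : ∀ x ∈ V, P.b * x - x * P.b ∈ V)

-- Induction on the nilpotency order of `ad a` at `x`: in `x a⁻¹ = a⁻¹ x + a⁻¹ [a, x] a⁻¹` the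
-- commutator lies again in `V` and has smaller order. Solving the same identity for `a⁻¹ x` gives
-- the other half.
include ha in
lemma toLoc_mul_frac_a_mem (x : A) (hx : x ∈ V) : P.toLoc x * P.frac 1 0 ∈ P.leftSpan V ∧
    P.frac 1 0 * P.toLoc x ∈ P.rightSpan V := by
  obtain ⟨n, hn⟩ := P.nil_a x
  induction n generalizing x with
  | zero =>
    have : x = 0 := hn
    rw [this, map_zero, zero_mul, mul_zero]
    exact ⟨zero_mem _, zero_mem _⟩
  | succ n ih =>
    obtain ⟨h1, h2⟩ := ih _ (ha x hx) (by simpa using hn)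
    have e := P.toLoc_mul_frac_one_zero x
    refine ⟨?_, ?_⟩
    · rw [e, mul_assoc]
      exact add_mem (P.frac_mul_mem_leftSpan _ _ (P.toLoc_mem_leftSpan hx))
        (P.frac_mul_mem_leftSpan _ _ h1)
    · rw [← sub_eq_iff_eq_add] at e
      rw [← e]
      exact sub_mem (P.mul_frac_mem_rightSpan _ _ (P.toLoc_mem_rightSpan hx))
        (P.mul_frac_mem_rightSpan _ _ h2)

include hb in
lemma toLoc_mul_frac_b_mem (x : A) (hx : x ∈ V) : P.toLoc x * P.frac 0 1 ∈ P.leftSpan V ∧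
    P.frac 0 1 * P.toLoc x ∈ P.rightSpan V := by
  obtain ⟨n, hn⟩ := P.nil_b x
  induction n generalizing x with
  | zero =>
    have : x = 0 := hn
    rw [this, map_zero, zero_mul, mul_zero]
    exact ⟨zero_mem _, zero_mem _⟩
  | succ n ih =>
    obtain ⟨h1, h2⟩ := ih _ (hb x hx) (by simpa using hn)
    have e := P.toLoc_mul_frac_zero_one x
    refine ⟨?_, ?_⟩
    · rw [e, mul_assoc]
      exact add_mem (P.frac_mul_mem_leftSpan _ _ (P.toLoc_mem_leftSpan hx))
        (P.frac_mul_mem_leftSpan _ _ h1)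
    · rw [← sub_eq_iff_eq_add] at e
      rw [← e]
      exact sub_mem (P.mul_frac_mem_rightSpan _ _ (P.toLoc_mem_rightSpan hx))
        (P.mul_frac_mem_rightSpan _ _ h2)

-- The inverses are peeled off one at a time. With `V` the nilradical of the minimal parabolic
-- attached to `α`, this is what carries nilpotency conditions across fractions.
include ha hb in
lemma leftSpan_rightSpan_nat (i j : ℕ) :
    (∀ x ∈ P.leftSpan V, x * P.frac i j ∈ P.leftSpan V) ∧
    (∀ x ∈ P.rightSpan V, P.frac i j * x ∈ P.rightSpan V) := by
  induction i with
  | zero =>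
    induction j with
    | zero => simp [frac_zero]
    | succ j ih =>
      have e1 : P.frac ((0 : ℕ) : ℤ) ((j + 1 : ℕ) : ℤ) = P.frac (0 : ℕ) j * P.frac 0 1 := by
        rw [frac_mul_frac]; push_cast; simp
      refine ⟨fun x hx => ?_, fun x hx => ?_⟩
      · rw [e1, ← mul_assoc]
        exact P.leftSpan_mul_of_forall _ (fun x hx => (P.toLoc_mul_frac_b_mem hb x hx).1)
          (ih.1 x hx)
      · rw [e1, mul_assoc]
        exact ih.2 _ (P.mul_rightSpan_of_forall _ (fun x hx => (P.toLoc_mul_frac_b_mem hb x hx).2)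
          hx)
  | succ i ih =>
    have e1 : P.frac ((i + 1 : ℕ) : ℤ) (j : ℤ) = P.frac (i : ℕ) j * P.frac 1 0 := by
      rw [frac_mul_frac]; push_cast; simp
    refine ⟨fun x hx => ?_, fun x hx => ?_⟩
    · rw [e1, ← mul_assoc]
      exact P.leftSpan_mul_of_forall _ (fun x hx => (P.toLoc_mul_frac_a_mem ha x hx).1)
        (ih.1 x hx)
    · rw [e1, mul_assoc]
      exact ih.2 _ (P.mul_rightSpan_of_forall _ (fun x hx => (P.toLoc_mul_frac_a_mem ha x hx).2)
        hx)

include ha hb in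
lemma toLoc_mul_frac_mem_leftSpan (i j : ℕ) {x : A} (hx : x ∈ V) :
    P.toLoc x * P.frac i j ∈ P.leftSpan V :=
  (P.leftSpan_rightSpan_nat ha hb i j).1 _ (P.toLoc_mem_leftSpan hx)

include ha hb in
lemma frac_mul_toLoc_mem_rightSpan (i j : ℕ) {x : A} (hx : x ∈ V) :
    P.frac i j * P.toLoc x ∈ P.rightSpan V :=
  (P.leftSpan_rightSpan_nat ha hb i j).2 _ (P.toLoc_mem_rightSpan hx)

end Span

lemma toLoc_mul_frac_eq (u : A) (k l i j : ℕ) (hi : i ≤ k) (hj : j ≤ l) :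
    P.toLoc u * P.frac i j = P.toLoc (u * (P.a ^ (k - i) * P.b ^ (l - j))) * P.frac k l := by
  rw [map_mul, ← frac_neg_nat, mul_assoc, frac_mul_frac]
  congr 2 <;> push_cast [hi, hj] <;> ring

/-- Every element of the localisation is a right fraction with denominator `aⁿ bⁿ`. -/
lemma exists_right_frac (x : P.Loc) : ∃ (n : ℕ) (u : A), x = P.toLoc u * P.frac n n := by
  obtain ⟨n, u, rfl⟩ := P.exists_left_frac x
  -- For `V = ⊤` the right span already consists of sums of right fractions; only a common
  -- denominator remains to be found.
  have h := P.frac_mul_toLoc_mem_rightSpan (V := ⊤) (by simp) (by simp) n n (x := u) (by simp)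
  generalize P.frac n n * P.toLoc u = x at h
  induction h using AddSubgroup.closure_induction with
  | mem x hx =>
    obtain ⟨i, j, y, -, rfl⟩ := hx
    refine ⟨i.toNat + j.toNat, y * (P.a ^ ((i.toNat + j.toNat : ℕ) - i).toNat *
      P.b ^ ((i.toNat + j.toNat : ℕ) - j).toNat), ?_⟩
    rw [map_mul, ← frac_neg_nat, mul_assoc, frac_mul_frac]
    congr 2 <;> omega
  | zero => exact ⟨0, 0, by simp⟩
  | add x y _ _ h1 h2 =>
    obtain ⟨n, u, rfl⟩ := h1
    obtain ⟨m, v, rfl⟩ := h2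
    rw [P.toLoc_mul_frac_eq u (n + m) (n + m) n n (by omega) (by omega),
      P.toLoc_mul_frac_eq v (n + m) (n + m) m m (by omega) (by omega), ← add_mul, ← map_add]
    exact ⟨_, _, rfl⟩
  | neg x _ h =>
    obtain ⟨n, u, rfl⟩ := h
    exact ⟨n, -u, by rw [map_neg, neg_mul]⟩

lemma exists_smul_proj_frac (s : P.Bimod) : ∃ (n : ℕ) (u : A), s = u • P.proj (P.frac n n) := by
  obtain ⟨x, rfl⟩ := P.proj_surjective s
  obtain ⟨n, u, rfl⟩ := P.exists_right_frac x
  exact ⟨n, u, (P.smul_proj _ _).symm⟩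

lemma bimodHom_ext {N : Type u} [AddCommGroup N] [Module A N] {g h : BimodHom (A := A) P.Bimod N}
    (H : ∀ n : ℕ, g (P.proj (P.frac n n)) = h (P.proj (P.frac n n))) : g = h := by
  refine BimodHom.ext fun s => ?_
  obtain ⟨n, u, rfl⟩ := P.exists_smul_proj_frac s
  rw [BimodHom.map_smul', BimodHom.map_smul', H]

/-- This is `AdNil.movesPast` in the opposite ring, where `ad a` changes only by a sign. -/
lemma _root_.TakiffO.AdNil.exists_mul_pow {a x : A} (h : AdNil a x) (i : ℕ) :
    ∃ (j : ℕ) (y : A), x * a ^ j = a ^ i * y := by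
  have key : ∀ (n : ℕ) (x : A), (fun y => a * y - y * a)^[n] x = 0 →
      (fun y => MulOpposite.op a * y - y * MulOpposite.op a)^[n] (MulOpposite.op x) = 0 := by
    intro n
    induction n with
    | zero => intro x hx; exact congrArg MulOpposite.op hx
    | succ n ih =>
      intro x hx
      rw [Function.iterate_succ_apply] at hx ⊢
      have h1 : (fun y => a * y - y * a)^[n] (-(a * x - x * a)) = 0 := by
        have := iterate_ad_add a (a * x - x * a) (-(a * x - x * a)) n
        rw [add_neg_cancel, iterate_ad_zero, hx, zero_add] at this
        exact this.symm
      have := ih _ h1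
      rwa [neg_sub] at this
  obtain ⟨n, hn⟩ := h
  obtain ⟨j, y, hy⟩ := AdNil.movesPast ⟨n, key n x hn⟩ i
  exact ⟨j, y.unop, congrArg MulOpposite.unop hy⟩

lemma zpow_a_mul_toLoc (u : A) (i : ℤ) : ∃ (q : ℕ) (v : A),
    ((P.ua ^ i : P.Locˣ) : P.Loc) * P.toLoc u = P.toLoc v * P.frac q 0 := by
  obtain ⟨k, rfl | rfl⟩ := i.eq_nat_or_neg
  · exact ⟨0, P.a ^ k * u, by simp [coe_ua, frac_zero]⟩
  · obtain ⟨q, v, h⟩ := (P.nil_a u).exists_mul_pow k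
    refine ⟨q, v, ?_⟩
    rw [frac, neg_zero, zpow_zero, mul_one, zpow_neg, zpow_neg, zpow_natCast, zpow_natCast,
      Units.eq_mul_inv_iff_mul_eq, mul_assoc, Units.inv_mul_eq_iff_eq_mul]
    simpa [coe_ua] using congrArg P.toLoc h

lemma zpow_b_mul_toLoc (u : A) (i : ℤ) : ∃ (q : ℕ) (v : A),
    ((P.ub ^ i : P.Locˣ) : P.Loc) * P.toLoc u = P.toLoc v * P.frac 0 q := by
  obtain ⟨k, rfl | rfl⟩ := i.eq_nat_or_neg
  · exact ⟨0, P.b ^ k * u, by simp [coe_ub, frac_zero]⟩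
  · obtain ⟨q, v, h⟩ := (P.nil_b u).exists_mul_pow k
    refine ⟨q, v, ?_⟩
    rw [frac, neg_zero, zpow_zero, one_mul, zpow_neg, zpow_neg, zpow_natCast, zpow_natCast,
      Units.eq_mul_inv_iff_mul_eq, mul_assoc, Units.inv_mul_eq_iff_eq_mul]
    simpa [coe_ub] using congrArg P.toLoc h

lemma _root_.TakiffO.AdNil.cancel_left {a r : A} (h : AdNil a r) (hr : a * r = 0) :
    ∃ n : ℕ, r * a ^ n = 0 := by
  obtain ⟨n, hn⟩ := h
  induction n generalizing r with
  | zero => exact ⟨0, by simpa using hn⟩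
  | succ n ih =>
    obtain ⟨m, hm⟩ := ih (r := a * r - r * a)
      (by rw [hr, zero_sub, mul_neg, ← mul_assoc, hr, zero_mul, neg_zero]) (by simpa using hn)
    exact ⟨m + 1, by rw [pow_succ', ← mul_assoc]; simpa [hr] using hm⟩

lemma _root_.TakiffO.AdNil.cancel_left_pow {a r : A} (h : ∀ x : A, AdNil a x) (i : ℕ)
    (hr : a ^ i * r = 0) : ∃ n : ℕ, r * a ^ n = 0 := by
  induction i generalizing r with
  | zero => exact ⟨0, by simpa using hr⟩
  | succ i ih =>
    rw [pow_succ, mul_assoc] at hr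
    obtain ⟨m, hm⟩ := ih hr
    rw [mul_assoc] at hm
    obtain ⟨k, hk⟩ := (h (r * a ^ m)).cancel_left (by rw [hm])
    exact ⟨m + k, by rw [pow_add, ← mul_assoc, hk]⟩

/-- The left Ore condition gives an annihilator on the left. Local nilpotency of `ad a` and `ad b`
moves it to the right, where it can be absorbed by the sequence in `exists_bimodHom`. -/
lemma exists_mul_pow_eq_zero {r : A} (hr : P.toLoc r = 0) :
    ∃ n : ℕ, r * (P.a ^ n * P.b ^ n) = 0 := by
  have h0 : r /ₒ (1 : P.powers) = 0 /ₒ 1 := by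
    rw [OreLocalization.zero_oreDiv]; exact hr
  obtain ⟨⟨_, i, j, rfl⟩, v, h1, h2⟩ := OreLocalization.oreDiv_eq_iff.mp h0
  have h3 : P.a ^ i * (P.b ^ j * r) = 0 := by
    have h4 : P.a ^ i * P.b ^ j * 1 = v * 1 := h2
    rw [mul_one, mul_one] at h4
    rw [← mul_assoc, h4]
    rw [← smul_eq_mul, ← h1, smul_zero]
  obtain ⟨k, hk⟩ := AdNil.cancel_left_pow P.nil_a i h3
  rw [mul_assoc] at hk
  obtain ⟨l, hl⟩ := AdNil.cancel_left_pow P.nil_b j hk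
  refine ⟨k + l, ?_⟩
  rw [pow_add P.b, add_comm, pow_add, ← mul_assoc, ← mul_assoc]
  have e : r * (P.a ^ l * P.a ^ k) * P.b ^ k * P.b ^ l
      = r * P.a ^ k * P.b ^ l * (P.a ^ l * P.b ^ k) := by
    rw [(Commute.pow_pow_self P.a l k).eq]
    simp only [mul_assoc]
    rw [← mul_assoc (P.b ^ l) (P.a ^ l), ((P.comm.symm).pow_pow l l).eq, mul_assoc,
      (Commute.pow_pow_self P.b l k).eq]
  rw [e, hl, zero_mul]

/-- A sequence `n k` that behaves like `a⁻ᵏ b⁻ᵏ` defines a linear map on the bimodule. -/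
theorem exists_bimodHom {N : Type u} [AddCommGroup N] [Module A N] (n : ℕ → N)
    (hn : ∀ k, (P.a * P.b) • n (k + 1) = n k) (ha : ∀ k, P.a ^ k • n k = 0)
    (hb : ∀ k, P.b ^ k • n k = 0) :
    ∃ g : BimodHom (A := A) P.Bimod N, ∀ k : ℕ, g (P.proj (P.frac k k)) = n k := by
  have hn' : ∀ p k, (P.a ^ p * P.b ^ p) • n (k + p) = n k := by
    intro p
    induction p with
    | zero => simp
    | succ p ih =>
      intro k
      rw [← hn k, ← ih (k + 1), ← mul_smul]
      congr 1
      · rw [pow_succ', pow_succ', mul_assoc, ← mul_assoc (P.a ^ p), (P.comm.pow_left p).eq]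
        simp only [mul_assoc]
      · congr 1; omega
  -- The right fraction `u a⁻ᵏ b⁻ᵏ` must go to `u • n k`. Over a common denominator two
  -- presentations differ by a numerator killed on the right by some `aᵖ bᵖ`, and `n (k + l) = aᵖ bᵖ
  -- • n (k + l + p)`.
  have wd : ∀ (u u' : A) (k l : ℕ), P.toLoc u * P.frac k k = P.toLoc u' * P.frac l l →
      u • n k = u' • n l := by
    intro u u' k l h
    rw [P.toLoc_mul_frac_eq u (k + l) (k + l) k k (by omega) (by omega),
      P.toLoc_mul_frac_eq u' (k + l) (k + l) l l (by omega) (by omega)] at h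
    have h1 := congrArg (· * P.frac (-(k + l : ℕ)) (-(k + l : ℕ))) h
    simp only [mul_assoc, frac_mul_neg, mul_one, Nat.add_sub_cancel_left, Nat.add_sub_cancel] at h1
    rw [← sub_eq_zero, ← map_sub] at h1
    obtain ⟨p, hp⟩ := P.exists_mul_pow_eq_zero h1
    have h2 := congrArg (· • n (k + l + p)) hp
    simp only [zero_smul] at h2
    rw [mul_smul, hn', sub_smul, sub_eq_zero, mul_smul, mul_smul u', hn' l k, add_comm k l,
      hn' k l] at h2
    exact h2
  choose K U hU using P.exists_right_frac
  let g : P.Loc →ₗ[A] N :=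
    { toFun := fun x => U x • n (K x)
      map_add' := fun x y => by
        rw [← hn' (K y) (K x)]
        conv_rhs => rw [← hn' (K x) (K y)]
        rw [add_comm (K y), ← mul_smul, ← mul_smul, ← add_smul]
        refine wd _ _ _ _ ?_
        rw [← hU, map_add, add_mul]
        nth_rewrite 1 [hU x, hU y]
        rw [P.toLoc_mul_frac_eq (U x) (K x + K y) (K x + K y) (K x) (K x) (by omega) (by omega),
          P.toLoc_mul_frac_eq (U y) (K x + K y) (K x + K y) (K y) (K y) (by omega) (by omega),
          Nat.add_sub_cancel_left, Nat.add_sub_cancel]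
      map_smul' := fun v x => by
        rw [RingHom.id_apply, ← mul_smul]
        refine wd _ _ _ _ ?_
        rw [← hU, smul_eq_toLoc_mul, map_mul, mul_assoc, ← hU] }
  have hg : ∀ (u : A) (k : ℕ), g (P.toLoc u * P.frac k k) = u • n k := fun u k => wd _ _ _ _ (hU _).symm
  -- A generator with nonnegative exponent of `a` can be written `v a^q a⁻q b⁻q`, and `a^q` kills `n
  -- q`; likewise for `b`.
  have hsub : P.sub ≤ LinearMap.ker g := by
    intro x hx
    change x ∈ AddSubgroup.closure P.gens at hx
    rw [LinearMap.mem_ker]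
    induction hx using AddSubgroup.closure_induction with
    | zero => rw [map_zero]
    | add x y _ _ h1 h2 => rw [map_add, h1, h2, add_zero]
    | neg x _ h => rw [map_neg, h, neg_zero]
    | mem x hx =>
      obtain ⟨i, j, u, h, rfl⟩ := hx
      rcases h with h | h
      · obtain ⟨p, rfl⟩ := Int.eq_ofNat_of_zero_le h
        obtain ⟨q, v, hv⟩ := P.zpow_b_mul_toLoc (P.a ^ p * u) j
        have e : ((P.ua ^ (p : ℤ) : P.Locˣ) : P.Loc) * ((P.ub ^ j : P.Locˣ) : P.Loc) * P.toLoc u =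
            P.toLoc (v * P.a ^ q) * P.frac q q := by
          rw [← Units.val_mul, ((P.commute_units).zpow_zpow _ j).eq, Units.val_mul, mul_assoc]
          simp only [zpow_natCast, Units.val_pow_eq_pow_val, coe_ua]
          rw [← map_pow, ← map_mul, hv, map_mul, map_pow, mul_assoc, a_pow_mul_frac, sub_self]
        exact (congrArg g e).trans ((hg _ _).trans (by rw [mul_smul, ha, smul_zero]))
      · obtain ⟨p, rfl⟩ := Int.eq_ofNat_of_zero_le h
        obtain ⟨q, v, hv⟩ := P.zpow_a_mul_toLoc (P.b ^ p * u) i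
        have e : ((P.ua ^ i : P.Locˣ) : P.Loc) * ((P.ub ^ (p : ℤ) : P.Locˣ) : P.Loc) * P.toLoc u =
            P.toLoc (v * P.b ^ q) * P.frac q q := by
          rw [mul_assoc]
          simp only [zpow_natCast, Units.val_pow_eq_pow_val, coe_ub]
          rw [← map_pow, ← map_mul, hv, map_mul, map_pow, mul_assoc, b_pow_mul_frac, sub_self]
        exact (congrArg g e).trans ((hg _ _).trans (by rw [mul_smul, hb, smul_zero]))
  refine ⟨BimodHom.ofLin (P.sub.liftQ g hsub), fun k => ?_⟩
  have := hg 1 k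
  rw [map_one, one_mul, one_smul] at this
  exact this

end OrePair

/-- Elements completing an `OrePair` `(f, f̄)` to a system satisfying the relations of the Takiff
algebra of `𝔰𝔩₂`. -/
structure TakiffTriple {A : Type u} [Ring A] [Algebra ℂ A] (P : OrePair A) where
  /-- The raising element. -/
  e : A
  /-- The barred raising element. -/
  e' : A
  /-- The coroot. -/
  h : A
  /-- The barred coroot. -/
  h' : A
  e_a : e * P.a = P.a * e + h
  e_b : e * P.b = P.b * e + h'
  e'_a : e' * P.a = P.a * e' + h'
  e'_b : e' * P.b = P.b * e'
  h_a : h * P.a = P.a * h - (2 : ℂ) • P.a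
  h_b : h * P.b = P.b * h - (2 : ℂ) • P.b
  h'_a : h' * P.a = P.a * h' - (2 : ℂ) • P.b
  h'_b : h' * P.b = P.b * h'
  h_e : h * e = e * h + (2 : ℂ) • e
  h_e' : h * e' = e' * h + (2 : ℂ) • e'
  h'_e : h' * e = e * h' + (2 : ℂ) • e'
  h'_e' : h' * e' = e' * h'
  e_e' : e * e' = e' * e
  h_h' : h * h' = h' * h

/-! ### Commutation formulas for fractions; regular sequences -/

namespace OrePair

variable {A : Type u} [Ring A] (P : OrePair A)

lemma toLoc_mul_frac_one_zero' {x y : A} (h : x * P.a = P.a * x + y) :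
    P.toLoc x * P.frac 1 0 = P.frac 1 0 * P.toLoc x - P.frac 1 0 * P.toLoc y * P.frac 1 0 := by
  rw [toLoc_mul_frac_one_zero, h, sub_add_cancel_left, map_neg]
  noncomm_ring

lemma toLoc_mul_frac_zero_one' {x y : A} (h : x * P.b = P.b * x + y) :
    P.toLoc x * P.frac 0 1 = P.frac 0 1 * P.toLoc x - P.frac 0 1 * P.toLoc y * P.frac 0 1 := by
  rw [toLoc_mul_frac_zero_one, h, sub_add_cancel_left, map_neg]
  noncomm_ring

section Formulas

variable [Algebra ℂ A]

lemma toLoc_smul (t : ℂ) (x : A) : P.toLoc (t • x) = t • P.toLoc x :=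
  (OreLocalization.smul_oreDiv_one t x).symm

lemma cartan_mul_frac {h : A} {t : ℂ} (ha : h * P.a = P.a * h - t • P.a)
    (hb : h * P.b = P.b * h - t • P.b) (i j : ℕ) :
    P.toLoc h * P.frac i j = P.frac i j * P.toLoc h + ((i + j : ℂ) * t) • P.frac i j := by
  have sa : P.toLoc h * P.frac 1 0 = P.frac 1 0 * P.toLoc h + t • P.frac 1 0 := by
    rw [P.toLoc_mul_frac_one_zero' (y := -(t • P.a)) (by rw [ha, sub_eq_add_neg]), map_neg,
      toLoc_smul, mul_neg, neg_mul, sub_neg_eq_add, mul_smul_comm, smul_mul_assoc, frac_mul_a,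
      sub_self, frac_zero, one_mul]
  have sb : P.toLoc h * P.frac 0 1 = P.frac 0 1 * P.toLoc h + t • P.frac 0 1 := by
    rw [P.toLoc_mul_frac_zero_one' (y := -(t • P.b)) (by rw [hb, sub_eq_add_neg]), map_neg,
      toLoc_smul, mul_neg, neg_mul, sub_neg_eq_add, mul_smul_comm, smul_mul_assoc, frac_mul_b,
      sub_self, frac_zero, one_mul]
  induction i with
  | zero =>
    induction j with
    | zero => simp [frac_zero]
    | succ j ih =>
      have e1 : P.frac ((0 : ℕ) : ℤ) ((j + 1 : ℕ) : ℤ) = P.frac 0 1 * P.frac (0 : ℕ) j := by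
        rw [frac_mul_frac]; push_cast; simp [add_comm]
      rw [e1, ← mul_assoc, sb, add_mul, mul_assoc, ih, mul_add, smul_mul_assoc, mul_smul_comm,
        ← mul_assoc, add_assoc, ← add_smul]
      congr 2; push_cast; ring
  | succ i ih =>
    have e1 : P.frac ((i + 1 : ℕ) : ℤ) (j : ℤ) = P.frac 1 0 * P.frac (i : ℕ) j := by
      rw [frac_mul_frac]; push_cast; simp [add_comm]
    rw [e1, ← mul_assoc, sa, add_mul, mul_assoc, ih, mul_add, smul_mul_assoc, mul_smul_comm,
      ← mul_assoc, add_assoc, ← add_smul]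
    congr 2; push_cast; ring

lemma mul_frac_zero_of_commute {x : A} (hb : x * P.b = P.b * x) (j : ℕ) :
    P.toLoc x * P.frac 0 j = P.frac 0 j * P.toLoc x := by
  have sb : P.toLoc x * P.frac 0 1 = P.frac 0 1 * P.toLoc x := by
    rw [P.toLoc_mul_frac_zero_one' (y := 0) (by rw [hb, add_zero]), map_zero, mul_zero, zero_mul,
      sub_zero]
  induction j with
  | zero => simp [frac_zero]
  | succ j ih =>
    have e1 : P.frac 0 ((j + 1 : ℕ) : ℤ) = P.frac 0 1 * P.frac 0 j := by
      rw [frac_mul_frac, add_zero, add_comm 1]; push_cast; rfl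
    rw [e1, ← mul_assoc, sb, mul_assoc, ih, mul_assoc]

/-- A barred Cartan element is not diagonal on fractions: `[h, a] = -t b` makes `a⁻¹` contribute `t
a⁻² b`, moving the exponents from `(i, j)` to `(i + 1, j - 1)`. For `j = 1` the extra term dies in
the bimodule. -/
lemma cartan_bar_mul_frac {h : A} {t : ℂ} (ha : h * P.a = P.a * h - t • P.b)
    (hb : h * P.b = P.b * h) (i j : ℕ) :
    P.toLoc h * P.frac i j = P.frac i j * P.toLoc h + ((i : ℂ) * t) • P.frac (i + 1) (j - 1) := by
  have sa : P.toLoc h * P.frac 1 0 = P.frac 1 0 * P.toLoc h + t • P.frac 2 (-1) := by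
    rw [P.toLoc_mul_frac_one_zero' (y := -(t • P.b)) (by rw [ha, sub_eq_add_neg]), map_neg,
      toLoc_smul, mul_neg, neg_mul, sub_neg_eq_add, mul_smul_comm, smul_mul_assoc, frac_mul_b,
      frac_mul_frac]
    norm_num
  induction i with
  | zero => simpa using P.mul_frac_zero_of_commute hb j
  | succ i ih =>
    have e1 : P.frac ((i + 1 : ℕ) : ℤ) (j : ℤ) = P.frac 1 0 * P.frac (i : ℕ) j := by
      rw [frac_mul_frac]; push_cast; simp [add_comm]
    rw [e1, ← mul_assoc, sa, add_mul, mul_assoc, ih, mul_add, smul_mul_assoc, mul_smul_comm,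
      ← mul_assoc, add_assoc, frac_mul_frac, frac_mul_frac, frac_mul_frac]
    rw [show (1 : ℤ) + (i + 1) = (i + 1 : ℕ) + 1 by push_cast; ring,
      show (2 : ℤ) + i = (i + 1 : ℕ) + 1 by push_cast; ring,
      show (0 : ℤ) + (j - 1) = j - 1 by ring, show (-1 : ℤ) + j = j - 1 by ring, ← add_smul]
    congr 2; push_cast; ring

variable {P} (D : TakiffTriple P)

/-- The useful term is the one containing `h'`: applied to a vector killed by `e'` it raises the
exponent of `a`, up to `h'`. In `e_mul_frac` the corresponding term raises the exponent of `b`. -/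
lemma e'_mul_frac (i j : ℕ) : P.toLoc D.e' * P.frac i j = P.frac i j * P.toLoc D.e' -
    (i : ℂ) • (P.frac (i + 1) j * P.toLoc D.h') -
      ((i : ℂ) * (i + 1)) • P.frac (i + 2) (j - 1) := by
  induction i with
  | zero => simpa using P.mul_frac_zero_of_commute D.e'_b j
  | succ i ih =>
    have e1 : P.frac ((i + 1 : ℕ) : ℤ) (j : ℤ) = P.frac 1 0 * P.frac (i : ℕ) j := by
      rw [frac_mul_frac]; push_cast; simp [add_comm]
    have sa := P.toLoc_mul_frac_one_zero' D.e'_a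
    have sh := P.cartan_bar_mul_frac D.h'_a D.h'_b (i + 1) j
    rw [e1, ← mul_assoc, sa, sub_mul, mul_assoc, ih, mul_assoc (P.frac 1 0 * _), ← e1,
      mul_assoc (P.frac 1 0) (P.toLoc D.h'), sh]
    simp only [mul_sub, mul_add, mul_smul_comm, ← mul_assoc, frac_mul_frac]
    rw [show (1 : ℤ) + (i + 1) = (i + 1 : ℕ) + 1 by push_cast; ring,
      show (1 : ℤ) + (i + 2) = (i + 1 : ℕ) + 2 by push_cast; ring,
      show (1 : ℤ) + (i + 1 : ℕ) = (i + 1 : ℕ) + 1 by push_cast; ring,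
      show (1 : ℤ) + ((i + 1 : ℕ) + 1) = (i + 1 : ℕ) + 2 by push_cast; ring]
    simp only [zero_add]
    push_cast
    rw [add_comm (1 : ℤ)]
    module

lemma e_mul_frac (i j : ℕ) : P.toLoc D.e * P.frac i j = P.frac i j * P.toLoc D.e -
    (j : ℂ) • (P.frac i (j + 1) * P.toLoc D.h') - (i : ℂ) • (P.frac (i + 1) j * P.toLoc D.h) -
      ((i : ℂ) * (i + 1) + 2 * i * j) • P.frac (i + 1) j := by
  induction i with
  | zero =>
    have sb := P.toLoc_mul_frac_zero_one' D.e_b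
    induction j with
    | zero => simp [frac_zero]
    | succ j ih =>
      have e1 : P.frac ((0 : ℕ) : ℤ) ((j + 1 : ℕ) : ℤ) = P.frac 0 1 * P.frac (0 : ℕ) j := by
        rw [frac_mul_frac]; push_cast; simp [add_comm]
      have sh := P.mul_frac_zero_of_commute D.h'_b (j + 1)
      have e2 : P.frac 0 ((j + 1 : ℕ) : ℤ) = P.frac 0 1 * P.frac (0 : ℕ) j := by
        rw [← e1]; simp
      rw [e1, ← mul_assoc, sb, sub_mul, mul_assoc, ih, mul_assoc (P.frac 0 1 * _), ← e2,
        mul_assoc (P.frac 0 1) (P.toLoc D.h'), sh]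
      simp only [mul_sub, mul_add, mul_smul_comm, ← mul_assoc, frac_mul_frac]
      rw [show (1 : ℤ) + (j + 1) = (j + 1 : ℕ) + 1 by push_cast; ring,
        show (1 : ℤ) + (j + 1 : ℕ) = (j + 1 : ℕ) + 1 by push_cast; ring]
      simp only [zero_add, Nat.cast_zero, e2, frac_mul_frac]
      push_cast
      module
  | succ i ih =>
    have e1 : P.frac ((i + 1 : ℕ) : ℤ) (j : ℤ) = P.frac 1 0 * P.frac (i : ℕ) j := by
      rw [frac_mul_frac]; push_cast; simp [add_comm]
    have sa := P.toLoc_mul_frac_one_zero' D.e_a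
    have sh := P.cartan_mul_frac D.h_a D.h_b (i + 1) j
    rw [e1, ← mul_assoc, sa, sub_mul, mul_assoc, ih, mul_assoc (P.frac 1 0 * _), ← e1,
      mul_assoc (P.frac 1 0) (P.toLoc D.h), sh]
    simp only [mul_sub, mul_add, mul_smul_comm, ← mul_assoc, frac_mul_frac]
    rw [show (1 : ℤ) + (i + 1) = (i + 1 : ℕ) + 1 by push_cast; ring,
      show (1 : ℤ) + (i + 1 : ℕ) = (i + 1 : ℕ) + 1 by push_cast; ring,
      show (1 : ℤ) + i = (i + 1 : ℕ) by push_cast; ring]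
    simp only [zero_add]
    push_cast
    module

end Formulas

/-! ### Tensors as single fractions, and their vanishing -/

section Br

variable {M : Type u} [AddCommGroup M] [Module A M]

/-- The element `a⁻ⁱ b⁻ʲ ⊗ m` of `S ⊗_A M`. -/
noncomputable def br (i j : ℤ) : M →+ BalTensor (A := A) P.Bimod M :=
  pureTensor (A := A) P.Bimod (P.proj (P.frac i j))

lemma pureTensor_proj_mul (x : P.Loc) (u : A) (m : M) :
    pureTensor (A := A) P.Bimod (P.proj (x * P.toLoc u)) m =
      pureTensor P.Bimod (P.proj x) (u • m) := by
  rw [← op_smul_proj, pureTensor_op_smul]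

lemma smul_br (u : A) (i j : ℤ) (m : M) :
    u • P.br i j m = pureTensor P.Bimod (P.proj (P.toLoc u * P.frac i j)) m := by
  rw [br, smul_pureTensor, smul_proj]

lemma br_smul (u : A) (i j : ℤ) (m : M) :
    P.br i j (u • m) = pureTensor P.Bimod (P.proj (P.frac i j * P.toLoc u)) m := by
  rw [br, pureTensor_proj_mul]

lemma br_eq_zero {i j : ℤ} (h : i ≤ 0 ∨ j ≤ 0) (m : M) : P.br i j m = 0 := by
  rw [br, P.proj_frac i j h, map_zero]; rfl

lemma a_smul_br (i j : ℤ) (m : M) : P.a • P.br i j m = P.br (i - 1) j m := by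
  rw [smul_br, a_mul_frac, br]

lemma b_smul_br (i j : ℤ) (m : M) : P.b • P.br i j m = P.br i (j - 1) m := by
  rw [smul_br, b_mul_frac, br]

lemma br_a_smul (i j : ℤ) (m : M) : P.br i j (P.a • m) = P.br (i - 1) j m := by
  rw [br_smul, frac_mul_a, br]

lemma br_b_smul (i j : ℤ) (m : M) : P.br i j (P.b • m) = P.br i (j - 1) m := by
  rw [br_smul, frac_mul_b, br]

lemma a_pow_smul_br (n : ℕ) (i j : ℤ) (m : M) : P.a ^ n • P.br i j m = P.br (i - n) j m := by
  rw [smul_br, map_pow, a_pow_mul_frac, br]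

lemma b_pow_smul_br (n : ℕ) (i j : ℤ) (m : M) : P.b ^ n • P.br i j m = P.br i (j - n) m := by
  rw [smul_br, map_pow, b_pow_mul_frac, br]

lemma br_a_pow_smul (n : ℕ) (i j : ℤ) (m : M) : P.br i j (P.a ^ n • m) = P.br (i - n) j m := by
  rw [br_smul, map_pow, frac_mul_a_pow, br]

lemma br_b_pow_smul (n : ℕ) (i j : ℤ) (m : M) : P.br i j (P.b ^ n • m) = P.br i (j - n) m := by
  rw [br_smul, map_pow, frac_mul_b_pow, br]

lemma br_raise (n i j : ℕ) (hi : i ≤ n) (hj : j ≤ n) (m : M) :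
    P.br i j m = P.br n n ((P.a ^ (n - i) * P.b ^ (n - j)) • m) := by
  rw [mul_smul, br_a_pow_smul, br_b_pow_smul]
  congr 2 <;> push_cast [hi, hj] <;> ring

/-- A left fraction lets its numerator pass to the module, and `br_raise` equalises exponents, so a
sum of tensors is again a single fraction. -/
lemma exists_br (t : BalTensor (A := A) P.Bimod M) : ∃ (n : ℕ) (m : M), t = P.br n n m := by
  induction t using balTensor_induction with
  | h1 s m =>
    obtain ⟨x, rfl⟩ := P.proj_surjective s
    obtain ⟨n, u, rfl⟩ := P.exists_left_frac x
    exact ⟨n, u • m, by rw [pureTensor_proj_mul, br]⟩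
  | h2 x y hx hy =>
    obtain ⟨n, m, rfl⟩ := hx
    obtain ⟨k, l, rfl⟩ := hy
    rw [P.br_raise (n + k) n n (by omega) (by omega), P.br_raise (n + k) k k (by omega) (by omega),
      ← map_add]
    exact ⟨_, _, rfl⟩

lemma pureTensor_eq_smul_br (s : P.Bimod) : ∃ (n : ℕ) (u : A), ∀ m : M,
    pureTensor (A := A) P.Bimod s m = u • P.br n n m := by
  obtain ⟨n, u, rfl⟩ := P.exists_smul_proj_frac s
  exact ⟨n, u, fun m => rfl⟩

lemma map_br {N : Type u} [AddCommGroup N] [Module A N] (f : M →ₗ[A] N) (i j : ℤ) (m : M) :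
    BalTensor.map P.Bimod f (P.br i j m) = P.br i j (f m) := rfl

/-- `a` and `b` form a regular sequence on `M` (in the order `b`, `a`). -/
def IsRegularOn (M : Type u) [AddCommGroup M] [Module A M] : Prop :=
  (∀ m : M, P.b • m = 0 → m = 0) ∧ ∀ m z : M, P.a • m = P.b • z → ∃ w, m = P.b • w

variable {P} in
lemma IsRegularOn.b_pow_inj (h : P.IsRegularOn M) (n : ℕ) {m : M} (hm : P.b ^ n • m = 0) :
    m = 0 := by
  induction n with
  | zero => simpa using hm
  | succ n ih => exact ih (h.1 _ (by rw [← mul_smul, ← pow_succ', hm]))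

variable {P} in
lemma IsRegularOn.a_of_b_pow (h : P.IsRegularOn M) (n : ℕ) {m z : M}
    (hm : P.a • m = P.b ^ n • z) : ∃ w, m = P.b ^ n • w := by
  induction n generalizing m z with
  | zero => exact ⟨m, by simp⟩
  | succ n ih =>
    rw [pow_succ', mul_smul] at hm
    obtain ⟨w, rfl⟩ := h.2 _ _ hm
    rw [← mul_smul, P.comm.eq, mul_smul, ← sub_eq_zero, ← smul_sub] at hm
    obtain ⟨v, rfl⟩ := ih (sub_eq_zero.mp (h.1 _ hm))
    exact ⟨v, by rw [pow_succ', mul_smul]⟩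

variable {P} in
lemma IsRegularOn.a_pow_of_b_pow (h : P.IsRegularOn M) (k n : ℕ) {m z : M}
    (hm : P.a ^ k • m = P.b ^ n • z) : ∃ w, m = P.b ^ n • w := by
  induction k generalizing m z with
  | zero => exact ⟨z, by simpa using hm⟩
  | succ k ih =>
    rw [pow_succ', mul_smul] at hm
    obtain ⟨w, hw⟩ := h.a_of_b_pow n hm
    exact ih hw

-- With `b_pow_inj_mod`, the usual cancellation in a regular sequence: a factor `aᵖ` cancels modulo
-- `(aᵖ⁺ᵏ, bⁿ)`, leaving the ideal `(aᵏ, bⁿ)`. Both serve to clear denominators in `of_br_eq_zero`.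
variable {P} in
lemma IsRegularOn.a_pow_inj_mod (h : P.IsRegularOn M) (k n : ℕ) {m y z : M} (p : ℕ)
    (hm : P.a ^ p • m = P.a ^ (p + k) • y + P.b ^ n • z) : ∃ y z, m = P.a ^ k • y + P.b ^ n • z := by
  have h1 : P.a ^ p • (m - P.a ^ k • y) = P.b ^ n • z := by
    rw [smul_sub, hm, ← mul_smul, ← pow_add, add_sub_cancel_left]
  obtain ⟨w, hw⟩ := h.a_pow_of_b_pow p n h1
  exact ⟨y, w, by rw [← hw]; abel⟩

variable {P} in
lemma IsRegularOn.b_pow_inj_mod (h : P.IsRegularOn M) (k n : ℕ) {m y z : M} (p : ℕ)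
    (hm : P.b ^ p • m = P.a ^ k • y + P.b ^ (p + n) • z) :
    ∃ y z, m = P.a ^ k • y + P.b ^ n • z := by
  have h1 : P.a ^ k • y = P.b ^ p • (m - P.b ^ n • z) := by
    rw [smul_sub, hm, ← mul_smul, ← pow_add]; abel
  obtain ⟨w, rfl⟩ := h.a_pow_of_b_pow k p h1
  rw [← mul_smul, (P.comm.pow_pow k p).eq, mul_smul, ← sub_eq_zero, ← smul_sub] at h1
  have h2 := h.b_pow_inj p h1
  exact ⟨w, z, by rw [sub_sub_eq_add_sub, sub_eq_zero] at h2; rw [h2]⟩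

lemma toLoc_smul_eq (u : A) (x : OreLocalization P.powers M) : P.toLoc u • x = u • x :=
  OreLocalization.oreDiv_one_smul u x

/-- The map `m ↦ m / 1` from a module to its localisation. -/
noncomputable def num (M : Type u) [AddCommGroup M] [Module A M] :
    M →+ OreLocalization P.powers M where
  toFun m := m /ₒ (1 : P.powers)
  map_zero' := OreLocalization.zero_oreDiv _
  map_add' m n := by rw [OreLocalization.add_oreDiv]

lemma num_smul (u : A) (m : M) : P.num M (u • m) = P.toLoc u • P.num M m :=
  OreLocalization.smul_div_one.symm

lemma exists_of_num_eq {m n : M} (h : P.num M m = P.num M n) :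
    ∃ p q : ℕ, (P.a ^ p * P.b ^ q) • m = (P.a ^ p * P.b ^ q) • n := by
  obtain ⟨⟨_, p, q, rfl⟩, v, h5, h6⟩ := OreLocalization.oreDiv_eq_iff.mp h
  have h7 : P.a ^ p * P.b ^ q = v := by simpa using h6
  subst h7
  exact ⟨p, q, h5.symm⟩

/-- The sum of the images of `M[a⁻¹]` and `M[b⁻¹]` in the localisation of `M`. -/
noncomputable def axes (M : Type u) [AddCommGroup M] [Module A M] :
    Submodule A (OreLocalization P.powers M) where
  carrier := {x | ∃ (k : ℕ) (m n : M), x = P.frac k 0 • P.num M m + P.frac 0 k • P.num M n}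
  zero_mem' := ⟨0, 0, 0, by simp⟩
  add_mem' := by
    rintro _ _ ⟨k, m, n, rfl⟩ ⟨l, m', n', rfl⟩
    refine ⟨k + l, P.a ^ l • m + P.a ^ k • m', P.b ^ l • n + P.b ^ k • n', ?_⟩
    simp only [map_add, num_smul, smul_add, map_pow, ← mul_smul, frac_mul_a_pow, frac_mul_b_pow]
    push_cast
    rw [add_sub_cancel_left, add_sub_cancel_right]
    abel
  smul_mem' := by
    rintro u _ ⟨k, m, n, rfl⟩
    obtain ⟨p, y, hy⟩ := (P.nil_a u).movesPast k
    obtain ⟨q, z, hz⟩ := (P.nil_b u).movesPast k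
    refine ⟨p + q, P.a ^ q • (y • m), P.b ^ p • (z • n), ?_⟩
    have h1 : P.toLoc u * P.frac k 0 = P.frac p 0 * P.toLoc y := by
      have h := congrArg (fun x => P.frac p 0 * P.toLoc x * P.frac k 0) hy
      simp only [map_mul, map_pow, ← mul_assoc, frac_mul_a_pow] at h
      simpa [frac_zero, mul_assoc, a_pow_mul_frac] using h
    have h2 : P.toLoc u * P.frac 0 k = P.frac 0 q * P.toLoc z := by
      have h := congrArg (fun x => P.frac 0 q * P.toLoc x * P.frac 0 k) hz
      simp only [map_mul, map_pow, ← mul_assoc, frac_mul_b_pow] at h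
      simpa [frac_zero, mul_assoc, b_pow_mul_frac] using h
    rw [smul_add, ← toLoc_smul_eq, ← toLoc_smul_eq, ← mul_smul, ← mul_smul, h1, h2]
    rw [num_smul, num_smul P y, num_smul, num_smul P z, map_pow, map_pow, mul_smul, mul_smul,
      ← mul_smul (P.frac _ _) (P.toLoc _ ^ _), ← mul_smul (P.frac _ _) (P.toLoc _ ^ _)]
    rw [frac_mul_a_pow, frac_mul_b_pow]
    push_cast
    rw [add_sub_cancel_right, add_sub_cancel_left]

/-- The map `x ↦ x • m` modulo the axes. -/
noncomputable def toAxesQuotientAux (m : M) :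
    P.Loc →ₗ[A] (OreLocalization P.powers M ⧸ P.axes M) where
  toFun x := (P.axes M).mkQ (x • P.num M m)
  map_add' x y := by rw [add_smul, map_add]
  map_smul' u x := by
    rw [smul_eq_toLoc_mul, mul_smul, toLoc_smul_eq, map_smul]; rfl

lemma toAxesQuotientAux_apply (m : M) (x : P.Loc) :
    P.toAxesQuotientAux m x = (P.axes M).mkQ (x • P.num M m) := rfl

lemma sub_le_ker_toAxesQuotientAux (m : M) :
    P.sub ≤ LinearMap.ker (P.toAxesQuotientAux m) := by
  intro x hx
  change x ∈ AddSubgroup.closure P.gens at hx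
  rw [LinearMap.mem_ker]
  induction hx using AddSubgroup.closure_induction with
  | zero => rw [map_zero]
  | add x y _ _ h1 h2 => rw [map_add, h1, h2, add_zero]
  | neg x _ h => rw [map_neg, h, neg_zero]
  | mem x hx =>
    obtain ⟨i, j, u, h, rfl⟩ := hx
    rw [toAxesQuotientAux_apply, Submodule.mkQ_apply, Submodule.Quotient.mk_eq_zero, mul_smul,
      ← num_smul, ← Units.val_mul]
    have e : ((P.ua ^ i * P.ub ^ j : P.Locˣ) : P.Loc) = P.frac (-i) (-j) := by simp [frac]
    rw [e]
    rcases h with h | h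
    · refine ⟨j.natAbs, 0, P.b ^ (j.natAbs + j).toNat • P.a ^ i.toNat • u • m, ?_⟩
      rw [num_smul, num_smul P (P.b ^ _), num_smul P (P.a ^ _), num_smul, ← mul_smul, ← mul_smul,
        ← mul_smul, ← mul_smul, map_pow, map_pow,
        frac_mul_b_pow, frac_mul_a_pow, map_zero, smul_zero, zero_add]
      congr 3 <;> omega
    · refine ⟨i.natAbs, P.a ^ (i.natAbs + i).toNat • P.b ^ j.toNat • u • m, 0, ?_⟩
      rw [num_smul, num_smul P (P.a ^ _), num_smul P (P.b ^ _), num_smul, ← mul_smul, ← mul_smul,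
        ← mul_smul, ← mul_smul, map_pow, map_pow,
        frac_mul_a_pow, frac_mul_b_pow, map_zero, smul_zero, add_zero]
      congr 3 <;> omega

/-- `m ↦ (x ↦ x • m)` modulo the axes. -/
noncomputable def toAxesQuotient (M : Type u) [AddCommGroup M] [Module A M] :
    M →ₗ[A] BimodHom (A := A) P.Bimod (OreLocalization P.powers M ⧸ P.axes M) where
  toFun m := BimodHom.ofLin (P.sub.liftQ (P.toAxesQuotientAux m)
    (P.sub_le_ker_toAxesQuotientAux m))
  map_add' m n := BimodHom.ext fun s => by
    obtain ⟨x, rfl⟩ := P.proj_surjective s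
    change P.toAxesQuotientAux (m + n) x = P.toAxesQuotientAux m x + P.toAxesQuotientAux n x
    rw [toAxesQuotientAux_apply, map_add, smul_add, map_add]
    rfl
  map_smul' u m := BimodHom.ext fun s => by
    obtain ⟨x, rfl⟩ := P.proj_surjective s
    rw [RingHom.id_apply, BimodHom.smul_apply, op_smul_proj]
    change P.toAxesQuotientAux (u • m) x = P.toAxesQuotientAux m (x * P.toLoc u)
    rw [toAxesQuotientAux_apply, toAxesQuotientAux_apply, mul_smul, num_smul]

-- Map `S ⊗ M` to `M[a⁻¹, b⁻¹] / (M[a⁻¹] + M[b⁻¹])`, the Čech form of second local cohomology.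
-- Vanishing there becomes, after clearing denominators, `a^(p+k) b^(q+k) m ∈ a^(p+k+i) M +
-- b^(q+k+j) M`, and regularity cancels `a^(p+k)` and `b^(q+k)`.
variable {P} in
theorem IsRegularOn.of_br_eq_zero (h : P.IsRegularOn M) {i j : ℕ} {m : M} (hm : P.br i j m = 0) :
    ∃ y z, m = P.a ^ i • y + P.b ^ j • z := by
  have h1 : balLift (P.toAxesQuotient M) (P.br i j m) = 0 := by rw [hm, map_zero]
  have h2 : (P.axes M).mkQ (P.frac i j • P.num M m) = 0 := h1
  rw [Submodule.mkQ_apply, Submodule.Quotient.mk_eq_zero] at h2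
  obtain ⟨k, y, z, hk⟩ := h2
  have h3 := congrArg (P.frac (-(i + k : ℕ)) (-(j + k : ℕ)) • ·) hk
  simp only [smul_add, ← mul_smul, frac_mul_frac] at h3
  have h4 : P.num M ((P.a ^ k * P.b ^ k) • m) =
      P.num M ((P.a ^ i * P.b ^ (j + k)) • y + (P.a ^ (i + k) * P.b ^ j) • z) := by
    rw [map_add, num_smul, num_smul, num_smul, ← frac_neg_nat, ← frac_neg_nat, ← frac_neg_nat]
    convert h3 using 3 <;> congr 1 <;> push_cast <;> ring
  obtain ⟨p, q, h5⟩ := P.exists_of_num_eq h4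
  have h8 : P.a ^ (p + k) • (P.b ^ (q + k) • m) = P.a ^ (p + k + i) • (P.b ^ (j + q) • z) +
      P.b ^ (q + k + j) • (P.a ^ (i + p) • y) := by
    have c : ∀ k l m n : ℕ, P.a ^ k * P.b ^ l * (P.a ^ m * P.b ^ n) =
        P.a ^ (k + m) * P.b ^ (l + n) := by
      intro k l m n
      rw [pow_add, pow_add, mul_assoc, ← mul_assoc (P.b ^ l), ((P.comm.symm).pow_pow l m).eq]
      simp only [mul_assoc]
    rw [smul_add, ← mul_smul, ← mul_smul, ← mul_smul, c, c, c] at h5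
    rw [← mul_smul, ← mul_smul, ← mul_smul, ((P.comm.symm).pow_pow _ _).eq, h5, add_comm]
    congr 4 <;> ring
  obtain ⟨y1, z1, h9⟩ := h.a_pow_inj_mod i (q + k + j) (p + k) h8
  exact h.b_pow_inj_mod i j (q + k) h9

end Br

end OrePair

/-- `x` acts locally nilpotently on `M`. -/
def LocNilpotent {A : Type u} [Ring A] (x : A) (M : Type u) [AddCommGroup M] [Module A M] : Prop :=
  ∀ m : M, ∃ n : ℕ, x ^ n • m = 0

/-- `x - c` acts locally nilpotently on `M`. -/
def LocGenEigen {A : Type u} [Ring A] [Algebra ℂ A] (x : A) (c : ℂ) (M : Type u) [AddCommGroup M]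
    [Module A M] : Prop :=
  ∀ m : M, ∃ n : ℕ, (x - algebraMap ℂ A c) ^ n • m = 0

section

variable {A : Type u} [Ring A] {M : Type u} [AddCommGroup M] [Module A M]

/-- Descending induction along powers of a locally nilpotent element. -/
lemma mem_of_pow_smul_mem {x : A} {L : Set M} {p : M → Prop} (hp : ∀ m, p m → p (x • m))
    (h : ∀ m, p m → x • m ∈ L → m ∈ L) (n : ℕ) {m : M} (hm : p m) (hx : x ^ n • m ∈ L) : m ∈ L := by
  induction n generalizing m with
  | zero => simpa using hx
  | succ n ih =>
    rw [pow_succ, mul_smul] at hx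
    exact h m hm (ih (hp m hm) hx)

variable [Algebra ℂ A] [Module ℂ M] [IsScalarTower ℂ A M]

/-- If `x m` and `(x - c) m` both lie in `L`, so does `c m`, hence `m`; descend along the powers of
`x - c`. This is the form in which invertibility of `h̄_α` enters: a factor `h̄_α` cancels modulo
any subspace that it preserves. -/
lemma LocGenEigen.mem_of_smul_mem {x : A} {c : ℂ} (hc : c ≠ 0) (hx : LocGenEigen x c M)
    (L : Submodule ℂ M) (hL : ∀ m ∈ L, x • m ∈ L) {m : M} (hm : x • m ∈ L) : m ∈ L := by
  obtain ⟨n, hn⟩ := hx m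
  refine mem_of_pow_smul_mem (x := x - algebraMap ℂ A c) (L := L) (p := fun m => x • m ∈ L)
    ?_ ?_ n hm (by rw [hn]; exact zero_mem _)
  · intro m hm
    rw [sub_smul, smul_sub, algebraMap_smul, smul_comm x c m]
    exact sub_mem (hL _ hm) (L.smul_mem _ hm)
  · intro m hm h
    rw [sub_smul, algebraMap_smul] at h
    have : c • m ∈ L := by
      have h2 := sub_mem hm h
      rwa [sub_sub_cancel] at h2
    exact (L.smul_mem_iff hc).mp this

end

/-! ### Regularity and coregularity for the Takiff algebra of `sl₂` -/

namespace TakiffTriple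

variable {A : Type u} [Ring A] [Algebra ℂ A] {P : OrePair A} (D : TakiffTriple P)
  {M : Type u} [AddCommGroup M] [Module A M] [Module ℂ M] [IsScalarTower ℂ A M]

lemma h'_smul_e_smul {w : M} (hw : D.e' • w = 0) : D.h' • D.e • w = D.e • D.h' • w := by
  rw [← mul_smul, D.h'_e, add_smul, smul_assoc, hw, smul_zero, add_zero, mul_smul]

lemma e'_smul_e_pow {w : M} (hw : D.e' • w = 0) (k : ℕ) : D.e' • D.e ^ k • w = 0 := by
  rw [← mul_smul, ((show Commute D.e D.e' from D.e_e').symm.pow_right k).eq, mul_smul, hw,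
    smul_zero]

lemma h'_smul_e_pow_smul {w : M} (hw : D.e' • w = 0) (k : ℕ) :
    D.h' • D.e ^ k • w = D.e ^ k • D.h' • w := by
  induction k with
  | zero => simp
  | succ k ih =>
    rw [pow_succ', mul_smul, D.h'_smul_e_smul (D.e'_smul_e_pow hw k), ih, mul_smul]

/-- On the kernel of `e'` the elements `h'` and `e` commute, so the commutators `[e, b] = h'` simply
add up. The analogue for `e'` and `a` needs no condition because `h'` and `e'` always commute. -/
lemma e_pow_succ_b_smul {w : M} (hw : D.e' • w = 0) (k : ℕ) : D.e ^ (k + 1) • P.b • w =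
    P.b • D.e ^ (k + 1) • w + (k + 1 : ℂ) • D.h' • D.e ^ k • w := by
  induction k with
  | zero => simp [← mul_smul, D.e_b, add_smul]
  | succ k ih =>
    rw [pow_succ', mul_smul, ih, smul_add, smul_comm D.e (_ : ℂ),
      ← D.h'_smul_e_smul (D.e'_smul_e_pow hw k), ← mul_smul D.e P.b, D.e_b, add_smul,
      mul_smul P.b, mul_smul D.e, ← mul_smul D.e (D.e ^ k), ← pow_succ', add_assoc]
    congr 1
    push_cast
    rw [add_smul ((k : ℂ) + 1) 1, one_smul]
    abel

lemma e'_pow_succ_a_smul (w : M) (k : ℕ) : D.e' ^ (k + 1) • P.a • w =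
    P.a • D.e' ^ (k + 1) • w + (k + 1 : ℂ) • D.h' • D.e' ^ k • w := by
  induction k with
  | zero => simp [← mul_smul, D.e'_a, add_smul]
  | succ k ih =>
    rw [pow_succ', mul_smul, ih, smul_add, smul_comm D.e' (_ : ℂ), ← mul_smul D.e' D.h',
      ← D.h'_e', ← mul_smul D.e' P.a, D.e'_a, add_smul, mul_smul P.a, mul_smul D.h' D.e',
      ← mul_smul D.e' (D.e' ^ k), ← mul_smul D.e' (D.e' ^ (k + 1)), ← pow_succ', ← pow_succ',
      add_assoc]
    congr 1
    push_cast
    rw [add_smul ((k : ℂ) + 1) 1, one_smul]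
    abel

lemma natCast_succ_smul_mem {L : Submodule ℂ M} {k : ℕ} {m : M} (h : (k + 1 : ℂ) • m ∈ L) :
    m ∈ L := (L.smul_mem_iff (by exact_mod_cast Nat.succ_ne_zero k)).mp h

/-- The image of `x`, as a complex subspace. -/
def image (x : A) (M : Type u) [AddCommGroup M] [Module A M] [Module ℂ M] [IsScalarTower ℂ A M] :
    Submodule ℂ M := LinearMap.range (Algebra.lsmul ℂ ℂ M x)

lemma mem_image {x : A} {m : M} : m ∈ image x M ↔ ∃ y : M, x • y = m := Iff.rfl

lemma smul_mem_image_of_commute {x y : A} (h : y * x = x * y) {m : M} (hm : m ∈ image x M) :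
    y • m ∈ image x M := by
  obtain ⟨z, rfl⟩ := hm
  exact ⟨y • z, by simp [← mul_smul, h]⟩

section Highest

variable {c : ℂ} (hc : c ≠ 0) (hh : LocGenEigen D.h' c M) (he : LocNilpotent D.e M)
  (he' : LocNilpotent D.e' M)

-- Let `b w = 0` and `e' w = 0`. If also `e^(k+1) w = 0`, the formula for `e^(k+1) b w` leaves `h'
-- e^k w = 0`, so powers of `e` descend until `w = 0`. Since `e'` commutes with `b`, it preserves
-- the kernel of `b`, and its local nilpotency reduces the general case to this one.
include hc hh he he' in
lemma b_smul_inj {m : M} (hm : P.b • m = 0) : m = 0 := by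
  have hbot : ∀ m : M, D.h' • m = 0 → m = 0 := fun m h =>
    (hh.mem_of_smul_mem hc ⊥ (by simp) (m := m) (by simpa using h))
  have h1 : ∀ w : M, P.b • w = 0 → D.e' • w = 0 → w = 0 := by
    intro w hb he2
    obtain ⟨k, hk⟩ := he w
    induction k with
    | zero => simpa using hk
    | succ k ih =>
      have := D.e_pow_succ_b_smul he2 k
      rw [hb, hk, smul_zero, smul_zero, zero_add] at this
      exact ih (hbot _ ((smul_eq_zero_iff_right (by exact_mod_cast Nat.succ_ne_zero k)).mp
        this.symm))
  obtain ⟨k, hk⟩ := he' m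
  refine mem_of_pow_smul_mem (x := D.e') (L := {m : M | m = 0}) (p := fun m => P.b • m = 0)
    ?_ ?_ k hm hk
  · intro m hm
    rw [← mul_smul, ← D.e'_b, mul_smul, hm, smul_zero]
  · exact fun m hm h => h1 m hm h

-- Modulo `b M`, which is stable under `a`, `e'` and `h'`, the formula for `e'^(k+1) a m` turns
-- `e'^(k+1) m ∈ b M` into `h' e'^k m ∈ b M`; then `h'` cancels and `k` descends to zero.
include hc hh he' in
lemma mem_image_b_of_a_smul_mem {m : M} (hm : P.a • m ∈ image P.b M) : m ∈ image P.b M := by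
  obtain ⟨k, hk⟩ := he' m
  have hk' : D.e' ^ k • m ∈ image P.b M := by rw [hk]; exact zero_mem _
  clear hk
  induction k with
  | zero => simpa using hk'
  | succ k ih =>
    refine ih (hh.mem_of_smul_mem hc _
      (fun m hm => smul_mem_image_of_commute D.h'_b hm) (natCast_succ_smul_mem (k := k) ?_))
    rw [← sub_eq_of_eq_add' (D.e'_pow_succ_a_smul m k)]
    have h1 : ∀ (k : ℕ) (m : M), m ∈ image P.b M → D.e' ^ k • m ∈ image P.b M := fun k m hm =>
      smul_mem_image_of_commute ((show Commute D.e' P.b from D.e'_b).pow_left k).eq hm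
    exact sub_mem (h1 _ _ hm) (smul_mem_image_of_commute P.comm.eq hk')

include hc hh he he' in
lemma isRegularOn : P.IsRegularOn M :=
  ⟨fun _ h => D.b_smul_inj hc hh he he' h, fun m z h => by
    obtain ⟨w, hw⟩ := D.mem_image_b_of_a_smul_mem hc hh he' ⟨z, h.symm⟩
    exact ⟨w, hw.symm⟩⟩

-- A form of Nakayama's lemma. Working modulo `b M` and using nilpotency of `e'` gives `M = b M`. A
-- vector killed by `e` and `e'` is then `b y` with `e' y = 0`, by injectivity of `b`, and the
-- formula for `e^(k+1) b y` forces `y = 0`. Without common kernel of the locally nilpotent `e`,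
-- `e'`, the module vanishes.
include hc hh he he' in
lemma subsingleton_of_forall_eq_add (h : ∀ m : M, ∃ y z : M, m = P.a • y + P.b • z) (m : M) :
    m = 0 := by
  have hbot : ∀ m : M, D.h' • m = 0 → m = 0 := fun m h =>
    (hh.mem_of_smul_mem hc ⊥ (by simp) (m := m) (by simpa using h))
  have hL : ∀ m : M, m ∈ image P.b M := by
    intro m
    have h1 : ∀ (k : ℕ) (m : M), m ∈ image P.b M → D.e' ^ k • m ∈ image P.b M := fun k m hm =>
      smul_mem_image_of_commute ((show Commute D.e' P.b from D.e'_b).pow_left k).eq hm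
    obtain ⟨k, hk⟩ := he' m
    refine mem_of_pow_smul_mem (x := D.e') (L := (image P.b M : Set M)) (p := fun _ => True)
      (fun _ _ => trivial) ?_ k trivial (by rw [hk]; exact zero_mem (image P.b M))
    intro m _ hm
    obtain ⟨y, z, rfl⟩ := h m
    have hbz : P.b • z ∈ image P.b M := ⟨z, rfl⟩
    refine add_mem ?_ hbz
    refine smul_mem_image_of_commute P.comm.eq ?_
    rw [smul_add] at hm
    have hm' : D.e' • P.a • y ∈ image P.b M := by
      have := sub_mem hm (h1 1 _ hbz)
      simpa using this
    obtain ⟨r, hr⟩ := he' y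
    have hr' : D.e' ^ r • y ∈ image P.b M := by rw [hr]; exact zero_mem _
    clear hr
    induction r with
    | zero => simpa using hr'
    | succ r ih =>
      refine ih (hh.mem_of_smul_mem hc _
        (fun m hm => smul_mem_image_of_commute D.h'_b hm) (natCast_succ_smul_mem (k := r) ?_))
      rw [← sub_eq_of_eq_add' (D.e'_pow_succ_a_smul y r)]
      refine sub_mem ?_ (smul_mem_image_of_commute P.comm.eq hr')
      rw [pow_succ, mul_smul]
      exact h1 _ _ hm'
  have h2 : ∀ m : M, D.e' • m = 0 → D.e • m = 0 → m = 0 := by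
    intro m hm1 hm2
    obtain ⟨y, rfl⟩ := mem_image.mp (hL m)
    have hy : D.e' • y = 0 := by
      rw [← mul_smul, D.e'_b, mul_smul] at hm1
      exact D.b_smul_inj hc hh he he' hm1
    obtain ⟨r, hr⟩ := he y
    have : y = 0 := by
      induction r with
      | zero => simpa using hr
      | succ r ih =>
        have := D.e_pow_succ_b_smul hy r
        rw [hr, smul_zero, zero_add, pow_succ, mul_smul, hm2, smul_zero] at this
        exact ih (hbot _ ((smul_eq_zero_iff_right (by exact_mod_cast Nat.succ_ne_zero r)).mp
          this.symm))
    rw [this, smul_zero]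
  have h3 : ∀ m : M, D.e' • m = 0 → m = 0 := by
    intro m hm
    obtain ⟨k, hk⟩ := he m
    exact mem_of_pow_smul_mem (x := D.e) (L := {m : M | m = 0}) (p := fun m => D.e' • m = 0)
      (fun m hm => by simpa using D.e'_smul_e_pow hm 1) (fun m hm h => h2 m hm h) k hm hk
  obtain ⟨k, hk⟩ := he' m
  exact mem_of_pow_smul_mem (x := D.e') (L := {m : M | m = 0}) (p := fun m => True)
      (fun m hm => trivial) (fun m _ h => h3 m h) k trivial hk

/-- The highest weight vectors: the common kernel of `e` and `e'`. -/
def highest (M : Type u) [AddCommGroup M] [Module A M] [Module ℂ M] [IsScalarTower ℂ A M] :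
    Submodule ℂ M where
  carrier := {v | D.e • v = 0 ∧ D.e' • v = 0}
  zero_mem' := by simp
  add_mem' := by rintro x y ⟨h1, h2⟩ ⟨h3, h4⟩; simp [smul_add, h1, h2, h3, h4]
  smul_mem' := by
    rintro t x ⟨h1, h2⟩
    exact ⟨by rw [smul_comm, h1, smul_zero], by rw [smul_comm, h2, smul_zero]⟩

lemma h'_smul_mem_highest {v : M} (hv : v ∈ D.highest M) : D.h' • v ∈ D.highest M := by
  obtain ⟨h1, h2⟩ := hv
  refine ⟨?_, ?_⟩
  · rw [← D.h'_smul_e_smul h2, h1, smul_zero]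
  · rw [← mul_smul, ← D.h'_e', mul_smul, h2, smul_zero]

lemma h_smul_mem_highest {v : M} (hv : v ∈ D.highest M) : D.h • v ∈ D.highest M := by
  obtain ⟨h1, h2⟩ := hv
  refine ⟨?_, ?_⟩
  · rw [← mul_smul, eq_sub_of_add_eq D.h_e.symm, sub_smul, mul_smul, smul_assoc, h1]; simp
  · rw [← mul_smul, eq_sub_of_add_eq D.h_e'.symm, sub_smul, mul_smul, smul_assoc, h2]; simp

include hc hh he he' in
/-- Every element is highest weight modulo the images of `a` and `b`. -/
lemma exists_highest (m : M) : ∃ y z : M, ∃ v ∈ D.highest M, m = P.a • y + P.b • z + v := by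
  let L : Submodule ℂ M := image P.a M ⊔ image P.b M ⊔ D.highest M
  have ha : ∀ y : M, P.a • y ∈ L := fun y =>
    Submodule.mem_sup_left (Submodule.mem_sup_left ⟨y, rfl⟩)
  have hb : ∀ y : M, P.b • y ∈ L := fun y =>
    Submodule.mem_sup_left (Submodule.mem_sup_right ⟨y, rfl⟩)
  have hV : ∀ v ∈ D.highest M, v ∈ L := fun v hv => Submodule.mem_sup_right hv
  have hdec : ∀ m ∈ L, ∃ y z : M, ∃ v ∈ D.highest M, m = P.a • y + P.b • z + v := by
    intro m hm
    obtain ⟨x, hx, v, hv, rfl⟩ := Submodule.mem_sup.mp hm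
    obtain ⟨_, ⟨y, rfl⟩, _, ⟨z, rfl⟩, rfl⟩ := Submodule.mem_sup.mp hx
    exact ⟨y, z, v, hv, rfl⟩
  have hL : ∀ m ∈ L, D.h' • m ∈ L := by
    intro m hm
    obtain ⟨y, z, v, hv, rfl⟩ := hdec m hm
    rw [smul_add, smul_add, ← mul_smul, ← mul_smul, D.h'_a, D.h'_b, sub_smul, mul_smul, mul_smul,
      smul_assoc]
    exact add_mem (add_mem (sub_mem (ha _) (L.smul_mem _ (hb _))) (hb _))
      (hV _ (D.h'_smul_mem_highest hv))
  refine hdec m ?_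
  have h1 : ∀ (k : ℕ) (w : M), D.e' • w = 0 → D.e ^ k • w = 0 → w ∈ L := by
    intro k
    induction k with
    | zero => intro w _ hw; rw [pow_zero, one_smul] at hw; rw [hw]; exact zero_mem _
    | succ k ih =>
      intro w hw1 hw2
      rcases k with _ | k
      · exact hV w ⟨by simpa using hw2, hw1⟩
      refine hh.mem_of_smul_mem hc L hL (natCast_succ_smul_mem (k := k) ?_)
      -- Both terms have the same image under `e^(k+1)`, so the difference has smaller `e`-order and
      -- lies in `L` by induction. As `b e w` is in `L`, so is `h' w`, and `h'` cancels.
      have h2 : P.b • D.e • w - (k + 1 : ℂ) • D.h' • w ∈ L := by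
        refine ih _ ?_ ?_
        · rw [smul_sub, ← mul_smul D.e' P.b, D.e'_b, mul_smul, ← mul_smul D.e' D.e, ← D.e_e', mul_smul,
            hw1, smul_comm D.e' (_ : ℂ), ← mul_smul D.e' D.h', ← D.h'_e', mul_smul, hw1]
          simp
        · have h3 := D.e_pow_succ_b_smul hw1 (k + 1)
          have h4 := D.e_pow_succ_b_smul (w := D.e • w) (by simpa using D.e'_smul_e_pow hw1 1) k
          rw [← mul_smul (D.e ^ _) D.e, ← mul_smul (D.e ^ _) D.e, ← pow_succ, ← pow_succ, hw2,
            smul_zero, zero_add] at h4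
          rw [smul_sub, h4, smul_comm (D.e ^ _), ← D.h'_smul_e_pow_smul hw1, sub_self]
      have := sub_mem (hb (D.e • w)) h2
      rwa [sub_sub_cancel] at this
  have h5 : ∀ (k : ℕ) (w : M), D.e' ^ k • w = 0 → w ∈ L := by
    intro k
    induction k with
    | zero => intro w hw; rw [pow_zero, one_smul] at hw; rw [hw]; exact zero_mem _
    | succ k ih =>
      intro w hw2
      rcases k with _ | k
      · obtain ⟨r, hr⟩ := he w
        exact h1 r w (by simpa using hw2) hr
      refine hh.mem_of_smul_mem hc L hL (natCast_succ_smul_mem (k := k) ?_)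
      have h2 : P.a • D.e' • w - (k + 1 : ℂ) • D.h' • w ∈ L := by
        refine ih _ ?_
        have h4 := D.e'_pow_succ_a_smul (D.e' • w) k
        rw [← mul_smul (D.e' ^ _) D.e', ← mul_smul (D.e' ^ _) D.e', ← pow_succ, ← pow_succ, hw2,
          smul_zero, zero_add] at h4
        rw [smul_sub, h4, smul_comm (D.e' ^ _), ← mul_smul (D.e' ^ _),
          ← ((show Commute D.h' D.e' from D.h'_e').pow_right _).eq, mul_smul, sub_self]
      have := sub_mem (ha (D.e' • w)) h2
      rwa [sub_sub_cancel] at this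
  obtain ⟨k, hk⟩ := he' m
  exact h5 k m hk

end Highest

section Lowest

variable {c : ℂ} (hc : c ≠ 0) (hh : LocGenEigen D.h' c M)

/-- The mirror situation: now `a` and `b` are the locally nilpotent elements, and the commutators
give surjectivity where they gave injectivity before. -/
lemma e_b_pow_succ_smul (w : M) (k : ℕ) : D.e • P.b ^ (k + 1) • w =
    P.b ^ (k + 1) • D.e • w + (k + 1 : ℂ) • P.b ^ k • D.h' • w := by
  induction k with
  | zero => simp [← mul_smul, D.e_b, add_smul]
  | succ k ih =>
    rw [pow_succ', mul_smul, ← mul_smul D.e, D.e_b, add_smul, mul_smul, ih, ← mul_smul D.h',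
      ((show Commute D.h' P.b from D.h'_b).pow_right _).eq, smul_add, smul_comm P.b (_ : ℂ),
      ← mul_smul P.b (P.b ^ _), ← mul_smul P.b (P.b ^ _), mul_smul (P.b ^ _) D.h', ← pow_succ',
      ← pow_succ', add_assoc]
    congr 1
    push_cast
    rw [add_smul ((k : ℂ) + 1) 1, one_smul]

lemma b_smul_a_pow {w : M} (hw : P.b • w = 0) (k : ℕ) : P.b • P.a ^ k • w = 0 := by
  rw [← mul_smul, (P.comm.symm.pow_right k).eq, mul_smul, hw, smul_zero]

lemma h'_a_smul {w : M} (hw : P.b • w = 0) : D.h' • P.a • w = P.a • D.h' • w := by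
  rw [← mul_smul, D.h'_a, sub_smul, smul_assoc, hw, smul_zero, sub_zero, mul_smul]

lemma h'_a_pow_smul {w : M} (hw : P.b • w = 0) (k : ℕ) :
    D.h' • P.a ^ k • w = P.a ^ k • D.h' • w := by
  induction k with
  | zero => simp
  | succ k ih => rw [pow_succ', mul_smul, D.h'_a_smul (b_smul_a_pow hw k), ih, mul_smul]

lemma e'_a_pow_succ_smul {w : M} (hw : P.b • w = 0) (k : ℕ) : D.e' • P.a ^ (k + 1) • w =
    P.a ^ (k + 1) • D.e' • w + (k + 1 : ℂ) • P.a ^ k • D.h' • w := by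
  induction k with
  | zero => simp [← mul_smul, D.e'_a, add_smul]
  | succ k ih =>
    rw [pow_succ', mul_smul, ← mul_smul D.e', D.e'_a, add_smul, mul_smul, ih,
      D.h'_a_pow_smul hw, smul_add, smul_comm P.a (_ : ℂ),
      ← mul_smul P.a (P.a ^ _), ← mul_smul P.a (P.a ^ _), ← pow_succ', ← pow_succ', add_assoc]
    congr 1
    push_cast
    rw [add_smul ((k : ℂ) + 1) 1, one_smul]

variable (X : Submodule ℂ M)

include hc hh in
/-- `b` is surjective on every stable subspace. -/
lemma exists_b_smul_eq (hXe : ∀ m ∈ X, D.e • m ∈ X) (hXb : ∀ m ∈ X, P.b • m ∈ X)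
    (hXh : ∀ m ∈ X, D.h' • m ∈ X) (hb : LocNilpotent P.b M) {m : M} (hm : m ∈ X) :
    ∃ y ∈ X, P.b • y = m := by
  let L : Submodule ℂ M := X.map (Algebra.lsmul ℂ ℂ M P.b)
  have hL' : ∀ y ∈ X, P.b • y ∈ L := fun y hy => ⟨y, hy, rfl⟩
  have hL : ∀ m ∈ L, D.h' • m ∈ L := by
    rintro _ ⟨y, hy, rfl⟩
    change D.h' • P.b • y ∈ L
    rw [← mul_smul, D.h'_b, mul_smul]
    exact hL' _ (hXh _ hy)
  have h1 : ∀ (k : ℕ) (m : M), m ∈ X → P.b ^ k • m = 0 → m ∈ L := by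
    intro k
    induction k with
    | zero => intro w _ hw; rw [pow_zero, one_smul] at hw; rw [hw]; exact zero_mem _
    | succ k ih =>
      intro m hmX hm
      refine hh.mem_of_smul_mem hc _ hL (natCast_succ_smul_mem (k := k) ?_)
      -- Applying `b^k` to this vector gives `e b^(k+1) m = 0`, so the induction hypothesis applies
      -- to it.
      have h2 : P.b • D.e • m + (k + 1 : ℂ) • D.h' • m ∈ L := by
        refine ih _ (add_mem (hXb _ (hXe _ hmX)) (X.smul_mem _ (hXh _ hmX))) ?_
        rw [smul_add, ← mul_smul _ P.b, ← pow_succ, smul_comm (P.b ^ k), ← D.e_b_pow_succ_smul, hm,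
          smul_zero]
      have := sub_mem h2 (hL' _ (hXe _ hmX))
      rwa [add_sub_cancel_left] at this
  obtain ⟨k, hk⟩ := hb m
  obtain ⟨y, hy, h⟩ := h1 k m hm hk
  exact ⟨y, hy, h⟩

include hc hh in
/-- `a` is surjective on the kernel of `b` in every stable subspace. -/
lemma exists_a_smul_eq (hXe' : ∀ m ∈ X, D.e' • m ∈ X) (hXa : ∀ m ∈ X, P.a • m ∈ X)
    (hXh : ∀ m ∈ X, D.h' • m ∈ X) (ha : LocNilpotent P.a M) {m : M} (hmX : m ∈ X)
    (hm : P.b • m = 0) : ∃ y ∈ X, P.b • y = 0 ∧ P.a • y = m := by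
  let L : Submodule ℂ M :=
    (X ⊓ LinearMap.ker (Algebra.lsmul ℂ ℂ M P.b)).map (Algebra.lsmul ℂ ℂ M P.a)
  have hL' : ∀ y ∈ X, P.b • y = 0 → P.a • y ∈ L := fun y hyX hy => ⟨y, ⟨hyX, hy⟩, rfl⟩
  have hL : ∀ m ∈ L, D.h' • m ∈ L := by
    rintro _ ⟨y, ⟨hyX, hy⟩, rfl⟩
    have hy' : P.b • y = 0 := hy
    change D.h' • P.a • y ∈ L
    rw [D.h'_a_smul hy']
    refine hL' _ (hXh _ hyX) ?_
    rw [← mul_smul, ← D.h'_b, mul_smul, hy', smul_zero]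
  have h1 : ∀ (k : ℕ) (m : M), m ∈ X → P.b • m = 0 → P.a ^ k • m = 0 → m ∈ L := by
    intro k
    induction k with
    | zero => intro w _ _ hw; rw [pow_zero, one_smul] at hw; rw [hw]; exact zero_mem _
    | succ k ih =>
      intro m hmX hm0 hm
      have he0 : P.b • D.e' • m = 0 := by rw [← mul_smul, ← D.e'_b, mul_smul, hm0, smul_zero]
      have hh0 : P.b • D.h' • m = 0 := by rw [← mul_smul, ← D.h'_b, mul_smul, hm0, smul_zero]
      refine hh.mem_of_smul_mem hc _ hL (natCast_succ_smul_mem (k := k) ?_)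
      have h2 : P.a • D.e' • m + (k + 1 : ℂ) • D.h' • m ∈ L := by
        refine ih _ (add_mem (hXa _ (hXe' _ hmX)) (X.smul_mem _ (hXh _ hmX))) ?_ ?_
        · rw [smul_add, smul_comm P.b (_ : ℂ), hh0, smul_zero, add_zero]
          simpa using b_smul_a_pow he0 1
        · rw [smul_add, ← mul_smul _ P.a, ← pow_succ, smul_comm (P.a ^ k),
            ← D.e'_a_pow_succ_smul hm0, hm, smul_zero]
      have := sub_mem h2 (hL' _ (hXe' _ hmX) he0)
      rwa [add_sub_cancel_left] at this
  obtain ⟨k, hk⟩ := ha m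
  obtain ⟨y, ⟨hyX, hy⟩, h⟩ := h1 k m hmX hm hk
  exact ⟨y, hyX, hy, h⟩

end Lowest

end TakiffTriple

/-! ### Twisting modules of highest type -/

namespace OrePair

variable {A : Type u} [Ring A] [Algebra ℂ A] (P : OrePair A)
  {M : Type u} [AddCommGroup M] [Module A M]

lemma br_algebraMap_smul (t : ℂ) (i j : ℤ) (m : M) :
    P.br i j (algebraMap ℂ A t • m) = t • P.br i j m := by
  rw [← algebraMap_smul A t (P.br i j m), br_smul, smul_br, Algebra.algebraMap_eq_smul_one,
    toLoc_smul, map_one, mul_smul_one, smul_one_mul]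

lemma pureTensor_proj_smul (t : ℂ) (x : P.Loc) (m : M) :
    pureTensor (A := A) P.Bimod (P.proj (t • x)) m = t • pureTensor P.Bimod (P.proj x) m := by
  rw [← algebraMap_smul A t (pureTensor P.Bimod (P.proj x) m), smul_pureTensor, smul_proj,
    Algebra.algebraMap_eq_smul_one, toLoc_smul, map_one, smul_one_mul]

lemma cartan_smul_br {h : A} {t : ℂ} (ha : h * P.a = P.a * h - t • P.a)
    (hb : h * P.b = P.b * h - t • P.b) (i j : ℕ) (m : M) :
    h • P.br i j m = P.br i j (h • m) + ((i + j : ℂ) * t) • P.br i j m := by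
  rw [smul_br, P.cartan_mul_frac ha hb, map_add, map_add, AddMonoidHom.add_apply,
    pureTensor_proj_mul, pureTensor_proj_smul]
  rfl

lemma cartan_bar_smul_br {h : A} {t : ℂ} (ha : h * P.a = P.a * h - t • P.b)
    (hb : h * P.b = P.b * h) (i j : ℕ) (m : M) :
    h • P.br i j m = P.br i j (h • m) + ((i : ℂ) * t) • P.br (i + 1) (j - 1) m := by
  rw [smul_br, P.cartan_bar_mul_frac ha hb, map_add, map_add, AddMonoidHom.add_apply,
    pureTensor_proj_mul, pureTensor_proj_smul]
  rfl

/-- The submodule of `S ⊗ M` generated by the `s ⊗ n` with `n ∈ N`. -/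
noncomputable def push (N : Submodule A M) : Submodule A (BalTensor (A := A) P.Bimod M) :=
  LinearMap.range (BalTensor.map P.Bimod N.subtype)

/-- The submodule of the `m` with `s ⊗ m ∈ K` for all `s`. -/
def pull (K : Submodule A (BalTensor (A := A) P.Bimod M)) : Submodule A M where
  carrier := {m | ∀ s, pureTensor (A := A) P.Bimod s m ∈ K}
  zero_mem' s := by rw [map_zero]; exact zero_mem _
  add_mem' h1 h2 s := by rw [map_add]; exact add_mem (h1 s) (h2 s)
  smul_mem' u m h s := by rw [← pureTensor_op_smul]; exact h _

lemma mem_push {N : Submodule A M} {t : BalTensor (A := A) P.Bimod M} :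
    t ∈ P.push N ↔ ∃ n : ℕ, ∃ m ∈ N, t = P.br n n m := by
  constructor
  · rintro ⟨x, rfl⟩
    obtain ⟨n, m, rfl⟩ := P.exists_br x
    exact ⟨n, m, m.2, P.map_br _ _ _ _⟩
  · rintro ⟨n, m, hm, rfl⟩
    exact ⟨P.br n n ⟨m, hm⟩, P.map_br _ _ _ _⟩

lemma pureTensor_mem_push {N : Submodule A M} {m : M} (hm : m ∈ N) (s : P.Bimod) :
    pureTensor (A := A) P.Bimod s m ∈ P.push N :=
  ⟨pureTensor P.Bimod s ⟨m, hm⟩, rfl⟩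

lemma push_le_iff {N : Submodule A M} {K : Submodule A (BalTensor (A := A) P.Bimod M)} :
    P.push N ≤ K ↔ N ≤ P.pull K := by
  constructor
  · exact fun h m hm s => h (P.pureTensor_mem_push hm s)
  · intro h t ht
    obtain ⟨n, m, hm, rfl⟩ := P.mem_push.mp ht
    exact h hm _

lemma locNilpotent_a : LocNilpotent P.a (BalTensor (A := A) P.Bimod M) := by
  intro t
  obtain ⟨n, m, rfl⟩ := P.exists_br t
  exact ⟨n, by rw [a_pow_smul_br, sub_self, br_eq_zero _ (Or.inl le_rfl)]⟩

lemma locNilpotent_b : LocNilpotent P.b (BalTensor (A := A) P.Bimod M) := by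
  intro t
  obtain ⟨n, m, rfl⟩ := P.exists_br t
  exact ⟨n, by rw [b_pow_smul_br, sub_self, br_eq_zero _ (Or.inr le_rfl)]⟩

variable {P}

/-- Write `t` with exponents `n + k`. The condition on `a^k` and `of_br_eq_zero` strip the excess
power of `a`, and then the condition on `b^k` strips that of `b`. -/
lemma IsRegularOn.exists_br_eq (h : P.IsRegularOn M) {t : BalTensor (A := A) P.Bimod M} {k : ℕ}
    (ha : P.a ^ k • t = 0) (hb : P.b ^ k • t = 0) : ∃ m, t = P.br k k m := by
  obtain ⟨n, m, rfl⟩ := P.exists_br t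
  rw [P.br_raise (n + k) n n (by omega) (by omega)] at ha hb ⊢
  generalize (P.a ^ (n + k - n) * P.b ^ (n + k - n)) • m = x at ha hb ⊢
  rw [a_pow_smul_br] at ha
  have ha' : P.br (n : ℕ) (n + k : ℕ) x = 0 := by rw [← ha]; congr 2; push_cast; ring
  obtain ⟨y, z, rfl⟩ := h.of_br_eq_zero ha'
  rw [map_add, br_a_pow_smul, br_b_pow_smul, P.br_eq_zero (i := (n + k : ℕ)) (by simp), add_zero,
    b_pow_smul_br] at hb
  have hb' : P.br (k : ℕ) (n : ℕ) y = 0 := by rw [← hb]; congr 2 <;> push_cast <;> ring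
  obtain ⟨y', z', rfl⟩ := h.of_br_eq_zero hb'
  refine ⟨z', ?_⟩
  rw [map_add, br_a_pow_smul, br_b_pow_smul, P.br_eq_zero (i := (n + k : ℕ)) (by simp), add_zero,
    map_add, br_a_pow_smul, br_b_pow_smul, P.br_eq_zero (by simp), zero_add]
  congr 2 <;> push_cast <;> ring

/-- A vanishing fraction has numerator `aⁿ y + bⁿ z` with `y`, `z` in `M`. Regularity of `M / N`
provides a Koszul correction, replacing `(y, z)` by `(y - bⁿ w, z + aⁿ w)`, that lands in `N`. -/
lemma map_subtype_injective (N : Submodule A M) (h : P.IsRegularOn (M ⧸ N)) (hM : P.IsRegularOn M) :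
    Function.Injective (BalTensor.map P.Bimod N.subtype) := by
  rw [← LinearMap.ker_eq_bot, LinearMap.ker_eq_bot']
  intro t ht
  obtain ⟨n, x, rfl⟩ := P.exists_br t
  rw [map_br] at ht
  obtain ⟨y, z, hyz⟩ := hM.of_br_eq_zero ht
  have h1 : P.a ^ n • N.mkQ y = P.b ^ n • (-N.mkQ z) := by
    rw [smul_neg, eq_neg_iff_add_eq_zero, ← map_smul, ← map_smul, ← map_add, ← hyz]
    simp
  obtain ⟨w, hw⟩ := h.a_pow_of_b_pow n n h1
  obtain ⟨w, rfl⟩ := N.mkQ_surjective w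
  rw [hw, ← sub_eq_zero, ← mul_smul, (P.comm.pow_pow n n).eq, mul_smul, ← smul_sub] at h1
  have h2 := h.b_pow_inj n h1
  have h3 : y - P.b ^ n • w ∈ N := by
    rw [← Submodule.Quotient.mk_eq_zero, ← Submodule.mkQ_apply, map_sub, hw, map_smul, sub_self]
  have h4 : z + P.a ^ n • w ∈ N := by
    rw [← Submodule.Quotient.mk_eq_zero, ← Submodule.mkQ_apply, map_add, map_smul, add_comm]
    rwa [sub_neg_eq_add] at h2
  have h5 : x = P.a ^ n • (⟨_, h3⟩ : N) + P.b ^ n • (⟨_, h4⟩ : N) := by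
    refine Subtype.ext ?_
    have := hyz
    simp only [Submodule.subtype_apply] at this
    rw [this]
    simp only [Submodule.coe_add, Submodule.coe_smul, smul_sub, smul_add, ← mul_smul,
      (P.comm.pow_pow n n).eq]
    abel
  rw [h5, map_add, br_a_pow_smul, br_b_pow_smul, P.br_eq_zero (by simp), P.br_eq_zero (by simp),
    add_zero]

lemma ker_map_mkQ (N : Submodule A M) (h : P.IsRegularOn (M ⧸ N)) :
    LinearMap.ker (BalTensor.map P.Bimod N.mkQ) = P.push N := by
  ext t
  rw [LinearMap.mem_ker]
  constructor
  · intro ht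
    obtain ⟨n, m, rfl⟩ := P.exists_br t
    rw [map_br] at ht
    obtain ⟨y, z, hyz⟩ := h.of_br_eq_zero ht
    obtain ⟨y, rfl⟩ := N.mkQ_surjective y
    obtain ⟨z, rfl⟩ := N.mkQ_surjective z
    refine P.mem_push.mpr ⟨n, m - (P.a ^ n • y + P.b ^ n • z), ?_, ?_⟩
    · rw [← Submodule.Quotient.mk_eq_zero, ← Submodule.mkQ_apply, map_sub, hyz, map_add, map_smul,
        map_smul, sub_self]
    · rw [map_sub, map_add, br_a_pow_smul, br_b_pow_smul, P.br_eq_zero (i := (n : ℤ) - n) (by simp),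
        P.br_eq_zero (j := (n : ℤ) - n) (by simp), add_zero, sub_zero]
  · intro ht
    obtain ⟨n, m, hm, rfl⟩ := P.mem_push.mp ht
    rw [map_br, Submodule.mkQ_apply, (Submodule.Quotient.mk_eq_zero N).mpr hm, map_zero]

lemma map_surjective {N : Type u} [AddCommGroup N] [Module A N] {f : M →ₗ[A] N}
    (hf : Function.Surjective f) : Function.Surjective (BalTensor.map P.Bimod f) := by
  intro t
  obtain ⟨n, x, rfl⟩ := P.exists_br t
  obtain ⟨y, rfl⟩ := hf x
  exact ⟨P.br n n y, P.map_br _ _ _ _⟩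

end OrePair

namespace TakiffTriple

variable {A : Type u} [Ring A] [Algebra ℂ A] {P : OrePair A} (D : TakiffTriple P)

/-- The raising elements act locally nilpotently, and `h'` acts with generalised eigenvalue `c`. -/
structure HighestType (c : ℂ) (M : Type u) [AddCommGroup M] [Module A M] : Prop where
  eig : LocGenEigen D.h' c M
  nil_e : LocNilpotent D.e M
  nil_e' : LocNilpotent D.e' M

variable {D} {c : ℂ} {M : Type u} [AddCommGroup M] [Module A M]

lemma HighestType.of_injective (h : D.HighestType c M) {N : Type u} [AddCommGroup N] [Module A N]
    (f : N →ₗ[A] M) (hf : Function.Injective f) : D.HighestType c N where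
  eig n := by
    obtain ⟨k, hk⟩ := h.eig (f n)
    exact ⟨k, hf (by rw [map_smul, hk, map_zero])⟩
  nil_e n := by
    obtain ⟨k, hk⟩ := h.nil_e (f n)
    exact ⟨k, hf (by rw [map_smul, hk, map_zero])⟩
  nil_e' n := by
    obtain ⟨k, hk⟩ := h.nil_e' (f n)
    exact ⟨k, hf (by rw [map_smul, hk, map_zero])⟩

lemma HighestType.of_surjective (h : D.HighestType c M) {N : Type u} [AddCommGroup N] [Module A N]
    (f : M →ₗ[A] N) (hf : Function.Surjective f) : D.HighestType c N where
  eig n := by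
    obtain ⟨m, rfl⟩ := hf n
    obtain ⟨k, hk⟩ := h.eig m
    exact ⟨k, by rw [← map_smul, hk, map_zero]⟩
  nil_e n := by
    obtain ⟨m, rfl⟩ := hf n
    obtain ⟨k, hk⟩ := h.nil_e m
    exact ⟨k, by rw [← map_smul, hk, map_zero]⟩
  nil_e' n := by
    obtain ⟨m, rfl⟩ := hf n
    obtain ⟨k, hk⟩ := h.nil_e' m
    exact ⟨k, by rw [← map_smul, hk, map_zero]⟩

lemma HighestType.submodule (h : D.HighestType c M) (N : Submodule A M) : D.HighestType c N :=
  h.of_injective N.subtype N.injective_subtype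

lemma HighestType.quotient (h : D.HighestType c M) (N : Submodule A M) :
    D.HighestType c (M ⧸ N) :=
  h.of_surjective N.mkQ N.mkQ_surjective

variable (hc : c ≠ 0)

include hc in
lemma HighestType.isRegularOn (h : D.HighestType c M) : P.IsRegularOn M := by
  let _ := Module.restrictScalars ℂ A M
  have _ := IsScalarTower.restrictScalars ℂ A M
  exact D.isRegularOn hc h.eig h.nil_e h.nil_e'

include hc in
lemma HighestType.eq_zero_of_forall (h : D.HighestType c M)
    (H : ∀ m : M, ∃ y z : M, m = P.a • y + P.b • z) (m : M) : m = 0 := by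
  let _ := Module.restrictScalars ℂ A M
  have _ := IsScalarTower.restrictScalars ℂ A M
  exact D.subsingleton_of_forall_eq_add hc h.eig h.nil_e h.nil_e' H m

include hc in
lemma HighestType.exists_highest (h : D.HighestType c M) (m : M) :
    ∃ y z v : M, D.e • v = 0 ∧ D.e' • v = 0 ∧ m = P.a • y + P.b • z + v := by
  let _ := Module.restrictScalars ℂ A M
  have _ := IsScalarTower.restrictScalars ℂ A M
  obtain ⟨y, z, v, ⟨h1, h2⟩, h3⟩ := D.exists_highest hc h.eig h.nil_e h.nil_e' m
  exact ⟨y, z, v, h1, h2, h3⟩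

include hc in
/-- The unit `M → Hom(S, S ⊗ M)` is injective. -/
theorem HighestType.eq_zero_of_pureTensor (h : D.HighestType c M) {m : M}
    (hm : ∀ s, pureTensor (A := A) P.Bimod s m = 0) : m = 0 := by
  -- `N` is the kernel of the unit. Since `S ⊗ N` embeds in `S ⊗ M`, every `a⁻¹ b⁻¹ ⊗ x` with `x ∈
  -- N` vanishes, so `N = a N + b N` and the Nakayama argument applies.
  let N : Submodule A M := P.pull ⊥
  have hN : D.HighestType c N := h.submodule N
  have h1 : ∀ x : N, x = 0 := by
    refine hN.eq_zero_of_forall hc fun x => ?_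
    have h2 : P.br (1 : ℕ) (1 : ℕ) x = 0 := by
      refine OrePair.map_subtype_injective N ((h.quotient N).isRegularOn hc) (h.isRegularOn hc) ?_
      rw [P.map_br, map_zero]
      exact x.2 _
    simpa using (hN.isRegularOn hc).of_br_eq_zero h2
  exact congrArg Subtype.val (h1 ⟨m, hm⟩)

lemma e'_smul_br (i j : ℕ) (m : M) : D.e' • P.br i j m = P.br i j (D.e' • m) -
    (i : ℂ) • P.br (i + 1) j (D.h' • m) - ((i : ℂ) * (i + 1)) • P.br (i + 2) (j - 1) m := by
  rw [P.smul_br, OrePair.e'_mul_frac D, map_sub, map_sub, map_sub, map_sub, AddMonoidHom.sub_apply,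
    AddMonoidHom.sub_apply, P.pureTensor_proj_mul, P.pureTensor_proj_smul, P.pureTensor_proj_smul,
    P.pureTensor_proj_mul]
  rfl

lemma e_smul_br (i j : ℕ) (m : M) : D.e • P.br i j m = P.br i j (D.e • m) -
    (j : ℂ) • P.br i (j + 1) (D.h' • m) - (i : ℂ) • P.br (i + 1) j (D.h • m) -
      ((i : ℂ) * (i + 1) + 2 * i * j) • P.br (i + 1) j m := by
  rw [P.smul_br, OrePair.e_mul_frac D, map_sub, map_sub, map_sub, map_sub, map_sub, map_sub,
    AddMonoidHom.sub_apply, AddMonoidHom.sub_apply, AddMonoidHom.sub_apply,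
    P.pureTensor_proj_mul, P.pureTensor_proj_smul, P.pureTensor_proj_smul, P.pureTensor_proj_smul,
    P.pureTensor_proj_mul, P.pureTensor_proj_mul]
  rfl

include hc in
/-- A subspace stable under `e`, `e'`, `h`, `h'` that contains `a⁻¹ b⁻¹ ⊗ v`, for a highest weight
vector `v`, contains all `a⁻ⁱ b⁻ʲ ⊗ v`. -/
theorem HighestType.br_mem (h : D.HighestType c M)
    (K : Submodule ℂ (BalTensor (A := A) P.Bimod M)) (he : ∀ t ∈ K, D.e • t ∈ K)
    (he' : ∀ t ∈ K, D.e' • t ∈ K) (hh : ∀ t ∈ K, D.h • t ∈ K) (hh' : ∀ t ∈ K, D.h' • t ∈ K)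
    {v : M} (hv : D.e • v = 0) (hv' : D.e' • v = 0) (hK : P.br (1 : ℕ) (1 : ℕ) v ∈ K) (i j : ℕ) :
    P.br i j v ∈ K := by
  let _ := Module.restrictScalars ℂ A M
  have _ := IsScalarTower.restrictScalars ℂ A M
  have smul_br : ∀ (t : ℂ) (i j : ℤ) (m : M), P.br i j (t • m) = t • P.br i j m := fun t i j m =>
    P.br_algebraMap_smul t i j m
  -- Membership of `a⁻¹ b⁻¹ ⊗ v` is kept in the definition so that the induction can be applied to
  -- `h v` and `h' v` as well.
  let V (i j : ℕ) : Submodule ℂ M :=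
    { carrier := {v | v ∈ D.highest M ∧ P.br (1 : ℕ) (1 : ℕ) v ∈ K ∧ P.br i j v ∈ K}
      zero_mem' := by simp
      add_mem' := by
        rintro x y ⟨h1, h2, h3⟩ ⟨h4, h5, h6⟩
        exact ⟨add_mem h1 h4, by rw [map_add]; exact add_mem h2 h5,
          by rw [map_add]; exact add_mem h3 h6⟩
      smul_mem' := by
        rintro t x ⟨h1, h2, h3⟩
        exact ⟨(D.highest M).smul_mem t h1, by rw [smul_br]; exact K.smul_mem t h2,
          by rw [smul_br]; exact K.smul_mem t h3⟩ }
  have hV1 : ∀ v ∈ V 1 1, D.h' • v ∈ V 1 1 := by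
    rintro v ⟨h1, h2, -⟩
    have := hh' _ h2
    rw [P.cartan_bar_smul_br D.h'_a D.h'_b, P.br_eq_zero (j := ((1 : ℕ) : ℤ) - 1) (by simp), smul_zero,
      add_zero] at this
    exact ⟨D.h'_smul_mem_highest h1, this, this⟩
  have hV2 : ∀ v ∈ V 1 1, D.h • v ∈ V 1 1 := by
    rintro v ⟨h1, h2, -⟩
    have := sub_mem (hh _ h2) (K.smul_mem (((1 : ℕ) + (1 : ℕ) : ℂ) * 2) h2)
    rw [P.cartan_smul_br D.h_a D.h_b, add_sub_cancel_right] at this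
    exact ⟨D.h_smul_mem_highest h1, this, this⟩
  -- `h'` maps `a⁻ⁱ b⁻ʲ ⊗ w` to `a⁻ⁱ b⁻ʲ ⊗ h' w` plus a multiple of `a⁻ⁱ⁻¹ b⁻ʲ⁺¹ ⊗ w`. When the
  -- latter is in `K`, the space `V i j` is stable under `h'`, and `h'` can be cancelled.
  have step : ∀ i j : ℕ, (∀ v ∈ V 1 1, P.br (i + 1) (j - 1) v ∈ K) →
      (∀ v ∈ V 1 1, P.br i j (D.h' • v) ∈ K) → ∀ v ∈ V 1 1, P.br i j v ∈ K := by
    intro i j h1 h2 v hv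
    have hs : ∀ w ∈ V i j, D.h' • w ∈ V i j := by
      rintro w ⟨h3, h4, h5⟩
      have := sub_mem (hh' _ h5) (K.smul_mem ((i : ℂ) * 2) (h1 w ⟨h3, h4, h4⟩))
      rw [P.cartan_bar_smul_br D.h'_a D.h'_b, add_sub_cancel_right] at this
      have h6 := hV1 w ⟨h3, h4, h4⟩
      exact ⟨h6.1, h6.2.1, this⟩
    have h7 := hV1 v hv
    exact (h.eig.mem_of_smul_mem hc (V i j) hs ⟨h7.1, h7.2.1, h2 v hv⟩).2.2
  -- The row `j = 1` is climbed with `e'`, whose last correction term then carries `b⁰` and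
  -- vanishes. Each further row is reached by applying `e` to the row below.
  have key : ∀ j i : ℕ, ∀ v ∈ V 1 1, P.br i j v ∈ K := by
    intro j
    induction j with
    | zero => intro i v _; rw [P.br_eq_zero (by simp)]; exact zero_mem _
    | succ j ihj =>
      rcases j with _ | j
      · intro i
        induction i with
        | zero => intro v _; rw [P.br_eq_zero (by simp)]; exact zero_mem _
        | succ i ih =>
          rcases i with _ | i
          · exact fun v hv => hv.2.1
          refine step _ _ (fun v _ => by rw [P.br_eq_zero (by simp)]; exact zero_mem _) ?_
          intro v hv
          have h1 := he' _ (ih v hv)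
          rw [D.e'_smul_br, hv.1.2, map_zero, P.br_eq_zero (i := ((i + 1 : ℕ) : ℤ) + 2) (by simp),
            smul_zero, sub_zero, zero_sub] at h1
          have h2 := (K.smul_mem_iff (s := ((i + 1 : ℕ) : ℂ))
            (by exact_mod_cast Nat.succ_ne_zero i)).mp (neg_mem_iff.mp h1)
          exact_mod_cast h2
      · intro i
        refine step _ _ (fun v hv => ?_) ?_
        · have := ihj (i + 1) v hv
          convert this using 2
          push_cast; ring_nf
        · intro v hv
          have h1 := he _ (ihj i v hv)
          have h3 : ∀ v ∈ V 1 1, P.br ((i : ℤ) + 1) ((j + 1 : ℕ) : ℤ) v ∈ K := fun v hv => by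
            exact_mod_cast ihj (i + 1) v hv
          rw [D.e_smul_br, hv.1.1, map_zero, zero_sub] at h1
          have h4 := add_mem (add_mem h1 (K.smul_mem ((i : ℂ) * (i + 1) + 2 * i * (j + 1 : ℕ))
            (h3 v hv))) (K.smul_mem (i : ℂ) (h3 _ (hV2 v hv)))
          rw [sub_add_cancel, sub_add_cancel, neg_mem_iff] at h4
          have h2 := (K.smul_mem_iff (s := ((j + 1 : ℕ) : ℂ))
            (by exact_mod_cast Nat.succ_ne_zero j)).mp h4
          exact_mod_cast h2
  exact key j i v ⟨⟨hv, hv'⟩, hK, hK⟩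

include hc in
lemma HighestType.mem_pull (h : D.HighestType c M)
    (K : Submodule A (BalTensor (A := A) P.Bimod M)) {v : M} (hv : D.e • v = 0)
    (hv' : D.e' • v = 0) (hK : P.br (1 : ℕ) (1 : ℕ) v ∈ K) : v ∈ P.pull K := by
  intro s
  obtain ⟨n, u, hs⟩ := P.pureTensor_eq_smul_br (M := M) s
  rw [hs]
  refine K.smul_mem u ?_
  exact h.br_mem hc (K.restrictScalars ℂ) (fun t ht => K.smul_mem _ ht)
    (fun t ht => K.smul_mem _ ht) (fun t ht => K.smul_mem _ ht) (fun t ht => K.smul_mem _ ht)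
    hv hv' hK n n

-- The numerator matters only modulo `a M + b M`, and by `exists_highest` a highest weight vector
-- can be chosen in each class.
include hc in
lemma HighestType.exists_br_one_one (h : D.HighestType c M) {t : BalTensor (A := A) P.Bimod M}
    (ha : P.a • t = 0) (hb : P.b • t = 0) :
    ∃ v : M, D.e • v = 0 ∧ D.e' • v = 0 ∧ t = P.br (1 : ℕ) (1 : ℕ) v := by
  obtain ⟨m, rfl⟩ := (h.isRegularOn hc).exists_br_eq (k := 1) (t := t) (by simpa) (by simpa)
  obtain ⟨y, z, v, h1, h2, rfl⟩ := h.exists_highest hc m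
  refine ⟨v, h1, h2, ?_⟩
  rw [map_add, map_add, P.br_a_smul, P.br_b_smul, P.br_eq_zero (by simp), P.br_eq_zero (by simp),
    zero_add, zero_add]

/-- Multiplying a nonzero vector by powers of `a` and then of `b` stops at a nonzero vector killed
by both. -/
lemma _root_.TakiffO.OrePair.eq_bot_of_invariants {N : Type u} [AddCommGroup N] [Module A N]
    (ha : LocNilpotent P.a N) (hb : LocNilpotent P.b N) (K : Submodule A N)
    (H : ∀ t ∈ K, P.a • t = 0 → P.b • t = 0 → t = 0) : K = ⊥ := by
  rw [Submodule.eq_bot_iff]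
  intro t ht
  obtain ⟨n, hn⟩ := ha t
  refine mem_of_pow_smul_mem (x := P.a) (L := {t : N | t = 0}) (p := fun t => t ∈ K)
    (fun t ht => K.smul_mem _ ht) ?_ n ht hn
  intro t ht hat
  obtain ⟨k, hk⟩ := hb t
  refine mem_of_pow_smul_mem (x := P.b) (L := {t : N | t = 0})
    (p := fun t => t ∈ K ∧ P.a • t = 0) ?_ (fun t ht hbt => H t ht.1 ht.2 hbt) k ⟨ht, hat⟩ hk
  rintro t ⟨ht, hat⟩
  exact ⟨K.smul_mem _ ht, by rw [← mul_smul, P.comm.eq, mul_smul, hat, smul_zero]⟩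

include hc in
theorem HighestType.eq_bot_of_pull (h : D.HighestType c M)
    (K : Submodule A (BalTensor (A := A) P.Bimod M)) (hK : P.pull K = ⊥) : K = ⊥ := by
  refine P.eq_bot_of_invariants P.locNilpotent_a P.locNilpotent_b K fun t ht ha hb => ?_
  obtain ⟨v, h1, h2, rfl⟩ := h.exists_br_one_one hc ha hb
  have := h.mem_pull hc K h1 h2 ht
  rw [hK, Submodule.mem_bot] at this
  rw [this, map_zero]

-- If all `s ⊗ m` come from `N`, they vanish in `S ⊗ (M / N)`; the unit of `M / N` is injective, so
-- `m ∈ N`.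
include hc in
theorem HighestType.pull_push (h : D.HighestType c M) (N : Submodule A M) :
    P.pull (P.push N) = N := by
  refine le_antisymm (fun m hm => ?_) (P.push_le_iff.mp le_rfl)
  rw [← Submodule.Quotient.mk_eq_zero]
  refine (h.quotient N).eq_zero_of_pureTensor hc fun s => ?_
  have := hm s
  rw [← OrePair.ker_map_mkQ N ((h.quotient N).isRegularOn hc), LinearMap.mem_ker] at this
  exact this

-- Pass to `M / pull K`. The image of `K` in its tensor product has zero pull-back, hence is zero,
-- so `K` lies in the kernel, which by `ker_map_mkQ` is `push (pull K)`.
include hc in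
theorem HighestType.push_pull (h : D.HighestType c M)
    (K : Submodule A (BalTensor (A := A) P.Bimod M)) : P.push (P.pull K) = K := by
  refine le_antisymm (P.push_le_iff.mpr le_rfl) ?_
  have hq := h.quotient (P.pull K)
  have hker := OrePair.ker_map_mkQ (P.pull K) (hq.isRegularOn hc)
  have h1 : K.map (BalTensor.map P.Bimod (P.pull K).mkQ) = ⊥ := by
    refine hq.eq_bot_of_pull hc _ ?_
    rw [Submodule.eq_bot_iff]
    intro x hx
    obtain ⟨m, rfl⟩ := (P.pull K).mkQ_surjective x
    rw [Submodule.mkQ_apply, Submodule.Quotient.mk_eq_zero]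
    intro s
    obtain ⟨k, hk, hks⟩ := hx s
    rw [← BalTensor.map_pureTensor, ← sub_eq_zero, ← map_sub, ← LinearMap.mem_ker, hker] at hks
    have := sub_mem hk (P.push_le_iff.mpr le_rfl hks)
    rwa [sub_sub_cancel] at this
  rw [← hker]
  exact LinearMap.le_ker_iff_map.mpr h1

/-- The lattice isomorphism between the submodules of `M` and those of `S ⊗ M`. -/
noncomputable def HighestType.orderIso (h : D.HighestType c M) (hc : c ≠ 0) :
    Submodule A M ≃o Submodule A (BalTensor (A := A) P.Bimod M) where
  toFun := P.push
  invFun := P.pull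
  left_inv := h.pull_push hc
  right_inv := h.push_pull hc
  map_rel_iff' := by
    intro N N'
    change P.push N ≤ P.push N' ↔ N ≤ N'
    rw [P.push_le_iff, h.pull_push hc]

lemma _root_.TakiffO.isCompactElement_map {α β : Type*} [PartialOrder α] [PartialOrder β]
    (f : α ≃o β) {k : α} (hk : IsCompactElement k) : IsCompactElement (f k) := by
  intro s u hs hd hu hle
  obtain ⟨x, ⟨y, hy, rfl⟩, hx⟩ := hk (f.symm '' s) (f.symm u) (hs.image _)
    (by
      rintro _ ⟨x, hx, rfl⟩ _ ⟨y, hy, rfl⟩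
      obtain ⟨z, hz, h1, h2⟩ := hd x hx y hy
      exact ⟨f.symm z, ⟨z, hz, rfl⟩, f.symm.monotone h1, f.symm.monotone h2⟩)
    (f.symm.isLUB_image'.mpr hu) (f.le_symm_apply.mpr hle)
  exact ⟨y, hy, f.le_symm_apply.mp hx⟩

/-- Finite generation means that the top submodule is a compact element, which depends on the
lattice alone. -/
lemma _root_.TakiffO.finite_iff_of_orderIso {R R' N N' : Type*} [Ring R] [Ring R']
    [AddCommGroup N] [AddCommGroup N'] [Module R N] [Module R' N']
    (f : Submodule R N ≃o Submodule R' N') : Module.Finite R N ↔ Module.Finite R' N' := by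
  rw [Module.finite_def, Module.finite_def, Submodule.fg_iff_compact, Submodule.fg_iff_compact,
    ← f.map_top]
  exact ⟨isCompactElement_map f, fun h => by simpa using isCompactElement_map f.symm h⟩

include hc in
lemma HighestType.finite_iff (h : D.HighestType c M) :
    Module.Finite A M ↔ Module.Finite A (BalTensor (A := A) P.Bimod M) :=
  finite_iff_of_orderIso (h.orderIso hc)

end TakiffTriple

/-! ### Weights -/

section Weights

variable {A : Type u} [Ring A] [Algebra ℂ A] {V : Type u} [AddCommGroup V] [Module ℂ V]
  (κ : V →ₗ[ℂ] A)

/-- `m` is a weight vector of weight `l` for the operators `κ h`. -/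
def IsWt (l : Module.Dual ℂ V) {M : Type u} [AddCommGroup M] [Module A M] (m : M) : Prop :=
  ∀ h : V, κ h • m = algebraMap ℂ A (l h) • m

/-- Every element of `M` is a sum of weight vectors. -/
def WtDecomp (M : Type u) [AddCommGroup M] [Module A M] : Prop :=
  ∀ m : M, ∃ v : Module.Dual ℂ V →₀ M, (∀ l, IsWt κ l (v l)) ∧ m = v.sum fun _ x => x

/-- `m` has only finitely many weights `l + k α`, `k ∈ ℕ`. -/
def WtBounded (α : Module.Dual ℂ V) (M : Type u) [AddCommGroup M] [Module A M] : Prop :=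
  ∀ l : Module.Dual ℂ V, ∃ K : ℕ, ∀ k ≥ K, ∀ m : M, IsWt κ (l + (k : ℂ) • α) m → m = 0

variable {κ} {M : Type u} [AddCommGroup M] [Module A M]

lemma IsWt.zero (l : Module.Dual ℂ V) : IsWt κ l (0 : M) := fun h => by simp

lemma IsWt.add {l : Module.Dual ℂ V} {m n : M} (hm : IsWt κ l m) (hn : IsWt κ l n) :
    IsWt κ l (m + n) := fun h => by rw [smul_add, smul_add, hm h, hn h]

lemma IsWt.neg {l : Module.Dual ℂ V} {m : M} (hm : IsWt κ l m) :
    IsWt κ l (-m) := fun h => by rw [smul_neg, smul_neg, hm h]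

lemma IsWt.sub {l : Module.Dual ℂ V} {m n : M} (hm : IsWt κ l m) (hn : IsWt κ l n) :
    IsWt κ l (m - n) := by rw [sub_eq_add_neg]; exact hm.add hn.neg

lemma IsWt.map {N : Type u} [AddCommGroup N] [Module A N] (f : M →ₗ[A] N) {l : Module.Dual ℂ V}
    {m : M} (hm : IsWt κ l m) : IsWt κ l (f m) := fun h => by
  rw [← map_smul, hm h, map_smul]

lemma IsWt.of_map {N : Type u} [AddCommGroup N] [Module A N] (f : M →ₗ[A] N)
    (hf : Function.Injective f) {l : Module.Dual ℂ V} {m : M} (hm : IsWt κ l (f m)) :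
    IsWt κ l m := fun h => hf (by rw [map_smul, hm h, map_smul])

/-- An element `x` of weight `β` shifts weights by `β`. -/
lemma IsWt.smul {l β : Module.Dual ℂ V} {x : A}
    (hx : ∀ h, κ h * x = x * κ h + β h • x) {m : M} (hm : IsWt κ l m) :
    IsWt κ (l + β) (x • m) := fun h => by
  rw [← mul_smul, hx, add_smul, mul_smul, hm h, ← mul_smul, ← Algebra.commutes, mul_smul,
    LinearMap.add_apply, map_add, add_smul, Algebra.smul_def, mul_smul]

lemma isWt_iff [Module ℂ M] [IsScalarTower ℂ A M] {l : Module.Dual ℂ V} {m : M} :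
    IsWt κ l m ↔ ∀ h, κ h • m = l h • m := by
  simp only [IsWt, algebraMap_smul]

/-- The components of an element of a stable subspace lie in that subspace. -/
lemma isWt_mem_of_sum_mem [Module ℂ M] [IsScalarTower ℂ A M] (X : Submodule ℂ M)
    (hX : ∀ h : V, ∀ x ∈ X, κ h • x ∈ X) (s : Finset (Module.Dual ℂ V))
    (v : Module.Dual ℂ V → M) (hv : ∀ l ∈ s, IsWt κ l (v l)) (hs : ∑ l ∈ s, v l ∈ X) :
    ∀ l ∈ s, v l ∈ X := by
  classical
  induction s using Finset.induction_on generalizing v with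
  | empty => simp
  | insert l₀ s hl₀ ih =>
    have h1 : ∀ l ∈ s, v l ∈ X := by
      intro l hl
      have hne : l ≠ l₀ := fun h => hl₀ (h ▸ hl)
      obtain ⟨h, hh⟩ : ∃ h, l h ≠ l₀ h := by
        by_contra hcon
        push Not at hcon
        exact hne (LinearMap.ext hcon)
      have h2 := ih (fun l => (l h - l₀ h) • v l)
        (fun l hl h' => by
          rw [smul_comm (κ h') (l h - l₀ h), hv l (Finset.mem_insert_of_mem hl) h',
            smul_comm]) ?_ l hl
      · exact (X.smul_mem_iff (sub_ne_zero.mpr hh)).mp h2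
      · have h3 : ∑ l ∈ s, (l h - l₀ h) • v l =
            κ h • (∑ l ∈ insert l₀ s, v l) - l₀ h • ∑ l ∈ insert l₀ s, v l := by
          rw [Finset.smul_sum, Finset.smul_sum, ← Finset.sum_sub_distrib,
            Finset.sum_insert hl₀, isWt_iff.mp (hv l₀ (Finset.mem_insert_self _ _)) h, sub_self,
            zero_add]
          refine Finset.sum_congr rfl fun l hl => ?_
          rw [isWt_iff.mp (hv l (Finset.mem_insert_of_mem hl)) h, sub_smul]
        rw [h3]
        exact sub_mem (hX h _ hs) (X.smul_mem _ hs)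
    intro l hl
    rcases Finset.mem_insert.mp hl with rfl | hl
    · rw [Finset.sum_insert hl₀] at hs
      have := sub_mem hs (sum_mem h1)
      rwa [add_sub_cancel_right] at this
    · exact h1 l hl

lemma isWt_mem_of_finsuppSum_mem [Module ℂ M] [IsScalarTower ℂ A M] (X : Submodule ℂ M)
    (hX : ∀ h : V, ∀ x ∈ X, κ h • x ∈ X)
    (v : Module.Dual ℂ V →₀ M) (hv : ∀ l, IsWt κ l (v l)) (hs : v.sum (fun _ x => x) ∈ X)
    (l : Module.Dual ℂ V) : v l ∈ X := by
  by_cases hl : l ∈ v.support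
  · exact isWt_mem_of_sum_mem X hX v.support v (fun l _ => hv l) hs l hl
  · rw [Finsupp.notMem_support_iff.mp hl]; exact zero_mem _

lemma isWt_eq_zero_of_sum_eq_zero (v : Module.Dual ℂ V →₀ M) (hv : ∀ l, IsWt κ l (v l))
    (hs : v.sum (fun _ x => x) = 0) (l : Module.Dual ℂ V) : v l = 0 := by
  let _ := Module.restrictScalars ℂ A M
  have _ := IsScalarTower.restrictScalars ℂ A M
  have := isWt_mem_of_finsuppSum_mem (M := M) ⊥ (by simp) v hv (by rw [hs]; exact zero_mem _) l
  simpa using this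

/-- Uniqueness of weight components, indexed with a shift `δ`: this is the form needed after
applying an operator that moves every weight by `δ`. -/
lemma isWt_eq_of_sum_eq {δ l : Module.Dual ℂ V} (v : Module.Dual ℂ V →₀ M)
    (hv : ∀ l, IsWt κ (l + δ) (v l)) {m : M} (hm : IsWt κ (l + δ) m)
    (hs : v.sum (fun _ x => x) = m) : v l = m := by
  classical
  let w : Module.Dual ℂ V →₀ M :=
    Finsupp.equivMapDomain (Equiv.addRight δ) (v - Finsupp.single l m)
  have h1 : ∀ l', IsWt κ l' (w l') := by
    intro l'
    rw [Finsupp.equivMapDomain_apply, Equiv.addRight_symm, Equiv.coe_addRight,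
      Finsupp.sub_apply]
    have h2 := hv (l' + -δ)
    rw [neg_add_cancel_right] at h2
    refine h2.sub ?_
    rw [Finsupp.single_apply]
    split_ifs with h
    · rw [h, neg_add_cancel_right] at hm; exact hm
    · exact IsWt.zero _
  have h3 := isWt_eq_zero_of_sum_eq_zero w h1
    (by rw [Finsupp.sum_equivMapDomain, Finsupp.sum_sub_index (fun _ _ _ => rfl), hs,
      Finsupp.sum_single_index rfl, sub_self]) (l + δ)
  have h4 : w (l + δ) = (v - Finsupp.single l m) (l + δ + -δ) := rfl
  rw [h4, Finsupp.sub_apply, add_neg_cancel_right, Finsupp.single_eq_same, sub_eq_zero] at h3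
  exact h3

lemma WtDecomp.of_surjective (hM : WtDecomp κ M) {N : Type u} [AddCommGroup N] [Module A N]
    (f : M →ₗ[A] N) (hf : Function.Surjective f) : WtDecomp κ N := by
  intro n
  obtain ⟨m, rfl⟩ := hf n
  obtain ⟨v, hv, rfl⟩ := hM m
  refine ⟨v.mapRange f (map_zero f), fun l => by simpa using (hv l).map f, ?_⟩
  rw [Finsupp.sum_mapRange_index (fun _ => rfl), map_finsuppSum]

lemma WtDecomp.mem_submodule (hM : WtDecomp κ M) (N : Submodule A M) {m : M} (hm : m ∈ N) :
    ∃ v : Module.Dual ℂ V →₀ M, (∀ l, IsWt κ l (v l)) ∧ (∀ l, v l ∈ N) ∧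
      m = v.sum fun _ x => x := by
  obtain ⟨v, hv, rfl⟩ := hM m
  refine ⟨v, hv, fun l => ?_, rfl⟩
  let _ := Module.restrictScalars ℂ A M
  have _ := IsScalarTower.restrictScalars ℂ A M
  exact isWt_mem_of_finsuppSum_mem (N.restrictScalars ℂ) (fun h x hx => N.smul_mem _ hx) v hv hm l

lemma WtDecomp.submodule (hM : WtDecomp κ M) (N : Submodule A M) : WtDecomp κ N := by
  classical
  rintro ⟨m, hm⟩
  obtain ⟨v, hv, hN, rfl⟩ := hM.mem_submodule N hm
  refine ⟨Finsupp.onFinset v.support (fun l => ⟨v l, hN l⟩) (fun l hl => ?_), fun l => ?_, ?_⟩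
  · rw [Finsupp.mem_support_iff]
    exact fun h => hl (Subtype.ext h)
  · exact IsWt.of_map N.subtype N.injective_subtype (hv l)
  · refine Subtype.ext ?_
    rw [Finsupp.onFinset_sum _ (fun _ => rfl), AddSubmonoidClass.coe_finsetSum]
    rfl

lemma wtDecomp_of_closure (h : AddSubgroup.closure {m : M | ∃ l, IsWt κ l m} = ⊤) :
    WtDecomp κ M := by
  classical
  intro m
  have hm : m ∈ AddSubgroup.closure {m : M | ∃ l, IsWt κ l m} := by rw [h]; trivial
  induction hm using AddSubgroup.closure_induction with
  | mem m hm =>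
    obtain ⟨l, hl⟩ := hm
    refine ⟨Finsupp.single l m, fun l' => ?_, by rw [Finsupp.sum_single_index rfl]⟩
    rw [Finsupp.single_apply]
    split_ifs with h
    · exact h ▸ hl
    · exact IsWt.zero _
  | zero => exact ⟨0, fun l => IsWt.zero _, by rw [Finsupp.sum_zero_index]⟩
  | add x y _ _ hx hy =>
    obtain ⟨v, hv, rfl⟩ := hx
    obtain ⟨w, hw, rfl⟩ := hy
    exact ⟨v + w, fun l => (hv l).add (hw l),
      by rw [Finsupp.sum_add_index' (fun _ => rfl) (fun _ _ _ => rfl)]⟩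
  | neg x _ hx =>
    obtain ⟨v, hv, rfl⟩ := hx
    refine ⟨-v, fun l => (hv l).neg, ?_⟩
    rw [Finsupp.sum_neg_index (fun _ => rfl), Finsupp.sum, Finsupp.sum, Finset.sum_neg_distrib]

lemma WtDecomp.closure_eq_top (h : WtDecomp κ M) :
    AddSubgroup.closure {m : M | ∃ l, IsWt κ l m} = ⊤ := by
  rw [eq_top_iff]
  rintro m -
  obtain ⟨v, hv, rfl⟩ := h m
  exact sum_mem fun l _ => AddSubgroup.subset_closure ⟨l, hv l⟩

end Weights

/-! ### Nilpotent action of a set of operators -/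

section KilledBy

variable {A : Type u} [Ring A] {M : Type u} [AddCommGroup M] [Module A M]

/-- All products of `n` elements of `V` kill `m`. -/
def KilledBy (V : Set A) : ℕ → M → Prop
  | 0, m => m = 0
  | n + 1, m => ∀ x ∈ V, KilledBy V n (x • m)

lemma KilledBy.zero (V : Set A) (n : ℕ) : KilledBy V n (0 : M) := by
  induction n with
  | zero => rfl
  | succ n ih => intro x _; rw [smul_zero]; exact ih

lemma KilledBy.add {V : Set A} {n : ℕ} {m m' : M} (h : KilledBy V n m) (h' : KilledBy V n m') :
    KilledBy V n (m + m') := by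
  induction n generalizing m m' with
  | zero => rw [show m = 0 from h, show m' = 0 from h', add_zero]; rfl
  | succ n ih => intro x hx; rw [smul_add]; exact ih (h x hx) (h' x hx)

lemma KilledBy.neg {V : Set A} {n : ℕ} {m : M} (h : KilledBy V n m) : KilledBy V n (-m) := by
  induction n generalizing m with
  | zero => rw [show m = 0 from h, neg_zero]; rfl
  | succ n ih => intro x hx; rw [smul_neg]; exact ih (h x hx)

lemma KilledBy.succ {V : Set A} {n : ℕ} {m : M} (h : KilledBy V n m) : KilledBy V (n + 1) m := by
  induction n generalizing m with
  | zero => rw [show m = 0 from h]; exact KilledBy.zero _ _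
  | succ n ih => intro x hx; exact ih (h x hx)

lemma KilledBy.mono {V : Set A} {n k : ℕ} (hnk : n ≤ k) {m : M} (h : KilledBy V n m) :
    KilledBy V k m := by
  induction k, hnk using Nat.le_induction with
  | base => exact h
  | succ k _ ih => exact ih.succ

lemma KilledBy.anti {V W : Set A} (hVW : V ⊆ W) {n : ℕ} {m : M} (h : KilledBy W n m) :
    KilledBy V n m := by
  induction n generalizing m with
  | zero => exact h
  | succ n ih => intro x hx; exact ih (h x (hVW hx))

/-- An element normalising `V` preserves the vectors killed by `n` elements of `V`. -/
lemma KilledBy.smul_of_normalizes {V : Set A} {y : A} (hy : ∀ x ∈ V, x * y - y * x ∈ V) {n : ℕ}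
    {m : M} (h : KilledBy V n m) : KilledBy V n (y • m) := by
  induction n generalizing m with
  | zero => rw [show m = 0 from h, smul_zero]; rfl
  | succ n ih =>
    intro x hx
    have e : x • y • m = y • x • m + (x * y - y * x) • m := by
      rw [sub_smul, mul_smul, mul_smul]; abel
    rw [e]
    exact (ih (h x hx)).add (h _ (hy x hx))

lemma KilledBy.map {N : Type u} [AddCommGroup N] [Module A N] (f : M →ₗ[A] N) {V : Set A} {n : ℕ}
    {m : M} (h : KilledBy V n m) : KilledBy V n (f m) := by
  induction n generalizing m with
  | zero => rw [show m = 0 from h, map_zero]; rfl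
  | succ n ih => intro x hx; rw [← map_smul]; exact ih (h x hx)

lemma KilledBy.of_map {N : Type u} [AddCommGroup N] [Module A N] (f : M →ₗ[A] N)
    (hf : Function.Injective f) {V : Set A} {n : ℕ} {m : M} (h : KilledBy V n (f m)) :
    KilledBy V n m := by
  induction n generalizing m with
  | zero => exact hf (by rw [map_zero]; exact h)
  | succ n ih => intro x hx; exact ih (by rw [map_smul]; exact h x hx)

lemma KilledBy.pow_smul {V : Set A} {x : A} (hx : x ∈ V) {n : ℕ} {m : M} (h : KilledBy V n m) :
    x ^ n • m = 0 := by
  induction n generalizing m with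
  | zero => rw [pow_zero, one_smul]; exact h
  | succ n ih => rw [pow_succ, mul_smul]; exact ih (h x hx)

end KilledBy

/-! ### The unit of the adjunction -/

section Unit

variable {A : Type u} [Ring A] [Algebra ℂ A] {V : Type u} [AddCommGroup V] [Module ℂ V]
  {κ : V →ₗ[ℂ] A} {P : OrePair A} {α : Module.Dual ℂ V}
  {M : Type u} [AddCommGroup M] [Module A M] {N : Type u} [AddCommGroup N] [Module A N]

lemma IsWt.br (ha : ∀ h, κ h * P.a = P.a * κ h - α h • P.a)
    (hb : ∀ h, κ h * P.b = P.b * κ h - α h • P.b) {l : Module.Dual ℂ V} {m : M} (hm : IsWt κ l m)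
    (i j : ℕ) : IsWt κ (l + (i + j : ℂ) • α) (P.br i j m) := fun h => by
  rw [P.cartan_smul_br (ha h) (hb h), hm h, P.br_algebraMap_smul, algebraMap_smul, ← add_smul]
  rfl

lemma wtDecomp_balTensor (ha : ∀ h, κ h * P.a = P.a * κ h - α h • P.a)
    (hb : ∀ h, κ h * P.b = P.b * κ h - α h • P.b) (hM : WtDecomp κ M) :
    WtDecomp κ (BalTensor (A := A) P.Bimod M) := by
  refine wtDecomp_of_closure ?_
  rw [eq_top_iff]
  rintro t -
  obtain ⟨n, m, rfl⟩ := P.exists_br t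
  obtain ⟨v, hv, rfl⟩ := hM m
  rw [map_finsuppSum]
  exact sum_mem fun l _ => AddSubgroup.subset_closure ⟨_, (hv l).br ha hb n n⟩

lemma bimodHom_smul_apply_frac (u : A) (g : BimodHom (A := A) P.Bimod N) (i j : ℤ) :
    (u • g) (P.proj (P.frac i j)) = g (P.proj (P.frac i j * P.toLoc u)) := rfl

lemma bimodHom_map_frac_smul (u : A) (g : BimodHom (A := A) P.Bimod N) (x : P.Loc) :
    g (P.proj (P.toLoc u * x)) = u • g (P.proj x) := by
  rw [← P.smul_proj, BimodHom.map_smul']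

lemma bimodHom_map_proj_smul (t : ℂ) (g : BimodHom (A := A) P.Bimod N) (x : P.Loc) :
    g (P.proj (t • x)) = algebraMap ℂ A t • g (P.proj x) := by
  rw [← bimodHom_map_frac_smul, Algebra.algebraMap_eq_smul_one, P.toLoc_smul, map_one,
    smul_one_mul]

lemma bimodHom_map_proj_add (g : BimodHom (A := A) P.Bimod N) (x y : P.Loc) :
    g (P.proj (x + y)) = g (P.proj x) + g (P.proj y) := by
  rw [map_add, BimodHom.map_add']

lemma bimodHom_map_proj_sub (g : BimodHom (A := A) P.Bimod N) (x y : P.Loc) :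
    g (P.proj (x - y)) = g (P.proj x) - g (P.proj y) := by
  rw [eq_sub_iff_add_eq, ← bimodHom_map_proj_add, sub_add_cancel]

lemma IsWt.bimodHom_apply (ha : ∀ h, κ h * P.a = P.a * κ h - α h • P.a)
    (hb : ∀ h, κ h * P.b = P.b * κ h - α h • P.b) {l : Module.Dual ℂ V}
    {g : BimodHom (A := A) P.Bimod N} (hg : IsWt κ l g) (i j : ℕ) :
    IsWt κ (l + (i + j : ℂ) • α) (g (P.proj (P.frac i j))) := fun h => by
  rw [← bimodHom_map_frac_smul, P.cartan_mul_frac (ha h) (hb h), bimodHom_map_proj_add,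
    bimodHom_map_proj_smul, ← bimodHom_smul_apply_frac, hg h, bimodHom_smul_apply_frac,
    Algebra.algebraMap_eq_smul_one, P.toLoc_smul, map_one, mul_smul_one, bimodHom_map_proj_smul,
    ← add_smul, ← map_add]
  congr 2

lemma a_smul_bimodHom_apply (g : BimodHom (A := A) P.Bimod N) (i j : ℤ) :
    P.a • g (P.proj (P.frac i j)) = g (P.proj (P.frac (i - 1) j)) := by
  rw [← bimodHom_map_frac_smul, P.a_mul_frac]

lemma b_smul_bimodHom_apply (g : BimodHom (A := A) P.Bimod N) (i j : ℤ) :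
    P.b • g (P.proj (P.frac i j)) = g (P.proj (P.frac i (j - 1))) := by
  rw [← bimodHom_map_frac_smul, P.b_mul_frac]

lemma bimodHom_apply_eq_zero (g : BimodHom (A := A) P.Bimod N) {i j : ℤ} (h : i ≤ 0 ∨ j ≤ 0) :
    g (P.proj (P.frac i j)) = 0 := by
  rw [P.proj_frac i j h, BimodHom.map_zero']

/-- A linear map is determined by its values on `a⁻ⁿ b⁻ⁿ` for large `n`. -/
lemma bimodHom_ext_of_le {g g' : BimodHom (A := A) P.Bimod N} (K : ℕ)
    (H : ∀ n ≥ K, g (P.proj (P.frac n n)) = g' (P.proj (P.frac n n))) : g = g' := by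
  refine P.bimodHom_ext fun n => ?_
  have e : ∀ g : BimodHom (A := A) P.Bimod N, g (P.proj (P.frac n n)) =
      P.b ^ K • P.a ^ K • g (P.proj (P.frac (n + K : ℕ) (n + K : ℕ))) := by
    intro g
    rw [← bimodHom_map_frac_smul, ← bimodHom_map_frac_smul, map_pow, map_pow, P.a_pow_mul_frac,
      P.b_pow_mul_frac]
    push_cast
    rw [add_sub_cancel_right]
  rw [e g, e g', H _ (by omega)]

/-- The value of `g` at `a⁻ᵏ b⁻ᵏ` is `a⁻ᵏ b⁻ᵏ ⊗ m_k` with `m_k` of weight `l`. Then `m_(k+1) - m_k =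
aᵏ y + bᵏ z`, where only the components of `y`, `z` of weight `l + kα` count; these vanish for large
`k`, and the stable value of `m_k` is the preimage. -/
theorem TakiffTriple.HighestType.exists_balUnit_eq_of_isWt {D : TakiffTriple P} {c : ℂ}
    (hc : c ≠ 0) (hM : D.HighestType c M) (ha : ∀ h, κ h * P.a = P.a * κ h - α h • P.a)
    (hb : ∀ h, κ h * P.b = P.b * κ h - α h • P.b) (hd : WtDecomp κ M) (hbd : WtBounded κ α M)
    {l : Module.Dual ℂ V} {g : BimodHom (A := A) P.Bimod (BalTensor (A := A) P.Bimod M)}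
    (hg : IsWt κ l g) : ∃ m : M, g = balUnit (A := A) P.Bimod M m := by
  have hreg := hM.isRegularOn hc
  have h1 : ∀ k : ℕ, ∃ m : M, IsWt κ l m ∧ g (P.proj (P.frac k k)) = P.br k k m := by
    intro k
    obtain ⟨m, hm⟩ := hreg.exists_br_eq (k := k) (t := g (P.proj (P.frac k k)))
      (by rw [← bimodHom_map_frac_smul, map_pow, P.a_pow_mul_frac, bimodHom_apply_eq_zero]; simp)
      (by rw [← bimodHom_map_frac_smul, map_pow, P.b_pow_mul_frac, bimodHom_apply_eq_zero]; simp)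
    obtain ⟨v, hv, rfl⟩ := hd m
    -- The value has weight `l + 2kα`, so only the component of weight `l` of the numerator
    -- contributes.
    refine ⟨v l, hv l, ?_⟩
    rw [map_finsuppSum] at hm
    refine (isWt_eq_of_sum_eq (δ := ((k : ℂ) + k) • α) (v.mapRange (P.br k k) (map_zero _)) ?_
      (hg.bimodHom_apply ha hb k k) ?_).symm
    · exact fun l => by simpa using (hv l).br ha hb k k
    · rw [hm, Finsupp.sum_mapRange_index (fun _ => rfl)]
  choose m hm hgm using h1
  obtain ⟨K, hK⟩ := hbd l
  have h2 : ∀ k ≥ K, m (k + 1) = m k := by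
    intro k hk
    have h3 : P.br k k (m (k + 1) - m k) = 0 := by
      rw [map_sub, sub_eq_zero, ← hgm k]
      have := congrArg (fun x => P.a • P.b • x) (hgm (k + 1))
      simp only [a_smul_bimodHom_apply, b_smul_bimodHom_apply, P.a_smul_br, P.b_smul_br] at this
      push_cast at this
      rw [add_sub_cancel_right] at this
      exact this.symm
    obtain ⟨y, z, hyz⟩ := hreg.of_br_eq_zero h3
    obtain ⟨v, hv, rfl⟩ := hd y
    obtain ⟨w, hw, rfl⟩ := hd z
    have hap : ∀ (n : ℕ) (h : V), κ h * P.a ^ n = P.a ^ n * κ h + ((-(n : ℂ)) • α) h • P.a ^ n := by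
      intro n h
      induction n with
      | zero => simp
      | succ n ih =>
        rw [pow_succ, ← mul_assoc, ih, add_mul, mul_assoc, ha, mul_sub, ← mul_assoc, smul_mul_assoc,
          mul_smul_comm, sub_add, ← sub_smul, sub_eq_add_neg, ← neg_smul]
        congr 2
        simp only [LinearMap.smul_apply, smul_eq_mul]; push_cast; ring
    have hbp : ∀ (n : ℕ) (h : V), κ h * P.b ^ n = P.b ^ n * κ h + ((-(n : ℂ)) • α) h • P.b ^ n := by
      intro n h
      induction n with
      | zero => simp
      | succ n ih =>
        rw [pow_succ, ← mul_assoc, ih, add_mul, mul_assoc, hb, mul_sub, ← mul_assoc, smul_mul_assoc,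
          mul_smul_comm, sub_add, ← sub_smul, sub_eq_add_neg, ← neg_smul]
        congr 2
        simp only [LinearMap.smul_apply, smul_eq_mul]; push_cast; ring
    have h4 := isWt_eq_of_sum_eq (δ := (-(k : ℂ)) • α) (l := l + (k : ℂ) • α)
      (m := m (k + 1) - m k)
      (v.mapRange (P.a ^ k • ·) (smul_zero _) + w.mapRange (P.b ^ k • ·) (smul_zero _))
      (fun l => by
        rw [Finsupp.add_apply, Finsupp.mapRange_apply, Finsupp.mapRange_apply]
        exact ((hv l).smul (hap k)).add ((hw l).smul (hbp k)))
      (by rw [add_assoc, ← add_smul, add_neg_cancel, zero_smul, add_zero]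
          exact (hm _).sub (hm _))
      (by
        rw [hyz, Finsupp.sum_add_index' (fun _ => rfl) (fun _ _ _ => rfl),
          Finsupp.sum_mapRange_index (fun _ => rfl), Finsupp.sum_mapRange_index (fun _ => rfl),
          Finsupp.smul_sum, Finsupp.smul_sum])
    rw [Finsupp.add_apply, Finsupp.mapRange_apply, Finsupp.mapRange_apply, hK k hk _ (hv _),
      hK k hk _ (hw _), smul_zero, smul_zero, add_zero] at h4
    exact (sub_eq_zero.mp h4.symm)
  have h5 : ∀ k ≥ K, m k = m K := by
    intro k hk
    induction k, hk using Nat.le_induction with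
    | base => rfl
    | succ k hk ih => rw [h2 k hk, ih]
  exact ⟨m K, bimodHom_ext_of_le K fun n hn => by rw [hgm n, h5 n hn]; rfl⟩

end Unit

/-! ### Coinduced elements -/

section Devissage

variable {A : Type u} [Ring A] [Algebra ℂ A] {N : Type u} [AddCommGroup N] [Module A N]
  [Module ℂ N] [IsScalarTower ℂ A N] {p q : A} (hpq : Commute p q) (X : Submodule ℂ N)

-- Here `q` is onto and `p` is onto on the kernel of `q`. A solution `w` of `p w = q y` in the
-- kernel of `q^j` is lifted through `q`, and the error, which lies in the kernel of `q`, is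
-- corrected there.
include hpq in
lemma exists_smul_eq_of_pow_smul_eq_zero (hX : ∀ y ∈ X, q • y ∈ X)
    (hXp : ∀ y ∈ X, p • y ∈ X) (hq : ∀ y ∈ X, ∃ z ∈ X, q • z = y)
    (hp : ∀ y ∈ X, q • y = 0 → ∃ z ∈ X, q • z = 0 ∧ p • z = y) (j : ℕ) {y : N} (hy : y ∈ X)
    (hyj : q ^ j • y = 0) : ∃ z ∈ X, q ^ j • z = 0 ∧ p • z = y := by
  induction j generalizing y with
  | zero =>
    rw [pow_zero, one_smul] at hyj
    exact ⟨0, zero_mem _, smul_zero _, by rw [smul_zero, hyj]⟩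
  | succ j ih =>
    obtain ⟨w, hw, hw1, hw2⟩ := ih (hX y hy) (by rw [← mul_smul, ← pow_succ, hyj])
    obtain ⟨w', hw', rfl⟩ := hq w hw
    obtain ⟨z, hz, hz1, hz2⟩ := hp (y - p • w') (sub_mem hy (hXp _ hw'))
      (by rw [smul_sub, ← hw2, ← mul_smul, ← mul_smul, hpq.eq, sub_self])
    refine ⟨w' + z, add_mem hw' hz, ?_, by rw [smul_add, hz2, add_sub_cancel]⟩
    rw [smul_add, pow_succ, mul_smul, mul_smul, hw1, hz1, smul_zero, add_zero]

include hpq in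
/-- If `(q, p)` is coregular on `X`, then `q` is surjective on the kernel of `p`. -/
lemma exists_smul_eq_of_smul_eq_zero (hXp : ∀ y ∈ X, p • y ∈ X)
    (hq : ∀ y ∈ X, ∃ z ∈ X, q • z = y)
    (hp : ∀ y ∈ X, q • y = 0 → ∃ z ∈ X, q • z = 0 ∧ p • z = y) {y : N} (hy : y ∈ X)
    (hy0 : p • y = 0) : ∃ z ∈ X, p • z = 0 ∧ q • z = y := by
  obtain ⟨w, hw, rfl⟩ := hq y hy
  obtain ⟨z, hz, hz1, hz2⟩ := hp (p • w) (hXp _ hw)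
    (by rw [← mul_smul, ← hpq.eq, mul_smul, hy0])
  exact ⟨w - z, sub_mem hw hz, by rw [smul_sub, hz2, sub_self], by rw [smul_sub, hz1, sub_zero]⟩

end Devissage

/-! ### The Casimir element and the construction of coinduced vectors -/

namespace TakiffTriple
variable {A : Type u} [Ring A] [Algebra ℂ A] {P : OrePair A} (D : TakiffTriple P)

/-- The Casimir element. -/
def casimir : A := 2 * (D.e' * P.a) + 2 * (D.e * P.b) + D.h' * D.h - 2 * D.h'

lemma h_a_nat : D.h * P.a = P.a * D.h - 2 * P.a := by rw [D.h_a, two_smul, two_mul]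
lemma h_b_nat : D.h * P.b = P.b * D.h - 2 * P.b := by rw [D.h_b, two_smul, two_mul]
lemma h'_a_nat : D.h' * P.a = P.a * D.h' - 2 * P.b := by rw [D.h'_a, two_smul, two_mul]
lemma h_e_nat : D.h * D.e = D.e * D.h + 2 * D.e := by rw [D.h_e, two_smul, two_mul]
lemma h_e'_nat : D.h * D.e' = D.e' * D.h + 2 * D.e' := by rw [D.h_e', two_smul, two_mul]
lemma h'_e_nat : D.h' * D.e = D.e * D.h' + 2 * D.e' := by rw [D.h'_e, two_smul, two_mul]

/-- The Casimir element is the coefficient of `ε` in `ef + fe + h²/2` evaluated at the elements `x +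
ε x̄`, rewritten with `a` and `b` on the right. It commutes with the Takiff algebra of `sl₂`, and on
a vector killed by `a` and `b` only `h' (h - 2)` survives. -/
lemma casimir_a : D.casimir * P.a = P.a * D.casimir := by
  unfold casimir
  linear_combination (norm := noncomm_ring) 2 * (D.e'_a * P.a) - 2 * (D.e * P.comm.eq) +
    2 * (D.e_a * P.b) + D.h' * D.h_a_nat + D.h'_a_nat * D.h - 2 * D.h'_a_nat + 2 * D.h_b_nat

lemma casimir_b : D.casimir * P.b = P.b * D.casimir := by
  unfold casimir
  linear_combination (norm := noncomm_ring) 2 * (D.e' * P.comm.eq) + 2 * (D.e'_b * P.a) +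
    2 * (D.e_b * P.b) + D.h' * D.h_b_nat + D.h'_b * D.h - 2 * D.h'_b

lemma casimir_e : D.casimir * D.e = D.e * D.casimir := by
  unfold casimir
  linear_combination (norm := noncomm_ring) -2 * (D.e' * D.e_a) - 2 * (D.e_e' * P.a) -
    2 * (D.e * D.e_b) + D.h' * D.h_e_nat + D.h'_e_nat * D.h

lemma casimir_e' : D.casimir * D.e' = D.e' * D.casimir := by
  unfold casimir
  linear_combination (norm := noncomm_ring) -2 * (D.e' * D.e'_a) - 2 * (D.e * D.e'_b) +
    2 * (D.e_e' * P.b) + D.h' * D.h_e'_nat + D.h'_e' * D.h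

lemma casimir_h' : D.casimir * D.h' = D.h' * D.casimir := by
  unfold casimir
  linear_combination (norm := noncomm_ring) -2 * (D.e' * D.h'_a_nat) - 2 * (D.h'_e' * P.a) -
    2 * (D.e * D.h'_b) - 2 * (D.h'_e_nat * P.b) + D.h' * D.h_h'

lemma casimir_cartan {k : A} {t : ℂ} (ka : k * P.a = P.a * k - t • P.a)
    (kb : k * P.b = P.b * k - t • P.b) (ke : k * D.e = D.e * k + t • D.e)
    (ke' : k * D.e' = D.e' * k + t • D.e') (kh : k * D.h = D.h * k) (kh' : k * D.h' = D.h' * k) :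
    D.casimir * k = k * D.casimir := by
  have h1 : D.e' * P.a * k = k * (D.e' * P.a) := by
    rw [← mul_assoc k, ke', add_mul, mul_assoc D.e' k, ka, mul_sub, smul_mul_assoc, mul_smul_comm,
      sub_add_cancel, mul_assoc]
  have h2 : D.e * P.b * k = k * (D.e * P.b) := by
    rw [← mul_assoc k, ke, add_mul, mul_assoc D.e k, kb, mul_sub, smul_mul_assoc, mul_smul_comm,
      sub_add_cancel, mul_assoc]
  unfold casimir
  linear_combination (norm := noncomm_ring) 2 * h1 + 2 * h2 - D.h' * kh - kh' * D.h + 2 * kh'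

section Module

variable {N : Type u} [AddCommGroup N] [Module A N] [Module ℂ N] [IsScalarTower ℂ A N]

lemma casimir_smul {τ : ℂ} {x : N} (ha : P.a • x = 0) (hb : P.b • x = 0)
    (hτ : D.h • x = τ • x) : D.casimir • x = (τ - 2) • D.h' • x := by
  have e1 : ∀ y : A, (2 * y) • x = (2 : ℂ) • y • x := fun y => by
    rw [two_mul, add_smul, two_smul]
  rw [casimir, sub_smul, add_smul, add_smul, e1, e1, e1, mul_smul, mul_smul, mul_smul, ha, hb,
    hτ, smul_comm D.h' τ]
  simp only [smul_zero, zero_add, ← sub_smul]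

lemma smul_h'_sub {τ c : ℂ} {x : N} (ha : P.a • x = 0) (hb : P.b • x = 0)
    (hτ : D.h • x = τ • x) : P.a • (D.h' - algebraMap ℂ A c) • x = 0 ∧
      P.b • (D.h' - algebraMap ℂ A c) • x = 0 ∧
      D.h • (D.h' - algebraMap ℂ A c) • x = τ • (D.h' - algebraMap ℂ A c) • x := by
  have hb' : P.b • D.h' • x = 0 := by rw [← mul_smul, ← D.h'_b, mul_smul, hb, smul_zero]
  have ha' : P.a • D.h' • x = 0 := by rw [← D.h'_a_smul hb, ha, smul_zero]
  have hτ' : D.h • D.h' • x = τ • D.h' • x := by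
    rw [← mul_smul, D.h_h', mul_smul, hτ, smul_comm]
  refine ⟨?_, ?_, ?_⟩
  · rw [sub_smul, smul_sub, ha', algebraMap_smul, smul_comm, ha, smul_zero, sub_zero]
  · rw [sub_smul, smul_sub, hb', algebraMap_smul, smul_comm, hb, smul_zero, sub_zero]
  · rw [sub_smul, smul_sub, hτ', algebraMap_smul, smul_comm D.h c, hτ, smul_sub, smul_comm c τ]

lemma casimir_pow_smul_eq_zero {τ c : ℂ} {x : N} (ha : P.a • x = 0) (hb : P.b • x = 0)
    (hτ : D.h • x = τ • x) {n : ℕ} (hn : (D.h' - algebraMap ℂ A c) ^ n • x = 0) :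
    (D.casimir - algebraMap ℂ A (c * (τ - 2))) ^ n • x = 0 := by
  induction n generalizing x with
  | zero => simpa using hn
  | succ n ih =>
    obtain ⟨h1, h2, h3⟩ := D.smul_h'_sub (c := c) ha hb hτ
    have h4 := ih h1 h2 h3 (by rw [← mul_smul, ← pow_succ, hn])
    have h5 : (D.casimir - algebraMap ℂ A (c * (τ - 2))) • x =
        (τ - 2) • (D.h' - algebraMap ℂ A c) • x := by
      rw [sub_smul D.casimir, D.casimir_smul ha hb hτ, algebraMap_smul, sub_smul D.h',
        algebraMap_smul, smul_sub, smul_smul, mul_comm]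
    rw [pow_succ, mul_smul, h5, smul_comm, h4, smul_zero]

/-- On weight vectors killed by `a` and `b`, the Casimir element and `h'` determine the weight. -/
lemma eq_zero_of_casimir {c s τ : ℂ} (hs : c * (τ - 2) ≠ s) {x : N} (ha : P.a • x = 0)
    (hb : P.b • x = 0) (hτ : D.h • x = τ • x) {k n : ℕ}
    (hk : (D.casimir - algebraMap ℂ A s) ^ k • x = 0)
    (hn : (D.h' - algebraMap ℂ A c) ^ n • x = 0) : x = 0 := by
  induction n generalizing x with
  | zero => simpa using hn
  | succ n ih =>
    obtain ⟨h1, h2, h3⟩ := D.smul_h'_sub (c := c) ha hb hτ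
    -- By induction on the order of `h' - c`, the vector `(h' - c) x` vanishes. Then the Casimir
    -- element acts on `x` by the scalar `c (τ - 2)`, which is not `s`.
    have h0 : (D.h' - algebraMap ℂ A c) • x = 0 := by
      refine ih h1 h2 h3 ?_ (by rw [← mul_smul, ← pow_succ, hn])
      have hcomm : Commute ((D.casimir - algebraMap ℂ A s) ^ k) (D.h' - algebraMap ℂ A c) :=
        (Commute.sub_right (Commute.sub_left D.casimir_h' (Algebra.commutes _ _))
          (Algebra.commutes _ _).symm).pow_left k
      rw [← mul_smul, hcomm.eq, mul_smul, hk, smul_zero]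
    have h4 : D.h' • x = c • x := by
      rwa [sub_smul, algebraMap_smul, sub_eq_zero] at h0
    have h5 : (D.casimir - algebraMap ℂ A s) • x = (c * (τ - 2) - s) • x := by
      rw [sub_smul, D.casimir_smul ha hb hτ, h4, algebraMap_smul, smul_smul, ← sub_smul, mul_comm]
    have h6 : ∀ k : ℕ, (D.casimir - algebraMap ℂ A s) ^ k • x = (c * (τ - 2) - s) ^ k • x := by
      intro k
      induction k with
      | zero => simp
      | succ k ih => rw [pow_succ, mul_smul, h5, smul_comm, ih, smul_smul, ← pow_succ']
    rw [h6] at hk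
    exact (smul_eq_zero_iff_right (pow_ne_zero k (sub_ne_zero.mpr hs))).mp hk

end Module

/-- The operators `κ h` act on the triple as a Cartan subalgebra containing `D.h`. -/
structure CartanAction {V : Type u} [AddCommGroup V] [Module ℂ V] (κ : V →ₗ[ℂ] A)
    (α : Module.Dual ℂ V) : Prop where
  a : ∀ h, κ h * P.a = P.a * κ h - α h • P.a
  b : ∀ h, κ h * P.b = P.b * κ h - α h • P.b
  e : ∀ h, κ h * D.e = D.e * κ h + α h • D.e
  e' : ∀ h, κ h * D.e' = D.e' * κ h + α h • D.e'
  h : ∀ h, κ h * D.h = D.h * κ h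
  h' : ∀ h, κ h * D.h' = D.h' * κ h
  exists_coroot : ∃ h₀, κ h₀ = D.h ∧ α h₀ = 2

section Values

variable {N : Type u} [AddCommGroup N] [Module A N]

lemma bimodHom_apply_frac_nat (g : BimodHom (A := A) P.Bimod N) {i j n : ℕ} (hi : i ≤ n)
    (hj : j ≤ n) : g (P.proj (P.frac i j)) =
      P.a ^ (n - i) • P.b ^ (n - j) • g (P.proj (P.frac n n)) := by
  rw [← bimodHom_map_frac_smul, ← bimodHom_map_frac_smul, map_pow, map_pow, P.b_pow_mul_frac,
    P.a_pow_mul_frac]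
  congr 3 <;> push_cast [hi, hj] <;> ring

lemma bimodHom_apply_frac_mem [Module ℂ N] [IsScalarTower ℂ A N] (X : Submodule ℂ N)
    (hXa : ∀ y ∈ X, P.a • y ∈ X) (hXb : ∀ y ∈ X, P.b • y ∈ X) (g : BimodHom (A := A) P.Bimod N)
    (hg : ∀ k : ℕ, g (P.proj (P.frac k k)) ∈ X) (i j : ℤ) : g (P.proj (P.frac i j)) ∈ X := by
  have hap : ∀ (k : ℕ), ∀ y ∈ X, P.a ^ k • y ∈ X := by
    intro k
    induction k with
    | zero => intro y hy; simpa using hy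
    | succ k ih => intro y hy; rw [pow_succ', mul_smul]; exact hXa _ (ih y hy)
  have hbp : ∀ (k : ℕ), ∀ y ∈ X, P.b ^ k • y ∈ X := by
    intro k
    induction k with
    | zero => intro y hy; simpa using hy
    | succ k ih => intro y hy; rw [pow_succ', mul_smul]; exact hXb _ (ih y hy)
  by_cases h : i ≤ 0 ∨ j ≤ 0
  · rw [bimodHom_apply_eq_zero g h]; exact zero_mem _
  · push Not at h
    obtain ⟨i, rfl⟩ := Int.eq_ofNat_of_zero_le h.1.le
    obtain ⟨j, rfl⟩ := Int.eq_ofNat_of_zero_le h.2.le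
    rw [bimodHom_apply_frac_nat g (le_max_left i j) (le_max_right i j)]
    exact hap _ _ (hbp _ _ (hg _))

lemma h_smul_bimodHom_apply {τ : ℂ} {f : BimodHom (A := A) P.Bimod N}
    (hf : D.h • f = algebraMap ℂ A τ • f) (i j : ℕ) : D.h • f (P.proj (P.frac i j)) =
      algebraMap ℂ A (τ + (i + j) * 2) • f (P.proj (P.frac i j)) := by
  rw [← bimodHom_map_frac_smul, P.cartan_mul_frac D.h_a D.h_b, bimodHom_map_proj_add,
    bimodHom_map_proj_smul, ← bimodHom_smul_apply_frac, hf, bimodHom_smul_apply_frac,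
    Algebra.algebraMap_eq_smul_one, P.toLoc_smul, map_one, mul_smul_one, bimodHom_map_proj_smul,
    ← add_smul, ← map_add, Algebra.algebraMap_eq_smul_one]

lemma h'_smul_apply (g : BimodHom (A := A) P.Bimod N) (i j : ℕ) :
    (D.h' • g) (P.proj (P.frac i j)) = D.h' • g (P.proj (P.frac i j)) -
      algebraMap ℂ A (i * 2) • g (P.proj (P.frac (i + 1) (j - 1))) := by
  rw [← bimodHom_map_frac_smul, P.cartan_bar_mul_frac D.h'_a D.h'_b, bimodHom_map_proj_add,
    bimodHom_map_proj_smul, ← bimodHom_smul_apply_frac, add_sub_cancel_right]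

lemma e'_smul_apply (g : BimodHom (A := A) P.Bimod N) (i j : ℕ) :
    (D.e' • g) (P.proj (P.frac i j)) = D.e' • g (P.proj (P.frac i j)) +
      algebraMap ℂ A i • (D.h' • g) (P.proj (P.frac (i + 1) j)) +
      algebraMap ℂ A (i * (i + 1)) • g (P.proj (P.frac (i + 2) (j - 1))) := by
  rw [← bimodHom_map_frac_smul, OrePair.e'_mul_frac D, bimodHom_map_proj_sub,
    bimodHom_map_proj_sub, bimodHom_map_proj_smul, bimodHom_map_proj_smul,
    ← bimodHom_smul_apply_frac, ← bimodHom_smul_apply_frac]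
  abel

lemma e_smul_apply (g : BimodHom (A := A) P.Bimod N) (i j : ℕ) :
    (D.e • g) (P.proj (P.frac i j)) = D.e • g (P.proj (P.frac i j)) +
      algebraMap ℂ A j • (D.h' • g) (P.proj (P.frac i (j + 1))) +
      algebraMap ℂ A i • (D.h • g) (P.proj (P.frac (i + 1) j)) +
      algebraMap ℂ A (i * (i + 1) + 2 * i * j) • g (P.proj (P.frac (i + 1) j)) := by
  rw [← bimodHom_map_frac_smul, OrePair.e_mul_frac D, bimodHom_map_proj_sub,
    bimodHom_map_proj_sub, bimodHom_map_proj_sub, bimodHom_map_proj_smul, bimodHom_map_proj_smul,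
    bimodHom_map_proj_smul, ← bimodHom_smul_apply_frac, ← bimodHom_smul_apply_frac,
    ← bimodHom_smul_apply_frac]
  abel

/-- The generalised eigenspace of the Casimir element. -/
def casimirEigen (s : ℂ) (N : Type u) [AddCommGroup N] [Module A N] [Module ℂ N]
    [IsScalarTower ℂ A N] : Submodule ℂ N where
  carrier := {x | ∃ k : ℕ, (D.casimir - algebraMap ℂ A s) ^ k • x = 0}
  zero_mem' := ⟨0, smul_zero _⟩
  add_mem' := by
    rintro x y ⟨k, hk⟩ ⟨l, hl⟩
    refine ⟨k + l, ?_⟩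
    rw [smul_add, add_comm k l, pow_add, mul_smul, hk, smul_zero, zero_add, pow_mul_comm,
      mul_smul, hl, smul_zero]
  smul_mem' := by
    rintro t x ⟨k, hk⟩
    exact ⟨k, by rw [smul_comm, hk, smul_zero]⟩

lemma smul_mem_casimirEigen [Module ℂ N] [IsScalarTower ℂ A N] {s : ℂ} {y : A}
    (hy : D.casimir * y = y * D.casimir) {x : N} (hx : x ∈ D.casimirEigen s N) :
    y • x ∈ D.casimirEigen s N := by
  obtain ⟨k, hk⟩ := hx
  have hcomm : Commute ((D.casimir - algebraMap ℂ A s) ^ k) y :=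
    (Commute.sub_left hy (Algebra.commutes _ _)).pow_left k
  exact ⟨k, by rw [← mul_smul, hcomm.eq, mul_smul, hk, smul_zero]⟩

/-- A nonzero value `f(a⁻ⁱ b⁻ʲ)` with `i + j` minimal is killed by `a` and `b` and has
`h`-eigenvalue `τ + 2(i + j)`, so its Casimir eigenvalue would be `c (τ + 2(i + j) - 2)`. The
alternative in `hs` allows a position where the eigenvalues agree but the value is known to vanish.
-/
lemma bimodHom_eq_zero [Module ℂ N] [IsScalarTower ℂ A N] {c s τ : ℂ}
    (hN : LocGenEigen D.h' c N) {f : BimodHom (A := A) P.Bimod N}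
    (hf : D.h • f = algebraMap ℂ A τ • f)
    (hs : ∀ i j : ℕ, f (P.proj (P.frac (i + 1 : ℕ) (j + 1 : ℕ))) = 0 ∨
      c * (τ + ((i + 1 : ℕ) + (j + 1 : ℕ)) * 2 - 2) ≠ s)
    (hX : ∀ k : ℕ, f (P.proj (P.frac k k)) ∈ D.casimirEigen s N) : f = 0 := by
  have key : ∀ n i j : ℕ, i + j = n → f (P.proj (P.frac i j)) = 0 := by
    intro n
    induction n with
    | zero =>
      intro i j hij
      exact bimodHom_apply_eq_zero f (Or.inl (by omega))
    | succ n ih =>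
      intro i j hij
      rcases i with _ | i
      · exact bimodHom_apply_eq_zero f (Or.inl (by simp))
      rcases j with _ | j
      · exact bimodHom_apply_eq_zero f (Or.inr (by simp))
      rcases hs i j with h0 | hs
      · exact h0
      obtain ⟨k, hk⟩ := bimodHom_apply_frac_mem (D.casimirEigen s N)
        (fun y hy => D.smul_mem_casimirEigen D.casimir_a hy)
        (fun y hy => D.smul_mem_casimirEigen D.casimir_b hy) f hX (i + 1 : ℕ) (j + 1 : ℕ)
      obtain ⟨n', hn'⟩ := hN (f (P.proj (P.frac (i + 1 : ℕ) (j + 1 : ℕ))))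
      refine D.eq_zero_of_casimir hs ?_ ?_ ?_ hk hn'
      · rw [a_smul_bimodHom_apply]
        have := ih i (j + 1) (by omega)
        push_cast at this ⊢
        rwa [add_sub_cancel_right]
      · rw [b_smul_bimodHom_apply]
        have := ih (i + 1) j (by omega)
        push_cast at this ⊢
        rwa [add_sub_cancel_right]
      · rw [D.h_smul_bimodHom_apply hf, algebraMap_smul]
  exact P.bimodHom_ext fun n => key _ n n rfl

end Values

section Exists

variable {N : Type u} [AddCommGroup N] [Module A N]

/-- If all values of `g` are killed by products of `n` elements of `𝔪`, then so is `g`. -/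
lemma killedBy_bimodHom (𝔪 : Submodule ℂ A) (ha : ∀ x ∈ 𝔪, P.a * x - x * P.a ∈ 𝔪)
    (hb : ∀ x ∈ 𝔪, P.b * x - x * P.b ∈ 𝔪) {n : ℕ} {g : BimodHom (A := A) P.Bimod N}
    (hg : ∀ i j : ℕ, KilledBy (𝔪 : Set A) n (g (P.proj (P.frac i j)))) :
    KilledBy (𝔪 : Set A) n g := by
  induction n generalizing g with
  | zero => exact P.bimodHom_ext fun k => hg k k
  | succ n ih =>
    intro x hx
    refine ih fun i j => ?_
    rw [bimodHom_smul_apply_frac]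
    have h := P.frac_mul_toLoc_mem_rightSpan (V := 𝔪.toAddSubgroup) ha hb i j (x := x) hx
    generalize P.frac i j * P.toLoc x = z at h
    induction h using AddSubgroup.closure_induction with
    | mem z hz =>
      obtain ⟨i', j', y, hy, rfl⟩ := hz
      rw [bimodHom_map_frac_smul]
      by_cases h : i' ≤ 0 ∨ j' ≤ 0
      · rw [bimodHom_apply_eq_zero g h, smul_zero]; exact KilledBy.zero _ _
      · push Not at h
        obtain ⟨i', rfl⟩ := Int.eq_ofNat_of_zero_le h.1.le
        obtain ⟨j', rfl⟩ := Int.eq_ofNat_of_zero_le h.2.le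
        exact hg i' j' y hy
    | zero => rw [map_zero, BimodHom.map_zero']; exact KilledBy.zero _ _
    | add y z _ _ hy hz => rw [bimodHom_map_proj_add]; exact hy.add hz
    | neg y _ hy =>
      rw [← zero_sub, bimodHom_map_proj_sub, map_zero, BimodHom.map_zero', zero_sub]
      exact hy.neg

/-- The elements killed by products of `n` elements of `𝔪`. -/
def killed (𝔪 : Set A) (n : ℕ) (N : Type u) [AddCommGroup N] [Module A N] [Module ℂ N]
    [IsScalarTower ℂ A N] : Submodule ℂ N where
  carrier := {x | KilledBy 𝔪 n x}
  zero_mem' := KilledBy.zero _ _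
  add_mem' := KilledBy.add
  smul_mem' t x hx := by
    rw [← algebraMap_smul A]
    change KilledBy 𝔪 n x at hx
    change KilledBy 𝔪 n _
    induction n generalizing x with
    | zero => rw [show x = 0 from hx, smul_zero]; rfl
    | succ n ih =>
      intro y hy
      rw [← mul_smul, ← Algebra.commutes, mul_smul]
      exact ih _ (hx y hy)

variable {V : Type u} [AddCommGroup V] [Module ℂ V] {κ : V →ₗ[ℂ] A} {α : Module.Dual ℂ V}
  {D}

lemma CartanAction.pow_a (hκ : D.CartanAction κ α) (n : ℕ) (h : V) :
    κ h * P.a ^ n = P.a ^ n * κ h + ((-(n : ℂ)) • α) h • P.a ^ n := by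
  induction n with
  | zero => simp
  | succ n ih =>
    rw [pow_succ, ← mul_assoc, ih, add_mul, mul_assoc, hκ.a, mul_sub, ← mul_assoc, smul_mul_assoc,
      mul_smul_comm, sub_add, ← sub_smul, sub_eq_add_neg, ← neg_smul]
    congr 2
    simp only [LinearMap.smul_apply, smul_eq_mul]; push_cast; ring

lemma CartanAction.pow_b (hκ : D.CartanAction κ α) (n : ℕ) (h : V) :
    κ h * P.b ^ n = P.b ^ n * κ h + ((-(n : ℂ)) • α) h • P.b ^ n := by
  induction n with
  | zero => simp
  | succ n ih =>
    rw [pow_succ, ← mul_assoc, ih, add_mul, mul_assoc, hκ.b, mul_sub, ← mul_assoc, smul_mul_assoc,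
      mul_smul_comm, sub_add, ← sub_smul, sub_eq_add_neg, ← neg_smul]
    congr 2
    simp only [LinearMap.smul_apply, smul_eq_mul]; push_cast; ring

lemma CartanAction.casimir (hκ : D.CartanAction κ α) (h : V) :
    D.casimir * κ h = κ h * D.casimir :=
  D.casimir_cartan (hκ.a h) (hκ.b h) (hκ.e h) (hκ.e' h) (hκ.h h) (hκ.h' h)

/-- Division by `a b` inside a stable subspace, compatibly with weights. -/
lemma CartanAction.exists_ab_smul_eq [Module ℂ N] [IsScalarTower ℂ A N]
    (hκ : D.CartanAction κ α) {c : ℂ} (hc : c ≠ 0)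
    (hN : LocGenEigen D.h' c N) (hna : LocNilpotent P.a N) (hnb : LocNilpotent P.b N)
    (hd : WtDecomp κ N) (X : Submodule ℂ N) (hXa : ∀ m ∈ X, P.a • m ∈ X)
    (hXb : ∀ m ∈ X, P.b • m ∈ X) (hXe : ∀ m ∈ X, D.e • m ∈ X) (hXe' : ∀ m ∈ X, D.e' • m ∈ X)
    (hXh' : ∀ m ∈ X, D.h' • m ∈ X) (hXκ : ∀ h, ∀ m ∈ X, κ h • m ∈ X)
    {l : Module.Dual ℂ V} {k : ℕ} {x : N} (hx : x ∈ X) (hl : IsWt κ l x) (ha : P.a ^ k • x = 0)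
    (hb : P.b ^ k • x = 0) :
    ∃ y ∈ X, IsWt κ (l + (2 : ℂ) • α) y ∧ P.a ^ (k + 1) • y = 0 ∧ P.b ^ (k + 1) • y = 0 ∧
      (P.a * P.b) • y = x := by
  -- `c1` and `c2` say that `b, a` is coregular on `X`; `c3` and `c4` derive the same with the two
  -- elements exchanged.
  have c1 : ∀ y ∈ X, ∃ z ∈ X, P.b • z = y := fun y hy =>
    D.exists_b_smul_eq hc hN X hXe hXb hXh' hnb hy
  have c2 : ∀ y ∈ X, P.b • y = 0 → ∃ z ∈ X, P.b • z = 0 ∧ P.a • z = y := fun y hy hy0 =>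
    D.exists_a_smul_eq hc hN X hXe' hXa hXh' hna hy hy0
  have c3 : ∀ y ∈ X, ∃ z ∈ X, P.a • z = y := by
    intro y hy
    obtain ⟨n, hn⟩ := hnb y
    obtain ⟨z, hz, -, h⟩ := exists_smul_eq_of_pow_smul_eq_zero P.comm X hXb hXa c1 c2 n hy hn
    exact ⟨z, hz, h⟩
  have c4 : ∀ y ∈ X, P.a • y = 0 → ∃ z ∈ X, P.a • z = 0 ∧ P.b • z = y := fun y hy hy0 =>
    exists_smul_eq_of_smul_eq_zero P.comm X hXa c1 c2 hy hy0
  -- Divide by `b` inside the kernel of `a^k`, then by `a` inside the kernel of `b^(k+1)`; this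
  -- controls both exponents at once.
  obtain ⟨y, hy, hya, hyx⟩ :=
    exists_smul_eq_of_pow_smul_eq_zero P.comm.symm X hXa hXb c3 c4 k hx ha
  obtain ⟨z, hz, hzb, hzy⟩ := exists_smul_eq_of_pow_smul_eq_zero P.comm X hXb hXa c1 c2 (k + 1) hy
    (by rw [pow_succ, mul_smul, hyx, hb])
  have hza : P.a ^ (k + 1) • z = 0 := by rw [pow_succ, mul_smul, hzy, hya]
  have hzx : (P.a * P.b) • z = x := by rw [P.comm.eq, mul_smul, hzy, hyx]
  -- `Y` is stable under the Cartan operators, so replacing `z` by its component of weight `l + 2α`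
  -- keeps all the constraints.
  let Y : Submodule ℂ N := X ⊓ (LinearMap.ker (Algebra.lsmul ℂ ℂ N (P.a ^ (k + 1))) ⊓
    LinearMap.ker (Algebra.lsmul ℂ ℂ N (P.b ^ (k + 1))))
  have hYκ : ∀ h, ∀ m ∈ Y, κ h • m ∈ Y := by
    rintro h m ⟨h1, h2, h3⟩
    have h2' : P.a ^ (k + 1) • m = 0 := h2
    have h3' : P.b ^ (k + 1) • m = 0 := h3
    refine ⟨hXκ h m h1, ?_, ?_⟩
    · change P.a ^ (k + 1) • κ h • m = 0
      rw [← mul_smul, eq_sub_of_add_eq (hκ.pow_a (k + 1) h).symm, sub_smul, mul_smul, smul_assoc,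
        h2', smul_zero, smul_zero, sub_zero]
    · change P.b ^ (k + 1) • κ h • m = 0
      rw [← mul_smul, eq_sub_of_add_eq (hκ.pow_b (k + 1) h).symm, sub_smul, mul_smul, smul_assoc,
        h3', smul_zero, smul_zero, sub_zero]
  obtain ⟨v, hv, rfl⟩ := hd z
  obtain ⟨h1, h2, h3⟩ := isWt_mem_of_finsuppSum_mem Y hYκ v hv ⟨hz, hza, hzb⟩ (l + (2 : ℂ) • α)
  refine ⟨v (l + (2 : ℂ) • α), h1, hv _, h2, h3, ?_⟩
  have hab : ∀ h, κ h * (P.a * P.b) = P.a * P.b * κ h + ((-2 : ℂ) • α) h • (P.a * P.b) := by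
    intro h
    rw [← mul_assoc, hκ.a, sub_mul, mul_assoc, hκ.b, mul_sub, ← mul_assoc, smul_mul_assoc,
      mul_smul_comm, sub_sub, ← add_smul, sub_eq_add_neg, ← neg_smul]
    congr 2
    simp only [LinearMap.smul_apply, smul_eq_mul]; ring
  have h4 := isWt_eq_of_sum_eq (δ := (-2 : ℂ) • α) (l := l + (2 : ℂ) • α) (m := x)
      (v.mapRange ((P.a * P.b) • ·) (smul_zero _))
      (fun l => by rw [Finsupp.mapRange_apply]; exact (hv l).smul hab)
      (by rw [add_assoc, ← add_smul, add_neg_cancel, zero_smul, add_zero]; exact hl)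
      (by rw [← hzx, Finsupp.sum_mapRange_index (fun _ => rfl), Finsupp.smul_sum])
  exact h4

/-- A weight vector killed by `a` and `b` is the value at `a⁻¹ b⁻¹` of a highest weight vector of
the coinduced module. -/
theorem CartanAction.exists_bimodHom (hκ : D.CartanAction κ α) {c : ℂ} (hc : c ≠ 0)
    (hN : LocGenEigen D.h' c N) (hna : LocNilpotent P.a N) (hnb : LocNilpotent P.b N)
    (hd : WtDecomp κ N) (𝔪 : Submodule ℂ A)
    (hma : ∀ x ∈ 𝔪, P.a * x - x * P.a ∈ 𝔪) (hmb : ∀ x ∈ 𝔪, P.b * x - x * P.b ∈ 𝔪)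
    (hme : ∀ x ∈ 𝔪, D.e * x - x * D.e ∈ 𝔪) (hme' : ∀ x ∈ 𝔪, D.e' * x - x * D.e' ∈ 𝔪)
    (hmh' : ∀ x ∈ 𝔪, D.h' * x - x * D.h' ∈ 𝔪) (hmκ : ∀ h, ∀ x ∈ 𝔪, κ h * x - x * κ h ∈ 𝔪)
    {l : Module.Dual ℂ V} {v : N} (hl : IsWt κ l v) (ha : P.a • v = 0) (hb : P.b • v = 0) {n : ℕ}
    (hv : KilledBy (𝔪 : Set A) n v) :
    ∃ g : BimodHom (A := A) P.Bimod N, IsWt κ (l - (2 : ℂ) • α) g ∧ D.e • g = 0 ∧ D.e' • g = 0 ∧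
      KilledBy (𝔪 : Set A) n g ∧ g (P.proj (P.frac 1 1)) = v ∧
      ∀ (z : A) (t : ℂ), D.casimir * z = z * D.casimir → (∀ h, κ h * z = z * κ h) →
        z * P.a = P.a * z - t • P.b → z * P.b = P.b * z → ∀ k, z ^ k • v = 0 → z ^ k • g = 0 := by
  let _ := Module.restrictScalars ℂ A N
  have _ := IsScalarTower.restrictScalars ℂ A N
  obtain ⟨h₀, hh₀, hα⟩ := hκ.exists_coroot
  -- The generalised Casimir eigenvalue of `v`, which is killed by `a`, `b` and has `h`-eigenvalue
  -- `l h₀`. All values of `g` are kept in `X`, hence in this one generalised eigenspace.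
  let s : ℂ := c * (l h₀ - 2)
  let X : Submodule ℂ N := killed (𝔪 : Set A) n N ⊓ D.casimirEigen s N
  have hX : ∀ y : A, (∀ x ∈ 𝔪, y * x - x * y ∈ 𝔪) → D.casimir * y = y * D.casimir →
      ∀ m ∈ X, y • m ∈ X := fun y h1 h2 m hm =>
    ⟨KilledBy.smul_of_normalizes (fun x hx => by
      have := neg_mem (h1 x hx)
      rwa [neg_sub] at this) hm.1, D.smul_mem_casimirEigen h2 hm.2⟩
  have hXa := hX P.a hma D.casimir_a
  have hXb := hX P.b hmb D.casimir_b
  have hXe := hX D.e hme D.casimir_e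
  have hXe' := hX D.e' hme' D.casimir_e'
  have hXh' := hX D.h' hmh' D.casimir_h'
  have hXκ : ∀ h, ∀ m ∈ X, κ h • m ∈ X := fun h => hX (κ h) (hmκ h) (hκ.casimir h)
  have hvΩ : v ∈ D.casimirEigen s N := by
    obtain ⟨k, hk⟩ := hN v
    exact ⟨k, D.casimir_pow_smul_eq_zero ha hb (by rw [← hh₀, hl h₀, algebraMap_smul]) hk⟩
  -- The candidates for the value at `a⁻ᵏ b⁻ᵏ`. The first is `v`, of weight `l`, and each division
  -- by `a b` adds `2α`.
  let Seq (k : ℕ) : Type u := {x : N // x ∈ X ∧ IsWt κ (l + ((k : ℂ) * 2 - 2) • α) x ∧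
    P.a ^ k • x = 0 ∧ P.b ^ k • x = 0}
  have step : ∀ (k : ℕ) (x : Seq k), ∃ y : Seq (k + 1), (P.a * P.b) • y.1 = x.1 := by
    rintro k ⟨x, hx, hwt, hxa, hxb⟩
    obtain ⟨y, hy, hywt, hya, hyb, hyx⟩ := hκ.exists_ab_smul_eq hc hN hna hnb hd X hXa hXb hXe hXe'
      hXh' hXκ hx hwt hxa hxb
    refine ⟨⟨y, hy, ?_, hya, hyb⟩, hyx⟩
    convert hywt using 1
    rw [add_assoc, ← add_smul]
    congr 2
    push_cast; ring
  choose next hnext using step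
  let n₁ : Seq 1 := ⟨v, ⟨hv, hvΩ⟩, by simpa using hl, by simpa using ha, by simpa using hb⟩
  let sq : ∀ k : ℕ, Seq (k + 1) := fun k => Nat.rec n₁ (fun k x => next (k + 1) x) k
  -- The value at `a⁰ b⁰` has to be zero, so the recursion proper starts at `k = 1`.
  let w : ℕ → N := fun k => Nat.casesOn k 0 fun k => (sq k).1
  obtain ⟨g, hg⟩ := P.exists_bimodHom w
    (fun k => by
      cases k with
      | zero => change (P.a * P.b) • v = 0; rw [mul_smul, hb, smul_zero]
      | succ k => exact hnext (k + 1) (sq k))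
    (fun k => by
      cases k with
      | zero => exact smul_zero _
      | succ k => exact (sq k).2.2.2.1)
    (fun k => by
      cases k with
      | zero => exact smul_zero _
      | succ k => exact (sq k).2.2.2.2)
  have hgX : ∀ k : ℕ, g (P.proj (P.frac k k)) ∈ X := by
    intro k
    rw [hg]
    cases k with
    | zero => exact zero_mem X
    | succ k => exact (sq k).2.1
  have hgX' := bimodHom_apply_frac_mem X hXa hXb g hgX
  have hgwt : IsWt κ (l - (2 : ℂ) • α) g := by
    intro h
    refine P.bimodHom_ext fun k => ?_
    have h1 : IsWt κ (l + ((k : ℂ) * 2 - 2) • α) (w k) := by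
      cases k with
      | zero => exact IsWt.zero _
      | succ k => exact (sq k).2.2.1
    rw [bimodHom_smul_apply_frac, bimodHom_smul_apply_frac]
    have h2 := P.cartan_mul_frac (hκ.a h) (hκ.b h) k k
    rw [← sub_eq_iff_eq_add] at h2
    rw [← h2, bimodHom_map_proj_sub, bimodHom_map_frac_smul, bimodHom_map_proj_smul, hg, h1 h,
      ← sub_smul, ← map_sub, Algebra.algebraMap_eq_smul_one ((l - (2 : ℂ) • α) h), P.toLoc_smul,
      map_one, mul_smul_one, bimodHom_map_proj_smul, hg]
    congr 2
    simp only [LinearMap.add_apply, LinearMap.sub_apply, LinearMap.smul_apply, smul_eq_mul]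
    ring
  have hsh : ∀ {x : A} {l : Module.Dual ℂ V} {f : BimodHom (A := A) P.Bimod N},
      (∀ h, κ h * x = x * κ h + α h • x) → IsWt κ l f →
      D.h • x • f = algebraMap ℂ A (l h₀ + 2) • x • f := by
    intro x l f hx hf
    have := hf.smul hx h₀
    rwa [hh₀, LinearMap.add_apply, hα] at this
  have hh'X : ∀ i j : ℕ, (D.h' • g) (P.proj (P.frac i j)) ∈ X := by
    intro i j
    rw [D.h'_smul_apply, algebraMap_smul]
    exact sub_mem (hXh' _ (hgX' _ _)) (X.smul_mem _ (hgX' _ _))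
  -- The two Casimir eigenvalues differ by `2c (i + j + 1)`, so neither `e g` nor `e' g` can have a
  -- first nonzero value.
  have hne : ∀ i j : ℕ, c * ((l - (2 : ℂ) • α) h₀ + 2 + ((i + 1 : ℕ) + (j + 1 : ℕ)) * 2 - 2) ≠ s := by
    intro i j h
    have h1 := mul_left_cancel₀ hc h
    rw [LinearMap.sub_apply, LinearMap.smul_apply, hα, smul_eq_mul] at h1
    have h2 : ((i + j + 1 : ℕ) : ℂ) = 0 := by
      push_cast at h1 ⊢
      linear_combination h1 / 2
    exact absurd h2 (Nat.cast_ne_zero.mpr (by omega))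
  have hgv : g (P.proj (P.frac 1 1)) = v := by have h1 := hg 1; rw [Nat.cast_one] at h1; exact h1
  refine ⟨g, hgwt, ?_, ?_, ?_, hgv, ?_⟩
  · refine D.bimodHom_eq_zero hN (hsh hκ.e hgwt) (fun i j => Or.inr (hne i j)) fun k => ?_
    refine (show _ ∈ X from ?_).2
    rw [D.e_smul_apply, algebraMap_smul, algebraMap_smul, algebraMap_smul]
    refine add_mem (add_mem (add_mem (hXe _ (hgX' _ _)) (X.smul_mem _ ?_)) (X.smul_mem _ ?_))
      (X.smul_mem _ (hgX' _ _))
    · exact_mod_cast hh'X k (k + 1)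
    · rw [← hh₀, hgwt h₀, bimodHom_smul_apply_frac, Algebra.algebraMap_eq_smul_one, P.toLoc_smul,
        map_one, mul_smul_one, bimodHom_map_proj_smul, algebraMap_smul]
      exact X.smul_mem _ (hgX' _ _)
  · refine D.bimodHom_eq_zero hN (hsh hκ.e' hgwt) (fun i j => Or.inr (hne i j)) fun k => ?_
    refine (show _ ∈ X from ?_).2
    rw [D.e'_smul_apply, algebraMap_smul, algebraMap_smul]
    refine add_mem (add_mem (hXe' _ (hgX' _ _)) (X.smul_mem _ ?_)) (X.smul_mem _ (hgX' _ _))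
    exact_mod_cast hh'X (k + 1) k
  · exact killedBy_bimodHom 𝔪 hma hmb fun i j => (hgX' i j).1
  -- Here `z^k g` has the weight of `g`, and at `a⁻⁽ⁱ⁺¹⁾ b⁻⁽ʲ⁺¹⁾` the eigenvalues differ by `2c (i +
  -- j)`. Only `a⁻¹ b⁻¹` escapes the Casimir argument, and there the value is `z^k v = 0`.
  · intro z t hzΩ hzκ hza hzb k hk
    have hpow : ∀ k : ℕ, IsWt κ (l - (2 : ℂ) • α) (z ^ k • g) ∧
        (∀ i : ℕ, (z ^ k • g) (P.proj (P.frac i i)) ∈ D.casimirEigen s N) ∧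
        (z ^ k • g) (P.proj (P.frac 1 1)) = z ^ k • v := by
      intro k
      induction k with
      | zero =>
        simp only [pow_zero, one_smul]
        exact ⟨hgwt, fun i => (hgX' i i).2, hgv⟩
      | succ k ih =>
        obtain ⟨ih1, ih2, ih3⟩ := ih
        have ih2' := bimodHom_apply_frac_mem (D.casimirEigen s N)
          (fun y hy => D.smul_mem_casimirEigen D.casimir_a hy)
          (fun y hy => D.smul_mem_casimirEigen D.casimir_b hy) _ ih2
        have hval : ∀ i j : ℕ, (z ^ (k + 1) • g) (P.proj (P.frac i j)) =
            z • (z ^ k • g) (P.proj (P.frac i j)) -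
              algebraMap ℂ A (i * t) • (z ^ k • g) (P.proj (P.frac (i + 1) (j - 1))) := by
          intro i j
          rw [pow_succ', mul_smul, ← bimodHom_map_frac_smul, P.cartan_bar_mul_frac hza hzb,
            bimodHom_map_proj_add, bimodHom_map_proj_smul, ← bimodHom_smul_apply_frac,
            add_sub_cancel_right]
        refine ⟨fun h => ?_, fun i => ?_, ?_⟩
        · rw [pow_succ', mul_smul, ← mul_smul, hzκ, mul_smul, ih1 h, ← mul_smul,
            ← Algebra.commutes, mul_smul]
        · rw [hval, algebraMap_smul]
          exact sub_mem (D.smul_mem_casimirEigen hzΩ (ih2 i)) (Submodule.smul_mem _ _ (ih2' _ _))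
        · have hv1 := hval 1 1
          rw [Nat.cast_one] at hv1
          rw [hv1, ih3, bimodHom_apply_eq_zero _ (Or.inr (by norm_num)), smul_zero, sub_zero,
            pow_succ', mul_smul]
    obtain ⟨h1, h2, h3⟩ := hpow k
    refine D.bimodHom_eq_zero hN (by rw [← hh₀]; exact h1 h₀) (fun i j => ?_) h2
    by_cases hij : i + j = 0
    · obtain ⟨rfl, rfl⟩ : i = 0 ∧ j = 0 := by omega
      exact Or.inl (by simpa [hk] using h3)
    · refine Or.inr fun h => ?_
      have h1 := mul_left_cancel₀ hc h
      rw [LinearMap.sub_apply, LinearMap.smul_apply, hα, smul_eq_mul] at h1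
      have h2 : ((i + j : ℕ) : ℂ) = 0 := by
        push_cast at h1 ⊢
        linear_combination h1 / 2
      exact hij (Nat.cast_eq_zero.mp h2)

end Exists

end TakiffTriple

/-! ### Root space decomposition of a reductive Lie algebra -/

section Structure

variable {𝔤 : Type u} [LieRing 𝔤] [LieAlgebra ℂ 𝔤]

/-- The properties of the root space decomposition that are used below. -/
structure IsSplit (𝔥 : LieSubalgebra ℂ 𝔤) [LieRing.IsNilpotent 𝔥] : Prop where
  lie_cartan : ∀ h h' : 𝔥, ⁅(h : 𝔤), (h' : 𝔤)⁆ = 0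
  lie_root : ∀ (β : Module.Dual ℂ 𝔥) (x : 𝔤), x ∈ LieAlgebra.rootSpace 𝔥 β →
    ∀ h : 𝔥, ⁅(h : 𝔤), x⁆ = β h • x
  zero : ∀ x : 𝔤, x ∈ LieAlgebra.rootSpace 𝔥 ((0 : Module.Dual ℂ 𝔥) : 𝔥 → ℂ) → x ∈ 𝔥
  iSup_eq_top : ⨆ β : Module.Dual ℂ 𝔥, (LieAlgebra.rootSpace 𝔥 β).toSubmodule = ⊤
  finite : (roots 𝔥).Finite
  mem_span : ∀ β ∈ roots 𝔥, ∀ x ∈ LieAlgebra.rootSpace 𝔥 β, x ≠ 0 →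
    ∀ y ∈ LieAlgebra.rootSpace 𝔥 β, ∃ t : ℂ, y = t • x
  multiple : ∀ β ∈ roots 𝔥, ∀ t : ℂ, t • β ∈ roots 𝔥 → t = 1 ∨ t = -1
  exists_triple : ∀ β ∈ roots 𝔥, ∃ e ∈ LieAlgebra.rootSpace 𝔥 β,
    ∃ f ∈ LieAlgebra.rootSpace 𝔥 (-β), ∃ h : 𝔥, ⁅e, f⁆ = (h : 𝔤) ∧ β h = 2

variable [FiniteDimensional ℂ 𝔤]

/-- The preimage of the radical of the quotient is a central extension of a solvable ideal, hence
solvable, hence contained in the radical of `𝔤`, which is the centre. -/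
lemma hasTrivialRadical_quotient_center
    (hred : LieAlgebra.radical ℂ 𝔤 = LieAlgebra.center ℂ 𝔤) :
    LieAlgebra.HasTrivialRadical ℂ (𝔤 ⧸ LieAlgebra.center ℂ 𝔤) := by
  let π : 𝔤 →ₗ⁅ℂ⁆ 𝔤 ⧸ LieAlgebra.center ℂ 𝔤 :=
    { (LieSubmodule.Quotient.mk' (LieAlgebra.center ℂ 𝔤) : 𝔤 →ₗ[ℂ] _) with
      map_lie' := fun {x y} => LieSubmodule.Quotient.mk_bracket _ x y }
  have hπ : Function.Surjective π := LieSubmodule.Quotient.surjective_mk' _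
  have hker : π.ker = LieAlgebra.center ℂ 𝔤 := by
    ext x
    exact LieSubmodule.Quotient.mk_eq_zero _
  let R := LieAlgebra.radical ℂ (𝔤 ⧸ LieAlgebra.center ℂ 𝔤)
  have hsol : LieAlgebra.IsSolvable (R.comap π) := by
    obtain ⟨k, hk⟩ := LieAlgebra.IsSolvable.solvable ℂ R
    rw [LieIdeal.derivedSeries_eq_bot_iff] at hk
    have h1 : ∀ k, (LieAlgebra.derivedSeriesOfIdeal ℂ 𝔤 k (R.comap π)).map π ≤
        LieAlgebra.derivedSeriesOfIdeal ℂ _ k R := by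
      intro k
      induction k with
      | zero => exact LieIdeal.map_comap_le
      | succ k ih =>
        rw [LieAlgebra.derivedSeriesOfIdeal_succ, LieAlgebra.derivedSeriesOfIdeal_succ]
        exact (LieIdeal.map_bracket_le π).trans (LieSubmodule.mono_lie ih ih)
    have h2 := h1 k
    rw [hk, le_bot_iff, LieIdeal.map_eq_bot_iff, hker] at h2
    refine LieAlgebra.IsSolvable.mk (R := ℂ) (k := k + 1) ?_
    rw [LieIdeal.derivedSeries_eq_bot_iff, LieAlgebra.derivedSeriesOfIdeal_succ, eq_bot_iff]
    refine (LieSubmodule.mono_lie h2 h2).trans ?_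
    rw [LieSubmodule.lie_le_iff]
    intro x hx y _
    rw [← lie_skew, (LieModule.mem_maxTrivSubmodule ℂ 𝔤 𝔤 x).mp hx, neg_zero]
    exact zero_mem _
  have h3 := (LieAlgebra.LieIdeal.solvable_iff_le_radical ℂ 𝔤 (R.comap π)).mp hsol
  rw [hred] at h3
  refine ⟨?_⟩
  change R = ⊥
  rw [eq_bot_iff]
  intro y hy
  obtain ⟨x, rfl⟩ := hπ y
  have h4 : x ∈ π.ker := by
    rw [hker]
    exact h3 hy
  exact h4

end Structure

/-! ### Lifting root data along a central extension of a semisimple algebra -/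

section Central

variable {𝔤 : Type u} [LieRing 𝔤] [LieAlgebra ℂ 𝔤] [FiniteDimensional ℂ 𝔤]
  (𝔥 : LieSubalgebra ℂ 𝔤) [𝔥.IsCartanSubalgebra]
  {𝔮 : Type u} [LieRing 𝔮] [LieAlgebra ℂ 𝔮] [FiniteDimensional ℂ 𝔮] [LieAlgebra.IsKilling ℂ 𝔮]
  {π : 𝔤 →ₗ⁅ℂ⁆ 𝔮} (hπ : Function.Surjective π) (hker : ∀ x, π x = 0 → ∀ y : 𝔤, ⁅x, y⁆ = 0)

include hker in
lemma mem_cartan_of_map_eq_zero {x : 𝔤} (hx : π x = 0) : x ∈ 𝔥 := by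
  have : x ∈ 𝔥.normalizer := by
    rw [LieSubalgebra.mem_normalizer_iff]
    intro y _
    rw [hker x hx]
    exact zero_mem _
  rwa [LieSubalgebra.IsCartanSubalgebra.self_normalizing] at this

include hπ hker in
lemma isCartanSubalgebra_map : (𝔥.map π).IsCartanSubalgebra where
  nilpotent := by
    let f : 𝔥 →ₗ⁅ℂ⁆ 𝔥.map π :=
      { (π : 𝔤 →ₗ[ℂ] 𝔮).restrict (p := 𝔥.toSubmodule) (q := (𝔥.map π).toSubmodule)
          (fun x hx => ⟨x, hx, rfl⟩) with
        map_lie' := fun {x y} => Subtype.ext (LieHom.map_lie π (x : 𝔤) (y : 𝔤)) }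
    have hf : Function.Surjective f := by
      rintro ⟨_, x, hx, rfl⟩
      exact ⟨⟨x, hx⟩, rfl⟩
    exact hf.lieAlgebra_isNilpotent
  self_normalizing := by
    refine le_antisymm (fun y hy => ?_) (LieSubalgebra.le_normalizer _)
    obtain ⟨x, rfl⟩ := hπ y
    refine ⟨x, ?_, rfl⟩
    rw [LieSubalgebra.mem_normalizer_iff] at hy
    have : x ∈ 𝔥.normalizer := by
      rw [LieSubalgebra.mem_normalizer_iff]
      intro z hz
      obtain ⟨w, hw, hw'⟩ := hy (π z) ⟨z, hz, rfl⟩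
      have h1 : ⁅x, z⁆ - w ∈ 𝔥 := mem_cartan_of_map_eq_zero 𝔥 hker
        (by rw [map_sub, LieHom.map_lie, ← hw']; exact sub_self _)
      have := add_mem h1 hw
      rwa [sub_add_cancel] at this
    rwa [LieSubalgebra.IsCartanSubalgebra.self_normalizing] at this

include hker in
/-- Simultaneous eigenvectors with non-zero eigenvalue lift along a central extension. -/
lemma exists_eigenvector_lift {β : Module.Dual ℂ 𝔥} (hβ : β ≠ 0) {x : 𝔤}
    (hx : ∀ h : 𝔥, π ⁅(h : 𝔤), x⁆ = β h • π x) (hab : ∀ h h' : 𝔥, π ⁅(h : 𝔤), (h' : 𝔤)⁆ = 0) :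
    ∃ y : 𝔤, π y = π x ∧ ∀ h : 𝔥, ⁅(h : 𝔤), y⁆ = β h • y := by
  obtain ⟨h₀, h1⟩ : ∃ h, β h ≠ 0 := by
    by_contra hcon
    push Not at hcon
    exact hβ (LinearMap.ext hcon)
  have hz : ∀ h h' : 𝔥, ⁅(h' : 𝔤), ⁅(h : 𝔤), x⁆⁆ = β h • ⁅(h' : 𝔤), x⁆ := by
    intro h h'
    have h2 := hker (⁅(h : 𝔤), x⁆ - β h • x) (by rw [map_sub, map_smul, hx, sub_self]) (h' : 𝔤)
    rw [← lie_skew, neg_eq_zero, lie_sub, lie_smul, sub_eq_zero] at h2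
    exact h2
  -- Bracketing with `h₀` removes the central ambiguity in the choice of `x`.
  refine ⟨(β h₀)⁻¹ • ⁅(h₀ : 𝔤), x⁆, ?_, fun h => ?_⟩
  · rw [map_smul, hx, smul_smul, inv_mul_cancel₀ h1, one_smul]
  · have h3 : ⁅(h : 𝔤), ⁅(h₀ : 𝔤), x⁆⁆ = β h • ⁅(h₀ : 𝔤), x⁆ := by
      rw [leibniz_lie, hker _ (hab h h₀), zero_add, hz]
    rw [lie_smul, h3, smul_comm]

variable (π) in
/-- The restriction of `π` to the Cartan subalgebra. -/
def cartanMap : 𝔥 →ₗ[ℂ] 𝔥.map π :=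
  (π : 𝔤 →ₗ[ℂ] 𝔮).restrict (p := 𝔥.toSubmodule) (q := (𝔥.map π).toSubmodule)
    (fun x hx => ⟨x, hx, rfl⟩)

lemma cartanMap_surjective : Function.Surjective (cartanMap 𝔥 π) := by
  rintro ⟨_, x, hx, rfl⟩
  exact ⟨⟨x, hx⟩, rfl⟩

variable [(𝔥.map π).IsCartanSubalgebra]

lemma map_mem_rootSpace {χ : 𝔥.map π → ℂ} {β : 𝔥 → ℂ} (hχ : ∀ h, χ (cartanMap 𝔥 π h) = β h)
    {x : 𝔤} (hx : x ∈ LieAlgebra.rootSpace 𝔥 β) : π x ∈ LieAlgebra.rootSpace (𝔥.map π) χ := by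
  rw [LieAlgebra.rootSpace, LieModule.mem_genWeightSpace] at hx ⊢
  intro h'
  obtain ⟨h, rfl⟩ := cartanMap_surjective 𝔥 h'
  obtain ⟨k, hk⟩ := hx h
  refine ⟨k, ?_⟩
  rw [hχ]
  have key : ∀ (k : ℕ) (x : 𝔤),
      π (((LieModule.toEnd ℂ 𝔥 𝔤 h - β h • (1 : Module.End ℂ 𝔤)) ^ k) x) =
        ((LieModule.toEnd ℂ (𝔥.map π) 𝔮 (cartanMap 𝔥 π h) - β h • (1 : Module.End ℂ 𝔮)) ^ k)
          (π x) := by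
    intro k
    induction k with
    | zero => intro x; rfl
    | succ k ih =>
      intro x
      rw [pow_succ, Module.End.mul_apply, ih, pow_succ, Module.End.mul_apply]
      congr 1
      simp only [LinearMap.sub_apply, LinearMap.smul_apply, Module.End.one_apply, map_sub, map_smul]
      congr 1
      exact LieHom.map_lie π (h : 𝔤) x
  rw [← key, hk, map_zero]

-- Such a `z` is central, so zero is its only generalised eigenvalue. Hence a root of `𝔥` factors
-- through the image of `𝔥`.
include hker in
lemma weight_eq_zero_of_map_eq_zero {β : Module.Dual ℂ 𝔥} {x : 𝔤}
    (hx : x ∈ LieAlgebra.rootSpace 𝔥 β) (hx0 : x ≠ 0) {z : 𝔥} (hz : π z = 0) : β z = 0 := by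
  rw [LieAlgebra.rootSpace, LieModule.mem_genWeightSpace] at hx
  obtain ⟨k, hk⟩ := hx z
  have h0 : LieModule.toEnd ℂ 𝔥 𝔤 z = 0 := LinearMap.ext fun y => hker _ hz y
  rw [h0, zero_sub, ← neg_smul, smul_pow, one_pow, LinearMap.smul_apply, Module.End.one_apply,
    smul_eq_zero] at hk
  exact neg_eq_zero.mp (eq_zero_of_pow_eq_zero (hk.resolve_right hx0))

include hker in
/-- Every root of `𝔥` comes from a weight of its image. -/
lemma exists_weight {β : Module.Dual ℂ 𝔥} (hβ : β ∈ roots 𝔥) :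
    ∃ χ : LieModule.Weight ℂ (𝔥.map π) 𝔮, χ.IsNonZero ∧ (∀ h, χ (cartanMap 𝔥 π h) = β h) ∧
      ∀ x ∈ LieAlgebra.rootSpace 𝔥 β, π x = 0 → x = 0 := by
  obtain ⟨hβ0, hβ1⟩ := hβ
  obtain ⟨x, hx, hx0⟩ := (Submodule.ne_bot_iff _).mp
    (fun h => hβ1 ((LieSubmodule.toSubmodule_eq_bot _).mp h))
  let χ : 𝔥.map π → ℂ := fun h => β (Function.surjInv (cartanMap_surjective 𝔥) h)
  have hχ : ∀ h, χ (cartanMap 𝔥 π h) = β h := by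
    intro h
    rw [← sub_eq_zero, ← map_sub]
    refine weight_eq_zero_of_map_eq_zero 𝔥 hker hx hx0 ?_
    have := congrArg Subtype.val
      (Function.surjInv_eq (cartanMap_surjective 𝔥 (π := π)) (cartanMap 𝔥 π h))
    change π _ = π _ at this
    change π ((Function.surjInv (cartanMap_surjective 𝔥) (cartanMap 𝔥 π h) : 𝔥) - (h : 𝔤)) = 0
    rw [map_sub, sub_eq_zero]
    exact this
  have hinj : ∀ x ∈ LieAlgebra.rootSpace 𝔥 β, π x = 0 → x = 0 := by
    intro y hy hy0
    have h1 : y ∈ LieAlgebra.rootSpace 𝔥 (0 : 𝔥 → ℂ) := by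
      rw [LieAlgebra.rootSpace_zero_eq]
      exact mem_cartan_of_map_eq_zero 𝔥 hker hy0
    have h2 := LieModule.disjoint_genWeightSpace ℂ 𝔥 𝔤 (χ₁ := β) (χ₂ := 0)
      (fun h => hβ0 (LinearMap.ext (congrFun h)))
    have h3 := (disjoint_iff.mp h2).le (show y ∈ _ ⊓ _ from ⟨hy, h1⟩)
    exact h3
  have h1 := map_mem_rootSpace 𝔥 (π := π) hχ hx
  refine ⟨⟨χ, fun h => ?_⟩, fun h => ?_, hχ, hinj⟩
  · rw [LieAlgebra.rootSpace, h] at h1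
    exact hx0 (hinj x hx h1)
  · refine hβ0 (LinearMap.ext fun h' => ?_)
    rw [← hχ h']
    exact congrFun h _

include hker in
lemma lie_eq_smul_of_mem_rootSpace {β : Module.Dual ℂ 𝔥} (hβ : β ∈ roots 𝔥) {x : 𝔤}
    (hx : x ∈ LieAlgebra.rootSpace 𝔥 β) (h : 𝔥) : ⁅(h : 𝔤), x⁆ = β h • x := by
  obtain ⟨χ, -, hχ, hinj⟩ := exists_weight 𝔥 hker hβ
  have h1 := LieAlgebra.IsKilling.lie_eq_smul_of_mem_rootSpace (map_mem_rootSpace 𝔥 (π := π) hχ hx)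
    (cartanMap 𝔥 π h)
  rw [hχ] at h1
  rw [← sub_eq_zero]
  refine hinj _ (sub_mem (LieSubmodule.lie_mem (x := h) _ hx) (Submodule.smul_mem _ _ hx)) ?_
  rw [map_sub, map_smul, ← h1, LieHom.map_lie]
  exact sub_self _

lemma map_lie_cartan (h h' : 𝔥) : π ⁅(h : 𝔤), (h' : 𝔤)⁆ = 0 := by
  have h1 := trivial_lie_zero (𝔥.map π) (𝔥.map π) (cartanMap 𝔥 π h) (cartanMap 𝔥 π h')
  have h2 := congrArg Subtype.val h1
  rw [LieHom.map_lie]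
  exact h2

include hπ hker in
/-- Root vectors lift along `π`. -/
lemma exists_lift (χ : LieModule.Weight ℂ (𝔥.map π) 𝔮) (hχ : χ.IsNonZero) {β : Module.Dual ℂ 𝔥}
    (hβ : ∀ h, χ (cartanMap 𝔥 π h) = β h) (t : ℂ) (ht : t ≠ 0) {y : 𝔮}
    (hy : y ∈ LieAlgebra.rootSpace (𝔥.map π) (t • (χ : 𝔥.map π → ℂ))) :
    ∃ x : 𝔤, π x = y ∧ ∀ h : 𝔥, ⁅(h : 𝔤), x⁆ = (t * β h) • x := by
  obtain ⟨x, rfl⟩ := hπ y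
  have hβ0 : t • β ≠ 0 := by
    refine smul_ne_zero ht fun h => hχ ?_
    refine funext fun h' => ?_
    obtain ⟨h', rfl⟩ := cartanMap_surjective 𝔥 h'
    change χ (cartanMap 𝔥 π h') = 0
    rw [hβ, h]; rfl
  obtain ⟨y, hy1, hy2⟩ := exists_eigenvector_lift 𝔥 hker hβ0 (x := x) (fun h => by
    have := LieAlgebra.IsKilling.lie_eq_smul_of_mem_rootSpace hy (cartanMap 𝔥 π h)
    rw [Pi.smul_apply, hβ] at this
    rw [LieHom.map_lie]
    exact this) (map_lie_cartan 𝔥)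
  exact ⟨y, hy1, hy2⟩

lemma lie_lie_eq_zero {x y : 𝔤} {β : Module.Dual ℂ 𝔥} (hx : ∀ h : 𝔥, ⁅(h : 𝔤), x⁆ = (1 * β h) • x)
    (hy : ∀ h : 𝔥, ⁅(h : 𝔤), y⁆ = (-1 * β h) • y) (h : 𝔥) : ⁅(h : 𝔤), ⁅x, y⁆⁆ = 0 := by
  rw [leibniz_lie, hx, hy, smul_lie, lie_smul, ← add_smul, one_mul, neg_one_mul, add_neg_cancel,
    zero_smul]

lemma mem_cartan_of_lie_eq_zero {x : 𝔤} (hx : ∀ h : 𝔥, ⁅(h : 𝔤), x⁆ = 0) : x ∈ 𝔥 := by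
  have : x ∈ 𝔥.normalizer := by
    rw [LieSubalgebra.mem_normalizer_iff]
    intro y hy
    rw [← lie_skew, hx ⟨y, hy⟩, neg_zero]
    exact zero_mem _
  rwa [LieSubalgebra.IsCartanSubalgebra.self_normalizing] at this

lemma mem_rootSpace_of_lie {β : 𝔥 → ℂ} {x : 𝔤} (hx : ∀ h : 𝔥, ⁅(h : 𝔤), x⁆ = β h • x) :
    x ∈ LieAlgebra.rootSpace 𝔥 β :=
  LieModule.weightSpace_le_genWeightSpace 𝔤 β ((LieModule.mem_weightSpace β x).mpr hx)

variable (π) in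
/-- The functional on `𝔥` induced by a weight of the image. -/
def pullbackWeight (χ : LieModule.Weight ℂ (𝔥.map π) 𝔮) : Module.Dual ℂ 𝔥 :=
  χ.toLinear.comp (cartanMap 𝔥 π)

-- The image of `𝔥` is spanned by the brackets `[e, f]` of opposite root vectors. These lift to
-- simultaneous eigenvectors of opposite weight, whose bracket commutes with `𝔥`; and what remains,
-- the kernel, is central.
include hπ hker in
lemma lie_cartan_eq_zero (h h' : 𝔥) : ⁅(h : 𝔤), (h' : 𝔤)⁆ = 0 := by
  let C : Submodule ℂ 𝔥 :=
    { carrier := {x | ∀ h : 𝔥, ⁅(h : 𝔤), (x : 𝔤)⁆ = 0}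
      zero_mem' := fun h => lie_zero _
      add_mem' := fun {x y} hx hy h => by
        change ⁅(h : 𝔤), (x : 𝔤) + (y : 𝔤)⁆ = 0
        rw [lie_add, hx, hy, add_zero]
      smul_mem' := fun t x hx h => by
        change ⁅(h : 𝔤), t • (x : 𝔤)⁆ = 0
        rw [lie_smul, hx, smul_zero] }
  have h1 : (⊤ : Submodule ℂ (𝔥.map π)) ≤ C.map (cartanMap 𝔥 π) := by
    rw [← LieSubmodule.top_toSubmodule (R := ℂ) (L := 𝔥.map π) (M := 𝔥.map π),
      ← LieAlgebra.IsKilling.biSup_corootSpace_eq_top (K := ℂ) (L := 𝔮) (H := 𝔥.map π),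
      LieSubmodule.iSup_toSubmodule]
    refine iSup_le fun χ => ?_
    rw [LieSubmodule.iSup_toSubmodule]
    refine iSup_le fun hχ => ?_
    intro x hx
    have hx' : x ∈ LieAlgebra.corootSpace (χ : 𝔥.map π → ℂ) := hx
    rw [LieAlgebra.mem_corootSpace'] at hx'
    refine Submodule.span_le.mpr ?_ hx'
    rintro z ⟨y, hy, w, hw, hz⟩
    obtain ⟨e, rfl, he⟩ := exists_lift 𝔥 hπ hker χ hχ (β := pullbackWeight 𝔥 π χ) (fun _ => rfl) 1
      one_ne_zero (by rwa [one_smul])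
    obtain ⟨f, rfl, hf⟩ := exists_lift 𝔥 hπ hker χ hχ (β := pullbackWeight 𝔥 π χ) (fun _ => rfl)
      (-1) (by simp) (by rwa [neg_one_smul])
    have h3 := lie_lie_eq_zero 𝔥 he hf
    refine ⟨⟨⁅e, f⁆, mem_cartan_of_lie_eq_zero 𝔥 h3⟩, h3, Subtype.ext ?_⟩
    rw [← hz]
    exact LieHom.map_lie π e f
  obtain ⟨x, hx, hx'⟩ := h1 (show cartanMap 𝔥 π h' ∈ _ from trivial)
  have h2 := hker ((h' : 𝔤) - x)
    (by rw [map_sub, sub_eq_zero]; exact (congrArg Subtype.val hx').symm) (h : 𝔤)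
  rw [← lie_skew, neg_eq_zero, lie_sub, hx h, sub_zero] at h2
  exact h2

include hπ hker in
theorem isSplit_of_central : IsSplit 𝔥 where
  lie_cartan := lie_cartan_eq_zero 𝔥 hπ hker
  lie_root β x hx h := by
    by_cases hβ : β = 0
    · subst hβ
      have : x ∈ LieAlgebra.rootSpace 𝔥 (0 : 𝔥 → ℂ) := hx
      rw [LieAlgebra.rootSpace_zero_eq] at this
      rw [lie_cartan_eq_zero 𝔥 hπ hker h ⟨x, this⟩]
      simp
    by_cases hx0 : x = 0
    · simp [hx0]
    refine lie_eq_smul_of_mem_rootSpace 𝔥 hker ⟨hβ, fun h => hx0 ?_⟩ hx h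
    rw [h] at hx
    exact hx
  zero x hx := by
    have : x ∈ LieAlgebra.rootSpace 𝔥 (0 : 𝔥 → ℂ) := hx
    rwa [LieAlgebra.rootSpace_zero_eq] at this
  iSup_eq_top := by
    rw [eq_top_iff, ← LieSubmodule.top_toSubmodule (R := ℂ) (L := 𝔥) (M := 𝔤),
      ← LieModule.iSup_genWeightSpace_eq_top' ℂ 𝔥 𝔤, LieSubmodule.iSup_toSubmodule]
    exact iSup_le fun χ => le_iSup
      (fun β : Module.Dual ℂ 𝔥 => (LieAlgebra.rootSpace 𝔥 β).toSubmodule) χ.toLinear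
  finite := by
    refine Set.Finite.of_finite_image (f := fun β : Module.Dual ℂ 𝔥 => (β : 𝔥 → ℂ)) ?_
      DFunLike.coe_injective.injOn
    refine (LieModule.finite_genWeightSpace_ne_bot ℂ 𝔥 𝔤).subset ?_
    rintro _ ⟨β, hβ, rfl⟩
    exact hβ.2
  mem_span β hβ x hx hx0 y hy := by
    obtain ⟨χ, hχ0, hχ, hinj⟩ := exists_weight 𝔥 hker hβ
    have h1 := LieAlgebra.IsKilling.finrank_rootSpace_eq_one χ hχ0
    have hx' := map_mem_rootSpace 𝔥 (π := π) hχ hx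
    have hy' := map_mem_rootSpace 𝔥 (π := π) hχ hy
    obtain ⟨t, ht⟩ := (finrank_eq_one_iff_of_nonzero'
      (⟨π x, hx'⟩ : LieAlgebra.rootSpace (𝔥.map π) χ)
      (fun h => hx0 (hinj x hx (congrArg Subtype.val h)))).mp h1 ⟨π y, hy'⟩
    have ht' : t • π x = π y := congrArg Subtype.val ht
    refine ⟨t, sub_eq_zero.mp (hinj _ (sub_mem hy (Submodule.smul_mem _ t hx)) ?_)⟩
    rw [map_sub, map_smul, ht', sub_self]
  multiple β hβ t ht := by
    obtain ⟨χ, hχ0, hχ, -⟩ := exists_weight 𝔥 hker hβ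
    obtain ⟨χ', hχ0', hχ', -⟩ := exists_weight 𝔥 hker ht
    have h1 : (χ' : 𝔥.map π → ℂ) = t • (χ : 𝔥.map π → ℂ) := by
      refine funext fun h' => ?_
      obtain ⟨h', rfl⟩ := cartanMap_surjective 𝔥 h'
      rw [Pi.smul_apply, hχ, hχ']
      rfl
    rcases LieAlgebra.IsKilling.eq_neg_one_or_eq_zero_or_eq_one_of_eq_smul χ χ' hχ0 t h1 with
      h | h | h
    · exact Or.inr h
    · exact absurd (by rw [h, zero_smul]) ht.1
    · exact Or.inl h
  exists_triple β hβ := by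
    obtain ⟨χ, hχ0, hχ, -⟩ := exists_weight 𝔥 hker hβ
    obtain ⟨h, e, f, ht, he, hf⟩ :=
      LieAlgebra.IsKilling.exists_isSl2Triple_of_weight_isNonZero hχ0
    obtain ⟨e, rfl, he'⟩ := exists_lift 𝔥 hπ hker χ hχ0 hχ 1 one_ne_zero (by rwa [one_smul])
    obtain ⟨f, rfl, hf'⟩ := exists_lift 𝔥 hπ hker χ hχ0 hχ (-1) (by simp) (by rwa [neg_one_smul])
    have h3 := mem_cartan_of_lie_eq_zero 𝔥 (lie_lie_eq_zero 𝔥 he' hf')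
    refine ⟨e, mem_rootSpace_of_lie 𝔥 (fun h => by rw [he', one_mul]), f,
      mem_rootSpace_of_lie 𝔥 (fun h => by rw [hf', neg_one_mul]; rfl), ⟨⁅e, f⁆, h3⟩, rfl, ?_⟩
    have h4 := congrArg π (he' ⟨⁅e, f⁆, h3⟩)
    rw [LieHom.map_lie, LieHom.map_lie, ht.lie_e_f, ht.lie_h_e_smul ℂ, map_smul, one_mul] at h4
    exact (smul_left_injective ℂ ht.e_ne_zero h4).symm

end Central

/-- A reductive Lie algebra is split with respect to each of its Cartan subalgebras. -/
theorem isSplit_of_reductive {𝔤 : Type u} [LieRing 𝔤] [LieAlgebra ℂ 𝔤] [FiniteDimensional ℂ 𝔤]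
    (hred : LieAlgebra.radical ℂ 𝔤 = LieAlgebra.center ℂ 𝔤)
    (𝔥 : LieSubalgebra ℂ 𝔤) [𝔥.IsCartanSubalgebra] : IsSplit 𝔥 := by
  have _ := hasTrivialRadical_quotient_center hred
  let π : 𝔤 →ₗ⁅ℂ⁆ 𝔤 ⧸ LieAlgebra.center ℂ 𝔤 :=
    { (LieSubmodule.Quotient.mk' (LieAlgebra.center ℂ 𝔤) : 𝔤 →ₗ[ℂ] _) with
      map_lie' := fun {x y} => LieSubmodule.Quotient.mk_bracket _ x y }
  have hπ : Function.Surjective π := LieSubmodule.Quotient.surjective_mk' _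
  have hker : ∀ x, π x = 0 → ∀ y : 𝔤, ⁅x, y⁆ = 0 := fun x hx y => by
    have h1 : x ∈ LieAlgebra.center ℂ 𝔤 := (LieSubmodule.Quotient.mk_eq_zero _).mp hx
    rw [← lie_skew, (LieModule.mem_maxTrivSubmodule ℂ 𝔤 𝔤 x).mp h1, neg_zero]
  have _ := isCartanSubalgebra_map 𝔥 hπ hker
  exact isSplit_of_central 𝔥 hπ hker

/-! ### Positive roots and a simple reflection -/

section Roots

variable {𝔤 : Type u} [LieRing 𝔤] [LieAlgebra ℂ 𝔤] [FiniteDimensional ℂ 𝔤]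
  {𝔥 : LieSubalgebra ℂ 𝔤} [LieRing.IsNilpotent 𝔥]
  {Δ : Set (Module.Dual ℂ 𝔥)} (hΔ : IsSimpleSystem 𝔥 Δ)

include hΔ in
/-- Simple roots take arbitrary prescribed values at some element of the Cartan subalgebra. -/
lemma IsSimpleSystem.exists_dual (g : Δ → ℂ) : ∃ H : 𝔥, ∀ γ : Δ, (γ : Module.Dual ℂ 𝔥) H = g γ := by
  let b := Module.Basis.span hΔ.linearIndependent
  obtain ⟨F, hF⟩ := LinearMap.exists_extend (b.constr ℂ g)
  refine ⟨(Module.evalEquiv ℂ 𝔥).symm F, fun γ => ?_⟩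
  rw [Module.apply_evalEquiv_symm_apply]
  have h1 := LinearMap.congr_fun hF (b γ)
  rw [Module.Basis.constr_basis, LinearMap.comp_apply] at h1
  rw [← h1]
  congr 1
  exact congrArg Subtype.val (Module.Basis.span_apply hΔ.linearIndependent γ).symm

include hΔ in
/-- An element at which every simple root takes the value one. -/
lemma IsSimpleSystem.exists_grading : ∃ H : 𝔥, ∀ β ∈ AddSubmonoid.closure Δ, β ≠ 0 →
    ∃ n : ℕ, 0 < n ∧ β H = n := by
  obtain ⟨H, hH⟩ := hΔ.exists_dual (fun _ => 1)
  have key : ∀ β ∈ AddSubmonoid.closure Δ, β = 0 ∨ ∃ n : ℕ, 0 < n ∧ β H = n := by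
    intro β hβ
    induction hβ using AddSubmonoid.closure_induction with
    | mem γ hγ => exact Or.inr ⟨1, one_pos, by simpa using hH ⟨γ, hγ⟩⟩
    | zero => exact Or.inl rfl
    | add x y _ _ hx hy =>
      rcases hx with rfl | ⟨n, hn, hx⟩
      · simpa using hy
      rcases hy with rfl | ⟨m, hm, hy⟩
      · exact Or.inr ⟨n, hn, by simpa using hx⟩
      · exact Or.inr ⟨n + m, by omega, by simp [hx, hy]⟩
  exact ⟨H, fun β hβ hβ0 => (key β hβ).resolve_left hβ0⟩

-- `H` is dual to a simple root `γ ≠ α` occurring in `β`. There is one because `β` is not a multiple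
-- of `α`: among the multiples of `α` only `±α` are roots, and `-α` is not positive.
include hΔ in
lemma IsSimpleSystem.exists_coordinate (h𝔥 : IsSplit 𝔥) {α : Module.Dual ℂ 𝔥} (hα : α ∈ Δ)
    {β : Module.Dual ℂ 𝔥} (hβ : β ∈ posRoots 𝔥 Δ) (hβα : β ≠ α) :
    ∃ H : 𝔥, α H = 0 ∧ (∀ γ ∈ AddSubmonoid.closure Δ, ∃ n : ℕ, γ H = n) ∧
      ∃ n : ℕ, 0 < n ∧ β H = n := by
  classical
  choose H hH using fun γ : Δ => hΔ.exists_dual (Pi.single γ 1)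
  have hnat : ∀ γ : Δ, ∀ β ∈ AddSubmonoid.closure Δ, ∃ n : ℕ, β (H γ) = n := by
    intro γ β hβ
    induction hβ using AddSubmonoid.closure_induction with
    | mem δ hδ =>
      have := hH γ ⟨δ, hδ⟩
      rw [Pi.single_apply] at this
      split_ifs at this
      · exact ⟨1, by simpa using this⟩
      · exact ⟨0, by simpa using this⟩
    | zero => exact ⟨0, by simp⟩
    | add x y _ _ hx hy =>
      obtain ⟨n, hn⟩ := hx
      obtain ⟨m, hm⟩ := hy
      exact ⟨n + m, by simp [hn, hm]⟩
  have key : ∀ β ∈ AddSubmonoid.closure Δ, (∃ t : ℂ, β = t • α) ∨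
      ∃ γ : Δ, (γ : Module.Dual ℂ 𝔥) ≠ α ∧ ∃ n : ℕ, 0 < n ∧ β (H γ) = n := by
    intro β hβ
    induction hβ using AddSubmonoid.closure_induction with
    | mem δ hδ =>
      by_cases h : δ = α
      · exact Or.inl ⟨1, by rw [h, one_smul]⟩
      · exact Or.inr ⟨⟨δ, hδ⟩, h, 1, one_pos, by simpa using hH ⟨δ, hδ⟩ ⟨δ, hδ⟩⟩
    | zero => exact Or.inl ⟨0, (zero_smul _ _).symm⟩
    | add x y hx' hy' hx hy =>
      rcases hx with ⟨t, rfl⟩ | ⟨γ, hγ, n, hn, hx⟩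
      · rcases hy with ⟨t', rfl⟩ | ⟨γ, hγ, n, hn, hy⟩
        · exact Or.inl ⟨t + t', (add_smul _ _ _).symm⟩
        · obtain ⟨m, hm⟩ := hnat γ _ hx'
          exact Or.inr ⟨γ, hγ, m + n, by omega, by rw [LinearMap.add_apply, hm, hy]; simp⟩
      · obtain ⟨m, hm⟩ := hnat γ _ hy'
        exact Or.inr ⟨γ, hγ, n + m, by omega, by rw [LinearMap.add_apply, hm, hx]; simp⟩
  rcases key β hβ.2 with ⟨t, rfl⟩ | ⟨γ, hγ, hn⟩
  · exfalso
    rcases h𝔥.multiple α (hΔ.subset_roots hα) t hβ.1 with rfl | rfl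
    · exact hβα (one_smul _ _)
    · obtain ⟨n, hn⟩ := hnat ⟨α, hα⟩ _ hβ.2
      have h1 := hH ⟨α, hα⟩ ⟨α, hα⟩
      simp only [Pi.single_eq_same] at h1
      rw [LinearMap.smul_apply, h1, smul_eq_mul, mul_one] at hn
      have h2 : ((n + 1 : ℕ) : ℂ) = 0 := by push_cast; rw [← hn]; ring
      exact absurd (Nat.cast_eq_zero.mp h2) (by omega)
  · refine ⟨H γ, ?_, hnat γ, hn⟩
    have := hH γ ⟨α, hα⟩
    rwa [Pi.single_apply, if_neg (fun h => hγ (congrArg Subtype.val h).symm)] at this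

include hΔ in
/-- Translating a positive root other than `α` along the simple root `α`. -/
lemma IsSimpleSystem.add_smul_mem (h𝔥 : IsSplit 𝔥) {α : Module.Dual ℂ 𝔥} (hα : α ∈ Δ)
    {β : Module.Dual ℂ 𝔥} (hβ : β ∈ posRoots 𝔥 Δ) (hβα : β ≠ α) {t : ℂ}
    (ht : β + t • α ∈ roots 𝔥) : β + t • α ∈ posRoots 𝔥 Δ ∧ β + t • α ≠ α := by
  -- The coordinate given by `H` does not see `α`, so translation along `α` leaves it positive and
  -- the translated root cannot become negative.
  obtain ⟨H, hαH, hH, n, hn, hβH⟩ := hΔ.exists_coordinate h𝔥 hα hβ hβα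
  have h1 : (β + t • α) H = n := by simp [hαH, hβH]
  refine ⟨⟨ht, (hΔ.pos_or_neg _ ht).resolve_right fun h => ?_⟩, fun h => ?_⟩
  · obtain ⟨m, hm⟩ := hH _ h
    rw [LinearMap.neg_apply, h1] at hm
    have h2 : ((n + m : ℕ) : ℂ) = 0 := by push_cast; rw [← hm]; ring
    exact absurd (Nat.cast_eq_zero.mp h2) (by omega)
  · rw [h, hαH] at h1
    exact absurd (Nat.cast_eq_zero.mp h1.symm) (by omega)

include hΔ in
lemma IsSimpleSystem.add_smul_ne_zero (h𝔥 : IsSplit 𝔥) {α : Module.Dual ℂ 𝔥} (hα : α ∈ Δ)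
    {β : Module.Dual ℂ 𝔥} (hβ : β ∈ posRoots 𝔥 Δ) (hβα : β ≠ α) (t : ℂ) : β + t • α ≠ 0 := by
  intro h
  obtain ⟨H, hαH, hH, n, hn, hβH⟩ := hΔ.exists_coordinate h𝔥 hα hβ hβα
  have h1 : (β + t • α) H = n := by simp [hαH, hβH]
  rw [h] at h1
  exact absurd (Nat.cast_eq_zero.mp h1.symm) (by omega)

lemma mem_posRoots_of_mem {α : Module.Dual ℂ 𝔥} (hα : α ∈ Δ) (hΔ : IsSimpleSystem 𝔥 Δ) :
    α ∈ posRoots 𝔥 Δ := ⟨hΔ.subset_roots hα, AddSubmonoid.subset_closure hα⟩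

variable (𝔥 Δ) in
/-- The sum of the positive root spaces other than that of `α`. -/
noncomputable def nCompl (α : Module.Dual ℂ 𝔥) : Submodule ℂ 𝔤 :=
  ⨆ β ∈ {β | β ∈ posRoots 𝔥 Δ ∧ β ≠ α}, (LieAlgebra.rootSpace 𝔥 β).toSubmodule

lemma rootSpace_le_nCompl {α β : Module.Dual ℂ 𝔥} (hβ : β ∈ posRoots 𝔥 Δ) (hβα : β ≠ α) :
    (LieAlgebra.rootSpace 𝔥 β).toSubmodule ≤ nCompl 𝔥 Δ α :=
  le_iSup₂_of_le (f := fun β (_ : β ∈ {β | β ∈ posRoots 𝔥 Δ ∧ β ≠ α}) =>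
    (LieAlgebra.rootSpace 𝔥 β).toSubmodule) β ⟨hβ, hβα⟩ le_rfl

lemma rootSpace_le_nPlus {β : Module.Dual ℂ 𝔥} (hβ : β ∈ posRoots 𝔥 Δ) :
    (LieAlgebra.rootSpace 𝔥 β).toSubmodule ≤ nPlus 𝔥 Δ :=
  le_iSup₂_of_le (f := fun β (_ : β ∈ posRoots 𝔥 Δ) =>
    (LieAlgebra.rootSpace 𝔥 β).toSubmodule) β hβ le_rfl

lemma mem_rootSpace_of_lie_eq {β : 𝔥 → ℂ} {x : 𝔤} (hx : ∀ h : 𝔥, ⁅(h : 𝔤), x⁆ = β h • x) :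
    x ∈ LieAlgebra.rootSpace 𝔥 β :=
  LieModule.weightSpace_le_genWeightSpace 𝔤 β ((LieModule.mem_weightSpace β x).mpr hx)

include hΔ in
/-- Endomorphisms sending `g_β` into some `g_{β + tα}` preserve `nCompl`. -/
lemma IsSimpleSystem.map_mem_nCompl (h𝔥 : IsSplit 𝔥) {α : Module.Dual ℂ 𝔥} (hα : α ∈ Δ)
    (T : 𝔤 →ₗ[ℂ] 𝔤) (hT : ∀ β ∈ posRoots 𝔥 Δ, ∃ t : ℂ, ∀ x ∈ LieAlgebra.rootSpace 𝔥 β,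
      ∀ h : 𝔥, ⁅(h : 𝔤), T x⁆ = (β + t • α) h • T x)
    {x : 𝔤} (hx : x ∈ nCompl 𝔥 Δ α) : T x ∈ nCompl 𝔥 Δ α := by
  suffices h : nCompl 𝔥 Δ α ≤ (nCompl 𝔥 Δ α).comap T from h hx
  refine iSup₂_le fun β (hβ : β ∈ posRoots 𝔥 Δ ∧ β ≠ α) x hx => ?_
  obtain ⟨t, ht⟩ := hT β hβ.1
  have h1 : T x ∈ LieAlgebra.rootSpace 𝔥 (β + t • α) := mem_rootSpace_of_lie_eq (ht x hx)
  by_cases h0 : T x = 0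
  · change T x ∈ nCompl 𝔥 Δ α
    rw [h0]
    exact zero_mem _
  have h2 : β + t • α ∈ roots 𝔥 := by
    refine ⟨hΔ.add_smul_ne_zero h𝔥 hα hβ.1 hβ.2 t, fun h => h0 ?_⟩
    have h1' : T x ∈ LieAlgebra.rootSpace 𝔥 ((β + t • α : Module.Dual ℂ 𝔥) : 𝔥 → ℂ) := h1
    rw [h] at h1'
    exact h1'
  obtain ⟨h3, h4⟩ := hΔ.add_smul_mem h𝔥 hα hβ.1 hβ.2 h2
  exact rootSpace_le_nCompl h3 h4 h1

lemma IsSplit.lie_lie (h𝔥 : IsSplit 𝔥) {β γ : Module.Dual ℂ 𝔥} {x y : 𝔤}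
    (hx : x ∈ LieAlgebra.rootSpace 𝔥 γ) (hy : y ∈ LieAlgebra.rootSpace 𝔥 β) (h : 𝔥) :
    ⁅(h : 𝔤), ⁅x, y⁆⁆ = (β + γ) h • ⁅x, y⁆ := by
  rw [leibniz_lie, h𝔥.lie_root γ x hx h, h𝔥.lie_root β y hy h, smul_lie, lie_smul, ← add_smul,
    LinearMap.add_apply, add_comm (β h)]

include hΔ in
lemma IsSimpleSystem.lie_mem_nCompl (h𝔥 : IsSplit 𝔥) {α : Module.Dual ℂ 𝔥} (hα : α ∈ Δ) {s : ℂ}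
    {y : 𝔤} (hy : y ∈ LieAlgebra.rootSpace 𝔥 (s • α : Module.Dual ℂ 𝔥)) {x : 𝔤}
    (hx : x ∈ nCompl 𝔥 Δ α) : ⁅y, x⁆ ∈ nCompl 𝔥 Δ α :=
  hΔ.map_mem_nCompl h𝔥 hα (LieAlgebra.ad ℂ 𝔤 y)
    (fun _ _ => ⟨s, fun _ hx h => h𝔥.lie_lie hy hx h⟩) hx

include hΔ in
lemma IsSimpleSystem.lie_cartan_mem_nCompl (h𝔥 : IsSplit 𝔥) {α : Module.Dual ℂ 𝔥} (hα : α ∈ Δ)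
    (h : 𝔥) {x : 𝔤} (hx : x ∈ nCompl 𝔥 Δ α) : ⁅(h : 𝔤), x⁆ ∈ nCompl 𝔥 Δ α :=
  hΔ.map_mem_nCompl h𝔥 hα (LieAlgebra.ad ℂ 𝔤 (h : 𝔤))
    (fun β _ => ⟨0, fun x hx h' => by
      rw [LieAlgebra.ad_apply, h𝔥.lie_root β x hx h, lie_smul, h𝔥.lie_root β x hx h', zero_smul,
        add_zero, smul_comm]⟩) hx

end Roots

/-! ### The simple reflection and its lift `φ` -/

section Reflection

variable {𝔤 : Type u} [LieRing 𝔤] [LieAlgebra ℂ 𝔤] [FiniteDimensional ℂ 𝔤]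
  {𝔥 : LieSubalgebra ℂ 𝔤} [LieRing.IsNilpotent 𝔥]
  {Δ : Set (Module.Dual ℂ 𝔥)} (hΔ : IsSimpleSystem 𝔥 Δ) (h𝔥 : IsSplit 𝔥) {α : Module.Dual ℂ 𝔥}
  (hα : α ∈ Δ) (D : TwistingData 𝔥 α)

namespace TwistingData

include D in
lemma s_apply (l : Module.Dual ℂ 𝔥) : D.s l = l - l D.coroot • α := by
  simp [s, Module.preReflection_apply]

lemma s_s (l : Module.Dual ℂ 𝔥) : D.s (D.s l) = l := by
  have := D.root_coroot
  rw [s_apply, s_apply]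
  ext h
  simp only [LinearMap.sub_apply, LinearMap.smul_apply, smul_eq_mul, this]
  ring

lemma s_comp_reflection (l : Module.Dual ℂ 𝔥) (h : 𝔥) :
    l (Module.preReflection D.coroot α h) = D.s l h := by
  rw [s_apply, Module.preReflection_apply, map_sub, map_smul]
  simp [mul_comm]

lemma reflection_reflection (h : 𝔥) :
    Module.preReflection D.coroot α (Module.preReflection D.coroot α h) = h :=
  Module.involutive_preReflection D.root_coroot h

lemma φ_symm_coe (h : 𝔥) : D.φ.symm (h : 𝔤) = (Module.preReflection D.coroot α h : 𝔥) := by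
  rw [LieEquiv.symm_apply_eq, D.φ_coe, D.reflection_reflection]

include h𝔥 in
lemma lie_φ {β : Module.Dual ℂ 𝔥} {x : 𝔤} (hx : x ∈ LieAlgebra.rootSpace 𝔥 β) (h : 𝔥) :
    ⁅(h : 𝔤), D.φ x⁆ = D.s β h • D.φ x := by
  rw [← D.s_comp_reflection, ← map_smul, ← h𝔥.lie_root β x hx, LieEquiv.map_lie, D.φ_coe,
    D.reflection_reflection]

include h𝔥 in
lemma lie_φ_symm {β : Module.Dual ℂ 𝔥} {x : 𝔤} (hx : x ∈ LieAlgebra.rootSpace 𝔥 β) (h : 𝔥) :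
    ⁅(h : 𝔤), D.φ.symm x⁆ = D.s β h • D.φ.symm x := by
  rw [← D.s_comp_reflection, ← map_smul, ← h𝔥.lie_root β x hx, LieEquiv.map_lie, D.φ_symm_coe,
    D.reflection_reflection]

include hΔ h𝔥 hα in
lemma φ_mem_nCompl {x : 𝔤} (hx : x ∈ nCompl 𝔥 Δ α) : D.φ x ∈ nCompl 𝔥 Δ α :=
  hΔ.map_mem_nCompl h𝔥 hα (D.φ : 𝔤 →ₗ⁅ℂ⁆ 𝔤) (fun β _ => ⟨-β D.coroot, fun x hx h => by
    rw [neg_smul, ← sub_eq_add_neg, ← D.s_apply]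
    exact D.lie_φ h𝔥 hx h⟩) hx

include hΔ h𝔥 hα in
lemma φ_symm_mem_nCompl {x : 𝔤} (hx : x ∈ nCompl 𝔥 Δ α) : D.φ.symm x ∈ nCompl 𝔥 Δ α :=
  hΔ.map_mem_nCompl h𝔥 hα (D.φ.symm : 𝔤 →ₗ⁅ℂ⁆ 𝔤) (fun β _ => ⟨-β D.coroot, fun x hx h => by
    rw [neg_smul, ← sub_eq_add_neg, ← D.s_apply]
    exact D.lie_φ_symm h𝔥 hx h⟩) hx

include h𝔥 in
lemma s_mem_roots {β : Module.Dual ℂ 𝔥} (hβ : β ∈ roots 𝔥) : D.s β ∈ roots 𝔥 := by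
  obtain ⟨hβ0, hβ1⟩ := hβ
  refine ⟨fun h => hβ0 (by rw [← D.s_s β, h, map_zero]), fun h => hβ1 ?_⟩
  rw [LieSubmodule.eq_bot_iff]
  intro x hx
  have h1 : D.φ x ∈ LieAlgebra.rootSpace 𝔥 (D.s β) := mem_rootSpace_of_lie_eq (D.lie_φ h𝔥 hx)
  rw [h, LieSubmodule.mem_bot] at h1
  exact (map_eq_zero_iff _ D.φ.injective).mp h1

include hΔ h𝔥 hα in
lemma s_mem_posRoots {β : Module.Dual ℂ 𝔥} (hβ : β ∈ posRoots 𝔥 Δ) (hβα : β ≠ α) :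
    D.s β ∈ posRoots 𝔥 Δ ∧ D.s β ≠ α := by
  have h1 := D.s_mem_roots h𝔥 hβ.1
  rw [s_apply, sub_eq_add_neg, ← neg_smul] at h1 ⊢
  exact hΔ.add_smul_mem h𝔥 hα hβ hβα h1

-- `2ρ` is the sum of the positive roots; `s` permutes those other than `α` and negates `α`. The
-- shift `-2α` that results in `dotTwo_s` is the one produced by `f⁻¹ f̄⁻¹`.
include hΔ h𝔥 hα in
lemma s_two_rho : D.s ((2 : ℂ) • rho 𝔥 Δ) = (2 : ℂ) • rho 𝔥 Δ - (2 : ℂ) • α := by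
  classical
  have hfin : (posRoots 𝔥 Δ).Finite := h𝔥.finite.subset fun β hβ => hβ.1
  have h1 : (2 : ℂ) • rho 𝔥 Δ = ∑ β ∈ hfin.toFinset.erase α, β + α := by
    rw [rho, smul_smul, show (2 : ℂ) * (1 / 2) = 1 by norm_num, one_smul,
      finsum_mem_eq_finite_toFinset_sum _ hfin, Finset.sum_erase_add]
    exact hfin.mem_toFinset.mpr (mem_posRoots_of_mem hα hΔ)
  have h2 : D.s α = -α := by
    rw [s_apply, D.root_coroot, two_smul]
    abel
  have h3 : ∑ β ∈ hfin.toFinset.erase α, D.s β = ∑ β ∈ hfin.toFinset.erase α, β := by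
    have hmem : ∀ β ∈ hfin.toFinset.erase α, D.s β ∈ hfin.toFinset.erase α := by
      intro β hβ
      rw [Finset.mem_erase, hfin.mem_toFinset] at hβ ⊢
      exact (D.s_mem_posRoots hΔ h𝔥 hα hβ.2 hβ.1).symm
    exact Finset.sum_bij' (fun β _ => D.s β) (fun β _ => D.s β) hmem hmem
      (fun β _ => D.s_s β) (fun β _ => D.s_s β) (fun _ _ => rfl)
  rw [h1, map_add, map_sum, h3, h2, two_smul]
  abel

include hΔ h𝔥 hα in
lemma dotTwo_s (l : Module.Dual ℂ 𝔥) : dotTwo 𝔥 Δ D.s l = D.s l - (2 : ℂ) • α := by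
  rw [dotTwo, map_add, D.s_two_rho hΔ h𝔥 hα]
  abel

lemma e_ne_zero : D.e ≠ 0 := by
  intro h
  have h1 := D.lie_e_f
  rw [h, zero_lie] at h1
  have h2 : D.coroot = 0 := Subtype.ext h1.symm
  have h3 := D.root_coroot
  rw [h2, map_zero] at h3
  norm_num at h3

include hΔ h𝔥 hα in
lemma nPlus_eq : nPlus 𝔥 Δ = nCompl 𝔥 Δ α ⊔ ℂ ∙ D.e := by
  have hα' := mem_posRoots_of_mem hα hΔ
  refine le_antisymm (iSup₂_le fun β hβ => ?_) (sup_le ?_ ?_)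
  · by_cases h : β = α
    · subst h
      refine le_sup_of_le_right fun x hx => ?_
      obtain ⟨t, rfl⟩ := h𝔥.mem_span β hα'.1 D.e D.e_mem D.e_ne_zero x hx
      exact Submodule.smul_mem _ _ (Submodule.mem_span_singleton_self _)
    · exact le_sup_of_le_left (rootSpace_le_nCompl hβ h)
  · exact iSup₂_le fun β hβ => rootSpace_le_nPlus hβ.1
  · rw [Submodule.span_singleton_le_iff_mem]
    exact rootSpace_le_nPlus hα' D.e_mem

end TwistingData

end Reflection

/-! ### Existence of twisting data -/

section Existence

variable {𝔤 : Type u} [LieRing 𝔤] [LieAlgebra ℂ 𝔤] [FiniteDimensional ℂ 𝔤]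

lemma exists_exp (x : 𝔤) (hx : IsNilpotent (LieAlgebra.ad ℂ 𝔤 x)) : ∃ φ : 𝔤 ≃ₗ⁅ℂ⁆ 𝔤,
    ∀ y : 𝔤, ⁅x, ⁅x, ⁅x, y⁆⁆⁆ = 0 → φ y = y + ⁅x, y⁆ + (2⁻¹ : ℂ) • ⁅x, ⁅x, y⁆⁆ := by
  let _ : Module ℚ 𝔤 := Module.compHom 𝔤 (algebraMap ℚ ℂ)
  have hs : ∀ (q : ℚ) (y : 𝔤), q • y = (q : ℂ) • y := fun q y => rfl
  let _ : LieAlgebra ℚ 𝔤 := { lie_smul := fun q y z => by rw [hs, hs, lie_smul] }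
  have hx' : ((LieDerivation.ad ℂ 𝔤 x : LieDerivation ℂ 𝔤 𝔤) : 𝔤 →ₗ[ℂ] 𝔤) =
      LieAlgebra.ad ℂ 𝔤 x := by
    ext y
    simp
  refine ⟨LieDerivation.exp (LieDerivation.ad ℂ 𝔤 x) (by rw [hx']; exact hx), fun y hy => ?_⟩
  rw [LieDerivation.exp_map_apply, hx']
  have h1 := IsNilpotent.exp_smul_eq_sum (a := LieAlgebra.ad ℂ 𝔤 x) (m := y) (k := 3)
    (by simpa [pow_succ] using hy) hx
  refine h1.trans ?_
  simp only [Finset.sum_range_succ, Finset.sum_range_zero]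
  simp [hs, Nat.factorial, pow_two]

/-- The automorphism `exp(ad e) exp(-ad f) exp(ad e)` induces the reflection on `𝔥` and sends `e` to
`-f`, `f` to `-e`. Rescaling `e` by `i` and `f` by `-i` removes the signs and keeps `[e, f]`. -/
theorem nonempty_twistingData {𝔥 : LieSubalgebra ℂ 𝔤} [LieRing.IsNilpotent 𝔥] (h𝔥 : IsSplit 𝔥)
    {α : Module.Dual ℂ 𝔥} (hα : α ∈ roots 𝔥) : Nonempty (TwistingData 𝔥 α) := by
  obtain ⟨e, he, f, hf, h, hef, hh⟩ := h𝔥.exists_triple α hα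
  have hα0 := hα.1
  have he' : ∀ x : 𝔥, ⁅e, (x : 𝔤)⁆ = -(α x • e) := fun x => by
    rw [← lie_skew, h𝔥.lie_root α e he]
  have hf' : ∀ x : 𝔥, ⁅f, (x : 𝔤)⁆ = α x • f := fun x => by
    rw [← lie_skew, h𝔥.lie_root (-α) f hf, LinearMap.neg_apply, neg_smul, neg_neg]
  have hfe : ⁅f, e⁆ = -(h : 𝔤) := by rw [← lie_skew, hef]
  have hne : IsNilpotent (LieAlgebra.ad ℂ 𝔤 e) := by
    refine LieAlgebra.isNilpotent_ad_of_mem_rootSpace 𝔥 (χ := α) (fun h => ?_) he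
    exact hα0 (LinearMap.ext (congrFun h))
  have hnf : IsNilpotent (LieAlgebra.ad ℂ 𝔤 (-f)) := by
    rw [map_neg]
    refine IsNilpotent.neg ?_
    refine LieAlgebra.isNilpotent_ad_of_mem_rootSpace 𝔥 (χ := -α) (fun h => ?_) hf
    exact hα0 (LinearMap.ext fun x => by simpa using congrFun h x)
  obtain ⟨E, hE⟩ := exists_exp e hne
  obtain ⟨F, hF⟩ := exists_exp (-f) hnf
  have E_e : E e = e := by rw [hE e (by simp)]; simp
  have E_x : ∀ x : 𝔥, E (x : 𝔤) = x - α x • e := fun x => by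
    rw [hE _ (by simp [he']), he']; simp; abel
  have E_f : E f = f + h - e := by
    rw [hE f (by simp [hef, he']), hef, he', hh]
    simp [smul_smul]
    abel
  have F_f : F f = f := by rw [hF f (by simp)]; simp
  have F_x : ∀ x : 𝔥, F (x : 𝔤) = x - α x • f := fun x => by
    rw [hF _ (by simp [hf']), neg_lie, hf']; simp; abel
  have F_e : F e = e + h - f := by
    rw [hF e (by simp [hfe, hf']), neg_lie, hfe, neg_neg, neg_lie, hf', hh]
    simp [smul_smul]
    abel
  let φ : 𝔤 ≃ₗ⁅ℂ⁆ 𝔤 := (E.trans F).trans E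
  have φ_def : ∀ x, φ x = E (F (E x)) := fun x => rfl
  have E_h := E_x h
  have F_h := F_x h
  rw [hh] at E_h F_h
  have φ_e : φ e = -f := by
    rw [φ_def, E_e, F_e, map_sub, map_add, E_e, E_h, E_f, two_smul]
    abel
  have φ_f : φ f = -e := by
    rw [φ_def, E_f, map_sub, map_add, F_f, F_h, F_e, two_smul]
    rw [show f + ((h : 𝔤) - (f + f)) - (e + h - f) = -e by abel, map_neg, E_e]
  have φ_x : ∀ x : 𝔥, φ (x : 𝔤) = x - α x • (h : 𝔤) := fun x => by
    rw [φ_def, E_x, map_sub, map_smul, F_e, F_x,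
      show (x : 𝔤) - α x • f - α x • (e + h - f) = x - α x • e - α x • (h : 𝔤) by module,
      map_sub, map_sub, map_smul, map_smul, E_x, E_e, E_h]
    module
  have hI : Complex.I * Complex.I = -1 := Complex.I_mul_I
  exact ⟨{
    e := Complex.I • e
    f := (-Complex.I) • f
    coroot := h
    e_mem := Submodule.smul_mem _ _ he
    f_mem := Submodule.smul_mem _ _ hf
    lie_e_f := by
      rw [smul_lie, lie_smul, smul_smul, hef, mul_neg, hI, neg_neg, one_smul]
    root_coroot := hh
    φ := φ
    φ_coe := fun x => by
      rw [φ_x, Module.preReflection_apply]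
      rfl
    φ_e := by rw [map_smul, φ_e, smul_neg, neg_smul]
    φ_f := by rw [map_smul, φ_f, smul_neg, neg_smul, neg_neg] }⟩

end Existence

/-! ### Generators and relations of the enveloping algebra -/

section Generators

attribute [local instance 100] LieRing.ofAssociativeRing

variable {𝔤 : Type u} [LieRing 𝔤] [LieAlgebra ℂ 𝔤]

/-- The map `x ↦ x` from `𝔤` to `U(𝔤_ε)`. -/
noncomputable def uBase : 𝔤 →ₗ[ℂ] UTakiff 𝔤 :=
  (UniversalEnvelopingAlgebra.ι ℂ : Takiff 𝔤 →ₗ⁅ℂ⁆ UTakiff 𝔤).toLinearMap ∘ₗ base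

/-- The map `x ↦ x̄` from `𝔤` to `U(𝔤_ε)`. -/
noncomputable def uBar : 𝔤 →ₗ[ℂ] UTakiff 𝔤 :=
  (UniversalEnvelopingAlgebra.ι ℂ : Takiff 𝔤 →ₗ⁅ℂ⁆ UTakiff 𝔤).toLinearMap ∘ₗ bar

lemma toU_base (x : 𝔤) : toU (base x) = uBase x := rfl

lemma toU_bar (x : 𝔤) : toU (bar x) = uBar x := rfl

lemma uBase_mul (x y : 𝔤) : uBase x * uBase y = uBase y * uBase x + uBase ⁅x, y⁆ := by
  have := toU_lie (base x) (base y)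
  rw [show ⁅base x, base y⁆ = base ⁅x, y⁆ by simp [base]] at this
  rw [← toU_base, ← toU_base, ← toU_base, this]
  abel

lemma uBase_mul_uBar (x y : 𝔤) : uBase x * uBar y = uBar y * uBase x + uBar ⁅x, y⁆ := by
  have := toU_lie (base x) (bar y)
  rw [show ⁅base x, bar y⁆ = bar ⁅x, y⁆ by simp [base, bar]] at this
  rw [← toU_base, ← toU_bar, ← toU_bar, this]
  abel

lemma uBar_mul_uBase (x y : 𝔤) : uBar x * uBase y = uBase y * uBar x + uBar ⁅x, y⁆ := by
  rw [uBase_mul_uBar, ← lie_skew, map_neg]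
  abel

lemma uBar_mul (x y : 𝔤) : uBar x * uBar y = uBar y * uBar x := by
  have := toU_lie (bar x) (bar y)
  rw [show ⁅bar x, bar y⁆ = 0 by simp [bar]] at this
  rw [← toU_bar, ← toU_bar, ← sub_eq_zero, ← this]
  simp [toU]

lemma exists_base_add_bar (z : Takiff 𝔤) : ∃ x y : 𝔤, z = base x + bar y := by
  induction z using TensorProduct.induction_on with
  | zero => exact ⟨0, 0, by simp⟩
  | tmul d x =>
    refine ⟨d.fst • x, d.snd • x, ?_⟩
    have h : d = d.fst • (1 : DualNumber ℂ) + d.snd • DualNumber.eps := by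
      ext <;> simp
    conv_lhs => rw [h]
    rw [map_smul, map_smul, TensorProduct.add_tmul]
    rfl
  | add z w hz hw =>
    obtain ⟨x, y, rfl⟩ := hz
    obtain ⟨x', y', rfl⟩ := hw
    exact ⟨x + x', y + y', by rw [map_add, map_add]; abel⟩

lemma toU_base_add_bar (x y : 𝔤) : toU (base x + bar y) = uBase x + uBar y :=
  map_add (UniversalEnvelopingAlgebra.ι ℂ : Takiff 𝔤 →ₗ⁅ℂ⁆ UTakiff 𝔤) _ _

/-- Induction principle for `U(𝔤_ε)`. -/
lemma uTakiff_induction {p : UTakiff 𝔤 → Prop} (hC : ∀ r : ℂ, p (algebraMap ℂ _ r))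
    (hbase : ∀ x, p (uBase x)) (hbar : ∀ x, p (uBar x)) (hadd : ∀ u v, p u → p v → p (u + v))
    (hmul : ∀ u v, p u → p v → p (u * v)) (u : UTakiff 𝔤) : p u := by
  obtain ⟨t, rfl⟩ : ∃ t, UniversalEnvelopingAlgebra.mkAlgHom ℂ (Takiff 𝔤) t = u :=
    Quotient.exists_rep u
  induction t using TensorAlgebra.induction with
  | algebraMap r => rw [AlgHom.commutes]; exact hC r
  | ι x =>
    change p (toU x)
    obtain ⟨y, z, rfl⟩ := exists_base_add_bar x
    rw [toU_base_add_bar]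
    exact hadd _ _ (hbase y) (hbar z)
  | mul a b ha hb => rw [map_mul]; exact hmul _ _ ha hb
  | add a b ha hb => rw [map_add]; exact hadd _ _ ha hb

/-- Subspaces stable under `𝔤_ε` are submodules. -/
lemma smul_mem_of_stable {M : Type u} [AddCommGroup M] [Module (UTakiff 𝔤) M] (X : AddSubgroup M)
    (hC : ∀ r : ℂ, ∀ m ∈ X, algebraMap ℂ (UTakiff 𝔤) r • m ∈ X)
    (hbase : ∀ x : 𝔤, ∀ m ∈ X, uBase x • m ∈ X) (hbar : ∀ x : 𝔤, ∀ m ∈ X, uBar x • m ∈ X)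
    (u : UTakiff 𝔤) : ∀ m ∈ X, u • m ∈ X := by
  induction u using uTakiff_induction with
  | hC r => exact hC r
  | hbase x => exact hbase x
  | hbar x => exact hbar x
  | hadd u v hu hv => intro m hm; rw [add_smul]; exact add_mem (hu m hm) (hv m hm)
  | hmul u v hu hv => intro m hm; rw [mul_smul]; exact hu _ (hv m hm)

/-- The image of `V ⊕ V̄` in `U(𝔤_ε)`. -/
noncomputable def uSub (V : Submodule ℂ 𝔤) : Submodule ℂ (UTakiff 𝔤) := V.map uBase ⊔ V.map uBar

lemma mem_uSub {V : Submodule ℂ 𝔤} {u : UTakiff 𝔤} :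
    u ∈ uSub V ↔ ∃ x ∈ V, ∃ y ∈ V, uBase x + uBar y = u := by
  simp [uSub, Submodule.mem_sup]

lemma uBase_mem_uSub {V : Submodule ℂ 𝔤} {x : 𝔤} (hx : x ∈ V) : uBase x ∈ uSub V :=
  le_sup_left (a := V.map uBase) ⟨x, hx, rfl⟩

lemma uBar_mem_uSub {V : Submodule ℂ 𝔤} {x : 𝔤} (hx : x ∈ V) : uBar x ∈ uSub V :=
  le_sup_right (a := V.map uBase) ⟨x, hx, rfl⟩

lemma toU_mem_uSub {V : Submodule ℂ 𝔤} {x : Takiff 𝔤} (hx : x ∈ takiffSub V) :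
    toU x ∈ uSub V := by
  rw [takiffSub, Submodule.mem_sup] at hx
  obtain ⟨_, ⟨y, hy, rfl⟩, _, ⟨z, hz, rfl⟩, rfl⟩ := hx
  rw [toU_base_add_bar]
  exact add_mem (uBase_mem_uSub hy) (uBar_mem_uSub hz)

lemma exists_toU_of_mem_uSub {V : Submodule ℂ 𝔤} {u : UTakiff 𝔤} (hu : u ∈ uSub V) :
    ∃ x ∈ takiffSub V, toU x = u := by
  obtain ⟨x, hx, y, hy, rfl⟩ := mem_uSub.mp hu
  exact ⟨base x + bar y, add_mem (le_sup_left (a := V.map base) ⟨x, hx, rfl⟩)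
    (le_sup_right (a := V.map base) ⟨y, hy, rfl⟩), toU_base_add_bar x y⟩

/-- If `x` normalises `V`, then `x` and `x̄` normalise `uSub V`. -/
lemma uBase_normalizes {V : Submodule ℂ 𝔤} {x : 𝔤} (hx : ∀ y ∈ V, ⁅x, y⁆ ∈ V) {u : UTakiff 𝔤}
    (hu : u ∈ uSub V) : uBase x * u - u * uBase x ∈ uSub V := by
  obtain ⟨y, hy, z, hz, rfl⟩ := mem_uSub.mp hu
  rw [mul_add, add_mul, uBase_mul, uBase_mul_uBar]
  have := add_mem (uBase_mem_uSub (hx y hy)) (uBar_mem_uSub (hx z hz))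
  convert this using 1
  abel

lemma uBar_normalizes {V : Submodule ℂ 𝔤} {x : 𝔤} (hx : ∀ y ∈ V, ⁅x, y⁆ ∈ V) {u : UTakiff 𝔤}
    (hu : u ∈ uSub V) : uBar x * u - u * uBar x ∈ uSub V := by
  obtain ⟨y, hy, z, hz, rfl⟩ := mem_uSub.mp hu
  rw [mul_add, add_mul, uBar_mul_uBase, uBar_mul]
  have := uBar_mem_uSub (hx y hy)
  convert this using 1
  abel

lemma uSub_sup_span (V : Submodule ℂ 𝔤) (x : 𝔤) :
    uSub (V ⊔ ℂ ∙ x) = uSub V ⊔ Submodule.span ℂ {uBase x, uBar x} := by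
  rw [uSub, uSub, Submodule.map_sup, Submodule.map_sup, Submodule.map_span, Submodule.map_span,
    Set.image_singleton, Set.image_singleton, Submodule.span_insert]
  exact sup_sup_sup_comm _ _ _ _

lemma twist_uBase (φ : 𝔤 →ₗ⁅ℂ⁆ 𝔤) (x : 𝔤) : twist φ (uBase x) = uBase (φ x) := by
  change twist φ (UniversalEnvelopingAlgebra.ι ℂ (base x)) = _
  rw [twist, UniversalEnvelopingAlgebra.lift_ι_apply]
  rfl

lemma twist_uBar (φ : 𝔤 →ₗ⁅ℂ⁆ 𝔤) (x : 𝔤) : twist φ (uBar x) = uBar (φ x) := by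
  change twist φ (UniversalEnvelopingAlgebra.ι ℂ (bar x)) = _
  rw [twist, UniversalEnvelopingAlgebra.lift_ι_apply]
  rfl

lemma twist_twist {φ ψ : 𝔤 →ₗ⁅ℂ⁆ 𝔤} (h : ∀ x, φ (ψ x) = x) (u : UTakiff 𝔤) :
    twist φ (twist ψ u) = u := by
  induction u using uTakiff_induction with
  | hC r => simp only [AlgHom.commutes]
  | hbase x => rw [twist_uBase, twist_uBase, h]
  | hbar x => rw [twist_uBar, twist_uBar, h]
  | hadd u v hu hv => rw [map_add, map_add, hu, hv]
  | hmul u v hu hv => rw [map_mul, map_mul, hu, hv]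

end Generators

/-! ### The `sl₂`-triple of a simple root -/

section Triple

variable {𝔤 : Type u} [LieRing 𝔤] [LieAlgebra ℂ 𝔤]

/-- The action of the Cartan subalgebra. -/
noncomputable def κ (𝔥 : LieSubalgebra ℂ 𝔤) : 𝔥 →ₗ[ℂ] UTakiff 𝔤 := uBase ∘ₗ 𝔥.toSubmodule.subtype

/-- The action of the barred Cartan subalgebra. -/
noncomputable def κ' (𝔥 : LieSubalgebra ℂ 𝔤) : 𝔥 →ₗ[ℂ] UTakiff 𝔤 := uBar ∘ₗ 𝔥.toSubmodule.subtype

lemma κ_apply {𝔥 : LieSubalgebra ℂ 𝔤} (h : 𝔥) : κ 𝔥 h = uBase (h : 𝔤) := rfl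

lemma κ'_apply {𝔥 : LieSubalgebra ℂ 𝔤} (h : 𝔥) : κ' 𝔥 h = uBar (h : 𝔤) := rfl

variable [FiniteDimensional ℂ 𝔤]
  {𝔥 : LieSubalgebra ℂ 𝔤} [LieRing.IsNilpotent 𝔥] (h𝔥 : IsSplit 𝔥) {α : Module.Dual ℂ 𝔥}
  (D : TwistingData 𝔥 α)

namespace TwistingData

lemma pair_a : D.pair.a = uBase D.f := rfl

lemma pair_b : D.pair.b = uBar D.f := rfl

include h𝔥 in
lemma lie_h_e (h : 𝔥) : ⁅(h : 𝔤), D.e⁆ = α h • D.e := h𝔥.lie_root α _ D.e_mem h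

include h𝔥 in
lemma lie_h_f (h : 𝔥) : ⁅(h : 𝔤), D.f⁆ = -(α h • D.f) := by
  rw [h𝔥.lie_root (-α) _ D.f_mem h, LinearMap.neg_apply, neg_smul]

/-- The triple `e, f, h` and its barred version in `U(𝔤_ε)`. -/
noncomputable def triple (h𝔥 : IsSplit 𝔥) : TakiffTriple D.pair where
  e := uBase D.e
  e' := uBar D.e
  h := κ 𝔥 D.coroot
  h' := κ' 𝔥 D.coroot
  e_a := by rw [pair_a, uBase_mul, D.lie_e_f]; rfl
  e_b := by rw [pair_b, uBase_mul_uBar, D.lie_e_f]; rfl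
  e'_a := by rw [pair_a, uBar_mul_uBase, D.lie_e_f]; rfl
  e'_b := uBar_mul _ _
  h_a := by
    rw [pair_a, κ_apply, uBase_mul, D.lie_h_f h𝔥, D.root_coroot, map_neg, map_smul, sub_eq_add_neg]
  h_b := by
    rw [pair_b, κ_apply, uBase_mul_uBar, D.lie_h_f h𝔥, D.root_coroot, map_neg, map_smul,
      sub_eq_add_neg]
  h'_a := by
    rw [pair_a, κ'_apply, uBar_mul_uBase, D.lie_h_f h𝔥, D.root_coroot, map_neg, map_smul,
      sub_eq_add_neg]
    rfl
  h'_b := uBar_mul _ _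
  h_e := by rw [κ_apply, uBase_mul, D.lie_h_e h𝔥, D.root_coroot, map_smul]
  h_e' := by rw [κ_apply, uBase_mul_uBar, D.lie_h_e h𝔥, D.root_coroot, map_smul]
  h'_e := by rw [κ'_apply, uBar_mul_uBase, D.lie_h_e h𝔥, D.root_coroot, map_smul]
  h'_e' := uBar_mul _ _
  e_e' := by rw [uBase_mul_uBar, lie_self, map_zero, add_zero]
  h_h' := by rw [κ_apply, κ'_apply, uBase_mul_uBar, lie_self, map_zero, add_zero]

include h𝔥 in
lemma κ_a (h : 𝔥) : κ 𝔥 h * D.pair.a = D.pair.a * κ 𝔥 h - α h • D.pair.a := by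
  rw [pair_a, κ_apply, uBase_mul, D.lie_h_f h𝔥, map_neg, map_smul, sub_eq_add_neg]

include h𝔥 in
lemma κ_b (h : 𝔥) : κ 𝔥 h * D.pair.b = D.pair.b * κ 𝔥 h - α h • D.pair.b := by
  rw [pair_b, κ_apply, uBase_mul_uBar, D.lie_h_f h𝔥, map_neg, map_smul, sub_eq_add_neg]

include h𝔥 in
lemma κ'_a (h : 𝔥) : κ' 𝔥 h * D.pair.a = D.pair.a * κ' 𝔥 h - α h • D.pair.b := by
  rw [pair_a, κ'_apply, uBar_mul_uBase, D.lie_h_f h𝔥, map_neg, map_smul, sub_eq_add_neg]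
  rfl

lemma κ'_b (h : 𝔥) : κ' 𝔥 h * D.pair.b = D.pair.b * κ' 𝔥 h := uBar_mul _ _

include h𝔥 in
lemma κ'_e (h : 𝔥) : κ' 𝔥 h * uBase D.e = uBase D.e * κ' 𝔥 h + α h • uBar D.e := by
  rw [κ'_apply, uBar_mul_uBase, D.lie_h_e h𝔥, map_smul]

include h𝔥 in
lemma κ_κ' (h h' : 𝔥) : κ 𝔥 h * κ' 𝔥 h' = κ' 𝔥 h' * κ 𝔥 h := by
  rw [κ_apply, κ'_apply, uBase_mul_uBar, h𝔥.lie_cartan, map_zero, add_zero]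

include h𝔥 in
lemma cartanAction : (D.triple h𝔥).CartanAction (κ 𝔥) α where
  a := D.κ_a h𝔥
  b := D.κ_b h𝔥
  e h := by
    change κ 𝔥 h * uBase D.e = uBase D.e * κ 𝔥 h + α h • uBase D.e
    rw [κ_apply, uBase_mul, D.lie_h_e h𝔥, map_smul]
  e' h := by
    change κ 𝔥 h * uBar D.e = uBar D.e * κ 𝔥 h + α h • uBar D.e
    rw [κ_apply, uBase_mul_uBar, D.lie_h_e h𝔥, map_smul]
  h h := by
    change κ 𝔥 h * κ 𝔥 D.coroot = κ 𝔥 D.coroot * κ 𝔥 h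
    rw [κ_apply, κ_apply, uBase_mul, h𝔥.lie_cartan, map_zero, add_zero]
  h' h := κ_κ' h𝔥 h D.coroot
  exists_coroot := ⟨D.coroot, rfl, D.root_coroot⟩

-- Split off a multiple of `h_α`: the barred remainder, on which `α` vanishes, commutes with every
-- factor of the Casimir element, and `h̄_α` is covered by `casimir_h'`.
include h𝔥 in
lemma casimir_κ' (h : 𝔥) :
    (D.triple h𝔥).casimir * κ' 𝔥 h = κ' 𝔥 h * (D.triple h𝔥).casimir := by
  obtain ⟨k, t, hk, rfl⟩ : ∃ (k : 𝔥) (t : ℂ), α k = 0 ∧ h = k + t • D.coroot :=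
    ⟨h - (α h / 2) • D.coroot, α h / 2, by simp [D.root_coroot], by simp⟩
  have h1 : (D.triple h𝔥).casimir * κ' 𝔥 k = κ' 𝔥 k * (D.triple h𝔥).casimir := by
    have ka : κ' 𝔥 k * D.pair.a = D.pair.a * κ' 𝔥 k := by
      rw [D.κ'_a h𝔥, hk, zero_smul, sub_zero]
    have ke : κ' 𝔥 k * (D.triple h𝔥).e = (D.triple h𝔥).e * κ' 𝔥 k := by
      have := D.κ'_e h𝔥 k
      rw [hk, zero_smul, add_zero] at this
      exact this
    have kb := D.κ'_b k
    have ke' : κ' 𝔥 k * (D.triple h𝔥).e' = (D.triple h𝔥).e' * κ' 𝔥 k := uBar_mul _ _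
    have kh : κ' 𝔥 k * (D.triple h𝔥).h = (D.triple h𝔥).h * κ' 𝔥 k := (κ_κ' h𝔥 D.coroot k).symm
    have kh' : κ' 𝔥 k * (D.triple h𝔥).h' = (D.triple h𝔥).h' * κ' 𝔥 k := uBar_mul _ _
    have c : ∀ {x y : UTakiff 𝔤}, κ' 𝔥 k * x = x * κ' 𝔥 k → κ' 𝔥 k * y = y * κ' 𝔥 k →
        Commute (κ' 𝔥 k) (x * y) := fun hx hy => Commute.mul_right hx hy
    unfold TakiffTriple.casimir
    have c2 : Commute (κ' 𝔥 k) (2 : UTakiff 𝔤) := Commute.ofNat_right _ _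
    exact ((((c2.mul_right (c ke' ka)).add_right (c2.mul_right (c ke kb))).add_right
      (c kh' kh)).sub_right (c2.mul_right kh')).eq.symm
  rw [map_add, map_smul, mul_add, add_mul, h1, mul_smul_comm, smul_mul_assoc]
  congr 2
  exact (D.triple h𝔥).casimir_h'

lemma locNilpotent_of_killedBy {V : Submodule ℂ 𝔤} {M : Type u} [AddCommGroup M]
    [Module (UTakiff 𝔤) M] (h : ∀ m : M, ∃ n, KilledBy (uSub V : Set (UTakiff 𝔤)) n m) {u : UTakiff 𝔤}
    (hu : u ∈ uSub V) : LocNilpotent u M := fun m => by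
  obtain ⟨n, hn⟩ := h m
  exact ⟨n, hn.pow_smul hu⟩

end TwistingData

end Triple

/-! ### Local finiteness and local nilpotency -/

section LocallyFinite

variable {A : Type u} [Ring A] [Algebra ℂ A] {M : Type u} [AddCommGroup M] [Module A M]

/-- All `n`-fold commutators of elements of `V` with `u` vanish. -/
def AdKilledBy (V : Set A) : ℕ → A → Prop
  | 0, u => u = 0
  | n + 1, u => ∀ x ∈ V, AdKilledBy V n (x * u - u * x)

lemma AdKilledBy.zero (V : Set A) (n : ℕ) : AdKilledBy V n (0 : A) := by
  induction n with
  | zero => rfl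
  | succ n ih => intro x _; rw [mul_zero, zero_mul, sub_zero]; exact ih

lemma AdKilledBy.add {V : Set A} {n : ℕ} {u v : A} (h : AdKilledBy V n u) (h' : AdKilledBy V n v) :
    AdKilledBy V n (u + v) := by
  induction n generalizing u v with
  | zero => rw [show u = 0 from h, show v = 0 from h', add_zero]; rfl
  | succ n ih =>
    intro x hx
    rw [mul_add, add_mul, add_sub_add_comm]
    exact ih (h x hx) (h' x hx)

lemma AdKilledBy.succ {V : Set A} {n : ℕ} {u : A} (h : AdKilledBy V n u) :
    AdKilledBy V (n + 1) u := by
  induction n generalizing u with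
  | zero => rw [show u = 0 from h]; exact AdKilledBy.zero _ _
  | succ n ih => intro x hx; exact ih (h x hx)

lemma AdKilledBy.mono {V : Set A} {n k : ℕ} (hnk : n ≤ k) {u : A} (h : AdKilledBy V n u) :
    AdKilledBy V k u := by
  induction k, hnk using Nat.le_induction with
  | base => exact h
  | succ k _ ih => exact ih.succ

/-- By the Leibniz rule, among `n + r` operators either `r` of them act on `u` by commutators or `n`
of them reach `m`. -/
lemma AdKilledBy.smul {V : Set A} {r n : ℕ} {u : A} (hu : AdKilledBy V r u) {m : M}
    (hm : KilledBy V n m) : KilledBy V (n + r) (u • m) := by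
  induction r generalizing u n m with
  | zero => rw [show u = 0 from hu, zero_smul]; exact KilledBy.zero _ _
  | succ r ihr =>
    induction n generalizing m with
    | zero => rw [show m = 0 from hm, smul_zero]; exact KilledBy.zero _ _
    | succ n ihn =>
      intro x hx
      have e : x • u • m = u • x • m + (x * u - u * x) • m := by
        rw [sub_smul, mul_smul, mul_smul]; abel
      rw [e]
      suffices h : KilledBy V (n + (r + 1)) (u • x • m + (x * u - u * x) • m) by
        rwa [show n + (r + 1) = n + 1 + r by omega] at h
      refine KilledBy.add (ihn (hm x hx)) ?_
      have := ihr (hu x hx) hm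
      rwa [show n + 1 + r = n + (r + 1) by omega] at this

variable [Module ℂ M] [IsScalarTower ℂ A M]

lemma KilledBy.smul_scalar {V : Set A} {n : ℕ} {m : M} (h : KilledBy V n m) (t : ℂ) :
    KilledBy V n (t • m) := (TakiffTriple.killed V n M).smul_mem t h

/-- The vectors moved into a subspace `W` by `m ↦ x m`, for `x` in the span of `s`. -/
lemma span_smul_mem {s : Set A} (W : Submodule ℂ M) {m : M} (h : ∀ x ∈ s, x • m ∈ W) :
    ∀ x ∈ Submodule.span ℂ s, x • m ∈ W := by
  intro x hx
  induction hx using Submodule.span_induction with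
  | mem x hx => exact h x hx
  | zero => rw [zero_smul]; exact zero_mem _
  | add x y _ _ hx hy => rw [add_smul]; exact add_mem hx hy
  | smul t x _ hx => rw [smul_assoc]; exact W.smul_mem t hx

lemma exists_stable_of_killedBy (V : Submodule ℂ A) (hV : V.FG) {n : ℕ} {m : M}
    (hm : KilledBy (V : Set A) n m) : ∃ W : Submodule ℂ M, FiniteDimensional ℂ W ∧ m ∈ W ∧
      ∀ x ∈ V, ∀ w ∈ W, x • w ∈ W := by
  induction n generalizing m with
  | zero => exact ⟨⊥, inferInstance, hm, fun x _ w hw => by simp_all⟩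
  | succ n ih =>
    obtain ⟨s, hs⟩ := hV
    have hsV : ∀ x ∈ s, x ∈ V := fun x hx => hs ▸ Submodule.subset_span hx
    choose W hW1 hW2 hW3 using fun x : s => ih (hm x (hsV x x.2))
    refine ⟨(⨆ x, W x) ⊔ ℂ ∙ m, inferInstance,
      le_sup_right (a := ⨆ x, W x) (Submodule.mem_span_singleton_self m), fun x hx w hw => ?_⟩
    refine le_sup_left (b := ℂ ∙ m) ?_
    obtain ⟨w₁, hw₁, w₂, hw₂, rfl⟩ := Submodule.mem_sup.mp hw
    obtain ⟨t, rfl⟩ := Submodule.mem_span_singleton.mp hw₂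
    rw [smul_add, smul_comm]
    refine add_mem ?_ (Submodule.smul_mem _ _ ?_)
    · suffices h : (⨆ x, W x) ≤ (⨆ x, W x).comap (Algebra.lsmul ℂ ℂ M x) from h hw₁
      exact iSup_le fun y w hw => le_iSup W y (hW3 y x hx w hw)
    · rw [← hs] at hx
      exact span_smul_mem _ (fun y hy => le_iSup W ⟨y, hy⟩ (hW2 ⟨y, hy⟩)) x hx

/-- A locally nilpotent element is nilpotent on a finite-dimensional subspace. -/
lemma LocNilpotent.exists_pow {x : A} (hx : LocNilpotent x M) (W : Submodule ℂ M)
    [FiniteDimensional ℂ W] : ∃ n : ℕ, ∀ w ∈ W, x ^ n • w = 0 := by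
  obtain ⟨s, hs⟩ := (Submodule.fg_iff_finiteDimensional W).mpr inferInstance
  choose n hn using hx
  refine ⟨s.sup n, fun w hw => ?_⟩
  rw [← hs] at hw
  induction hw using Submodule.span_induction with
  | mem w hw =>
    rw [← Nat.sub_add_cancel (Finset.le_sup (f := n) hw), pow_add, mul_smul, hn, smul_zero]
  | zero => rw [smul_zero]
  | add v w _ _ hv hw => rw [smul_add, hv, hw, add_zero]
  | smul t w _ hw => rw [smul_comm, hw, smul_zero]

lemma exists_stable_of_commute [DecidableEq A] (s : Finset A) (hs : ∀ x ∈ s, ∀ y ∈ s, Commute x y)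
    (hnil : ∀ x ∈ s, LocNilpotent x M) (m : M) : ∃ W : Submodule ℂ M, FiniteDimensional ℂ W ∧
      m ∈ W ∧ ∀ x ∈ s, ∀ w ∈ W, x • w ∈ W := by
  induction s using Finset.induction_on with
  | empty =>
    exact ⟨ℂ ∙ m, inferInstance, Submodule.mem_span_singleton_self m, fun x hx => by simp at hx⟩
  | insert x s hx ih =>
    obtain ⟨W, hW1, hW2, hW3⟩ := ih (fun y hy z hz => hs y (Finset.mem_insert_of_mem hy) z
      (Finset.mem_insert_of_mem hz)) (fun y hy => hnil y (Finset.mem_insert_of_mem hy))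
    obtain ⟨n, hn⟩ := (hnil x (Finset.mem_insert_self x s)).exists_pow W
    let W' : Submodule ℂ M := ⨆ i : Fin (n + 1), W.map (Algebra.lsmul ℂ ℂ M (x ^ (i : ℕ)))
    have hmem : ∀ i : ℕ, ∀ w ∈ W, x ^ i • w ∈ W' := by
      intro i w hw
      by_cases h : i < n + 1
      · exact le_iSup (fun i : Fin (n + 1) => W.map (Algebra.lsmul ℂ ℂ M (x ^ (i : ℕ)))) ⟨i, h⟩
          ⟨w, hw, rfl⟩
      · rw [← Nat.sub_add_cancel (show n ≤ i by omega), pow_add, mul_smul, hn w hw, smul_zero]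
        exact zero_mem _
    refine ⟨W', inferInstance, by simpa using hmem 0 m hW2, fun y hy w hw => ?_⟩
    suffices h : W' ≤ W'.comap (Algebra.lsmul ℂ ℂ M y) from h hw
    refine iSup_le fun i => ?_
    clear hw w
    rintro _ ⟨w, hw, rfl⟩
    change y • x ^ (i : ℕ) • w ∈ W'
    rcases Finset.mem_insert.mp hy with rfl | hy'
    · rw [← mul_smul, ← pow_succ']
      exact hmem _ w hw
    · rw [← mul_smul, ((hs y hy x (Finset.mem_insert_self x s)).pow_right i).eq, mul_smul]
      exact hmem _ _ (hW3 y hy' w hw)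

/-- If `p`, `q` are commuting locally nilpotent elements normalising `𝔪`, then vectors killed by
powers of `𝔪` are killed by powers of `𝔪 + ℂ p + ℂ q`. -/
lemma KilledBy.sup_span (𝔪 : Submodule ℂ A) (hfg : 𝔪.FG) {p q : A} (hpq : Commute p q)
    (hp : ∀ x ∈ 𝔪, p * x - x * p ∈ 𝔪) (hq : ∀ x ∈ 𝔪, q * x - x * q ∈ 𝔪)
    (hnp : LocNilpotent p M) (hnq : LocNilpotent q M) {n : ℕ} {m : M}
    (hm : KilledBy (𝔪 : Set A) n m) :
    ∃ N, KilledBy ((𝔪 ⊔ Submodule.span ℂ {p, q} : Submodule ℂ A) : Set A) N m := by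
  induction n generalizing m with
  | zero => exact ⟨0, hm⟩
  | succ n ih =>
    set V : Submodule ℂ A := 𝔪 ⊔ Submodule.span ℂ {p, q} with hV
    have hpow : ∀ {y : A}, (∀ x ∈ 𝔪, y * x - x * y ∈ 𝔪) → ∀ (i : ℕ) {m : M} {k : ℕ},
        KilledBy (𝔪 : Set A) k m → KilledBy (𝔪 : Set A) k (y ^ i • m) := by
      intro y hy i m k hm
      induction i with
      | zero => simpa using hm
      | succ i ih =>
        rw [pow_succ', mul_smul]
        exact KilledBy.smul_of_normalizes (fun x hx => by
          have := neg_mem (hy x hx)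
          rwa [neg_sub] at this) ih
    obtain ⟨k, hk⟩ := hnp m
    obtain ⟨l, hl⟩ := hnq m
    obtain ⟨s, hs⟩ := hfg
    have hs𝔪 : ∀ x ∈ s, x ∈ 𝔪 := fun x hx => hs ▸ Submodule.subset_span hx
    choose N hN using fun (x : s) (i j : ℕ) =>
      ih (hpow hp i (hpow hq j hm) x (hs𝔪 x x.2))
    let B : ℕ := Finset.univ.sup fun t : s × Fin k × Fin l => N t.1 t.2.1 t.2.2
    have hB : ∀ i j : ℕ, i < k → j < l → ∀ x ∈ 𝔪, KilledBy (V : Set A) B (x • p ^ i • q ^ j • m) := by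
      intro i j hi hj x hx
      rw [← hs] at hx
      refine span_smul_mem (TakiffTriple.killed (V : Set A) B M) (fun x hx => ?_) x hx
      exact (hN ⟨x, hx⟩ i j).mono (Finset.le_sup (f := fun t : s × Fin k × Fin l =>
        N t.1 t.2.1 t.2.2) (Finset.mem_univ (⟨x, hx⟩, ⟨i, hi⟩, ⟨j, hj⟩)))
    have hzero : ∀ i j : ℕ, k ≤ i ∨ l ≤ j → p ^ i • q ^ j • m = 0 := by
      rintro i j (h | h)
      · rw [← mul_smul, (hpq.pow_pow i j).eq, mul_smul, ← Nat.sub_add_cancel h, pow_add p, mul_smul,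
          hk, smul_zero, smul_zero]
      · rw [← Nat.sub_add_cancel h, pow_add q, mul_smul (q ^ (j - l)), hl, smul_zero, smul_zero]
    -- A factor `p` or `q` raises `i` or `j`, which leads to zero within the number of steps
    -- recorded by `d`. A factor from `𝔪` gives a vector covered by the outer induction, with the
    -- common bound `B` because `𝔪` is finitely generated and only finitely many `(i, j)` occur.
    have key : ∀ d i j : ℕ, k + l ≤ i + j + d → KilledBy (V : Set A) (B + d) (p ^ i • q ^ j • m) := by
      intro d
      induction d with
      | zero =>
        intro i j h
        rw [hzero i j (by omega)]
        exact KilledBy.zero _ _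
      | succ d ihd =>
        intro i j h
        by_cases h0 : k ≤ i ∨ l ≤ j
        · rw [hzero i j h0]
          exact KilledBy.zero _ _
        push Not at h0
        intro x hx
        obtain ⟨x, hx𝔪, y, hy, rfl⟩ := Submodule.mem_sup.mp hx
        obtain ⟨a, b, rfl⟩ := Submodule.mem_span_pair.mp hy
        rw [add_smul, add_smul, smul_assoc, smul_assoc]
        have h1 := (ihd (i + 1) j (by omega)).smul_scalar a
        have h2 := (ihd i (j + 1) (by omega)).smul_scalar b
        rw [pow_succ', mul_smul] at h1
        rw [pow_succ', mul_smul, ← mul_smul (p ^ i) q, (hpq.pow_left i).eq, mul_smul] at h2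
        exact ((hB i j h0.1 h0.2 x hx𝔪).mono (Nat.le_add_right B d)).add (h1.add h2)
    exact ⟨B + (k + l), by simpa using key (k + l) 0 0 (by omega)⟩

/-- Generalised eigenvectors of `x` are preserved by elements on which `ad x` is nilpotent. -/
lemma exists_pow_smul_smul_eq_zero {x u : A} (hu : AdNil x u) {m : M} {k : ℕ}
    (hm : x ^ k • m = 0) : ∃ j : ℕ, x ^ j • u • m = 0 := by
  obtain ⟨j, y, h⟩ := hu.movesPast k
  exact ⟨j, by rw [← mul_smul, h, mul_smul, hm, smul_zero]⟩

end LocallyFinite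

/-! ### Modules in category `𝒪` -/

section Modules

variable {𝔤 : Type u} [LieRing 𝔤] [LieAlgebra ℂ 𝔤] [FiniteDimensional ℂ 𝔤]
  (𝔥 : LieSubalgebra ℂ 𝔤) [LieRing.IsNilpotent 𝔥] (Δ : Set (Module.Dual ℂ 𝔥))
  (μ : Module.Dual ℂ 𝔥)

/-- The conditions defining `𝒪_ε^μ`, except for finite generation. -/
structure IsOmu (M : Type u) [AddCommGroup M] [Module (UTakiff 𝔤) M] : Prop where
  wt : WtDecomp (κ 𝔥) M
  killed : ∀ m : M, ∃ n, KilledBy (uSub (nPlus 𝔥 Δ) : Set (UTakiff 𝔤)) n m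
  eig : ∀ h : 𝔥, LocGenEigen (κ' 𝔥 h) (μ h) M

variable {𝔥 Δ μ}

lemma isHSemisimple_iff {M : Type u} [AddCommGroup M] [Module (UTakiff 𝔤) M] :
    IsHSemisimple 𝔥 M ↔ WtDecomp (κ 𝔥) M :=
  ⟨fun h => wtDecomp_of_closure h, fun h => h.closure_eq_top⟩

lemma uSub_nPlus_induction {p : UTakiff 𝔤 → Prop} (h0 : p 0)
    (hadd : ∀ u v, p u → p v → p (u + v))
    (hbase : ∀ β ∈ posRoots 𝔥 Δ, ∀ x ∈ LieAlgebra.rootSpace 𝔥 β, p (uBase x))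
    (hbar : ∀ β ∈ posRoots 𝔥 Δ, ∀ x ∈ LieAlgebra.rootSpace 𝔥 β, p (uBar x))
    {u : UTakiff 𝔤} (hu : u ∈ uSub (nPlus 𝔥 Δ)) : p u := by
  have key : ∀ f : 𝔤 →ₗ[ℂ] UTakiff 𝔤,
      (∀ β ∈ posRoots 𝔥 Δ, ∀ x ∈ LieAlgebra.rootSpace 𝔥 β, p (f x)) →
      ∀ x ∈ nPlus 𝔥 Δ, p (f x) := by
    intro f hf x hx
    refine Submodule.iSup_induction _ (motive := fun x => p (f x)) hx (fun β x hx => ?_)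
      (by rwa [map_zero]) (fun x y hx hy => by rw [map_add]; exact hadd _ _ hx hy)
    refine Submodule.iSup_induction _ (motive := fun x => p (f x)) hx (fun hβ x hx => hf β hβ x hx)
      (by rwa [map_zero]) (fun x y hx hy => by rw [map_add]; exact hadd _ _ hx hy)
  obtain ⟨x, hx, y, hy, rfl⟩ := mem_uSub.mp hu
  exact hadd _ _ (key _ hbase x hx) (key _ hbar y hy)

lemma IsSplit.induction (h𝔥 : IsSplit 𝔥) {p : 𝔤 → Prop} (h0 : p 0)
    (hadd : ∀ x y, p x → p y → p (x + y))
    (hroot : ∀ β : Module.Dual ℂ 𝔥, ∀ x ∈ LieAlgebra.rootSpace 𝔥 β, p x) (x : 𝔤) : p x := by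
  have hx : x ∈ ⨆ β : Module.Dual ℂ 𝔥, (LieAlgebra.rootSpace 𝔥 β).toSubmodule := by
    rw [h𝔥.iSup_eq_top]; trivial
  exact Submodule.iSup_induction _ (motive := p) hx hroot h0 hadd

lemma IsSplit.κ_mul_uBase (h𝔥 : IsSplit 𝔥) {β : Module.Dual ℂ 𝔥} {x : 𝔤}
    (hx : x ∈ LieAlgebra.rootSpace 𝔥 β) (h : 𝔥) :
    κ 𝔥 h * uBase x = uBase x * κ 𝔥 h + β h • uBase x := by
  rw [κ_apply, uBase_mul, h𝔥.lie_root β x hx, map_smul]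

lemma IsSplit.κ_mul_uBar (h𝔥 : IsSplit 𝔥) {β : Module.Dual ℂ 𝔥} {x : 𝔤}
    (hx : x ∈ LieAlgebra.rootSpace 𝔥 β) (h : 𝔥) :
    κ 𝔥 h * uBar x = uBar x * κ 𝔥 h + β h • uBar x := by
  rw [κ_apply, uBase_mul_uBar, h𝔥.lie_root β x hx, map_smul]

lemma IsSplit.lie_mem_rootSpace (h𝔥 : IsSplit 𝔥) {β γ : Module.Dual ℂ 𝔥} {x y : 𝔤}
    (hx : x ∈ LieAlgebra.rootSpace 𝔥 γ) (hy : y ∈ LieAlgebra.rootSpace 𝔥 β) :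
    ⁅x, y⁆ ∈ LieAlgebra.rootSpace 𝔥 (β + γ : Module.Dual ℂ 𝔥) :=
  mem_rootSpace_of_lie_eq fun h => h𝔥.lie_lie hx hy h

section AdNilpotent

variable (h𝔥 : IsSplit 𝔥) (hΔ : IsSimpleSystem 𝔥 Δ)

include h𝔥 in
lemma exists_degree_bound (H : 𝔥) : ∃ K : ℕ, ∀ β ∈ insert 0 (roots 𝔥), ∀ γ ∈ insert 0 (roots 𝔥),
    ∀ k : ℕ, γ H = β H + k → k < K := by
  have hF : (insert 0 (roots 𝔥)).Finite := h𝔥.finite.insert 0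
  have h1 : (Set.image2 (fun γ β : Module.Dual ℂ 𝔥 => γ H - β H) (insert 0 (roots 𝔥))
    (insert 0 (roots 𝔥))).Finite := hF.image2 _ hF
  obtain ⟨K, hK⟩ := (h1.preimage (f := fun k : ℕ => (k : ℂ))
    (fun x _ y _ h => Nat.cast_injective h)).bddAbove
  exact ⟨K + 1, fun β hβ γ hγ k hk => Nat.lt_succ_of_le
    (hK ⟨γ, hγ, β, hβ, by simp [hk]⟩)⟩

include h𝔥 in
lemma mem_insert_roots {β : Module.Dual ℂ 𝔥} {x : 𝔤} (hx : x ∈ LieAlgebra.rootSpace 𝔥 β)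
    (hx0 : x ≠ 0) : β ∈ insert 0 (roots 𝔥) := by
  by_cases h : β = 0
  · exact Or.inl h
  · refine Or.inr ⟨h, fun hb => hx0 ?_⟩
    rw [hb] at hx
    exact hx

-- Measured by the grading element `H`, each bracket with a positive root vector raises the degree
-- by a positive integer, and the degrees of the roots and of `0` form a finite set.
include h𝔥 hΔ in
lemma exists_adKilledBy (x : 𝔤) : ∃ r,
    AdKilledBy (uSub (nPlus 𝔥 Δ) : Set (UTakiff 𝔤)) r (uBase x) ∧
      AdKilledBy (uSub (nPlus 𝔥 Δ) : Set (UTakiff 𝔤)) r (uBar x) := by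
  obtain ⟨H, hH⟩ := hΔ.exists_grading
  obtain ⟨K, hK⟩ := exists_degree_bound h𝔥 H
  have key : ∀ (r : ℕ) (β : Module.Dual ℂ 𝔥) (x : 𝔤), x ∈ LieAlgebra.rootSpace 𝔥 β →
      (∀ γ ∈ insert 0 (roots 𝔥), ∀ k : ℕ, γ H = β H + k → k < r) →
      AdKilledBy (uSub (nPlus 𝔥 Δ) : Set (UTakiff 𝔤)) r (uBase x) ∧
      AdKilledBy (uSub (nPlus 𝔥 Δ) : Set (UTakiff 𝔤)) r (uBar x) := by
    intro r
    induction r with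
    | zero =>
      intro β x hx hr
      have : x = 0 := by
        by_contra hx0
        exact absurd (hr β (mem_insert_roots h𝔥 hx hx0) 0 (by simp)) (by omega)
      rw [this, map_zero, map_zero]
      exact ⟨rfl, rfl⟩
    | succ r ih =>
      intro β x hx hr
      have hrec : ∀ γ ∈ posRoots 𝔥 Δ, ∀ y ∈ LieAlgebra.rootSpace 𝔥 γ,
          AdKilledBy (uSub (nPlus 𝔥 Δ) : Set (UTakiff 𝔤)) r (uBase ⁅y, x⁆) ∧
          AdKilledBy (uSub (nPlus 𝔥 Δ) : Set (UTakiff 𝔤)) r (uBar ⁅y, x⁆) := by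
        intro γ hγ y hy
        obtain ⟨d, hd, hγd⟩ := hH γ hγ.2 hγ.1.1
        refine ih (β + γ) _ (h𝔥.lie_mem_rootSpace hy hx) fun δ hδ k hk => ?_
        have := hr δ hδ (d + k) (by rw [hk, LinearMap.add_apply, hγd]; push_cast; ring)
        omega
      constructor
      · intro u hu
        refine uSub_nPlus_induction (𝔥 := 𝔥) (Δ := Δ)
          (p := fun u => AdKilledBy (uSub (nPlus 𝔥 Δ) : Set (UTakiff 𝔤)) r
            (u * uBase x - uBase x * u)) ?_ ?_ ?_ ?_ hu
        · simpa using AdKilledBy.zero _ _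
        · intro u v hu hv
          rw [add_mul, mul_add, add_sub_add_comm]
          exact hu.add hv
        · intro γ hγ y hy
          rw [uBase_mul, add_sub_cancel_left]
          exact (hrec γ hγ y hy).1
        · intro γ hγ y hy
          rw [uBar_mul_uBase, add_sub_cancel_left]
          exact (hrec γ hγ y hy).2
      · intro u hu
        refine uSub_nPlus_induction (𝔥 := 𝔥) (Δ := Δ)
          (p := fun u => AdKilledBy (uSub (nPlus 𝔥 Δ) : Set (UTakiff 𝔤)) r
            (u * uBar x - uBar x * u)) ?_ ?_ ?_ ?_ hu
        · simpa using AdKilledBy.zero _ _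
        · intro u v hu hv
          rw [add_mul, mul_add, add_sub_add_comm]
          exact hu.add hv
        · intro γ hγ y hy
          rw [uBase_mul_uBar, add_sub_cancel_left]
          exact (hrec γ hγ y hy).2
        · intro γ hγ y hy
          rw [uBar_mul, sub_self]
          exact AdKilledBy.zero _ _
  refine h𝔥.induction (p := fun x => ∃ r,
    AdKilledBy (uSub (nPlus 𝔥 Δ) : Set (UTakiff 𝔤)) r (uBase x) ∧
      AdKilledBy (uSub (nPlus 𝔥 Δ) : Set (UTakiff 𝔤)) r (uBar x)) ?_ ?_ ?_ x
  · exact ⟨0, map_zero _, map_zero _⟩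
  · rintro x y ⟨r, h1, h2⟩ ⟨s, h3, h4⟩
    rw [map_add, map_add]
    exact ⟨r + s, (h1.mono (by omega)).add (h3.mono (by omega)),
      (h2.mono (by omega)).add (h4.mono (by omega))⟩
  · intro β x hx
    by_cases hx0 : x = 0
    · rw [hx0]; exact ⟨0, map_zero _, map_zero _⟩
    · exact ⟨K, key K β x hx fun γ hγ k hk => hK β (mem_insert_roots h𝔥 hx hx0) γ hγ k hk⟩

/-- Subtracting a scalar does not change commutators. The commutator of `h̄` with `x` is barred and
barred elements commute, so `ad` squares to zero on the generators, and local nilpotency passes to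
sums and products. -/
lemma adNil_κ' (h : 𝔥) (t : ℂ) (u : UTakiff 𝔤) : AdNil (κ' 𝔥 h - algebraMap ℂ _ t) u := by
  have e : (fun y : UTakiff 𝔤 => (κ' 𝔥 h - algebraMap ℂ _ t) * y -
      y * (κ' 𝔥 h - algebraMap ℂ _ t)) = fun y => κ' 𝔥 h * y - y * κ' 𝔥 h := by
    funext y
    rw [sub_mul, mul_sub, Algebra.commutes t y]
    abel
  have hiff : ∀ u : UTakiff 𝔤, (∃ n : ℕ, (fun y => κ' 𝔥 h * y - y * κ' 𝔥 h)^[n] u = 0) →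
      AdNil (κ' 𝔥 h - algebraMap ℂ _ t) u := by
    rintro u ⟨n, hn⟩
    exact ⟨n, by rw [e, hn]⟩
  induction u using uTakiff_induction with
  | hC r => exact hiff _ ⟨1, by simp [Algebra.commutes]⟩
  | hbase x =>
    refine hiff _ ⟨2, ?_⟩
    simp only [Function.iterate_succ, Function.iterate_zero, Function.comp_apply, id]
    rw [κ'_apply, uBar_mul_uBase, add_sub_cancel_left, uBar_mul, sub_self]
  | hbar x => exact hiff _ ⟨1, by simp [κ'_apply, uBar_mul]⟩
  | hadd u v hu hv => exact hu.add hv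
  | hmul u v hu hv => exact hu.mul hv

end AdNilpotent

end Modules

/-! ### Nilpotency form of `𝒪_ε^μ`, largest submodules, bounded weights -/

section Modules

variable {𝔤 : Type u} [LieRing 𝔤] [LieAlgebra ℂ 𝔤] [FiniteDimensional ℂ 𝔤]
  {𝔥 : LieSubalgebra ℂ 𝔤} [LieRing.IsNilpotent 𝔥] {Δ : Set (Module.Dual ℂ 𝔥)}
  {μ : Module.Dual ℂ 𝔥} (h𝔥 : IsSplit 𝔥) (hΔ : IsSimpleSystem 𝔥 Δ)
  {M : Type u} [AddCommGroup M] [Module (UTakiff 𝔤) M]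

section Graded

variable [Module ℂ M] [IsScalarTower ℂ (UTakiff 𝔤) M]

include h𝔥 in
lemma κ_smul_uBase_smul {β : Module.Dual ℂ 𝔥} {x : 𝔤} (hx : x ∈ LieAlgebra.rootSpace 𝔥 β)
    {H : 𝔥} {t : ℂ} {m : M} (hm : κ 𝔥 H • m = t • m) :
    κ 𝔥 H • uBase x • m = (t + β H) • uBase x • m := by
  rw [← mul_smul, h𝔥.κ_mul_uBase hx, add_smul, mul_smul, hm, smul_assoc, smul_comm, ← add_smul]

include h𝔥 in
lemma κ_smul_uBar_smul {β : Module.Dual ℂ 𝔥} {x : 𝔤} (hx : x ∈ LieAlgebra.rootSpace 𝔥 β)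
    {H : 𝔥} {t : ℂ} {m : M} (hm : κ 𝔥 H • m = t • m) :
    κ 𝔥 H • uBar x • m = (t + β H) • uBar x • m := by
  rw [← mul_smul, h𝔥.κ_mul_uBar hx, add_smul, mul_smul, hm, smul_assoc, smul_comm, ← add_smul]

include h𝔥 hΔ in
/-- In a finite-dimensional `𝔫_ε`-stable subspace, weight vectors are killed by powers of
`𝔫_ε`. -/
lemma killedBy_of_stable (W : Submodule ℂ M) [FiniteDimensional ℂ W]
    (hW : ∀ u ∈ uSub (nPlus 𝔥 Δ), ∀ w ∈ W, u • w ∈ W) {m : M} (hm : m ∈ W) {l : Module.Dual ℂ 𝔥}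
    (hl : IsWt (κ 𝔥) l m) : ∃ n, KilledBy (uSub (nPlus 𝔥 Δ) : Set (UTakiff 𝔤)) n m := by
  obtain ⟨H, hH⟩ := hΔ.exists_grading
  let f : Module.End ℂ M := Algebra.lsmul ℂ ℂ M (κ 𝔥 H)
  -- Eigenvectors of `H` with distinct eigenvalues are independent, so only finitely many shifts `k`
  -- occur in `W`; since `𝔫_ε` strictly raises `k`, long products vanish.
  let T : Set ℕ := {k | ∃ w ∈ W, w ≠ 0 ∧ κ 𝔥 H • w = (l H + k) • w}
  have hT : T.Finite := by
    choose w hw1 hw2 hw3 using fun k : T => k.2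
    have h1 : LinearIndependent ℂ w :=
      Module.End.eigenvectors_linearIndependent' f (fun k : T => l H + (k : ℕ))
        (fun x y hxy => Subtype.ext (by simpa using hxy)) w
        (fun k => ⟨Module.End.mem_eigenspace_iff.mpr (hw3 k), hw2 k⟩)
    have h2 : LinearIndependent ℂ (fun k => (⟨w k, hw1 k⟩ : W)) :=
      LinearIndependent.of_comp W.subtype h1
    have := h2.finite
    exact Set.toFinite T
  obtain ⟨K, hK⟩ := hT.bddAbove
  have key : ∀ (j k : ℕ) (w : M), w ∈ W → κ 𝔥 H • w = (l H + k) • w → K < k + j →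
      KilledBy (uSub (nPlus 𝔥 Δ) : Set (UTakiff 𝔤)) j w := by
    intro j
    induction j with
    | zero =>
      intro k w hw hwk hk
      by_contra h0
      exact absurd (hK ⟨w, hw, h0, hwk⟩) (by omega)
    | succ j ih =>
      intro k w hw hwk hk u hu
      refine uSub_nPlus_induction (𝔥 := 𝔥) (Δ := Δ)
        (p := fun u => KilledBy (uSub (nPlus 𝔥 Δ) : Set (UTakiff 𝔤)) j (u • w)) ?_ ?_ ?_ ?_ hu
      · rw [zero_smul]; exact KilledBy.zero _ _
      · intro u v hu hv; rw [add_smul]; exact hu.add hv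
      · intro β hβ x hx
        obtain ⟨d, hd, hβd⟩ := hH β hβ.2 hβ.1.1
        refine ih (k + d) _ (hW _ (uBase_mem_uSub (rootSpace_le_nPlus hβ hx)) w hw) ?_ (by omega)
        rw [κ_smul_uBase_smul h𝔥 hx hwk, hβd, Nat.cast_add, add_assoc]
      · intro β hβ x hx
        obtain ⟨d, hd, hβd⟩ := hH β hβ.2 hβ.1.1
        refine ih (k + d) _ (hW _ (uBar_mem_uSub (rootSpace_le_nPlus hβ hx)) w hw) ?_ (by omega)
        rw [κ_smul_uBar_smul h𝔥 hx hwk, hβd, Nat.cast_add, add_assoc]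
  exact ⟨K + 1, key (K + 1) 0 m hm (by simpa using isWt_iff.mp hl H) (by omega)⟩

end Graded

section CatOmu

lemma uSub_fg (V : Submodule ℂ 𝔤) : (uSub V).FG :=
  (Submodule.fg_iff_finiteDimensional _).mpr
    (inferInstanceAs (FiniteDimensional ℂ (V.map uBase ⊔ V.map uBar : Submodule ℂ (UTakiff 𝔤))))

include h𝔥 hΔ in
/-- The category `𝒪_ε^μ` in terms of nilpotency conditions. -/
theorem catOmu_iff {M : ModuleCat.{u} (UTakiff 𝔤)} :
    catOmu 𝔥 Δ μ M ↔ Module.Finite (UTakiff 𝔤) M ∧ IsOmu 𝔥 Δ μ M := by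
  let _ : Module ℂ M := ModuleCat.moduleOfAlgebraModule M
  have _ : IsScalarTower ℂ (UTakiff 𝔤) M := ModuleCat.isScalarTower_of_algebra_moduleCat M
  constructor
  · rintro ⟨⟨hfin, hss, hn, -⟩, heig⟩
    have hwt := isHSemisimple_iff.mp hss
    refine ⟨hfin, hwt, fun m => ?_, fun h m => heig m h⟩
    obtain ⟨v, hv, rfl⟩ := hwt m
    refine Finset.sum_induction _
      (fun m : M => ∃ n, KilledBy (uSub (nPlus 𝔥 Δ) : Set (UTakiff 𝔤)) n m) ?_
      ⟨0, rfl⟩ fun l _ => ?_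
    · rintro x y ⟨n, hn⟩ ⟨k, hk⟩
      exact ⟨n + k, (hn.mono (by omega)).add (hk.mono (by omega))⟩
    · obtain ⟨W, hW, hmW, hst⟩ := hn (v l)
      refine killedBy_of_stable h𝔥 hΔ W (fun u hu w hw => ?_) hmW (hv l)
      obtain ⟨x, hx, rfl⟩ := exists_toU_of_mem_uSub hu
      exact hst x hx w hw
  · rintro ⟨hfin, hM⟩
    refine ⟨⟨hfin, isHSemisimple_iff.mpr hM.wt, fun m => ?_, fun m => ?_⟩, fun m h => hM.eig h m⟩
    · obtain ⟨n, hn⟩ := hM.killed m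
      obtain ⟨W, hW, hmW, hst⟩ := exists_stable_of_killedBy _ (uSub_fg _) hn
      exact ⟨W, hW, hmW, fun x hx w hw => hst _ (toU_mem_uSub hx) w hw⟩
    · classical
      let b := Module.finBasis ℂ 𝔥
      let z : Fin (Module.finrank ℂ 𝔥) → UTakiff 𝔤 := fun i =>
        κ' 𝔥 (b i) - algebraMap ℂ _ (μ (b i))
      obtain ⟨W, hW, hmW, hst⟩ := exists_stable_of_commute (M := M) (Finset.univ.image z)
        (fun x hx y hy => by
          obtain ⟨i, -, rfl⟩ := Finset.mem_image.mp hx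
          obtain ⟨j, -, rfl⟩ := Finset.mem_image.mp hy
          have h1 : Commute (κ' 𝔥 (b i)) (κ' 𝔥 (b j)) := uBar_mul _ _
          exact (h1.sub_left (Algebra.commutes _ _)).sub_right
            ((Algebra.commutes _ _ : Commute _ _).symm))
        (fun x hx => by
          obtain ⟨i, -, rfl⟩ := Finset.mem_image.mp hx
          exact hM.eig (b i)) m
      refine ⟨W, hW, hmW, ?_⟩
      rintro _ ⟨x, hx, rfl⟩ w hw
      have hb : ∀ i, κ' 𝔥 (b i) • w ∈ W := fun i => by
        have h1 := hst (z i) (Finset.mem_image_of_mem _ (Finset.mem_univ i)) w hw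
        have h2 := add_mem h1 (W.smul_mem (μ (b i)) hw)
        rwa [← algebraMap_smul (UTakiff 𝔤), ← add_smul, sub_add_cancel] at h2
      change κ' 𝔥 ⟨x, hx⟩ • w ∈ W
      generalize (⟨x, hx⟩ : 𝔥) = y
      have h1 : y ∈ Submodule.span ℂ (Set.range b) := by
        rw [b.span_eq]; trivial
      induction h1 using Submodule.span_induction with
      | mem h hh => obtain ⟨i, rfl⟩ := hh; exact hb i
      | zero => rw [map_zero, zero_smul]; exact zero_mem _
      | add h h' _ _ h1 h2 => rw [map_add, add_smul]; exact add_mem h1 h2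
      | smul t h _ h1 => rw [map_smul, smul_assoc]; exact W.smul_mem t h1

end CatOmu

section Parts

include h𝔥 in
/-- The sums of weight vectors form a submodule. -/
lemma exists_wtPart (M : Type u) [AddCommGroup M] [Module (UTakiff 𝔤) M] :
    ∃ K : Submodule (UTakiff 𝔤) M,
      ∀ m, m ∈ K ↔ m ∈ AddSubgroup.closure {m : M | ∃ l, IsWt (κ 𝔥) l m} := by
  let X := AddSubgroup.closure {m : M | ∃ l, IsWt (κ 𝔥) l m}
  have hX : ∀ u : UTakiff 𝔤, (∀ (l : Module.Dual ℂ 𝔥) (m : M), IsWt (κ 𝔥) l m → u • m ∈ X) →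
      ∀ m ∈ X, u • m ∈ X := by
    intro u hu m hm
    induction hm using AddSubgroup.closure_induction with
    | mem m hm => obtain ⟨l, hl⟩ := hm; exact hu l m hl
    | zero => rw [smul_zero]; exact zero_mem _
    | add m n _ _ hm hn => rw [smul_add]; exact add_mem hm hn
    | neg m _ hm => rw [smul_neg]; exact neg_mem hm
  have key := smul_mem_of_stable X
    (fun r => hX _ fun l m hl => AddSubgroup.subset_closure ⟨l, fun h => by
      rw [← mul_smul, ← Algebra.commutes, mul_smul, hl h, ← mul_smul, ← mul_smul,
        Algebra.commutes r]⟩)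
    (fun x => hX _ fun l m hl => by
      refine h𝔥.induction (p := fun x => uBase x • m ∈ X) ?_ ?_ ?_ x
      · rw [map_zero, zero_smul]; exact zero_mem _
      · intro x y hx hy; rw [map_add, add_smul]; exact add_mem hx hy
      · intro β x hx
        exact AddSubgroup.subset_closure ⟨l + β, hl.smul (h𝔥.κ_mul_uBase hx)⟩)
    (fun x => hX _ fun l m hl => by
      refine h𝔥.induction (p := fun x => uBar x • m ∈ X) ?_ ?_ ?_ x
      · rw [map_zero, zero_smul]; exact zero_mem _
      · intro x y hx hy; rw [map_add, add_smul]; exact add_mem hx hy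
      · intro β x hx
        exact AddSubgroup.subset_closure ⟨l + β, hl.smul (h𝔥.κ_mul_uBar hx)⟩)
  exact ⟨{ X.toAddSubmonoid with smul_mem' := fun u m hm => key u m hm }, fun m => Iff.rfl⟩

include h𝔥 in
lemma wtDecomp_of_mem_closure {K : Submodule (UTakiff 𝔤) M}
    (hK : ∀ m ∈ K, m ∈ AddSubgroup.closure {m : M | ∃ l, IsWt (κ 𝔥) l m}) : WtDecomp (κ 𝔥) K := by
  obtain ⟨K', hK'⟩ := exists_wtPart h𝔥 M
  have hle : K ≤ K' := fun m hm => (hK' m).mpr (hK m hm)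
  have h1 : WtDecomp (κ 𝔥) K' := by
    refine wtDecomp_of_closure ?_
    rw [eq_top_iff]
    rintro ⟨m, hm⟩ -
    have hm' := (hK' m).mp hm
    suffices ∀ hm : m ∈ K', (⟨m, hm⟩ : K') ∈ AddSubgroup.closure {m : K' | ∃ l, IsWt (κ 𝔥) l m} from
      this hm
    clear hm
    induction hm' using AddSubgroup.closure_induction with
    | mem m hm =>
      intro hmK
      obtain ⟨l, hl⟩ := hm
      exact AddSubgroup.subset_closure ⟨l, IsWt.of_map K'.subtype Subtype.val_injective hl⟩
    | zero => intro hmK; exact zero_mem _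
    | add m n hm' hn' hm hn =>
      intro hmK
      exact add_mem (hm ((hK' m).mpr hm')) (hn ((hK' n).mpr hn'))
    | neg m hm' hm =>
      intro hmK
      exact neg_mem (hm ((hK' m).mpr hm'))
  have h2 := h1.submodule (K.comap K'.subtype)
  refine h2.of_surjective (K'.subtype.restrict (p := K.comap K'.subtype) (q := K)
    fun x hx => hx) ?_
  rintro ⟨m, hm⟩
  exact ⟨⟨⟨m, hle hm⟩, hm⟩, rfl⟩

include h𝔥 in
lemma mem_hPart_iff {m : M} :
    m ∈ hPart 𝔥 M ↔ m ∈ AddSubgroup.closure {m : M | ∃ l, IsWt (κ 𝔥) l m} := by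
  obtain ⟨K, hK⟩ := exists_wtPart h𝔥 M
  rw [← hK]
  refine ⟨fun hm => ?_, fun hm => ?_⟩
  · refine (sSup_le fun N hN => ?_ : hPart 𝔥 M ≤ K) hm
    intro n hn
    rw [hK]
    have h1 : (⟨n, hn⟩ : N) ∈ AddSubgroup.closure (weightVectors 𝔥 N) := by
      rw [show AddSubgroup.closure (weightVectors 𝔥 N) = ⊤ from hN]; trivial
    have h2 := AddSubgroup.mem_map_of_mem N.subtype.toAddMonoidHom h1
    rw [AddMonoidHom.map_closure] at h2
    refine AddSubgroup.closure_mono ?_ h2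
    rintro _ ⟨v, ⟨l, hl⟩, rfl⟩
    exact ⟨l, IsWt.map N.subtype hl⟩
  · refine (le_sSup ?_ : K ≤ hPart 𝔥 M) hm
    exact isHSemisimple_iff.mpr (wtDecomp_of_mem_closure h𝔥 fun m hm => (hK m).mp hm)

include h𝔥 in
lemma wtDecomp_hPart (M : Type u) [AddCommGroup M] [Module (UTakiff 𝔤) M] :
    WtDecomp (κ 𝔥) (hPart 𝔥 M) :=
  wtDecomp_of_mem_closure h𝔥 fun _ hm => (mem_hPart_iff h𝔥).mp hm

include h𝔥 hΔ in
/-- The largest submodule satisfying the conditions of `𝒪_ε^μ`. -/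
lemma exists_omuPart (μ : Module.Dual ℂ 𝔥) (M : Type u) [AddCommGroup M] [Module (UTakiff 𝔤) M] :
    ∃ K : Submodule (UTakiff 𝔤) M, IsOmu 𝔥 Δ μ K ∧ ∀ m, m ∈ K ↔
      m ∈ AddSubgroup.closure {m : M | ∃ l, IsWt (κ 𝔥) l m} ∧
      (∃ n, KilledBy (uSub (nPlus 𝔥 Δ) : Set (UTakiff 𝔤)) n m) ∧
      ∀ h, ∃ k, (κ' 𝔥 h - algebraMap ℂ _ (μ h)) ^ k • m = 0 := by
  obtain ⟨K', hK'⟩ := exists_wtPart h𝔥 M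
  let _ := Module.restrictScalars ℂ (UTakiff 𝔤) M
  have _ : IsScalarTower ℂ (UTakiff 𝔤) M := IsScalarTower.restrictScalars ℂ (UTakiff 𝔤) M
  let X : AddSubgroup M :=
    { carrier := {m | ∃ n, KilledBy (uSub (nPlus 𝔥 Δ) : Set (UTakiff 𝔤)) n m}
      zero_mem' := ⟨0, rfl⟩
      add_mem' := by
        rintro x y ⟨n, hn⟩ ⟨k, hk⟩
        exact ⟨n + k, (hn.mono (by omega)).add (hk.mono (by omega))⟩
      neg_mem' := by
        rintro x ⟨n, hn⟩
        exact ⟨n, hn.neg⟩ }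
  have hX := smul_mem_of_stable X
    (fun r m ⟨n, hn⟩ => ⟨n, by
      rw [algebraMap_smul (UTakiff 𝔤) r m]
      exact hn.smul_scalar r⟩)
    (fun x m ⟨n, hn⟩ => by
      obtain ⟨r, h1, -⟩ := exists_adKilledBy h𝔥 hΔ x
      exact ⟨n + r, h1.smul hn⟩)
    (fun x m ⟨n, hn⟩ => by
      obtain ⟨r, -, h1⟩ := exists_adKilledBy h𝔥 hΔ x
      exact ⟨n + r, h1.smul hn⟩)
  let K : Submodule (UTakiff 𝔤) M :=
    { carrier := {m | m ∈ K' ∧ m ∈ X ∧ ∀ h, ∃ k, (κ' 𝔥 h - algebraMap ℂ _ (μ h)) ^ k • m = 0}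
      zero_mem' := ⟨zero_mem _, zero_mem _, fun h => ⟨0, smul_zero _⟩⟩
      add_mem' := by
        rintro x y ⟨h1, h2, h3⟩ ⟨h4, h5, h6⟩
        refine ⟨add_mem h1 h4, add_mem h2 h5, fun h => ?_⟩
        obtain ⟨k, hk⟩ := h3 h
        obtain ⟨l, hl⟩ := h6 h
        refine ⟨k + l, ?_⟩
        rw [smul_add, pow_add, mul_smul _ _ y, hl, (Commute.pow_pow_self _ k l).eq, mul_smul, hk,
          smul_zero, smul_zero, add_zero]
      smul_mem' := by
        rintro u x ⟨h1, h2, h3⟩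
        refine ⟨K'.smul_mem u h1, hX u x h2, fun h => ?_⟩
        obtain ⟨k, hk⟩ := h3 h
        exact exists_pow_smul_smul_eq_zero (adNil_κ' h _ u) hk }
  refine ⟨K, ⟨wtDecomp_of_mem_closure h𝔥 fun m hm => (hK' m).mp hm.1, ?_, ?_⟩, fun m => ?_⟩
  · rintro ⟨m, hm⟩
    obtain ⟨n, hn⟩ := hm.2.1
    exact ⟨n, KilledBy.of_map K.subtype Subtype.val_injective hn⟩
  · rintro h ⟨m, hm⟩
    obtain ⟨n, hn⟩ := hm.2.2 h
    exact ⟨n, Subtype.ext hn⟩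
  · rw [← hK']
    rfl

lemma IsOmu.of_surjective (hM : IsOmu 𝔥 Δ μ M) {N : Type u} [AddCommGroup N]
    [Module (UTakiff 𝔤) N] (f : M →ₗ[UTakiff 𝔤] N) (hf : Function.Surjective f) :
    IsOmu 𝔥 Δ μ N where
  wt := hM.wt.of_surjective f hf
  killed n := by
    obtain ⟨m, rfl⟩ := hf n
    obtain ⟨k, hk⟩ := hM.killed m
    exact ⟨k, hk.map f⟩
  eig h n := by
    obtain ⟨m, rfl⟩ := hf n
    obtain ⟨k, hk⟩ := hM.eig h m
    exact ⟨k, by rw [← map_smul, hk, map_zero]⟩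

end Parts

section Bounded

variable [Module ℂ M] [IsScalarTower ℂ (UTakiff 𝔤) M]

variable (M) in
/-- The span of the eigenvectors of `H` with eigenvalue in `S`. -/
noncomputable def gradedSpan (H : 𝔥) (S : Set ℂ) : Submodule ℂ M :=
  ⨆ s ∈ S, Module.End.eigenspace (Algebra.lsmul ℂ ℂ M (κ 𝔥 H) : Module.End ℂ M) s

lemma mem_gradedSpan {H : 𝔥} {S : Set ℂ} {s : ℂ} (hs : s ∈ S) {m : M} (hm : κ 𝔥 H • m = s • m) :
    m ∈ gradedSpan M H S :=
  le_iSup₂_of_le (f := fun s (_ : s ∈ S) =>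
    Module.End.eigenspace (Algebra.lsmul ℂ ℂ M (κ 𝔥 H) : Module.End ℂ M) s) s hs le_rfl
    (Module.End.mem_eigenspace_iff.mpr hm)

lemma smul_mem_gradedSpan {H : 𝔥} {S : Set ℂ} {u : UTakiff 𝔤}
    (hu : ∀ s ∈ S, ∀ m : M, κ 𝔥 H • m = s • m → u • m ∈ gradedSpan M H S) :
    ∀ m ∈ gradedSpan M H S, u • m ∈ gradedSpan M H S := by
  intro m hm
  suffices h : gradedSpan M H S ≤ (gradedSpan M H S).comap (Algebra.lsmul ℂ ℂ M u) from h hm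
  exact iSup₂_le fun s hs m hm => hu s hs m (Module.End.mem_eigenspace_iff.mp hm)

variable (M Δ) in
/-- The largest `𝔫_ε`-stable subspace of `gradedSpan M H S`. -/
noncomputable def stablePart (H : 𝔥) (S : Set ℂ) : Submodule ℂ M :=
  sSup {W | W ≤ gradedSpan M H S ∧ ∀ u ∈ uSub (nPlus 𝔥 Δ), ∀ w ∈ W, u • w ∈ W}

lemma stablePart_le (H : 𝔥) (S : Set ℂ) : stablePart Δ M H S ≤ gradedSpan M H S :=
  sSup_le fun _ hW => hW.1

lemma le_stablePart {H : 𝔥} {S : Set ℂ} {W : Submodule ℂ M} (h1 : W ≤ gradedSpan M H S)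
    (h2 : ∀ u ∈ uSub (nPlus 𝔥 Δ), ∀ w ∈ W, u • w ∈ W) : W ≤ stablePart Δ M H S :=
  le_sSup ⟨h1, h2⟩

lemma smul_mem_stablePart {H : 𝔥} {S : Set ℂ} {u : UTakiff 𝔤} (hu : u ∈ uSub (nPlus 𝔥 Δ)) {m : M}
    (hm : m ∈ stablePart Δ M H S) : u • m ∈ stablePart Δ M H S := by
  suffices h : stablePart Δ M H S ≤ (stablePart Δ M H S).comap (Algebra.lsmul ℂ ℂ M u) from h hm
  exact sSup_le fun W hW w hw => le_stablePart hW.1 hW.2 (hW.2 u hu w hw)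

lemma stablePart_mono {H : 𝔥} {S T : Set ℂ} (h : S ⊆ T) :
    stablePart Δ M H S ≤ stablePart Δ M H T :=
  le_stablePart ((stablePart_le H S).trans (biSup_mono h)) fun _ hu _ hw =>
    smul_mem_stablePart hu hw

variable {H : 𝔥} (hH : ∀ β ∈ AddSubmonoid.closure Δ, β ≠ 0 → ∃ n : ℕ, 0 < n ∧ β H = n)
  {S : Set ℂ} (hS : ∀ s ∈ S, ∀ k : ℕ, s - k ∈ S)

-- Positive root vectors preserve the stable part by definition. The others lower the `H`-degree by
-- a natural number, and `S` is closed under such subtractions.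
include h𝔥 hΔ hH hS in
lemma smul_mem_gradedSpan_of_mem (x : 𝔤) {m : M} (hm : m ∈ stablePart Δ M H S) :
    uBase x • m ∈ gradedSpan M H S ∧ uBar x • m ∈ gradedSpan M H S := by
  have hm' := stablePart_le H S hm
  refine h𝔥.induction
    (p := fun x => uBase x • m ∈ gradedSpan M H S ∧ uBar x • m ∈ gradedSpan M H S) ?_ ?_ ?_ x
  · simp only [map_zero, zero_smul]
    exact ⟨zero_mem _, zero_mem _⟩
  · rintro x y ⟨h1, h2⟩ ⟨h3, h4⟩
    rw [map_add, map_add, add_smul, add_smul]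
    exact ⟨add_mem h1 h3, add_mem h2 h4⟩
  intro β x hx
  by_cases hx0 : x = 0
  · simp only [hx0, map_zero, zero_smul]
    exact ⟨zero_mem _, zero_mem _⟩
  by_cases hβ : β ∈ posRoots 𝔥 Δ
  · exact ⟨stablePart_le H S (smul_mem_stablePart (uBase_mem_uSub (rootSpace_le_nPlus hβ hx)) hm),
      stablePart_le H S (smul_mem_stablePart (uBar_mem_uSub (rootSpace_le_nPlus hβ hx)) hm)⟩
  have hneg : ∃ n : ℕ, β H = -n := by
    rcases mem_insert_roots h𝔥 hx hx0 with rfl | hβr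
    · exact ⟨0, by simp⟩
    · have h1 := (hΔ.pos_or_neg β hβr).resolve_left fun h => hβ ⟨hβr, h⟩
      obtain ⟨n, -, hn⟩ := hH _ h1 (neg_ne_zero.mpr hβr.1)
      exact ⟨n, by rw [← hn, LinearMap.neg_apply, neg_neg]⟩
  obtain ⟨n, hn⟩ := hneg
  constructor
  · refine smul_mem_gradedSpan (fun s hs w hw => mem_gradedSpan (hS s hs n) ?_) m hm'
    rw [κ_smul_uBase_smul h𝔥 hx hw, hn, sub_eq_add_neg]
  · refine smul_mem_gradedSpan (fun s hs w hw => mem_gradedSpan (hS s hs n) ?_) m hm'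
    rw [κ_smul_uBar_smul h𝔥 hx hw, hn, sub_eq_add_neg]

-- With `Y` the stable part, `Y + 𝔤_ε Y` is still `𝔫_ε`-stable, by `v u y = u v y + [v, u] y`, and
-- it lies in the graded span. Maximality of `Y` gives `𝔤_ε Y ⊆ Y`.
include h𝔥 hΔ hH hS in
lemma uSub_top_smul_mem_stablePart {u : UTakiff 𝔤} (hu : u ∈ uSub (⊤ : Submodule ℂ 𝔤)) {m : M}
    (hm : m ∈ stablePart Δ M H S) : u • m ∈ stablePart Δ M H S := by
  let Y := stablePart Δ M H S
  let W : Submodule ℂ M := Y ⊔ Submodule.span ℂ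
    {w | ∃ u ∈ uSub (⊤ : Submodule ℂ 𝔤), ∃ y ∈ Y, w = u • y}
  have hW : W ≤ Y := by
    refine le_stablePart (sup_le (stablePart_le H S) ?_) ?_
    · rw [Submodule.span_le]
      rintro _ ⟨u, hu, y, hy, rfl⟩
      obtain ⟨x, -, x', -, rfl⟩ := mem_uSub.mp hu
      change (uBase x + uBar x') • y ∈ gradedSpan M H S
      rw [add_smul]
      exact add_mem (smul_mem_gradedSpan_of_mem h𝔥 hΔ hH hS x hy).1
        (smul_mem_gradedSpan_of_mem h𝔥 hΔ hH hS x' hy).2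
    · intro v hv w hw
      suffices h : W ≤ W.comap (Algebra.lsmul ℂ ℂ M v) from h hw
      refine sup_le (fun y hy => ?_) ?_
      · exact (le_sup_left : Y ≤ W) (smul_mem_stablePart hv hy)
      rw [Submodule.span_le]
      rintro _ ⟨u, hu, y, hy, rfl⟩
      change v • u • y ∈ W
      have hc : v * u - u * v ∈ uSub (⊤ : Submodule ℂ 𝔤) := by
        obtain ⟨x, -, x', -, rfl⟩ := mem_uSub.mp hv
        have h1 := uBase_normalizes (x := x) (fun _ _ => Submodule.mem_top) hu
        have h2 := uBar_normalizes (x := x') (fun _ _ => Submodule.mem_top) hu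
        have h3 := add_mem h1 h2
        rwa [sub_add_sub_comm, ← add_mul, ← mul_add] at h3
      have e : v • u • y = u • v • y + (v * u - u * v) • y := by
        rw [sub_smul, mul_smul, mul_smul]; abel
      rw [e]
      exact add_mem
        (le_sup_right (a := Y) (Submodule.subset_span ⟨u, hu, _, smul_mem_stablePart hv hy, rfl⟩))
        (le_sup_right (a := Y) (Submodule.subset_span ⟨_, hc, y, hy, rfl⟩))
  exact hW (le_sup_right (a := Y) (Submodule.subset_span ⟨u, hu, m, hm, rfl⟩))

include h𝔥 hΔ hH hS in
lemma smul_mem_stablePart_of_mem (u : UTakiff 𝔤) {m : M} (hm : m ∈ stablePart Δ M H S) :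
    u • m ∈ stablePart Δ M H S :=
  smul_mem_of_stable (stablePart Δ M H S).toAddSubgroup
    (fun r m hm => by
      rw [algebraMap_smul]
      exact (stablePart Δ M H S).smul_mem r hm)
    (fun _ _ hm => uSub_top_smul_mem_stablePart h𝔥 hΔ hH hS (uBase_mem_uSub trivial) hm)
    (fun _ _ hm => uSub_top_smul_mem_stablePart h𝔥 hΔ hH hS (uBar_mem_uSub trivial) hm) u m hm

-- One positive root vector raises the degree by at most `K`, so at most `n` of them lead from `c`
-- to degrees below `c + n K`, all of which lie in `S`.
include h𝔥 hH hS in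
lemma mem_stablePart_of_killedBy {K : ℕ} (hK : ∀ β ∈ posRoots 𝔥 Δ, ∀ k : ℕ, β H = k → k ≤ K)
    {n : ℕ} {c : ℂ} {m : M} (hc : κ 𝔥 H • m = c • m)
    (hm : KilledBy (uSub (nPlus 𝔥 Δ) : Set (UTakiff 𝔤)) n m) (hcS : c + n * K ∈ S) :
    m ∈ stablePart Δ M H S := by
  induction n generalizing c m with
  | zero => rw [show m = 0 from hm]; exact zero_mem _
  | succ n ih =>
    have hu : ∀ u ∈ uSub (nPlus 𝔥 Δ), u • m ∈ stablePart Δ M H S := by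
      have hshift : ∀ β ∈ posRoots 𝔥 Δ, c + β H + n * K ∈ S := by
        intro β hβ
        obtain ⟨d, -, hd⟩ := hH β hβ.2 hβ.1.1
        have := hS _ hcS (K - d)
        rw [Nat.cast_sub (hK β hβ d hd)] at this
        convert this using 1
        rw [hd]
        push_cast
        ring
      intro u hu
      refine uSub_nPlus_induction (𝔥 := 𝔥) (Δ := Δ) (p := fun u => u • m ∈ stablePart Δ M H S)
        ?_ ?_ ?_ ?_ hu
      · rw [zero_smul]; exact zero_mem _
      · intro u v hu hv; rw [add_smul]; exact add_mem hu hv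
      · intro β hβ x hx
        exact ih (κ_smul_uBase_smul h𝔥 hx hc) (hm _ (uBase_mem_uSub (rootSpace_le_nPlus hβ hx)))
          (hshift β hβ)
      · intro β hβ x hx
        exact ih (κ_smul_uBar_smul h𝔥 hx hc) (hm _ (uBar_mem_uSub (rootSpace_le_nPlus hβ hx)))
          (hshift β hβ)
    have hcS' : c ∈ S := by
      have := hS _ hcS ((n + 1) * K)
      push_cast at this
      rwa [add_sub_cancel_right] at this
    have hle : stablePart Δ M H S ⊔ ℂ ∙ m ≤ stablePart Δ M H S := by
      refine le_stablePart (sup_le (stablePart_le H S) ?_) fun u hu' w hw => ?_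
      · rw [Submodule.span_singleton_le_iff_mem]
        exact mem_gradedSpan hcS' hc
      · obtain ⟨y, hy, z, hz, rfl⟩ := Submodule.mem_sup.mp hw
        obtain ⟨t, rfl⟩ := Submodule.mem_span_singleton.mp hz
        rw [smul_add, smul_comm]
        exact le_sup_left (b := ℂ ∙ m)
          (add_mem (smul_mem_stablePart hu' hy) (Submodule.smul_mem _ t (hu u hu')))
    exact hle (le_sup_right (a := stablePart Δ M H S) (Submodule.mem_span_singleton_self m))

end Bounded

include h𝔥 hΔ in
/-- The weights of a module in `𝒪_ε^μ` are bounded above in the direction of `α`. -/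
theorem IsOmu.wtBounded [Module.Finite (UTakiff 𝔤) M] (hM : IsOmu 𝔥 Δ μ M) {α : Module.Dual ℂ 𝔥}
    (hα : α ∈ Δ) : WtBounded (κ 𝔥) α M := by
  classical
  let _ := Module.restrictScalars ℂ (UTakiff 𝔤) M
  have _ := IsScalarTower.restrictScalars ℂ (UTakiff 𝔤) M
  obtain ⟨H, hH⟩ := hΔ.exists_grading
  obtain ⟨K, hK⟩ := exists_degree_bound h𝔥 H
  have hK' : ∀ β ∈ posRoots 𝔥 Δ, ∀ k : ℕ, β H = k → k ≤ K := fun β hβ k hk =>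
    (hK 0 (Or.inl rfl) β (Or.inr hβ.1) k (by simpa using hk)).le
  -- The degrees lying below one of finitely many bounds. Each vector belongs to the stable part for
  -- some `F`; finitely many generators share one `G`, and the stable part is a submodule.
  let S : Finset ℂ → Set ℂ := fun F => {z | ∃ f ∈ F, ∃ k : ℕ, z = f - k}
  have hS : ∀ F, ∀ s ∈ S F, ∀ k : ℕ, s - k ∈ S F := by
    rintro F _ ⟨f, hf, j, rfl⟩ k
    exact ⟨f, hf, j + k, by push_cast; ring⟩
  have hmono : ∀ {F G}, F ⊆ G → stablePart Δ M H (S F) ≤ stablePart Δ M H (S G) := fun hFG =>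
    stablePart_mono fun z ⟨f, hf, k, hz⟩ => ⟨f, hFG hf, k, hz⟩
  have h1 : ∀ m : M, ∃ F, m ∈ stablePart Δ M H (S F) := by
    intro m
    obtain ⟨v, hv, rfl⟩ := hM.wt m
    refine Finset.sum_induction _ (fun m : M => ∃ F, m ∈ stablePart Δ M H (S F)) ?_
      ⟨∅, zero_mem _⟩ fun l _ => ?_
    · rintro x y ⟨F, hF⟩ ⟨G, hG⟩
      exact ⟨F ∪ G, add_mem (hmono Finset.subset_union_left hF) (hmono Finset.subset_union_right hG)⟩
    · obtain ⟨n, hn⟩ := hM.killed (v l)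
      exact ⟨{l H + n * K}, mem_stablePart_of_killedBy h𝔥 hH (hS _) hK' (isWt_iff.mp (hv l) H) hn
        ⟨_, Finset.mem_singleton_self _, 0, by simp⟩⟩
  obtain ⟨s, hs⟩ := Module.Finite.fg_top (R := UTakiff 𝔤) (M := M)
  choose F hF using h1
  let G : Finset ℂ := s.biUnion F
  have h2 : ∀ m : M, m ∈ stablePart Δ M H (S G) := by
    intro m
    have hm : m ∈ Submodule.span (UTakiff 𝔤) (s : Set M) := by rw [hs]; trivial
    induction hm using Submodule.span_induction with
    | mem m hm => exact hmono (Finset.subset_biUnion_of_mem F hm) (hF m)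
    | zero => exact zero_mem _
    | add x y _ _ hx hy => exact add_mem hx hy
    | smul u x _ hx => exact smul_mem_stablePart_of_mem h𝔥 hΔ hH (hS G) u hx
  have h3 : ∀ (t : ℂ) (m : M), κ 𝔥 H • m = t • m → m ≠ 0 → t ∈ S G := by
    intro t m hm hm0
    by_contra ht
    have h4 := (Module.End.eigenspaces_iSupIndep
      (Algebra.lsmul ℂ ℂ M (κ 𝔥 H) : Module.End ℂ M)) t
    refine hm0 ((Submodule.disjoint_def.mp h4) m (Module.End.mem_eigenspace_iff.mpr hm) ?_)
    refine (iSup₂_le fun s hs => ?_ : gradedSpan M H (S G) ≤ _) (stablePart_le H (S G) (h2 m))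
    exact le_iSup₂_of_le (f := fun s (_ : s ≠ t) =>
      Module.End.eigenspace (Algebra.lsmul ℂ ℂ M (κ 𝔥 H) : Module.End ℂ M) s) s
      (fun h => ht (h ▸ hs)) le_rfl
  intro l
  obtain ⟨d, hd, hαd⟩ := hH α (AddSubmonoid.subset_closure hα) (hΔ.subset_roots hα).1
  -- A nonzero vector of weight `l + kα` has degree `f - j` with `f ∈ G`, so `k d + j = f - l H`.
  -- The bound `B` exceeds the norm of every such difference, which excludes `k ≥ B`.
  obtain ⟨B, hB⟩ := exists_nat_gt (∑ f ∈ G, ‖f - l H‖)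
  refine ⟨B, fun k hk m hm => ?_⟩
  by_contra hm0
  obtain ⟨f, hf, j, hj⟩ := h3 _ m (isWt_iff.mp hm H) hm0
  rw [LinearMap.add_apply, LinearMap.smul_apply, hαd, smul_eq_mul] at hj
  have h5 : f - l H = ((k * d + j : ℕ) : ℂ) := by push_cast; linear_combination -hj
  have h6 : ‖f - l H‖ ≤ ∑ f ∈ G, ‖f - l H‖ :=
    Finset.single_le_sum (f := fun f => ‖f - l H‖) (fun _ _ => norm_nonneg _) hf
  rw [h5, Complex.norm_natCast] at h6
  have h7 : ((k * d + j : ℕ) : ℝ) < B := h6.trans_lt hB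
  have h8 : k * d + j < B := by exact_mod_cast h7
  have h9 : k ≤ k * d := Nat.le_mul_of_pos_right k hd
  omega

end Modules

/-! ### Twisting modules in category `𝒪` -/

section TensorConditions

variable {A : Type u} [Ring A] [Algebra ℂ A] {P : OrePair A} {M : Type u} [AddCommGroup M]
  [Module A M]

/-- An element of `𝔪` times a fraction is a sum of fractions followed by elements of `𝔪`, and these
pass to `m`, lowering `n`. -/
lemma KilledBy.br (𝔪 : Submodule ℂ A) (ha : ∀ x ∈ 𝔪, P.a * x - x * P.a ∈ 𝔪)
    (hb : ∀ x ∈ 𝔪, P.b * x - x * P.b ∈ 𝔪) {n : ℕ} {m : M} (hm : KilledBy (𝔪 : Set A) n m)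
    (i j : ℤ) : KilledBy (𝔪 : Set A) n (P.br i j m) := by
  induction n generalizing i j m with
  | zero => rw [show m = 0 from hm, map_zero]; rfl
  | succ n ih =>
    intro x hx
    by_cases h : i ≤ 0 ∨ j ≤ 0
    · rw [P.br_eq_zero h, smul_zero]; exact KilledBy.zero _ _
    push Not at h
    obtain ⟨i, rfl⟩ := Int.eq_ofNat_of_zero_le h.1.le
    obtain ⟨j, rfl⟩ := Int.eq_ofNat_of_zero_le h.2.le
    rw [P.smul_br]
    have h := P.toLoc_mul_frac_mem_leftSpan (V := 𝔪.toAddSubgroup) ha hb i j (x := x) hx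
    generalize P.toLoc x * P.frac i j = z at h
    induction h using AddSubgroup.closure_induction with
    | mem z hz =>
      obtain ⟨i', j', y, hy, rfl⟩ := hz
      rw [P.pureTensor_proj_mul]
      exact ih (hm y hy) i' j'
    | zero => rw [map_zero, map_zero]; exact KilledBy.zero _ _
    | add y z _ _ hy hz => rw [map_add, map_add]; exact hy.add hz
    | neg y _ hy => rw [map_neg, map_neg]; exact hy.neg

/-- With `y = z - c`, applying `y` to `a⁻ⁱ b⁻ʲ ⊗ m` gives `a⁻ⁱ b⁻ʲ ⊗ y m` plus a multiple of `a⁻ⁱ⁻¹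
b⁻ʲ⁺¹ ⊗ m`. The first term lowers the nilpotency order of the vector and the second lowers `j`, so a
double induction terminates. -/
lemma LocGenEigen.balTensor {z : A} {c t : ℂ} (ha : z * P.a = P.a * z - t • P.b)
    (hb : z * P.b = P.b * z) (hM : LocGenEigen z c M) :
    LocGenEigen z c (BalTensor (A := A) P.Bimod M) := by
  set y := z - algebraMap ℂ A c with hy
  have ya : y * P.a = P.a * y - t • P.b := by
    rw [hy, sub_mul, ha, mul_sub, Algebra.commutes]; abel
  have yb : y * P.b = P.b * y := by rw [hy, sub_mul, hb, mul_sub, Algebra.commutes]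
  have key : ∀ (j i k : ℕ) (m : M), y ^ k • m = 0 → ∃ n, y ^ n • P.br i j m = 0 := by
    intro j
    induction j with
    | zero => exact fun i k m _ => ⟨0, by rw [P.br_eq_zero (by simp), smul_zero]⟩
    | succ j ihj =>
      intro i k
      induction k with
      | zero =>
        intro m hm
        rw [pow_zero, one_smul] at hm
        exact ⟨0, by rw [hm, map_zero, smul_zero]⟩
      | succ k ihk =>
        intro m hm
        obtain ⟨n, hn⟩ := ihk (y • m) (by rw [← mul_smul, ← pow_succ]; exact hm)
        obtain ⟨n', hn'⟩ := ihj (i + 1) (k + 1) m hm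
        refine ⟨n + n' + 1, ?_⟩
        rw [pow_succ, mul_smul, P.cartan_bar_smul_br ya yb, smul_add]
        have e1 : y ^ (n + n') • P.br i (j + 1 : ℕ) (y • m) = 0 := by
          rw [add_comm, pow_add, mul_smul, hn, smul_zero]
        have e2 : y ^ (n + n') • P.br (i + 1) ((j + 1 : ℕ) - 1) m = 0 := by
          rw [pow_add, mul_smul, show (((j + 1 : ℕ) : ℤ) - 1) = j by push_cast; ring]
          rw [show y ^ n' • P.br ((i : ℤ) + 1) j m = 0 by exact_mod_cast hn', smul_zero]
        rw [e1, zero_add, smul_comm, e2, smul_zero]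
  intro x
  obtain ⟨n, m, rfl⟩ := P.exists_br x
  obtain ⟨k, hk⟩ := hM m
  exact key n n k m hk

end TensorConditions

/-! ### Transport of the conditions defining `𝒪` along `φ` -/

section Twist

variable {𝔤 : Type u} [LieRing 𝔤] [LieAlgebra ℂ 𝔤] [FiniteDimensional ℂ 𝔤]
  {𝔥 : LieSubalgebra ℂ 𝔤} [LieRing.IsNilpotent 𝔥] {Δ : Set (Module.Dual ℂ 𝔥)}
  {μ : Module.Dual ℂ 𝔥} (h𝔥 : IsSplit 𝔥) (hΔ : IsSimpleSystem 𝔥 Δ)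
  {α : Module.Dual ℂ 𝔥} (hα : α ∈ Δ) (D : TwistingData 𝔥 α)

section Transport

variable {X Y : Type u} [AddCommGroup X] [Module (UTakiff 𝔤) X] [AddCommGroup Y]
  [Module (UTakiff 𝔤) Y] (i : X ≃+ Y) {τ : UTakiff 𝔤 →ₐ[ℂ] UTakiff 𝔤}
  (hi : ∀ u x, i (τ u • x) = u • i x)

include hi

lemma IsWt.twist {k : 𝔥 →ₗ[ℂ] UTakiff 𝔤} {r : 𝔥 → 𝔥} (hr : ∀ h, τ (k h) = k (r h))
    {l l' : Module.Dual ℂ 𝔥} (hl : ∀ h, l (r h) = l' h) {x : X} (hx : IsWt k l x) :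
    IsWt k l' (i x) := fun h => by
  rw [← hi, hr, hx, hl, ← hi, AlgHom.commutes]

lemma WtDecomp.twist {r : 𝔥 → 𝔥} (hr : ∀ h, τ (κ 𝔥 h) = κ 𝔥 (r h))
    {s : Module.Dual ℂ 𝔥 → Module.Dual ℂ 𝔥} (hs : ∀ l h, l (r h) = s l h)
    (hX : WtDecomp (κ 𝔥) X) : WtDecomp (κ 𝔥) Y := by
  refine wtDecomp_of_closure (eq_top_iff.mpr fun y _ => ?_)
  obtain ⟨x, rfl⟩ := i.surjective y
  obtain ⟨v, hv, rfl⟩ := hX x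
  rw [map_finsuppSum]
  exact sum_mem fun l _ => AddSubgroup.subset_closure ⟨_, (hv l).twist i hi hr (hs l)⟩

lemma KilledBy.twist {V W : Set (UTakiff 𝔤)} (hVW : ∀ u ∈ V, τ u ∈ W) {n : ℕ} {x : X}
    (hx : KilledBy W n x) : KilledBy V n (i x) := by
  induction n generalizing x with
  | zero => rw [show x = 0 from hx, map_zero]; rfl
  | succ n ih => intro u hu; rw [← hi]; exact ih (hx _ (hVW u hu))

lemma LocGenEigen.twist {u v : UTakiff 𝔤} (huv : τ v = u) {c : ℂ} (hX : LocGenEigen u c X) :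
    LocGenEigen v c Y := fun y => by
  obtain ⟨x, rfl⟩ := i.surjective y
  obtain ⟨n, hn⟩ := hX x
  refine ⟨n, ?_⟩
  rw [← hi, map_pow, map_sub, huv, AlgHom.commutes, hn, map_zero]

lemma finite_twist {σ : UTakiff 𝔤 →ₐ[ℂ] UTakiff 𝔤} (hστ : ∀ u, σ (τ u) = u)
    (hτσ : ∀ u, τ (σ u) = u) [Module.Finite (UTakiff 𝔤) X] : Module.Finite (UTakiff 𝔤) Y := by
  have : RingHomSurjective σ.toRingHom := ⟨fun u => ⟨τ u, hστ u⟩⟩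
  let f : X →ₛₗ[σ.toRingHom] Y :=
    { toFun := i
      map_add' := map_add i
      map_smul' := fun u x => by
        change i (u • x) = σ u • i x
        rw [← hi, hτσ] }
  exact Module.Finite.of_surjective f i.surjective

end Transport

variable {M : Type u} [AddCommGroup M] [Module (UTakiff 𝔤) M]

namespace TwistingData

lemma twist_κ (h : 𝔥) : twist (D.φ : 𝔤 →ₗ⁅ℂ⁆ 𝔤) (κ 𝔥 h) =
    κ 𝔥 (Module.preReflection D.coroot α h) := by
  rw [κ_apply, twist_uBase, κ_apply]
  exact congrArg uBase (D.φ_coe h)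

lemma twist_κ' (h : 𝔥) : twist (D.φ : 𝔤 →ₗ⁅ℂ⁆ 𝔤) (κ' 𝔥 h) =
    κ' 𝔥 (Module.preReflection D.coroot α h) := by
  rw [κ'_apply, twist_uBar, κ'_apply]
  exact congrArg uBar (D.φ_coe h)

lemma twist_symm_κ (h : 𝔥) : twist (D.φ.symm : 𝔤 →ₗ⁅ℂ⁆ 𝔤) (κ 𝔥 h) =
    κ 𝔥 (Module.preReflection D.coroot α h) := by
  rw [κ_apply, twist_uBase, κ_apply]
  exact congrArg uBase (D.φ_symm_coe h)

lemma twist_symm_κ' (h : 𝔥) : twist (D.φ.symm : 𝔤 →ₗ⁅ℂ⁆ 𝔤) (κ' 𝔥 h) =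
    κ' 𝔥 (Module.preReflection D.coroot α h) := by
  rw [κ'_apply, twist_uBar, κ'_apply]
  exact congrArg uBar (D.φ_symm_coe h)

lemma twist_twist_symm (u : UTakiff 𝔤) :
    twist (D.φ : 𝔤 →ₗ⁅ℂ⁆ 𝔤) (twist (D.φ.symm : 𝔤 →ₗ⁅ℂ⁆ 𝔤) u) = u :=
  twist_twist (fun x => D.φ.apply_symm_apply x) u

lemma twist_symm_twist (u : UTakiff 𝔤) :
    twist (D.φ.symm : 𝔤 →ₗ⁅ℂ⁆ 𝔤) (twist (D.φ : 𝔤 →ₗ⁅ℂ⁆ 𝔤) u) = u :=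
  twist_twist (fun x => D.φ.symm_apply_apply x) u

lemma twist_mem_uSub {φ : 𝔤 →ₗ⁅ℂ⁆ 𝔤} {V W : Submodule ℂ 𝔤} (h : ∀ x ∈ V, φ x ∈ W)
    {u : UTakiff 𝔤} (hu : u ∈ uSub V) : twist φ u ∈ uSub W := by
  obtain ⟨x, hx, y, hy, rfl⟩ := mem_uSub.mp hu
  rw [map_add, twist_uBase, twist_uBar]
  exact add_mem (uBase_mem_uSub (h x hx)) (uBar_mem_uSub (h y hy))

include h𝔥 hΔ hα in
lemma φ_mem {x : 𝔤} (hx : x ∈ nPlus 𝔥 Δ) : D.φ x ∈ nCompl 𝔥 Δ α ⊔ ℂ ∙ D.f := by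
  rw [D.nPlus_eq hΔ h𝔥 hα, Submodule.mem_sup] at hx
  obtain ⟨y, hy, z, hz, rfl⟩ := hx
  obtain ⟨t, rfl⟩ := Submodule.mem_span_singleton.mp hz
  rw [map_add, map_smul, D.φ_e]
  exact Submodule.add_mem_sup (D.φ_mem_nCompl hΔ h𝔥 hα hy)
    (Submodule.smul_mem _ _ (Submodule.mem_span_singleton_self _))

include h𝔥 hΔ hα in
lemma φ_symm_mem {x : 𝔤} (hx : x ∈ nCompl 𝔥 Δ α ⊔ ℂ ∙ D.f) : D.φ.symm x ∈ nPlus 𝔥 Δ := by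
  rw [Submodule.mem_sup] at hx
  obtain ⟨y, hy, z, hz, rfl⟩ := hx
  obtain ⟨t, rfl⟩ := Submodule.mem_span_singleton.mp hz
  rw [map_add, map_smul, ← D.φ_e, LieEquiv.symm_apply_apply, D.nPlus_eq hΔ h𝔥 hα]
  exact Submodule.add_mem_sup (D.φ_symm_mem_nCompl hΔ h𝔥 hα hy)
    (Submodule.smul_mem _ _ (Submodule.mem_span_singleton_self _))

/-- The analogue of `IsOmu` for the image of the standard Borel subalgebra under `φ`. -/
structure IsOpp (Δ : Set (Module.Dual ℂ 𝔥)) (μ : Module.Dual ℂ 𝔥) (X : Type u) [AddCommGroup X]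
    [Module (UTakiff 𝔤) X] : Prop where
  wt : WtDecomp (κ 𝔥) X
  killed : ∀ x : X, ∃ n, KilledBy (uSub (nCompl 𝔥 Δ α ⊔ ℂ ∙ D.f) : Set (UTakiff 𝔤)) n x
  eig : ∀ h : 𝔥, LocGenEigen (κ' 𝔥 h) (μ h) X

section

variable {X Y : Type u} [AddCommGroup X] [Module (UTakiff 𝔤) X] [AddCommGroup Y]
  [Module (UTakiff 𝔤) Y]

include h𝔥 hΔ hα in
lemma IsOpp.isOmu (hX : D.IsOpp Δ μ X) (i : X ≃+ Y)
    (hi : ∀ u x, i (twist (D.φ : 𝔤 →ₗ⁅ℂ⁆ 𝔤) u • x) = u • i x) : IsOmu 𝔥 Δ (D.s μ) Y where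
  wt := hX.wt.twist i hi D.twist_κ D.s_comp_reflection
  killed y := by
    obtain ⟨x, rfl⟩ := i.surjective y
    obtain ⟨n, hn⟩ := hX.killed x
    exact ⟨n, hn.twist i hi fun u hu => twist_mem_uSub (fun x hx => D.φ_mem h𝔥 hΔ hα hx) hu⟩
  eig h := by
    rw [← D.s_comp_reflection]
    exact (hX.eig _).twist i hi (D.twist_κ' h)

include h𝔥 hΔ hα in
lemma isOpp_of_isOmu (hY : IsOmu 𝔥 Δ (D.s μ) Y) (i : Y ≃+ X)
    (hi : ∀ u y, i (twist (D.φ.symm : 𝔤 →ₗ⁅ℂ⁆ 𝔤) u • y) = u • i y) : D.IsOpp Δ μ X where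
  wt := hY.wt.twist i hi D.twist_symm_κ D.s_comp_reflection
  killed x := by
    obtain ⟨y, rfl⟩ := i.surjective x
    obtain ⟨n, hn⟩ := hY.killed y
    exact ⟨n, hn.twist i hi fun u hu => twist_mem_uSub (fun x hx => D.φ_symm_mem h𝔥 hΔ hα hx) hu⟩
  eig h := by
    rw [← D.s_s μ, ← D.s_comp_reflection]
    exact (hY.eig _).twist i hi (D.twist_symm_κ' h)

end

include h𝔥 hΔ hα in
lemma lie_f_mem_nCompl {x : 𝔤} (hx : x ∈ nCompl 𝔥 Δ α) : ⁅D.f, x⁆ ∈ nCompl 𝔥 Δ α :=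
  hΔ.lie_mem_nCompl h𝔥 hα (s := -1) (by rw [neg_one_smul]; exact D.f_mem) hx

include h𝔥 hΔ hα in
lemma lie_e_mem_nCompl {x : 𝔤} (hx : x ∈ nCompl 𝔥 Δ α) : ⁅D.e, x⁆ ∈ nCompl 𝔥 Δ α :=
  hΔ.lie_mem_nCompl h𝔥 hα (s := 1) (by rw [one_smul]; exact D.e_mem) hx

include hΔ hα in
lemma e_mem_nPlus : D.e ∈ nPlus 𝔥 Δ :=
  rootSpace_le_nPlus (mem_posRoots_of_mem hα hΔ) D.e_mem

lemma nCompl_le_nPlus : nCompl 𝔥 Δ α ≤ nPlus 𝔥 Δ :=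
  iSup₂_le fun _ hβ => rootSpace_le_nPlus hβ.1

lemma uSub_mono {V W : Submodule ℂ 𝔤} (h : V ≤ W) : uSub V ≤ uSub W :=
  sup_le_sup (Submodule.map_mono h) (Submodule.map_mono h)

include hΔ hα in
lemma _root_.TakiffO.IsOmu.highestType (hM : IsOmu 𝔥 Δ μ M) :
    (D.triple h𝔥).HighestType (μ D.coroot) M where
  eig := hM.eig D.coroot
  nil_e := locNilpotent_of_killedBy hM.killed (uBase_mem_uSub (D.e_mem_nPlus hΔ hα))
  nil_e' := locNilpotent_of_killedBy hM.killed (uBar_mem_uSub (D.e_mem_nPlus hΔ hα))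

-- The nilradical of the minimal parabolic keeps its nilpotency across fractions, and `f`, `f̄` act
-- locally nilpotently on `S ⊗ M` by construction. They commute and normalise that nilradical, so
-- `KilledBy.sup_span` combines the two.
include h𝔥 hΔ hα in
lemma isOpp_balTensor (hM : IsOmu 𝔥 Δ μ M) : D.IsOpp Δ μ (BalTensor (A := UTakiff 𝔤) D.S M) where
  wt := wtDecomp_balTensor (D.κ_a h𝔥) (D.κ_b h𝔥) hM.wt
  killed x := by
    obtain ⟨k, m, rfl⟩ := D.pair.exists_br x
    obtain ⟨n, hn⟩ := hM.killed m
    have ha : ∀ u ∈ uSub (nCompl 𝔥 Δ α), D.pair.a * u - u * D.pair.a ∈ uSub (nCompl 𝔥 Δ α) :=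
      fun u hu => uBase_normalizes (fun y hy => D.lie_f_mem_nCompl h𝔥 hΔ hα hy) hu
    have hb : ∀ u ∈ uSub (nCompl 𝔥 Δ α), D.pair.b * u - u * D.pair.b ∈ uSub (nCompl 𝔥 Δ α) :=
      fun u hu => uBar_normalizes (fun y hy => D.lie_f_mem_nCompl h𝔥 hΔ hα hy) hu
    rw [uSub_sup_span]
    exact KilledBy.sup_span _ (uSub_fg _) D.pair.comm ha hb D.pair.locNilpotent_a
      D.pair.locNilpotent_b ((hn.anti (uSub_mono nCompl_le_nPlus)).br _ ha hb k k)
  eig h := (hM.eig h).balTensor (D.κ'_a h𝔥 h) (D.κ'_b h)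

/-- The identity from `S ⊗ M` to `T M`. -/
noncomputable def toT (M : ModuleCat.{u} (UTakiff 𝔤)) :
    BalTensor (A := UTakiff 𝔤) D.S M ≃+ D.T.obj M := AddEquiv.refl (BalTensor (A := UTakiff 𝔤) D.S M)

lemma toT_smul (M : ModuleCat.{u} (UTakiff 𝔤)) (u : UTakiff 𝔤) (x : BalTensor (A := UTakiff 𝔤) D.S M) :
    D.toT M (twist (D.φ : 𝔤 →ₗ⁅ℂ⁆ 𝔤) u • x) = u • D.toT M x := rfl

/-- The module `φ⁻¹(N)`. -/
noncomputable abbrev untwist (N : ModuleCat.{u} (UTakiff 𝔤)) : ModuleCat.{u} (UTakiff 𝔤) :=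
  (ModuleCat.restrictScalars (twist (D.φ.symm : 𝔤 →ₗ⁅ℂ⁆ 𝔤)).toRingHom).obj N

/-- The identity from `N` to `φ⁻¹(N)`. -/
noncomputable def toUntwist (N : ModuleCat.{u} (UTakiff 𝔤)) : N ≃+ D.untwist N := AddEquiv.refl N

lemma toUntwist_smul (N : ModuleCat.{u} (UTakiff 𝔤)) (u : UTakiff 𝔤) (x : N) :
    D.toUntwist N (twist (D.φ.symm : 𝔤 →ₗ⁅ℂ⁆ 𝔤) u • x) = u • D.toUntwist N x := rfl

include h𝔥 in
lemma catC_T {M : ModuleCat.{u} (UTakiff 𝔤)} (hM : catC 𝔥 M) : catC 𝔥 (D.T.obj M) :=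
  isHSemisimple_iff.mpr ((wtDecomp_balTensor (D.κ_a h𝔥) (D.κ_b h𝔥)
    (isHSemisimple_iff.mp hM)).twist (D.toT M) (D.toT_smul M) D.twist_κ D.s_comp_reflection)

include h𝔥 in
lemma catC_G (N : ModuleCat.{u} (UTakiff 𝔤)) : catC 𝔥 (D.G.obj N) :=
  isHSemisimple_iff.mpr (wtDecomp_hPart h𝔥 _)

include h𝔥 hΔ hα in
lemma catOmu_T (hμ : μ D.coroot ≠ 0) {M : ModuleCat.{u} (UTakiff 𝔤)} (hM : catOmu 𝔥 Δ μ M) :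
    catOmu 𝔥 Δ (D.s μ) (D.T.obj M) := by
  obtain ⟨hfin, hM⟩ := (catOmu_iff h𝔥 hΔ).mp hM
  refine (catOmu_iff h𝔥 hΔ).mpr ⟨?_, (D.isOpp_balTensor h𝔥 hΔ hα hM).isOmu h𝔥 hΔ hα D (D.toT M)
    (D.toT_smul M)⟩
  have := ((hM.highestType h𝔥 hΔ hα D).finite_iff hμ).mp hfin
  exact finite_twist (D.toT M) (D.toT_smul M) D.twist_symm_twist D.twist_twist_symm

end TwistingData

end Twist

/-! ### Coinduced modules and the counit -/

/-- A submodule containing all vectors killed by `a` and `b` is everything. -/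
lemma TakiffTriple.eq_top_of_invariants {A : Type u} [Ring A] [Algebra ℂ A] {P : OrePair A}
    (D : TakiffTriple P) {N : Type u} [AddCommGroup N] [Module A N] {c : ℂ} (hc : c ≠ 0)
    (hN : LocGenEigen D.h' c N) (ha : LocNilpotent P.a N) (hb : LocNilpotent P.b N)
    (Y : Submodule A N) (H : ∀ v : N, P.a • v = 0 → P.b • v = 0 → v ∈ Y) : Y = ⊤ := by
  let _ := Module.restrictScalars ℂ A N
  have _ := IsScalarTower.restrictScalars ℂ A N
  -- Coregularity inside `Y` yields corrections `z, w ∈ Y` such that `t - z - w` is killed by `a`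
  -- and `b`. So `N / Y` has no nonzero vector killed by both, and therefore vanishes.
  have h1 : ∀ t : N, P.a • t ∈ Y → P.b • t ∈ Y → t ∈ Y := by
    intro t hat hbt
    obtain ⟨z, hz, hbz⟩ := D.exists_b_smul_eq hc hN (Y.restrictScalars ℂ)
      (fun m hm => Y.smul_mem _ hm) (fun m hm => Y.smul_mem _ hm) (fun m hm => Y.smul_mem _ hm) hb hbt
    obtain ⟨w, hw, hbw, haw⟩ := D.exists_a_smul_eq hc hN (Y.restrictScalars ℂ)
      (fun m hm => Y.smul_mem _ hm) (fun m hm => Y.smul_mem _ hm) (fun m hm => Y.smul_mem _ hm) ha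
      (m := P.a • t - P.a • z) (sub_mem hat (Y.smul_mem _ hz))
      (by rw [← smul_sub, ← mul_smul, ← P.comm.eq, mul_smul, smul_sub, hbz, sub_self, smul_zero])
    have h2 : t - z - w ∈ Y := H _ (by rw [smul_sub, smul_sub, haw, sub_self])
      (by rw [smul_sub, smul_sub, hbz, hbw, sub_self, sub_zero])
    have := add_mem (add_mem h2 hw) hz
    rwa [sub_add_cancel, sub_add_cancel] at this
  have h3 : (⊤ : Submodule A (N ⧸ Y)) = ⊥ := by
    refine P.eq_bot_of_invariants (fun x => ?_) (fun x => ?_) ⊤ fun t _ h4 h5 => ?_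
    · obtain ⟨m, rfl⟩ := Y.mkQ_surjective x
      obtain ⟨n, hn⟩ := ha m
      exact ⟨n, by rw [← map_smul, hn, map_zero]⟩
    · obtain ⟨m, rfl⟩ := Y.mkQ_surjective x
      obtain ⟨n, hn⟩ := hb m
      exact ⟨n, by rw [← map_smul, hn, map_zero]⟩
    · obtain ⟨m, rfl⟩ := Y.mkQ_surjective t
      rw [← map_smul, Submodule.mkQ_apply, Submodule.Quotient.mk_eq_zero] at h4 h5
      rw [Submodule.mkQ_apply, Submodule.Quotient.mk_eq_zero]
      exact h1 m h4 h5
  refine eq_top_iff.mpr fun x _ => ?_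
  rw [← Submodule.Quotient.mk_eq_zero]
  exact (Submodule.mem_bot A).mp (h3 ▸ Submodule.mem_top)

section Comp

variable {A : Type u} [Ring A] {S : Type u} [AddCommGroup S] [Module A S] [Module Aᵐᵒᵖ S]
  [SMulCommClass A Aᵐᵒᵖ S] {N N' : Type u} [AddCommGroup N] [Module A N] [AddCommGroup N']
  [Module A N']

/-- Composition of elements of `Hom_A(S, N)` with a linear map. -/
def BimodHom.comp (f : N →ₗ[A] N') : BimodHom (A := A) S N →ₗ[A] BimodHom (A := A) S N' where
  toFun g := BimodHom.ofLin (f ∘ₗ g.toLin)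
  map_add' _ _ := BimodHom.ext fun _ => map_add f _ _
  map_smul' _ _ := BimodHom.ext fun _ => rfl

lemma BimodHom.comp_apply (f : N →ₗ[A] N') (g : BimodHom (A := A) S N) (s : S) :
    BimodHom.comp f g s = f (g s) := rfl

end Comp

section Counit

variable {𝔤 : Type u} [LieRing 𝔤] [LieAlgebra ℂ 𝔤] [FiniteDimensional ℂ 𝔤]
  {𝔥 : LieSubalgebra ℂ 𝔤} [LieRing.IsNilpotent 𝔥] {Δ : Set (Module.Dual ℂ 𝔥)}
  {μ : Module.Dual ℂ 𝔥} (h𝔥 : IsSplit 𝔥) (hΔ : IsSimpleSystem 𝔥 Δ)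
  {α : Module.Dual ℂ 𝔥} (hα : α ∈ Δ) (D : TwistingData 𝔥 α) (hμ : μ D.coroot ≠ 0)

namespace TwistingData

lemma isNilpotent_ad_e : IsNilpotent (LieAlgebra.ad ℂ 𝔤 D.e) := by
  refine LieAlgebra.isNilpotent_ad_of_mem_rootSpace 𝔥 (χ := α) (fun h => ?_) D.e_mem
  have h1 := congrFun h D.coroot
  have h2 := D.root_coroot
  simp [h2] at h1

include h𝔥 hΔ hα in
/-- A vector killed by `e`, `ē` and powers of the nilradical of the minimal parabolic is killed by
powers of `𝔫_ε`. -/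
lemma exists_killedBy_nPlus {M : Type u} [AddCommGroup M] [Module (UTakiff 𝔤) M] {m : M}
    (he : uBase D.e • m = 0) (he' : uBar D.e • m = 0) {n : ℕ}
    (hm : KilledBy (uSub (nCompl 𝔥 Δ α) : Set (UTakiff 𝔤)) n m) :
    ∃ k, KilledBy (uSub (nPlus 𝔥 Δ) : Set (UTakiff 𝔤)) k m := by
  let _ := Module.restrictScalars ℂ (UTakiff 𝔤) M
  have _ := IsScalarTower.restrictScalars ℂ (UTakiff 𝔤) M
  -- On the cyclic submodule generated by `m`, the elements `e` and `ē` are locally nilpotent,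
  -- because they kill the generator and are ad-nilpotent. This makes `KilledBy.sup_span`
  -- applicable.
  let X : Submodule (UTakiff 𝔤) M := Submodule.span (UTakiff 𝔤) {m}
  have hX : ∀ x : UTakiff 𝔤, (∀ u, AdNil x u) → x • m = 0 → LocNilpotent x X := by
    rintro x hx hxm ⟨y, hy⟩
    obtain ⟨u, rfl⟩ := Submodule.mem_span_singleton.mp hy
    obtain ⟨j, hj⟩ := exists_pow_smul_smul_eq_zero (hx u) (k := 1) (m := m) (by rwa [pow_one])
    exact ⟨j, Subtype.ext hj⟩
  have hcomm : Commute (uBase D.e) (uBar D.e) := by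
    rw [commute_iff_eq, uBase_mul_uBar, lie_self, map_zero, add_zero]
  have h1 : KilledBy (uSub (nCompl 𝔥 Δ α) : Set (UTakiff 𝔤)) n
      (⟨m, Submodule.mem_span_singleton_self m⟩ : X) :=
    KilledBy.of_map X.subtype Subtype.val_injective hm
  obtain ⟨k, hk⟩ := KilledBy.sup_span _ (uSub_fg _) hcomm
    (fun u hu => uBase_normalizes (fun y hy => D.lie_e_mem_nCompl h𝔥 hΔ hα hy) hu)
    (fun u hu => uBar_normalizes (fun y hy => D.lie_e_mem_nCompl h𝔥 hΔ hα hy) hu)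
    (hX _ (adNil_toU 1 D.e D.isNilpotent_ad_e) he)
    (hX _ (adNil_toU DualNumber.eps D.e D.isNilpotent_ad_e) he') h1
  refine ⟨k, ?_⟩
  rw [D.nPlus_eq hΔ h𝔥 hα, uSub_sup_span]
  exact hk.map X.subtype

variable {N : Type u} [AddCommGroup N] [Module (UTakiff 𝔤) N] {D}

section

variable (K : Submodule (UTakiff 𝔤) (BimodHom (A := UTakiff 𝔤) D.S N)) (hK : IsOmu 𝔥 Δ μ K)

-- The kernel of evaluation pulls back to the maps `g ∈ K` with all `g(s) = 0`, that is to zero, and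
-- for modules of highest type this forces the kernel to vanish.
include hΔ hα hμ hK h𝔥 in
lemma balLift_subtype_injective : Function.Injective (balLift K.subtype) := by
  rw [← LinearMap.ker_eq_bot]
  refine (hK.highestType h𝔥 hΔ hα D).eq_bot_of_pull hμ _ ?_
  rw [Submodule.eq_bot_iff]
  intro g hg
  exact Subtype.ext (BimodHom.ext fun s => LinearMap.mem_ker.mp (hg s))

variable (hK' : ∀ m, m ∈ K ↔
  m ∈ AddSubgroup.closure {m : BimodHom (A := UTakiff 𝔤) D.S N | ∃ l, IsWt (κ 𝔥) l m} ∧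
    (∃ n, KilledBy (uSub (nPlus 𝔥 Δ) : Set (UTakiff 𝔤)) n m) ∧
    ∀ h, ∃ k, (κ' 𝔥 h - algebraMap ℂ _ (μ h)) ^ k • m = 0) (hN : D.IsOpp Δ μ N)

-- The coinduced vector `g` with `g(a⁻¹ b⁻¹) = v` has a weight, is killed by `e`, `ē` and by powers
-- of the nilradical of the minimal parabolic, and inherits nilpotency of `h̄ - μ(h)` from `v`.
-- These are the conditions for membership in `K`.
include hΔ hα hμ h𝔥 hN hK' in
lemma mem_range_of_isWt {v : N} {l : Module.Dual ℂ 𝔥} (hl : IsWt (κ 𝔥) l v)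
    (ha : D.pair.a • v = 0) (hb : D.pair.b • v = 0) : v ∈ LinearMap.range (balLift K.subtype) := by
  have hf : D.f ∈ nCompl 𝔥 Δ α ⊔ ℂ ∙ D.f :=
    Submodule.mem_sup_right (Submodule.mem_span_singleton_self _)
  obtain ⟨n, hn⟩ := hN.killed v
  obtain ⟨g, hg1, hg2, hg3, hg4, hg5, hg6⟩ := (D.cartanAction h𝔥).exists_bimodHom hμ
    (hN.eig D.coroot) (locNilpotent_of_killedBy hN.killed (uBase_mem_uSub hf))
    (locNilpotent_of_killedBy hN.killed (uBar_mem_uSub hf)) hN.wt (uSub (nCompl 𝔥 Δ α))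
    (fun u hu => uBase_normalizes (fun y hy => D.lie_f_mem_nCompl h𝔥 hΔ hα hy) hu)
    (fun u hu => uBar_normalizes (fun y hy => D.lie_f_mem_nCompl h𝔥 hΔ hα hy) hu)
    (fun u hu => uBase_normalizes (fun y hy => D.lie_e_mem_nCompl h𝔥 hΔ hα hy) hu)
    (fun u hu => uBar_normalizes (fun y hy => D.lie_e_mem_nCompl h𝔥 hΔ hα hy) hu)
    (fun u hu => uBar_normalizes (fun y hy => hΔ.lie_cartan_mem_nCompl h𝔥 hα _ hy) hu)
    (fun h u hu => uBase_normalizes (fun y hy => hΔ.lie_cartan_mem_nCompl h𝔥 hα h hy) hu)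
    hl ha hb (hn.anti (uSub_mono le_sup_left))
  have hgK : g ∈ K := by
    refine (hK' g).mpr ⟨AddSubgroup.subset_closure ⟨_, hg1⟩,
      D.exists_killedBy_nPlus h𝔥 hΔ hα hg2 hg3 hg4, fun h => ?_⟩
    obtain ⟨k, hk⟩ := hN.eig h v
    -- The last clause of `exists_bimodHom` is used with `z = h̄ - μ(h)`, which commutes with the
    -- Casimir element and with `𝔥`.
    refine ⟨k, hg6 _ (α h) ?_ (fun h' => ?_) ?_ ?_ k hk⟩
    · rw [mul_sub, sub_mul, D.casimir_κ' h𝔥, Algebra.commutes]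
    · rw [mul_sub, sub_mul, κ_κ' h𝔥, Algebra.commutes]
    · rw [sub_mul, D.κ'_a h𝔥, mul_sub, Algebra.commutes]; abel
    · rw [sub_mul, D.κ'_b, mul_sub, Algebra.commutes]
  exact ⟨pureTensor (A := UTakiff 𝔤) D.S (D.pair.proj (D.pair.frac 1 1)) ⟨g, hgK⟩, hg5⟩

include hΔ hα hμ h𝔥 hN hK' in
lemma balLift_subtype_surjective : Function.Surjective (balLift K.subtype) := by
  have hf : D.f ∈ nCompl 𝔥 Δ α ⊔ ℂ ∙ D.f :=
    Submodule.mem_sup_right (Submodule.mem_span_singleton_self _)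
  rw [← LinearMap.range_eq_top]
  refine (D.triple h𝔥).eq_top_of_invariants hμ (hN.eig D.coroot)
    (locNilpotent_of_killedBy hN.killed (uBase_mem_uSub hf))
    (locNilpotent_of_killedBy hN.killed (uBar_mem_uSub hf)) _ fun v ha hb => ?_
  let _ := Module.restrictScalars ℂ (UTakiff 𝔤) N
  have _ := IsScalarTower.restrictScalars ℂ (UTakiff 𝔤) N
  let X : Submodule ℂ N := LinearMap.ker (Algebra.lsmul ℂ ℂ N D.pair.a) ⊓
    LinearMap.ker (Algebra.lsmul ℂ ℂ N D.pair.b)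
  have hX : ∀ h : 𝔥, ∀ x ∈ X, κ 𝔥 h • x ∈ X := by
    rintro h x ⟨h1, h2⟩
    change D.pair.a • x = 0 at h1
    change D.pair.b • x = 0 at h2
    have e1 : D.pair.a * κ 𝔥 h = κ 𝔥 h * D.pair.a + α h • D.pair.a := by
      rw [D.κ_a h𝔥, sub_add_cancel]
    have e2 : D.pair.b * κ 𝔥 h = κ 𝔥 h * D.pair.b + α h • D.pair.b := by
      rw [D.κ_b h𝔥, sub_add_cancel]
    refine ⟨?_, ?_⟩
    · change D.pair.a • κ 𝔥 h • x = 0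
      rw [← mul_smul, e1, add_smul, mul_smul, smul_assoc, h1, smul_zero, smul_zero, add_zero]
    · change D.pair.b • κ 𝔥 h • x = 0
      rw [← mul_smul, e2, add_smul, mul_smul, smul_assoc, h2, smul_zero, smul_zero, add_zero]
  obtain ⟨w, hw, rfl⟩ := hN.wt v
  have h3 := isWt_mem_of_finsuppSum_mem X hX w hw ⟨ha, hb⟩
  exact sum_mem fun l _ => mem_range_of_isWt h𝔥 hΔ hα hμ K hK' hN (hw l) (h3 l).1 (h3 l).2

-- Since `N ≅ S ⊗ K`, a weight vector of `Hom(S, N)` is one of `Hom(S, S ⊗ K)`. As `K` is finitely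
-- generated its weights are bounded, so by the theorem on the unit this vector comes from `K`.
include hΔ hα hμ h𝔥 hN hK' hK in
lemma hPart_bimodHom_eq [Module.Finite (UTakiff 𝔤) K] :
    hPart 𝔥 (BimodHom (A := UTakiff 𝔤) D.S N) = K := by
  refine le_antisymm (fun g hg => ?_) fun g hg => (mem_hPart_iff h𝔥).mpr ((hK' g).mp hg).1
  refine (AddSubgroup.closure_le K.toAddSubgroup).mpr ?_ ((mem_hPart_iff h𝔥).mp hg)
  rintro g ⟨l, hl⟩
  let E := LinearEquiv.ofBijective (balLift K.subtype)
    ⟨balLift_subtype_injective h𝔥 hΔ hα hμ K hK,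
      balLift_subtype_surjective h𝔥 hΔ hα hμ K hK' hN⟩
  obtain ⟨m, hm⟩ := (hK.highestType h𝔥 hΔ hα D).exists_balUnit_eq_of_isWt hμ (D.κ_a h𝔥) (D.κ_b h𝔥)
    hK.wt (hK.wtBounded h𝔥 hΔ hα) (hl.map (BimodHom.comp E.symm.toLinearMap))
  have : g = m := by
    refine BimodHom.ext fun s => ?_
    have h1 := congrArg (fun g => E (g s)) hm
    simp only [BimodHom.comp_apply, balUnit_apply] at h1
    exact (E.apply_symm_apply _).symm.trans h1
  rw [this]
  exact m.2

end

include hΔ hα hμ h𝔥 in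
theorem IsOpp.hPart [Module.Finite (UTakiff 𝔤) N] (hN : D.IsOpp Δ μ N) :
    IsOmu 𝔥 Δ μ (hPart 𝔥 (BimodHom (A := UTakiff 𝔤) D.S N)) ∧
      Module.Finite (UTakiff 𝔤) (TakiffO.hPart 𝔥 (BimodHom (A := UTakiff 𝔤) D.S N)) ∧
      Function.Bijective (balLift (TakiffO.hPart 𝔥 (BimodHom (A := UTakiff 𝔤) D.S N)).subtype) := by
  obtain ⟨K, hK, hK'⟩ := exists_omuPart h𝔥 hΔ μ (BimodHom (A := UTakiff 𝔤) D.S N)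
  have hbij : Function.Bijective (balLift K.subtype) :=
    ⟨balLift_subtype_injective h𝔥 hΔ hα hμ K hK,
      balLift_subtype_surjective h𝔥 hΔ hα hμ K hK' hN⟩
  -- Finite generation descends from `N ≅ S ⊗ K` to `K` through the isomorphism of submodule
  -- lattices.
  have hfin : Module.Finite (UTakiff 𝔤) K :=
    ((hK.highestType h𝔥 hΔ hα D).finite_iff hμ).mpr
      (Module.Finite.equiv (LinearEquiv.ofBijective _ hbij).symm)
  rw [hPart_bimodHom_eq h𝔥 hΔ hα hμ K hK hK' hN]
  exact ⟨hK, hfin, hbij⟩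

variable (D) in
include hΔ hα hμ h𝔥 in
lemma catOmu_G {N : ModuleCat.{u} (UTakiff 𝔤)} (hN : catOmu 𝔥 Δ (D.s μ) N) :
    catOmu 𝔥 Δ μ (D.G.obj N) := by
  obtain ⟨hfin, hN⟩ := (catOmu_iff h𝔥 hΔ).mp hN
  have := finite_twist (D.toUntwist N) (D.toUntwist_smul N) D.twist_twist_symm D.twist_symm_twist
  have h := (D.isOpp_of_isOmu h𝔥 hΔ hα hN (D.toUntwist N) (D.toUntwist_smul N)).hPart h𝔥 hΔ hα hμ
  exact (catOmu_iff h𝔥 hΔ).mpr ⟨h.2.1, h.1⟩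

include hΔ hα hμ h𝔥 in
theorem balUnit_bijective {M : Type u} [AddCommGroup M] [Module (UTakiff 𝔤) M]
    [Module.Finite (UTakiff 𝔤) M] (hM : IsOmu 𝔥 Δ μ M) :
    Function.Injective (balUnit (A := UTakiff 𝔤) D.S M) ∧
      ∀ g ∈ TakiffO.hPart 𝔥 (BimodHom (A := UTakiff 𝔤) D.S (BalTensor (A := UTakiff 𝔤) D.S M)),
        ∃ m, balUnit (A := UTakiff 𝔤) D.S M m = g := by
  constructor
  · rw [injective_iff_map_eq_zero]
    intro m hm
    refine (hM.highestType h𝔥 hΔ hα D).eq_zero_of_pureTensor hμ fun s => ?_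
    exact congrArg (fun g => g s) hm
  · intro g hg
    refine (AddSubgroup.closure_le (LinearMap.range (balUnit (A := UTakiff 𝔤) D.S M)).toAddSubgroup).mpr
      ?_ ((mem_hPart_iff h𝔥).mp hg)
    rintro g ⟨l, hl⟩
    obtain ⟨m, hm⟩ := (hM.highestType h𝔥 hΔ hα D).exists_balUnit_eq_of_isWt hμ (D.κ_a h𝔥) (D.κ_b h𝔥)
      hM.wt (hM.wtBounded h𝔥 hΔ hα) hl
    exact ⟨m, hm.symm⟩

end TwistingData

end Counit

/-! ### The adjunction and the equivalence -/

section BalEquiv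

variable {A : Type u} [Ring A] (S : Type u) [AddCommGroup S] [Module A S] [Module Aᵐᵒᵖ S]
  [SMulCommClass A Aᵐᵒᵖ S] (M N : Type u) [AddCommGroup M] [Module A M] [AddCommGroup N]
  [Module A N]

/-- The tensor-hom adjunction for the bimodule `S`. -/
noncomputable def balEquiv :
    (BalTensor (A := A) S M →ₗ[A] N) ≃ (M →ₗ[A] BimodHom (A := A) S N) where
  toFun f := BimodHom.comp f ∘ₗ balUnit (A := A) S M
  invFun g := balLift g
  left_inv f := by
    refine LinearMap.ext fun t => ?_
    refine balTensor_induction (p := fun t => balLift _ t = f t) t (fun s m => rfl) ?_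
    exact fun x y hx hy => by rw [map_add, map_add, hx, hy]
  right_inv g := LinearMap.ext fun m => BimodHom.ext fun s => rfl

end BalEquiv

section Functors

variable {𝔤 : Type u} [LieRing 𝔤] [LieAlgebra ℂ 𝔤] [FiniteDimensional ℂ 𝔤]
  {𝔥 : LieSubalgebra ℂ 𝔤} [LieRing.IsNilpotent 𝔥] {Δ : Set (Module.Dual ℂ 𝔥)}
  {μ : Module.Dual ℂ 𝔥} (h𝔥 : IsSplit 𝔥) (hΔ : IsSimpleSystem 𝔥 Δ)
  {α : Module.Dual ℂ 𝔥} (hα : α ∈ Δ) (D : TwistingData 𝔥 α) (hμ : μ D.coroot ≠ 0)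

lemma map_mem_hPart {M X : Type u} [AddCommGroup M] [Module (UTakiff 𝔤) M] [AddCommGroup X]
    [Module (UTakiff 𝔤) X] (hM : IsHSemisimple 𝔥 M) (f : M →ₗ[UTakiff 𝔤] X) (m : M) :
    f m ∈ hPart 𝔥 X := by
  refine hPart_le_comap 𝔥 f (le_sSup (a := ⊤) (s := {N : Submodule (UTakiff 𝔤) M | IsHSemisimple 𝔥 N}) ?_
    Submodule.mem_top)
  change IsHSemisimple 𝔥 (⊤ : Submodule (UTakiff 𝔤) M)
  rw [isHSemisimple_iff] at hM ⊢
  exact hM.of_surjective Submodule.topEquiv.symm.toLinearMap Submodule.topEquiv.symm.surjective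

/-- Maps from an `𝔥`-semisimple module take values in the largest `𝔥`-semisimple submodule. -/
def hPartEquiv {M X : Type u} [AddCommGroup M] [Module (UTakiff 𝔤) M] [AddCommGroup X]
    [Module (UTakiff 𝔤) X] (hM : IsHSemisimple 𝔥 M) :
    (M →ₗ[UTakiff 𝔤] X) ≃ (M →ₗ[UTakiff 𝔤] hPart 𝔥 X) where
  toFun f := f.codRestrict _ (map_mem_hPart hM f)
  invFun g := (hPart 𝔥 X).subtype ∘ₗ g
  left_inv _ := rfl
  right_inv _ := rfl

namespace TwistingData

/-- Maps `T M → N` are the same as maps `S ⊗ M → φ⁻¹(N)`. -/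
noncomputable def twistEquiv (M N : ModuleCat.{u} (UTakiff 𝔤)) :
    (D.T.obj M ⟶ N) ≃ (BalTensor (A := UTakiff 𝔤) D.S M →ₗ[UTakiff 𝔤] D.untwist N) where
  toFun f :=
    { toFun := fun x => D.toUntwist N (f.hom (D.toT M x))
      map_add' := fun x y => by rw [map_add, map_add, map_add]
      map_smul' := fun u x => by
        rw [← D.twist_twist_symm u, D.toT_smul, map_smul, D.toUntwist_smul, D.twist_twist_symm]
        rfl }
  invFun g := (ModuleCat.homEquiv (M := D.T.obj M) (N := N)).symm
    { toFun := fun x => (D.toUntwist N).symm (g ((D.toT M).symm x))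
      map_add' := fun x y => by rw [map_add, map_add, map_add]
      map_smul' := fun u x => by
        obtain ⟨y, rfl⟩ := (D.toT M).surjective x
        rw [← D.toT_smul, AddEquiv.symm_apply_apply, AddEquiv.symm_apply_apply, map_smul]
        obtain ⟨z, hz⟩ := (D.toUntwist N).surjective (g y)
        rw [← hz, ← D.toUntwist_smul, D.twist_symm_twist, AddEquiv.symm_apply_apply]
        rfl }
  left_inv f := rfl
  right_inv g := rfl

/-- The adjunction on the level of morphisms. -/
noncomputable def homEquiv {M : ModuleCat.{u} (UTakiff 𝔤)} (hM : IsHSemisimple 𝔥 M)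
    (N : ModuleCat.{u} (UTakiff 𝔤)) : (D.T.obj M ⟶ N) ≃ (M ⟶ D.G.obj N) :=
  (D.twistEquiv M N).trans ((balEquiv D.S M (D.untwist N)).trans
    ((hPartEquiv hM).trans (ModuleCat.homEquiv (M := M) (N := D.G.obj N)).symm))

lemma homEquiv_naturality_left_symm {M M' : ModuleCat.{u} (UTakiff 𝔤)} (hM : IsHSemisimple 𝔥 M)
    (hM' : IsHSemisimple 𝔥 M') {N : ModuleCat.{u} (UTakiff 𝔤)} (f : M' ⟶ M) (g : M ⟶ D.G.obj N) :
    (D.homEquiv hM' N).symm (f ≫ g) = D.T.map f ≫ (D.homEquiv hM N).symm g := by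
  rw [Equiv.symm_apply_eq]
  refine ModuleCat.hom_ext (LinearMap.ext fun m => Subtype.ext (BimodHom.ext fun s => ?_))
  rfl

lemma homEquiv_naturality_right {M : ModuleCat.{u} (UTakiff 𝔤)} (hM : IsHSemisimple 𝔥 M)
    {N N' : ModuleCat.{u} (UTakiff 𝔤)} (f : D.T.obj M ⟶ N) (g : N ⟶ N') :
    D.homEquiv hM N' (f ≫ g) = D.homEquiv hM N f ≫ D.G.map g := rfl

/-- The adjunction between the restrictions of `T` and `G` to full subcategories. -/
noncomputable def restrictAdjunction {p q : ObjectProperty (ModuleCat.{u} (UTakiff 𝔤))}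
    (hp : ∀ M, p M → catC 𝔥 M) (hT : ∀ M, p M → q (D.T.obj M)) (hG : ∀ N, q N → p (D.G.obj N)) :
    restrictTo D.T hT ⊣ restrictTo D.G hG :=
  Adjunction.mkOfHomEquiv
    { homEquiv := fun M N => (q.fullyFaithfulι.homEquiv (X := (restrictTo D.T hT).obj M) (Y := N)).trans
        ((D.homEquiv (hp M.obj M.property) N.obj).trans (p.fullyFaithfulι.homEquiv (X := M) (Y := (restrictTo D.G hG).obj N)).symm)
      homEquiv_naturality_left_symm := fun {M' M _} f g => ObjectProperty.hom_ext _
        (D.homEquiv_naturality_left_symm (hp _ M.property) (hp _ M'.property) f.hom g.hom)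
      homEquiv_naturality_right := fun {M _ _} f g => ObjectProperty.hom_ext _
        (D.homEquiv_naturality_right (hp _ M.property) f.hom g.hom) }

lemma exists_untwist_T (M : ModuleCat.{u} (UTakiff 𝔤)) :
    ∃ θ : D.untwist (D.T.obj M) →ₗ[UTakiff 𝔤] BalTensor (A := UTakiff 𝔤) D.S M,
      ∀ x, θ x = (D.toT M).symm ((D.toUntwist _).symm x) :=
  ⟨{ toFun := fun x => (D.toT M).symm ((D.toUntwist _).symm x)
     map_add' := fun x y => by rw [map_add, map_add]
     map_smul' := fun u x => by
       obtain ⟨y, rfl⟩ := (D.toUntwist _).surjective x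
       obtain ⟨z, rfl⟩ := (D.toT M).surjective y
       rw [← D.toUntwist_smul, ← D.toT_smul, D.twist_twist_symm]
       simp only [AddEquiv.symm_apply_apply, RingHom.id_apply] }, fun _ => rfl⟩

-- The unit of the adjunction takes values in maps to `φ⁻¹(φ(S ⊗ M))`. The map `θ` undoes the two
-- twists, and the statement about `balUnit` carries over.
include h𝔥 hΔ hα hμ in
lemma bijective_of_apply_eq {M Y : Type u} [AddCommGroup M] [Module (UTakiff 𝔤) M]
    [Module.Finite (UTakiff 𝔤) M] [AddCommGroup Y] [Module (UTakiff 𝔤) Y] (hM : IsOmu 𝔥 Δ μ M)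
    (θ : Y →ₗ[UTakiff 𝔤] BalTensor (A := UTakiff 𝔤) D.S M) (hθ : Function.Injective θ)
    (η : M → hPart 𝔥 (BimodHom (A := UTakiff 𝔤) D.S Y))
    (hη : ∀ m s, θ ((hPart 𝔥 (BimodHom (A := UTakiff 𝔤) D.S Y)).subtype (η m) s) =
      pureTensor (A := UTakiff 𝔤) D.S s m) : Function.Bijective η := by
  obtain ⟨h1, h2⟩ := balUnit_bijective h𝔥 hΔ hα hμ (D := D) hM
  constructor
  · intro m m' h
    refine h1 (BimodHom.ext fun s => ?_)
    rw [balUnit_apply, balUnit_apply, ← hη, ← hη, h]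
  · intro g
    obtain ⟨m, hm⟩ := h2 _ (hPart_le_comap 𝔥 (BimodHom.comp θ) g.2)
    refine ⟨m, Subtype.ext (BimodHom.ext fun s => hθ ?_)⟩
    refine (hη m s).trans ?_
    rw [← balUnit_apply, hm, BimodHom.comp_apply]

include h𝔥 hΔ hα hμ in
lemma bijective_homEquiv_id {M : ModuleCat.{u} (UTakiff 𝔤)} (hM : catOmu 𝔥 Δ μ M) :
    Function.Bijective (D.homEquiv hM.1.2.1 (D.T.obj M) (𝟙 _)).hom := by
  obtain ⟨hfin, hO⟩ := (catOmu_iff h𝔥 hΔ).mp hM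
  obtain ⟨θ, hθ⟩ := D.exists_untwist_T M
  refine D.bijective_of_apply_eq h𝔥 hΔ hα hμ hO θ (fun x y h => ?_) _ fun m s => ?_
  · rw [hθ, hθ] at h
    exact (D.toUntwist _).symm.injective ((D.toT M).symm.injective h)
  · exact hθ _

include h𝔥 hΔ hα hμ in
lemma isIso_homEquiv_id {M : ModuleCat.{u} (UTakiff 𝔤)} (hM : catOmu 𝔥 Δ μ M) :
    IsIso (D.homEquiv hM.1.2.1 (D.T.obj M) (𝟙 _)) :=
  (ConcreteCategory.isIso_iff_bijective _).mpr (D.bijective_homEquiv_id h𝔥 hΔ hα hμ hM)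

include h𝔥 hΔ hα hμ in
lemma isIso_homEquiv_symm_id {N : ModuleCat.{u} (UTakiff 𝔤)} (hN : catOmu 𝔥 Δ (D.s μ) N) :
    IsIso ((D.homEquiv (D.catC_G h𝔥 N) N).symm (𝟙 _)) := by
  obtain ⟨hfin, hO⟩ := (catOmu_iff h𝔥 hΔ).mp hN
  have := finite_twist (D.toUntwist N) (D.toUntwist_smul N) D.twist_twist_symm D.twist_symm_twist
  have h := (D.isOpp_of_isOmu h𝔥 hΔ hα hO (D.toUntwist N) (D.toUntwist_smul N)).hPart h𝔥 hΔ hα hμ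
  rw [ConcreteCategory.isIso_iff_bijective]
  exact h.2.2

include h𝔥 hΔ hα hμ in
theorem exists_equivalence :
    ∃ (hT : ∀ M, catOmu 𝔥 Δ μ M → catOmu 𝔥 Δ (D.s μ) (D.T.obj M))
      (hG : ∀ N, catOmu 𝔥 Δ (D.s μ) N → catOmu 𝔥 Δ μ (D.G.obj N))
      (E : (catOmu 𝔥 Δ μ).FullSubcategory ≌ (catOmu 𝔥 Δ (D.s μ)).FullSubcategory),
      E.functor = restrictTo D.T hT ∧ E.inverse = restrictTo D.G hG := by
  refine ⟨fun M hM => D.catOmu_T h𝔥 hΔ hα hμ hM, fun N hN => D.catOmu_G h𝔥 hΔ hα hμ hN, ?_⟩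
  let adj := D.restrictAdjunction (p := catOmu 𝔥 Δ μ) (q := catOmu 𝔥 Δ (D.s μ))
    (fun M hM => hM.1.2.1) (fun M hM => D.catOmu_T h𝔥 hΔ hα hμ hM)
    (fun N hN => D.catOmu_G h𝔥 hΔ hα hμ hN)
  have h1 : ∀ X, IsIso (adj.unit.app X) := fun X => by
    have : IsIso ((catOmu 𝔥 Δ μ).ι.map (adj.unit.app X)) :=
      D.isIso_homEquiv_id h𝔥 hΔ hα hμ X.property
    exact isIso_of_reflects_iso _ (catOmu 𝔥 Δ μ).ι
  have h2 : ∀ Y, IsIso (adj.counit.app Y) := fun Y => by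
    have : IsIso ((catOmu 𝔥 Δ (D.s μ)).ι.map (adj.counit.app Y)) :=
      D.isIso_homEquiv_symm_id h𝔥 hΔ hα hμ Y.property
    exact isIso_of_reflects_iso _ (catOmu 𝔥 Δ (D.s μ)).ι
  exact ⟨adj.toEquivalence, rfl, rfl⟩

end TwistingData

end Functors

/-! ### Verma modules -/

section Verma

variable {𝔤 : Type u} [LieRing 𝔤] [LieAlgebra ℂ 𝔤] [FiniteDimensional ℂ 𝔤]
  {𝔥 : LieSubalgebra ℂ 𝔤} [LieRing.IsNilpotent 𝔥] {Δ : Set (Module.Dual ℂ 𝔥)}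
  {l μ : Module.Dual ℂ 𝔥} {M : Type u} [AddCommGroup M] [Module (UTakiff 𝔤) M]

/-- A vector of weight `l` on which `h̄` acts by `μ(h)` and which is killed by `V ⊕ V̄`. -/
structure IsHighestVector (V : Submodule ℂ 𝔤) (l μ : Module.Dual ℂ 𝔥) (m : M) : Prop where
  wt : IsWt (κ 𝔥) l m
  bar : IsWt (κ' 𝔥) μ m
  killed : ∀ u ∈ uSub V, u • m = 0

lemma IsHighestVector.map {V : Submodule ℂ 𝔤} {m : M} (h : IsHighestVector V l μ m) {N : Type u}
    [AddCommGroup N] [Module (UTakiff 𝔤) N] (f : M →ₗ[UTakiff 𝔤] N) :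
    IsHighestVector V l μ (f m) :=
  ⟨h.wt.map f, h.bar.map f, fun u hu => by rw [← map_smul, h.killed u hu, map_zero]⟩

lemma IsHighestVector.vermaIdeal_le {m : M} (h : IsHighestVector (nPlus 𝔥 Δ) l μ m) :
    vermaIdeal 𝔥 Δ l μ ≤ LinearMap.ker (LinearMap.toSpanSingleton (UTakiff 𝔤) M m) := by
  refine Submodule.span_le.mpr ?_
  rintro u ((⟨x, hx, rfl⟩ | ⟨k, rfl⟩) | ⟨k, rfl⟩)
  · exact h.killed _ (toU_mem_uSub hx)
  · change (κ 𝔥 k - _) • m = 0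
    rw [sub_smul, h.wt k, sub_self]
  · change (κ' 𝔥 k - _) • m = 0
    rw [sub_smul, h.bar k, sub_self]

/-- The map from the Verma module attached to a highest weight vector. -/
noncomputable def vermaLift {m : M} (h : IsHighestVector (nPlus 𝔥 Δ) l μ m) :
    verma 𝔥 Δ l μ →ₗ[UTakiff 𝔤] M :=
  (vermaIdeal 𝔥 Δ l μ).liftQ (LinearMap.toSpanSingleton (UTakiff 𝔤) M m) h.vermaIdeal_le

variable (𝔥 Δ l μ) in
/-- The projection from `U` to the Verma module. -/
noncomputable def vermaMk : UTakiff 𝔤 →ₗ[UTakiff 𝔤] verma 𝔥 Δ l μ := (vermaIdeal 𝔥 Δ l μ).mkQ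

lemma vermaMk_surjective : Function.Surjective (vermaMk 𝔥 Δ l μ) := Submodule.mkQ_surjective _

lemma vermaMk_eq_zero {u : UTakiff 𝔤} (hu : u ∈ vermaIdeal 𝔥 Δ l μ) : vermaMk 𝔥 Δ l μ u = 0 :=
  (Submodule.Quotient.mk_eq_zero _).mpr hu

variable (𝔥 Δ l μ) in
/-- The generator of the Verma module. -/
noncomputable def vermaGen : verma 𝔥 Δ l μ := vermaMk 𝔥 Δ l μ 1

lemma vermaLift_vermaGen {m : M} (h : IsHighestVector (nPlus 𝔥 Δ) l μ m) :
    vermaLift h (vermaGen 𝔥 Δ l μ) = m := one_smul _ m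

lemma exists_smul_vermaGen (x : verma 𝔥 Δ l μ) : ∃ u : UTakiff 𝔤, x = u • vermaGen 𝔥 Δ l μ := by
  obtain ⟨u, rfl⟩ := vermaMk_surjective x
  refine ⟨u, ?_⟩
  rw [vermaGen, ← map_smul, smul_eq_mul, mul_one]

lemma verma_hom_ext {f g : verma 𝔥 Δ l μ →ₗ[UTakiff 𝔤] M}
    (h : f (vermaGen 𝔥 Δ l μ) = g (vermaGen 𝔥 Δ l μ)) : f = g := by
  refine LinearMap.ext fun x => ?_
  obtain ⟨u, rfl⟩ := exists_smul_vermaGen x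
  rw [map_smul, map_smul, h]

lemma smul_vermaGen_of_mem {u : UTakiff 𝔤} (hu : u ∈ vermaIdeal 𝔥 Δ l μ) :
    u • vermaGen 𝔥 Δ l μ = 0 := by
  rw [vermaGen, ← map_smul, smul_eq_mul, mul_one, vermaMk_eq_zero hu]

lemma isHighestVector_vermaGen : IsHighestVector (nPlus 𝔥 Δ) l μ (vermaGen 𝔥 Δ l μ) where
  wt h := by
    rw [← sub_eq_zero, ← sub_smul]
    exact smul_vermaGen_of_mem (Submodule.subset_span (Or.inl (Or.inr ⟨h, rfl⟩)))
  bar h := by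
    rw [← sub_eq_zero, ← sub_smul]
    exact smul_vermaGen_of_mem (Submodule.subset_span (Or.inr ⟨h, rfl⟩))
  killed u hu := by
    obtain ⟨x, hx, rfl⟩ := exists_toU_of_mem_uSub hu
    exact smul_vermaGen_of_mem (Submodule.subset_span (Or.inl (Or.inl ⟨x, hx, rfl⟩)))

lemma finite_verma : Module.Finite (UTakiff 𝔤) (verma 𝔥 Δ l μ) :=
  inferInstanceAs (Module.Finite (UTakiff 𝔤) (UTakiff 𝔤 ⧸ vermaIdeal 𝔥 Δ l μ))

/-- The generator satisfies the three conditions, so it lies in the largest submodule on which they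
hold, and that submodule is everything. -/
lemma isOmu_verma (h𝔥 : IsSplit 𝔥) (hΔ : IsSimpleSystem 𝔥 Δ) : IsOmu 𝔥 Δ μ (verma 𝔥 Δ l μ) := by
  obtain ⟨K, hK, hK'⟩ := exists_omuPart h𝔥 hΔ μ (verma 𝔥 Δ l μ)
  have hg := isHighestVector_vermaGen (𝔥 := 𝔥) (Δ := Δ) (l := l) (μ := μ)
  have h1 : vermaGen 𝔥 Δ l μ ∈ K := (hK' _).mpr
    ⟨AddSubgroup.subset_closure ⟨l, hg.wt⟩, ⟨1, hg.killed⟩, fun h => ⟨1, by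
      rw [pow_one, sub_smul, hg.bar h, sub_self]⟩⟩
  refine hK.of_surjective K.subtype fun x => ⟨⟨x, ?_⟩, rfl⟩
  obtain ⟨u, rfl⟩ := exists_smul_vermaGen x
  exact K.smul_mem u h1

end Verma

/-! ### Twisting Verma modules and their simple quotients -/

section TwistVerma

variable {𝔤 : Type u} [LieRing 𝔤] [LieAlgebra ℂ 𝔤] [FiniteDimensional ℂ 𝔤]
  {𝔥 : LieSubalgebra ℂ 𝔤} [LieRing.IsNilpotent 𝔥] {Δ : Set (Module.Dual ℂ 𝔥)}
  {l μ : Module.Dual ℂ 𝔥} (h𝔥 : IsSplit 𝔥) (hΔ : IsSimpleSystem 𝔥 Δ)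
  {α : Module.Dual ℂ 𝔥} (hα : α ∈ Δ) (D : TwistingData 𝔥 α) (hμ : μ D.coroot ≠ 0)
  {M : Type u} [AddCommGroup M] [Module (UTakiff 𝔤) M]

namespace TwistingData

section

variable {X Y : Type u} [AddCommGroup X] [Module (UTakiff 𝔤) X] [AddCommGroup Y]
  [Module (UTakiff 𝔤) Y]

include h𝔥 hΔ hα in
lemma isHighestVector_twist {x : X}
    (hx : IsHighestVector (nCompl 𝔥 Δ α ⊔ ℂ ∙ D.f) l μ x) (i : X ≃+ Y)
    (hi : ∀ u x, i (twist (D.φ : 𝔤 →ₗ⁅ℂ⁆ 𝔤) u • x) = u • i x) :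
    IsHighestVector (nPlus 𝔥 Δ) (D.s l) (D.s μ) (i x) where
  wt := hx.wt.twist i hi D.twist_κ (D.s_comp_reflection l)
  bar := hx.bar.twist i hi D.twist_κ' (D.s_comp_reflection μ)
  killed u hu := by
    rw [← hi, hx.killed _ (twist_mem_uSub (fun x hx => D.φ_mem h𝔥 hΔ hα hx) hu), map_zero]

include h𝔥 hΔ hα in
lemma isHighestVector_twist_symm {y : Y} (hy : IsHighestVector (nPlus 𝔥 Δ) l μ y) (i : Y ≃+ X)
    (hi : ∀ u y, i (twist (D.φ.symm : 𝔤 →ₗ⁅ℂ⁆ 𝔤) u • y) = u • i y) :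
    IsHighestVector (nCompl 𝔥 Δ α ⊔ ℂ ∙ D.f) (D.s l) (D.s μ) (i y) where
  wt := hy.wt.twist i hi D.twist_symm_κ (D.s_comp_reflection l)
  bar := hy.bar.twist i hi D.twist_symm_κ' (D.s_comp_reflection μ)
  killed u hu := by
    rw [← hi, hy.killed _ (twist_mem_uSub (fun x hx => D.φ_symm_mem h𝔥 hΔ hα hx) hu), map_zero]

end

lemma smul_eq_zero_of_mem_sup {x : 𝔤} {m : M}
    (h1 : ∀ u ∈ uSub (nCompl 𝔥 Δ α), u • m = 0) (h2 : uBase x • m = 0) (h3 : uBar x • m = 0) :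
    ∀ u ∈ uSub (nCompl 𝔥 Δ α ⊔ ℂ ∙ x), u • m = 0 := by
  let _ := Module.restrictScalars ℂ (UTakiff 𝔤) M
  have _ := IsScalarTower.restrictScalars ℂ (UTakiff 𝔤) M
  intro u hu
  rw [uSub_sup_span] at hu
  obtain ⟨y, hy, z, hz, rfl⟩ := Submodule.mem_sup.mp hu
  obtain ⟨s, t, rfl⟩ := Submodule.mem_span_pair.mp hz
  rw [add_smul, add_smul, smul_assoc, smul_assoc, h1 y hy, h2, h3, smul_zero, smul_zero, add_zero,
    add_zero]

include h𝔥 hΔ hα in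
lemma normalizes_a : ∀ u ∈ uSub (nCompl 𝔥 Δ α), D.pair.a * u - u * D.pair.a ∈ uSub (nCompl 𝔥 Δ α) :=
  fun _ hu => uBase_normalizes (fun _ hy => D.lie_f_mem_nCompl h𝔥 hΔ hα hy) hu

include h𝔥 hΔ hα in
lemma normalizes_b : ∀ u ∈ uSub (nCompl 𝔥 Δ α), D.pair.b * u - u * D.pair.b ∈ uSub (nCompl 𝔥 Δ α) :=
  fun _ hu => uBar_normalizes (fun _ hy => D.lie_f_mem_nCompl h𝔥 hΔ hα hy) hu

-- The fraction `a⁻¹ b⁻¹` adds `2α` to the weight. Multiplication by `a` or `b`, and the correction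
-- term for `h̄`, all produce an exponent zero and so vanish in `S`.
include h𝔥 hΔ hα in
lemma isHighestVector_br {m : M} (hm : IsHighestVector (nPlus 𝔥 Δ) l μ m) :
    IsHighestVector (nCompl 𝔥 Δ α ⊔ ℂ ∙ D.f) (l + (2 : ℂ) • α) μ
      (D.pair.br (1 : ℕ) (1 : ℕ) m) where
  wt := by
    have := hm.wt.br (D.κ_a h𝔥) (D.κ_b h𝔥) 1 1
    rwa [show ((1 : ℕ) : ℂ) + (1 : ℕ) = 2 by norm_num] at this
  bar h := by
    rw [D.pair.cartan_bar_smul_br (D.κ'_a h𝔥 h) (D.κ'_b h), hm.bar h, D.pair.br_algebraMap_smul,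
      algebraMap_smul, D.pair.br_eq_zero (j := ((1 : ℕ) : ℤ) - 1) (by simp), smul_zero, add_zero]
  killed := by
    refine smul_eq_zero_of_mem_sup ?_ ?_ ?_
    · have h1 : KilledBy (uSub (nCompl 𝔥 Δ α) : Set (UTakiff 𝔤)) 1 m :=
        fun u hu => hm.killed u (uSub_mono nCompl_le_nPlus hu)
      exact h1.br _ (D.normalizes_a h𝔥 hΔ hα) (D.normalizes_b h𝔥 hΔ hα) _ _
    · rw [← pair_a, D.pair.a_smul_br, D.pair.br_eq_zero (by simp)]
    · rw [← pair_b, D.pair.b_smul_br, D.pair.br_eq_zero (by simp)]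

lemma smul_sub_eq_zero {z w r : UTakiff 𝔤} {c : ℂ} {x : M} (h : z * w = w * z + r) (hw : w • x = 0)
    (hr : r • x = 0) : w • (z • x - algebraMap ℂ (UTakiff 𝔤) c • x) = 0 := by
  have h1 : w • z • x + r • x = z • w • x := by rw [← mul_smul, ← mul_smul, h, add_smul]
  rw [hw, hr, smul_zero, add_zero] at h1
  rw [smul_sub, h1, ← mul_smul, ← Algebra.commutes, mul_smul, hw, smul_zero, sub_zero]

include hΔ hα hμ h𝔥 in
/-- Highest weight vectors of `S ⊗ M` come from highest weight vectors of `M`. -/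
lemma exists_isHighestVector (hM : IsOmu 𝔥 Δ μ M) {t : BalTensor (A := UTakiff 𝔤) D.S M}
    (ht : IsHighestVector (nCompl 𝔥 Δ α ⊔ ℂ ∙ D.f) (l + (2 : ℂ) • α) μ t) :
    ∃ m : M, IsHighestVector (nPlus 𝔥 Δ) l μ m ∧ t = D.pair.br (1 : ℕ) (1 : ℕ) m := by
  have hH := hM.highestType h𝔥 hΔ hα D
  have hf : D.f ∈ nCompl 𝔥 Δ α ⊔ ℂ ∙ D.f :=
    Submodule.mem_sup_right (Submodule.mem_span_singleton_self _)
  obtain ⟨x, hx, hx', rfl⟩ := hH.exists_br_one_one hμ (ht.killed _ (uBase_mem_uSub hf))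
    (ht.killed _ (uBar_mem_uSub hf))
  -- On highest weight vectors `y ↦ a⁻¹ b⁻¹ ⊗ y` is injective, so the two eigenvalue equations for
  -- `x` can be checked after tensoring.
  have hinj : ∀ y : M, (D.triple h𝔥).e • y = 0 → (D.triple h𝔥).e' • y = 0 →
      D.pair.br (1 : ℕ) (1 : ℕ) y = 0 → y = 0 := fun y h1 h2 h3 =>
    hH.eq_zero_of_pureTensor hμ (hH.mem_pull hμ ⊥ h1 h2 h3)
  have hsc : ∀ {w : UTakiff 𝔤} (c : ℂ), w • x = 0 → (c • w) • x = 0 := fun c h => by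
    rw [Algebra.smul_def, mul_smul, h, smul_zero]
  refine ⟨x, ⟨fun h => ?_, fun h => ?_, ?_⟩, rfl⟩
  · have h1 := ht.wt h
    rw [D.pair.cartan_smul_br (D.κ_a h𝔥 h) (D.κ_b h𝔥 h), algebraMap_smul, LinearMap.add_apply,
      add_smul, LinearMap.smul_apply, smul_eq_mul,
      show ((1 : ℕ) : ℂ) + (1 : ℕ) = 2 by norm_num, add_left_inj, ← D.pair.br_algebraMap_smul] at h1
    rw [← sub_eq_zero]
    refine hinj _ ?_ ?_ (by rw [map_sub, h1, sub_self])
    · exact smul_sub_eq_zero ((D.cartanAction h𝔥).e h) hx (hsc _ hx)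
    · exact smul_sub_eq_zero ((D.cartanAction h𝔥).e' h) hx' (hsc _ hx')
  · have h1 := ht.bar h
    rw [D.pair.cartan_bar_smul_br (D.κ'_a h𝔥 h) (D.κ'_b h), algebraMap_smul,
      D.pair.br_eq_zero (j := ((1 : ℕ) : ℤ) - 1) (by simp), smul_zero, add_zero,
      ← D.pair.br_algebraMap_smul] at h1
    rw [← sub_eq_zero]
    refine hinj _ ?_ ?_ (by rw [map_sub, h1, sub_self])
    · exact smul_sub_eq_zero (D.κ'_e h𝔥 h) hx (hsc _ hx')
    · exact smul_sub_eq_zero (r := 0) (by rw [add_zero]; exact uBar_mul _ _) hx' (zero_smul _ x)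
  · rw [D.nPlus_eq hΔ h𝔥 hα]
    refine smul_eq_zero_of_mem_sup (fun u hu => ?_) hx hx'
    -- For `u` in the nilradical, `u x` is not known to be killed by `e` and `ē`, so `hinj` does not
    -- apply. Instead all `a⁻ⁱ b⁻ʲ ⊗ x` are shown to be killed by the nilradical, and `a⁻ⁿ b⁻ⁿ u` is
    -- rewritten as a sum of terms `y a⁻ⁱ b⁻ʲ` with `y` in the nilradical.
    let K := TakiffTriple.killed (uSub (nCompl 𝔥 Δ α) : Set (UTakiff 𝔤)) 1
      (BalTensor (A := UTakiff 𝔤) D.S M)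
    have hK : ∀ v : UTakiff 𝔤, (∀ u ∈ uSub (nCompl 𝔥 Δ α), v * u - u * v ∈ uSub (nCompl 𝔥 Δ α)) →
        ∀ t ∈ K, v • t ∈ K := fun v hv t ht => KilledBy.smul_of_normalizes (fun u hu => by
          have := neg_mem (hv u hu)
          rwa [neg_sub] at this) ht
    have h1 : ∀ i j : ℕ, D.pair.br i j x ∈ K := hH.br_mem hμ K
      (hK _ fun u hu => uBase_normalizes (fun y hy => D.lie_e_mem_nCompl h𝔥 hΔ hα hy) hu)
      (hK _ fun u hu => uBar_normalizes (fun y hy => D.lie_e_mem_nCompl h𝔥 hΔ hα hy) hu)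
      (hK _ fun u hu => uBase_normalizes (fun y hy => hΔ.lie_cartan_mem_nCompl h𝔥 hα _ hy) hu)
      (hK _ fun u hu => uBar_normalizes (fun y hy => hΔ.lie_cartan_mem_nCompl h𝔥 hα _ hy) hu)
      hx hx' fun u hu => ht.killed u (uSub_mono le_sup_left hu)
    refine hH.eq_zero_of_pureTensor hμ fun s => ?_
    obtain ⟨n, v, hv⟩ := D.pair.pureTensor_eq_smul_br (M := M) s
    rw [hv]
    suffices h2 : D.pair.br n n (u • x) = 0 by rw [h2, smul_zero]
    rw [D.pair.br_smul]
    have h := D.pair.frac_mul_toLoc_mem_rightSpan (V := (uSub (nCompl 𝔥 Δ α)).toAddSubgroup)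
      (D.normalizes_a h𝔥 hΔ hα) (D.normalizes_b h𝔥 hΔ hα) n n (x := u) hu
    generalize D.pair.frac n n * D.pair.toLoc u = z at h
    induction h using AddSubgroup.closure_induction with
    | mem z hz =>
      obtain ⟨i', j', y, hy, rfl⟩ := hz
      rw [← D.pair.smul_br]
      by_cases h : i' ≤ 0 ∨ j' ≤ 0
      · rw [D.pair.br_eq_zero h, smul_zero]
      · push Not at h
        obtain ⟨i', rfl⟩ := Int.eq_ofNat_of_zero_le h.1.le
        obtain ⟨j', rfl⟩ := Int.eq_ofNat_of_zero_le h.2.le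
        exact h1 i' j' y hy
    | zero => rw [map_zero, map_zero, AddMonoidHom.zero_apply]
    | add y z _ _ hy hz => rw [map_add, map_add, AddMonoidHom.add_apply, hy, hz, add_zero]
    | neg y _ hy => rw [map_neg, map_neg, AddMonoidHom.neg_apply, hy, neg_zero]

/-- The lattice isomorphism attached to a semilinear bijection. -/
def twistOrderIso {X Y : Type u} [AddCommGroup X] [Module (UTakiff 𝔤) X] [AddCommGroup Y]
    [Module (UTakiff 𝔤) Y] (i : X ≃+ Y) {σ τ : UTakiff 𝔤 →ₐ[ℂ] UTakiff 𝔤}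
    (hi : ∀ u x, i (τ u • x) = u • i x) (hτσ : ∀ u, τ (σ u) = u) :
    Submodule (UTakiff 𝔤) X ≃o Submodule (UTakiff 𝔤) Y where
  toFun K :=
    { K.toAddSubgroup.map i.toAddMonoidHom with
      smul_mem' := by
        rintro u _ ⟨x, hx, rfl⟩
        exact ⟨τ u • x, K.smul_mem _ hx, hi u x⟩ }
  invFun L :=
    { L.toAddSubgroup.comap i.toAddMonoidHom with
      smul_mem' := by
        intro u x hx
        change i (u • x) ∈ L
        rw [← hτσ u, hi]
        exact L.smul_mem _ hx }
  left_inv K := Submodule.ext fun x => by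
    change i x ∈ i '' K ↔ _
    rw [i.injective.mem_set_image]; rfl
  right_inv L := SetLike.coe_injective (Set.image_preimage_eq _ i.surjective)
  map_rel_iff' {K K'} := Set.image_subset_image_iff i.injective

lemma mem_twistOrderIso {X Y : Type u} [AddCommGroup X] [Module (UTakiff 𝔤) X] [AddCommGroup Y]
    [Module (UTakiff 𝔤) Y] (i : X ≃+ Y) {σ τ : UTakiff 𝔤 →ₐ[ℂ] UTakiff 𝔤}
    (hi : ∀ u x, i (τ u • x) = u • i x) (hτσ : ∀ u, τ (σ u) = u) {K : Submodule (UTakiff 𝔤) X}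
    {x : X} : i x ∈ twistOrderIso i hi hτσ K ↔ x ∈ K := i.injective.mem_set_image

-- The universal property of the Verma module applied to the twist of `a⁻¹ b⁻¹ ⊗ v` gives a map. It
-- is onto because this vector generates `S ⊗ M`, and injective because the structure of the
-- untwisted target as some `S ⊗ K` yields a map back that fixes the generator.
include hΔ hα hμ h𝔥 in
theorem exists_verma_equiv (l : Module.Dual ℂ 𝔥) :
    Nonempty (verma 𝔥 Δ (dotTwo 𝔥 Δ D.s l) (D.s μ) ≃ₗ[UTakiff 𝔤] D.T.obj (verma 𝔥 Δ l μ)) := by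
  rw [D.dotTwo_s hΔ h𝔥 hα]
  set l' := D.s l - (2 : ℂ) • α with hl'
  -- The shift by `2α` caused by `a⁻¹ b⁻¹` becomes the shift by `-2α` after the reflection.
  have hsl : D.s (l + (2 : ℂ) • α) = l' := by
    rw [hl', map_add, map_smul, D.s_apply α, D.root_coroot, two_smul ℂ α]
    module
  have hsl' : D.s l' = l + (2 : ℂ) • α := by rw [← hsl, D.s_s]
  let M := verma 𝔥 Δ l μ
  have hM : IsOmu 𝔥 Δ μ M := isOmu_verma h𝔥 hΔ
  have hH := hM.highestType h𝔥 hΔ hα D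
  let v : M := vermaGen 𝔥 Δ l μ
  have hv : IsHighestVector (nPlus 𝔥 Δ) l μ v := isHighestVector_vermaGen
  let t : BalTensor (A := UTakiff 𝔤) D.S M := D.pair.br (1 : ℕ) (1 : ℕ) v
  have ht : IsHighestVector (nPlus 𝔥 Δ) l' (D.s μ) (D.toT M t) := by
    rw [← hsl]
    exact D.isHighestVector_twist h𝔥 hΔ hα (D.isHighestVector_br h𝔥 hΔ hα hv) (D.toT M)
      (D.toT_smul M)
  have hψ := vermaLift_vermaGen ht
  generalize vermaLift ht = ψ at hψ
  refine ⟨LinearEquiv.ofBijective ψ ⟨?_, ?_⟩⟩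
  · let N := verma 𝔥 Δ l' (D.s μ)
    have hN : D.IsOpp Δ μ (D.untwist N) := D.isOpp_of_isOmu h𝔥 hΔ hα (isOmu_verma h𝔥 hΔ)
      (D.toUntwist N) (D.toUntwist_smul N)
    have hfin : Module.Finite (UTakiff 𝔤) N := finite_verma
    have := finite_twist (D.toUntwist N) (D.toUntwist_smul N) D.twist_twist_symm D.twist_symm_twist
    obtain ⟨hX, -, hE⟩ := hN.hPart h𝔥 hΔ hα hμ
    have hw : IsHighestVector (nCompl 𝔥 Δ α ⊔ ℂ ∙ D.f) (l + (2 : ℂ) • α) μ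
        (D.toUntwist N (vermaGen 𝔥 Δ l' (D.s μ))) := by
      have := D.isHighestVector_twist_symm h𝔥 hΔ hα
        (isHighestVector_vermaGen (𝔥 := 𝔥) (Δ := Δ) (l := l') (μ := D.s μ)) (D.toUntwist N)
        (D.toUntwist_smul N)
      rwa [hsl', D.s_s] at this
    -- Under `S ⊗ K ≅ φ⁻¹(N)` the generator of `N` is `a⁻¹ b⁻¹ ⊗ x` with `x` a highest weight vector
    -- of `K` of weight `(l, μ)`. Sending the generator of `M` to `x` and tensoring produces the
    -- left inverse.
    obtain ⟨x, hx, hxt⟩ := D.exists_isHighestVector h𝔥 hΔ hα hμ hX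
      (hw.map (LinearEquiv.ofBijective _ hE).symm.toLinearMap)
    let g : BalTensor (A := UTakiff 𝔤) D.S M →ₗ[UTakiff 𝔤] D.untwist N :=
      balLift (hPart 𝔥 (BimodHom (A := UTakiff 𝔤) D.S (D.untwist N))).subtype ∘ₗ
        BalTensor.map D.S (vermaLift hx)
    have hg : g t = D.toUntwist N (vermaGen 𝔥 Δ l' (D.s μ)) := by
      change balLift (hPart 𝔥 (BimodHom (A := UTakiff 𝔤) D.S (D.untwist N))).subtype
        (BalTensor.map D.S (vermaLift hx) (D.pair.br (1 : ℕ) (1 : ℕ) v)) = _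
      rw [D.pair.map_br, vermaLift_vermaGen, ← hxt]
      exact (LinearEquiv.ofBijective _ hE).apply_symm_apply _
    have hcomp : ((D.twistEquiv M N).symm g).hom ∘ₗ ψ = LinearMap.id := by
      refine verma_hom_ext ?_
      rw [LinearMap.comp_apply, hψ]
      exact (D.toUntwist N).injective hg
    exact Function.LeftInverse.injective (g := ((D.twistEquiv M N).symm g).hom)
      fun x => LinearMap.congr_fun hcomp x
  · let K := (twistOrderIso (D.toT M) (D.toT_smul M) D.twist_twist_symm).symm (LinearMap.range ψ)
    have hK : t ∈ K := ⟨vermaGen 𝔥 Δ l' (D.s μ), hψ⟩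
    have h1 := hH.mem_pull hμ K (hv.killed _ (uBase_mem_uSub (D.e_mem_nPlus hΔ hα)))
      (hv.killed _ (uBar_mem_uSub (D.e_mem_nPlus hΔ hα))) hK
    intro y
    obtain ⟨z, rfl⟩ := (D.toT M).surjective y
    suffices h2 : z ∈ K from h2
    obtain ⟨n, m, rfl⟩ := D.pair.exists_br z
    obtain ⟨u, rfl⟩ := exists_smul_vermaGen m
    exact (D.pair.pull K).smul_mem u h1 _

lemma map_sSup_ne_top {R R' X Y : Type*} [Ring R] [Ring R'] [AddCommGroup X] [AddCommGroup Y]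
    [Module R X] [Module R' Y] (f : Submodule R X ≃o Submodule R' Y) :
    f (sSup {N | N ≠ ⊤}) = sSup {N | N ≠ ⊤} := by
  rw [f.map_sSup, ← sSup_image]
  congr 1
  ext N
  simp only [Set.mem_image, Set.mem_ofPred_eq]
  constructor
  · rintro ⟨K, hK, rfl⟩
    rwa [Ne, map_eq_top_iff]
  · exact fun h => ⟨f.symm N, by rwa [Ne, map_eq_top_iff], f.apply_symm_apply N⟩

-- The lattice isomorphism between `M` and its twist, composed with the one given by the isomorphism
-- of Verma modules, matches the sums of all proper submodules. By `ker_map_mkQ` the sum for `M`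
-- corresponds to the kernel of `T M → T L`.
include hΔ hα hμ h𝔥 in
theorem exists_simpleQuot_equiv (l : Module.Dual ℂ 𝔥) :
    Nonempty (simpleQuot 𝔥 Δ (dotTwo 𝔥 Δ D.s l) (D.s μ) ≃ₗ[UTakiff 𝔤]
      D.T.obj (simpleQuot 𝔥 Δ l μ)) := by
  obtain ⟨ψ⟩ := D.exists_verma_equiv h𝔥 hΔ hα hμ l
  let M := verma 𝔥 Δ l μ
  have hH := (isOmu_verma (l := l) (μ := μ) h𝔥 hΔ).highestType h𝔥 hΔ hα D
  let J : Submodule (UTakiff 𝔤) M := sSup {N | N ≠ ⊤}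
  obtain ⟨q, hq, h1⟩ : ∃ q : M →ₗ[UTakiff 𝔤] simpleQuot 𝔥 Δ l μ, Function.Surjective q ∧
      LinearMap.ker (BalTensor.map D.S q) = D.pair.push J :=
    ⟨J.mkQ, J.mkQ_surjective, OrePair.ker_map_mkQ J ((hH.quotient J).isRegularOn hμ)⟩
  obtain ⟨p, hp0⟩ : ∃ p : D.T.obj M →ₗ[UTakiff 𝔤] D.T.obj (simpleQuot 𝔥 Δ l μ),
      ∀ x, p (D.toT M x) = D.toT _ (BalTensor.map D.S q x) :=
    ⟨(D.T.map (ModuleCat.ofHom q)).hom, fun _ => rfl⟩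
  have hps : Function.Surjective p := fun y => by
    obtain ⟨z, rfl⟩ := (D.toT _).surjective y
    obtain ⟨x, rfl⟩ := D.pair.map_surjective hq z
    exact ⟨_, hp0 x⟩
  have hp : Function.Surjective (p ∘ₗ ψ.toLinearMap) := hps.comp ψ.surjective
  have hker : LinearMap.ker (p ∘ₗ ψ.toLinearMap) = sSup {N | N ≠ ⊤} := by
    rw [← map_sSup_ne_top (((hH.orderIso hμ).trans (twistOrderIso (D.toT M) (D.toT_smul M)
      D.twist_twist_symm)).trans (Submodule.orderIsoMapComap ψ).symm)]
    ext m
    obtain ⟨x, hx⟩ := (D.toT M).surjective (ψ m)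
    rw [LinearMap.mem_ker, LinearMap.comp_apply, LinearEquiv.coe_coe, ← hx, hp0,
      EmbeddingLike.map_eq_zero_iff, ← LinearMap.mem_ker, h1]
    change _ ↔ ψ m ∈ twistOrderIso (D.toT M) (D.toT_smul M) D.twist_twist_symm (D.pair.push J)
    rw [← hx, mem_twistOrderIso]
  exact ⟨(Submodule.quotEquivOfEq _ _ hker.symm).trans
    ((p ∘ₗ ψ.toLinearMap).quotKerEquivOfSurjective hp)⟩

end TwistingData

end TwistVerma

end TakiffO

theorem theorem5 {𝔤 : Type*} [LieRing 𝔤] [LieAlgebra ℂ 𝔤] [FiniteDimensional ℂ 𝔤]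
    (hred : LieAlgebra.radical ℂ 𝔤 = LieAlgebra.center ℂ 𝔤)
    (𝔥 : LieSubalgebra ℂ 𝔤) [𝔥.IsCartanSubalgebra]
    (Δ : Set (Module.Dual ℂ 𝔥)) (hΔ : TakiffO.IsSimpleSystem 𝔥 Δ)
    (α : Module.Dual ℂ 𝔥) (hα : α ∈ Δ) :
    Nonempty (TakiffO.TwistingData 𝔥 α) ∧
    ∀ D : TakiffO.TwistingData 𝔥 α,
      (∃ (hT : ∀ M, TakiffO.catC 𝔥 M → TakiffO.catC 𝔥 (D.T.obj M))
        (hG : ∀ N, TakiffO.catC 𝔥 N → TakiffO.catC 𝔥 (D.G.obj N)),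
        Nonempty (TakiffO.restrictTo D.T hT ⊣ TakiffO.restrictTo D.G hG)) ∧
      ∀ μ : Module.Dual ℂ 𝔥, μ D.coroot ≠ 0 →
        (∃ (hT : ∀ M, TakiffO.catOmu 𝔥 Δ μ M → TakiffO.catOmu 𝔥 Δ (D.s μ) (D.T.obj M))
          (hG : ∀ N, TakiffO.catOmu 𝔥 Δ (D.s μ) N → TakiffO.catOmu 𝔥 Δ μ (D.G.obj N))
          (E : (TakiffO.catOmu 𝔥 Δ μ).FullSubcategory ≌
            (TakiffO.catOmu 𝔥 Δ (D.s μ)).FullSubcategory),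
          E.functor = TakiffO.restrictTo D.T hT ∧ E.inverse = TakiffO.restrictTo D.G hG) ∧
        ∀ l : Module.Dual ℂ 𝔥,
          Nonempty (D.T.obj (TakiffO.verma 𝔥 Δ l μ) ≅
            TakiffO.verma 𝔥 Δ (TakiffO.dotTwo 𝔥 Δ D.s l) (D.s μ)) ∧
          Nonempty (D.T.obj (TakiffO.simpleQuot 𝔥 Δ l μ) ≅
            TakiffO.simpleQuot 𝔥 Δ (TakiffO.dotTwo 𝔥 Δ D.s l) (D.s μ)) := by
  have h𝔥 := TakiffO.isSplit_of_reductive hred 𝔥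
  refine ⟨TakiffO.nonempty_twistingData h𝔥 (hΔ.subset_roots hα), fun D => ⟨?_, fun μ hμ =>
    ⟨D.exists_equivalence h𝔥 hΔ hα hμ, fun l => ⟨?_, ?_⟩⟩⟩⟩
  · exact ⟨fun M hM => D.catC_T h𝔥 hM, fun N _ => D.catC_G h𝔥 N,
      ⟨D.restrictAdjunction (fun _ hM => hM) _ _⟩⟩
  · obtain ⟨E⟩ := D.exists_verma_equiv h𝔥 hΔ hα hμ l
    exact ⟨E.symm.toModuleIso⟩
  · obtain ⟨E⟩ := D.exists_simpleQuot_equiv h𝔥 hΔ hα hμ l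
    exact ⟨E.symm.toModuleIso⟩
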